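/- **Setting.** Let $B$ be a smooth manifold (finite-dimensional, Hausdorff, paracompact), $LB=C^\infty(S^1,B)$ its free loop space with its usual smooth structure (a map $\Gamma$ into $LB$ is smooth iff $(w,z)\mapsto\Gamma(w)(z)$ is smooth), and $ev:LB\times S^1\to B$ the evaluation map; $S^1$ has total length one. *Line bundles.* $\mathrm{Line}(X)$ is the set of isomorphism classes of hermitian line bundles with hermitian connection on $X$. *Gerbes.* A gerbe with connection on $B$ consists of an open covering $(U_\alpha)$, hermitian line bundles with connection $L_{\alpha\beta}$ over $U_\alpha\cap U_\beta$, parallel isometric isomorphisms $\theta_{\alpha\beta\gamma}:L_{\alpha\beta}\otimes L_{\beta\gamma}\cong L_{\alpha\gamma}$ over triple intersections which are associative over quadruple intersections (they induce $L_{\alpha\alpha}\cong\mathbb C$ and $L_{\beta\alpha}\cong L_{\alpha\beta}^*$, and amount to unit length parallel sections $\theta_{\alpha\beta\gamma}$ of $L_{\alpha\beta}\otimes L_{\beta\gamma}\otimes L_{\gamma\alpha}$ with $\delta\theta=1$), and forms $F_\alpha\in\Omega^2(U_\alpha)$ with $F_\beta-F_\alpha=c_1(\nabla^{L_{\alpha\beta}})$,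 where $c_1(\nabla)=\frac{-1}{2\pi i}R^\nabla$. Two gerbes with connection are isomorphic if on a common refinement of the coverings there are line bundles with connection $N_\alpha$ and parallel isometric isomorphisms $L'_{\alpha\beta}\cong N_\alpha^{-1}\otimes L_{\alpha\beta}\otimes N_\beta$ compatible with $\theta,\theta'$, and $F'_\alpha=F_\alpha+c_1(\nabla^{N_\alpha})$. $\mathrm{Gerbe}(B)$ is the set of isomorphism classes. *Deligne cohomology.* $H^k(X,\mathcal K^p)$ is the Čech hypercohomology (colimit over open coverings, alternating cochains, $d_{tot}=\delta+(-1)^q d$ on Čech degree $q$) of $\underline{U(1)}\xrightarrow{\frac1{2\pi i}d\log}\Omega^1\to\dots\to\Omega^p$. Let $l:\mathrm{Line}(X)\to H^1(X,\mathcal K^1)$ take a line bundle with local unit sections $s_\alpha$ to the class of $(s_\alpha/s_\beta,\ \frac{-1}{2\pi i}\nabla\log s_\alpha)$, and let $g:\mathrm{Gerbe}(X)\to H^2(X,\mathcal K^2)$ take a gerbe, after a refinement on which the $L_{\alpha\beta}$ have unit sections $s_{\alpha\beta}$ (with $s_{\alpha\alpha}=1$, $s_{\beta\alpha}=s_{\alpha\beta}^{-1}$),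 to the class of $(\theta_{\alpha\beta\gamma}/(s_{\alpha\beta}s_{\beta\gamma}s_{\gamma\alpha}),\ \frac1{2\pi i}\nabla\log s_{\alpha\beta},\ -F_\alpha)$. *Integration over the fibre.* $\int_{S^1}:H^2(X\times S^1,\mathcal K^2)\to H^1(X,\mathcal K^1)$ takes the class of a cocycle $(\theta_{\alpha\beta\gamma},a_{\alpha\beta},f_\alpha)$ on a covering $(U_\alpha)$ to the class of the following cocycle. For subdivisions $t:\mathbb Z_n\to S^1$ and labels $s:\mathbb Z_n\to I$ consider open sets of $x\in X$ with $\{x\}\times[t(i),t(i+1)]\subseteq U_{s(i)}$ for all $i$; on these take the 1-forms $$Y_{t,s}=-\sum_i\int_{[t(i),t(i+1)]}i_{\partial_t}f_{s(i)}\,dt-\sum_i a_{s(i-1)s(i)}|_{t(i)},$$ and, passing to common refinements of the subdivisions, the transition functions $$X_{s,s'}=\prod_i\exp\Big(2\pi i\int_{[t(i),t(i+1)]}a_{s(i)s'(i)}\Big)\,\theta_{s(i-1)s'(i-1)s'(i)}|_{t(i)}\;\theta_{s(i-1)s(i)s'(i)}^{-1}|_{t(i)} .$$ *Geometric transgression.*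 Let $\mathcal G$ be a gerbe with connection. For strictly monotone $t:\mathbb Z_n\to S^1$ ($n\ge1$) and $s:\mathbb Z_n\to I$ let $V(t,s)\subseteq LB$ be the set of loops with $\gamma([t(i),t(i+1)])\subseteq U_{s(i-1)}\cap U_{s(i)}$ for all $i$. A line bundle with connection $T\mathcal G$ over $LB$ is a transgression of $\mathcal G$ if it is glued from the hermitian line bundles with fibres $\bigotimes_{i}L_{s(i-1)s(i)}(\gamma(t(i)))$ over $V(t,s)$ by the following transition maps and with the following connection. (1) For a refinement $(t',s')$ of $(t,s)$, the additional factors lie in bundles $L_{\alpha\alpha}$ and are removed by $L_{\alpha\alpha}\cong\mathbb C$. (2) For a change of labels $s\to s'$ with the same $t$, $\theta$ identifies $\bigotimes_iL_{s(i-1)s(i)}(\gamma(t(i)))$ with $\bigotimes_iL_{s'(i-1)s'(i)}(\gamma(t(i)))\otimes\bigotimes_i\mathrm{Hom}\big(L_{s(i)s'(i)}(\gamma(t(i))),L_{s(i)s'(i)}(\gamma(t(i+1)))\big)$, and the second factor is identified with $\mathbb C$ by means of the parallel transport along $\gamma|_{[t(i),t(i+1)]}$ (which corresponds to $1$). (3)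 The parallel transport along a path $\Gamma:[a,b]\to V(t,s)$ is $$\bigotimes_i\|^{L_{s(i-1)s(i)}}_{\Gamma(\cdot)(t(i))}\;\prod_i\exp\Big(2\pi i\int_{[a,b]\times[t(i),t(i+1)]}\Gamma^*F_{s(i)}\Big),$$ with the orientation of $[a,b]\times[t(i),t(i+1)]$ in which the circle direction comes first. **Statement.** The following hold. 1. Every line bundle with connection on $LB$ and every gerbe with connection on $B$ has a cocycle as above, the maps $l:\mathrm{Line}(LB)\to H^1(LB,\mathcal K^1)$ and $g:\mathrm{Gerbe}(B)\to H^2(B,\mathcal K^2)$ are well defined and bijective, and they take tensor products to sums. 2. The map $\int_{S^1}:H^2(LB\times S^1,\mathcal K^2)\to H^1(LB,\mathcal K^1)$ is well defined. 3. Every gerbe with connection $\mathcal G$ on $B$ has a transgression, and the isomorphism class of the transgression depends only on the isomorphism class of $\mathcal G$; thus the geometric transgression $T:\mathrm{Gerbe}(B)\to\mathrm{Line}(LB)$ is well defined. 4. $l\circ T=\int_{S^1}\circ\,ev^*\circ g$ as maps $\mathrm{Gerbe}(B)\to H^1(LB,\mathcal K^1)$. -/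

import Mathlib

open Diffeology Set
open scoped Manifold ContDiff Topology

universe u v

noncomputable section

namespace GerbeTransgression

/-! ### Smooth spaces

Finite-dimensional manifolds, their free loop spaces and products of these with the circle are
all handled as diffeological spaces: a smooth function or a differential form on such a space is
given by a compatible family of smooth functions or forms on the domains of its plots. -/

abbrev Euc (n : ℕ) : Type := EuclideanSpace ℝ (Fin n)

/-- The diffeology of a manifold: plots are the smooth maps. -/
@[reducible]
def manifoldDiffeology (E : Type v) [NormedAddCommGroup E] [NormedSpace ℝ E]
    (B : Type u) [TopologicalSpace B] [ChartedSpace E B] : DiffeologicalSpace B :=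
  .ofCorePlotsOn {
    isPlotOn := fun {n w} _ p => ContMDiffOn 𝓘(ℝ, Euc n) 𝓘(ℝ, E) ∞ p w
    isPlotOn_congr := fun _ _ _ h => contMDiffOn_congr h
    isPlot := fun {n} p => ContMDiff 𝓘(ℝ, Euc n) 𝓘(ℝ, E) ∞ p
    isPlotOn_univ := contMDiffOn_univ
    isPlot_const := fun _ => contMDiff_const
    isPlotOn_reparam := fun _ _ _ h hp hf => hp.comp hf.contMDiffOn h.subset_preimage
    locality := fun _ _ h => fun x hx => by
      obtain ⟨w, hw, hxw, hp⟩ := h x hx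
      exact ((hp x hxw).contMDiffAt (hw.mem_nhds hxw)).contMDiffWithinAt }

/-- The manifold `B`, modelled on `E`, as a diffeological space. -/
def Mfd (_E : Type v) (B : Type u) : Type u := B

instance (E : Type v) [NormedAddCommGroup E] [NormedSpace ℝ E]
    (B : Type u) [TopologicalSpace B] [ChartedSpace E B] : DiffeologicalSpace (Mfd E B) :=
  manifoldDiffeology E B

instance : DiffeologicalSpace Circle := manifoldDiffeology (EuclideanSpace ℝ (Fin 1)) Circle

/-- The product diffeology on `X × S¹`. -/
instance {X : Type u} [DiffeologicalSpace X] : DiffeologicalSpace (X × Circle) where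
  plots _ := {p | IsPlot (fun w => (p w).1) ∧ IsPlot (fun w => (p w).2)}
  constant_plots _ := ⟨isPlot_const, isPlot_const⟩
  plot_reparam hp hf := ⟨isPlot_reparam hp.1 hf, isPlot_reparam hp.2 hf⟩
  locality {n p} hp := by
    refine ⟨DiffeologicalSpace.locality fun x => ?_, DiffeologicalSpace.locality fun x => ?_⟩
    · obtain ⟨w, hw, hx, h⟩ := hp x
      exact ⟨w, hw, hx, fun hf hs => (h hf hs).1⟩
    · obtain ⟨w, hw, hx, h⟩ := hp x
      exact ⟨w, hw, hx, fun hf hs => (h hf hs).2⟩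

/-- The free loop space `LB` of smooth maps `S¹ → B`. -/
abbrev Loop (E : Type v) [NormedAddCommGroup E] [NormedSpace ℝ E]
    (B : Type u) [TopologicalSpace B] [ChartedSpace E B] : Type u :=
  ContMDiffMap (𝓡 1) 𝓘(ℝ, E) Circle B ∞

section Loop

variable {E : Type v} [NormedAddCommGroup E] [NormedSpace ℝ E]
  {B : Type u} [TopologicalSpace B] [ChartedSpace E B]

/-- A plot `Γ : ℝⁿ → LB` is a family of loops for which `(w, z) ↦ Γ(w)(z)` is smooth. -/
instance : DiffeologicalSpace (Loop E B) :=
  .ofCorePlotsOn {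
    isPlotOn := fun {n w} _ Γ =>
      ContMDiffOn (𝓘(ℝ, Euc n).prod (𝓡 1)) 𝓘(ℝ, E) ∞
        (fun q : Euc n × Circle => Γ q.1 q.2) (w ×ˢ univ)
    isPlotOn_congr := fun _ _ _ h => contMDiffOn_congr fun q hq => by
      rw [h hq.1]
    isPlot := fun {n} Γ =>
      ContMDiff (𝓘(ℝ, Euc n).prod (𝓡 1)) 𝓘(ℝ, E) ∞ (fun q : Euc n × Circle => Γ q.1 q.2)
    isPlotOn_univ := by
      intro n Γ
      rw [univ_prod_univ, contMDiffOn_univ]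
    isPlot_const := fun γ => γ.contMDiff.comp contMDiff_snd
    isPlotOn_reparam := by
      intro n m w v hw hv Γ f h hΓ hf
      have hg : ContMDiffOn (𝓘(ℝ, Euc m).prod (𝓡 1)) (𝓘(ℝ, Euc n).prod (𝓡 1)) ∞
          (fun q : Euc m × Circle => (f q.1, q.2)) (v ×ˢ univ) :=
        (hf.contMDiffOn.comp contMDiffOn_fst fun q hq => hq.1).prodMk contMDiffOn_snd
      exact hΓ.comp hg fun q hq => ⟨h hq.1, mem_univ _⟩
    locality := by
      intro n w hw Γ h q hq
      obtain ⟨v, hv, hxv, hp⟩ := h q.1 hq.1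
      exact ((hp q ⟨hxv, mem_univ _⟩).contMDiffAt
        ((hv.prod isOpen_univ).mem_nhds ⟨hxv, mem_univ _⟩)).contMDiffWithinAt }

/-- The evaluation map `ev : LB × S¹ → B`. -/
def ev (q : Loop E B × Circle) : Mfd E B := q.1 q.2

theorem ev_smooth : DSmooth (ev (E := E) (B := B)) := by
  intro n p hp
  have h1 : ContMDiff (𝓘(ℝ, Euc n).prod (𝓡 1)) 𝓘(ℝ, E) ∞
    (fun q : Euc n × Circle => (p q.1).1 q.2) := hp.1
  have h2 : ContMDiff 𝓘(ℝ, Euc n) (𝓡 1) ∞ (fun w => (p w).2) := hp.2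
  have h3 : ContMDiff 𝓘(ℝ, Euc n) (𝓘(ℝ, Euc n).prod (𝓡 1)) ∞
    (fun w : Euc n => (w, (p w).2)) := contMDiff_id.prodMk h2
  exact h1.comp h3

end Loop

/-! ### Functions and differential forms -/

section Forms

variable {X : Type u} [DiffeologicalSpace X]

/-- Open sets: for manifolds these are the usual ones. -/
def DOpen (V : Set X) : Prop := IsOpen[dTopology] V

/-- Smoothness on an open set `V`; the values off `V` play no role. -/
def SmoothOn (V : Set X) (g : X → ℂ) : Prop :=
  ∀ (n : ℕ) (p : Euc n → X), IsPlot p → ContDiffOn ℝ ∞ (fun w => g (p w)) (p ⁻¹' V)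

/-- Carrier of real `k`-forms: to each plot `p : ℝⁿ → X` and each point of `ℝⁿ` an alternating
form on `ℝⁿ`, namely the value of the pullback along `p`.  The forms on an open set `V` are the
families satisfying `IsForm V`, and two of them are the same if they satisfy `FormEq V`. -/
abbrev PreForm (X : Type u) (k : ℕ) : Type u :=
  ∀ n : ℕ, (Euc n → X) → Euc n → (Euc n) [⋀^Fin k]→L[ℝ] ℝ

/-- `ξ` is a smooth `k`-form on the open set `V`: smooth on every plot and compatible with
smooth reparametrisation. -/
structure IsForm {k : ℕ} (V : Set X) (ξ : PreForm X k) : Prop where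
  smooth : ∀ (n : ℕ) (p : Euc n → X), IsPlot p → ContDiffOn ℝ ∞ (ξ n p) (p ⁻¹' V)
  natural : ∀ (m n : ℕ) (p : Euc n → X) (f : Euc m → Euc n), IsPlot p → ContDiff ℝ ∞ f →
    ∀ w, p (f w) ∈ V → ξ m (p ∘ f) w = (ξ n p (f w)).compContinuousLinearMap (fderiv ℝ f w)

/-- Two forms agree on `V`. -/
def FormEq {k : ℕ} (V : Set X) (ξ η : PreForm X k) : Prop :=
  ∀ (n : ℕ) (p : Euc n → X), IsPlot p → ∀ w, p w ∈ V → ξ n p w = η n p w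

/-- Exterior derivative. -/
def d {k : ℕ} (ξ : PreForm X k) : PreForm X (k + 1) := fun n p w => extDeriv (ξ n p) w

/-- Pullback of forms along a map. -/
def PreForm.pullback {Y : Type u} {k : ℕ} (φ : Y → X) (ξ : PreForm X k) : PreForm Y k :=
  fun n p => ξ n (φ ∘ p)

/-- For a `U(1)`-valued function `g`, the real 1-form `(1/i) d log g = (1/i) g⁻¹ dg`. -/
def dlog (g : X → ℂ) : PreForm X 1 := fun n p w =>
  ContinuousAlternatingMap.ofSubsingleton ℝ (Euc n) ℝ (0 : Fin 1)
    (Complex.imCLM ∘L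
      ((starRingEnd ℂ (g (p w))) • fderiv ℝ (fun w' => g (p w')) w))

/-- `ξ(ċ(τ))` for a 1-form `ξ` and a curve `c`. -/
def alongCurve (ξ : PreForm X 1) (c : ℝ → X) (τ : ℝ) : ℝ :=
  ξ 1 (fun w => c (w 0)) (EuclideanSpace.single 0 τ) (fun _ => EuclideanSpace.single 0 1)

/-- A smooth curve `ℝ → X`. -/
def IsCurve (c : ℝ → X) : Prop := IsPlot (fun w : Euc 1 => c (w 0))

/-- `F(∂σ/∂τ, ∂σ/∂x)` at `(x, τ)` for a 2-form `F` and a two-parameter map `σ(x, τ)`. -/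
def alongSurface (F : PreForm X 2) (σ : ℝ → ℝ → X) (x τ : ℝ) : ℝ :=
  F 2 (fun w => σ (w 0) (w 1)) !₂[x, τ] ![!₂[0, 1], !₂[1, 0]]

end Forms

/-! ### Hermitian line bundles with connection -/

/-- A hermitian line bundle with hermitian connection over the open set `W ⊆ X`: a family of
one-dimensional hermitian vector spaces with an atlas of local unit length sections `frame a` over
open sets `dom a` covering `W`, with smooth transition functions, and real 1-forms `conn a`,
the connection being `∇ (frame a) = i (conn a) ⊗ frame a`.
Fibres and frames off `W`, resp. off `dom a`, play no role. -/
structure LineBundle (X : Type u) [DiffeologicalSpace X] (W : Set X) where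
  Fib : X → Type
  [normedGroup : ∀ x, NormedAddCommGroup (Fib x)]
  [innerSpace : ∀ x, InnerProductSpace ℂ (Fib x)]
  rank_one : ∀ x ∈ W, Module.finrank ℂ (Fib x) = 1
  ι : Type u
  dom : ι → Set X
  dom_open : ∀ a, DOpen (dom a)
  dom_subset : ∀ a, dom a ⊆ W
  dom_cover : ∀ x ∈ W, ∃ a, x ∈ dom a
  frame : ι → ∀ x, Fib x
  norm_frame : ∀ a, ∀ x ∈ dom a, ‖frame a x‖ = 1
  smooth_trans : ∀ a b, SmoothOn (dom a ∩ dom b) fun x => inner ℂ (frame b x) (frame a x)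
  conn : ι → PreForm X 1
  conn_form : ∀ a, IsForm (dom a) (conn a)
  conn_trans : ∀ a b, FormEq (dom a ∩ dom b) (conn a - conn b)
    (dlog fun x => inner ℂ (frame b x) (frame a x))

attribute [instance] LineBundle.normedGroup LineBundle.innerSpace

namespace LineBundle

variable {X : Type u} [DiffeologicalSpace X] {W : Set X}

/-- `s` is a smooth section of unit length over the open set `O`. -/
def IsSmoothUnit (L : LineBundle X W) (O : Set X) (s : ∀ x, L.Fib x) : Prop :=
  (∀ x ∈ O, ‖s x‖ = 1) ∧
    ∀ a, SmoothOn (O ∩ L.dom a) fun x => inner ℂ (L.frame a x) (s x)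

/-- `s` is a smooth section of unit length over the open set `O` with `∇ log s = i ξ`,
that is `∇ s = i ξ ⊗ s`. -/
def IsUnitSection (L : LineBundle X W) (O : Set X) (s : ∀ x, L.Fib x) (ξ : PreForm X 1) : Prop :=
  L.IsSmoothUnit O s ∧
    ∀ a, FormEq (O ∩ L.dom a) ξ (L.conn a + dlog fun x => inner ℂ (L.frame a x) (s x))

/-- `σ` is a parallel section along the curve `c : [a, b] → W`. -/
def IsParallel (L : LineBundle X W) (c : ℝ → X) (a b : ℝ) (σ : ∀ τ, L.Fib (c τ)) : Prop :=
  ∀ τ ∈ Icc a b, c τ ∈ W ∧ ∀ k, c τ ∈ L.dom k →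
    HasDerivWithinAt (fun τ' => inner ℂ (L.frame k (c τ')) (σ τ'))
      (-Complex.I * (alongCurve (L.conn k) c τ : ℂ) * inner ℂ (L.frame k (c τ)) (σ τ))
      (Icc a b) τ

/-- Parallel transport along `c : [a, b] → W` takes `v` to `w` (points of the total space). -/
def Transports (L : LineBundle X W) (c : ℝ → X) (a b : ℝ) (v w : Σ x, L.Fib x) : Prop :=
  ∃ σ : ∀ τ, L.Fib (c τ), L.IsParallel c a b σ ∧
    (⟨c a, σ a⟩ : Σ x, L.Fib x) = v ∧ (⟨c b, σ b⟩ : Σ x, L.Fib x) = w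

/-- Isomorphism of hermitian line bundles with connection over all of `X`. -/
def Iso (L L' : LineBundle X (univ : Set X)) : Prop :=
  ∃ φ : ∀ x, L.Fib x ≃ₗᵢ[ℂ] L'.Fib x, ∀ (O : Set X) (s : ∀ x, L.Fib x) (ξ : PreForm X 1),
    DOpen O → L.IsUnitSection O s ξ → L'.IsUnitSection O (fun x => φ x (s x)) ξ

end LineBundle

/-- `Line(X)`: isomorphism classes of hermitian line bundles with connection. -/
def LineClass (X : Type u) [DiffeologicalSpace X] : Type (u + 1) :=
  Quot (LineBundle.Iso (X := X))

/-- An isometric isomorphism `L₁ ⊗ L₂ ≅ L₃` of line bundles with connection over the open set `V`,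
written as a fibrewise bilinear map with `‖a · b‖ = ‖a‖ ‖b‖` which takes pairs of smooth unit
length sections with `∇ log s₁ = i ξ₁`, `∇ log s₂ = i ξ₂` to smooth unit length sections with
`∇ log (s₁ s₂) = i (ξ₁ + ξ₂)`. -/
structure TensorIso {X : Type u} [DiffeologicalSpace X] {W₁ W₂ W₃ : Set X}
    (L₁ : LineBundle X W₁) (L₂ : LineBundle X W₂) (L₃ : LineBundle X W₃) (V : Set X) where
  mul : ∀ x, L₁.Fib x →ₗ[ℂ] L₂.Fib x →ₗ[ℂ] L₃.Fib x
  norm_mul : ∀ x ∈ V, ∀ a b, ‖mul x a b‖ = ‖a‖ * ‖b‖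
  parallel : ∀ (O : Set X) (s₁ : ∀ x, L₁.Fib x) (s₂ : ∀ x, L₂.Fib x) (ξ₁ ξ₂ : PreForm X 1),
    DOpen O → O ⊆ V → L₁.IsUnitSection O s₁ ξ₁ → L₂.IsUnitSection O s₂ ξ₂ →
    L₃.IsUnitSection O (fun x => mul x (s₁ x) (s₂ x)) (ξ₁ + ξ₂)

/-! ### Gerbes with connection -/

/-- A gerbe with connection in the Čech picture.  The unit length parallel section
`θ_{αβγ}` of `L_{αβ} ⊗ L_{βγ} ⊗ L_{γα}` is recorded as the isometric parallel isomorphism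
`L_{αβ} ⊗ L_{βγ} ≅ L_{αγ}` (contract the inverse of `θ_{αβγ}` with `L_{γα} = L_{αγ}*`), and
`δ θ = 1` as its associativity.  The isomorphism `L_{βα} ≅ L_{αβ}*` and the trivialisation of
`L_{αα}` are those given by these products. -/
structure Gerbe (X : Type u) [DiffeologicalSpace X] where
  I : Type u
  U : I → Set X
  U_open : ∀ α, DOpen (U α)
  U_cover : ∀ x, ∃ α, x ∈ U α
  L : ∀ α β, LineBundle X (U α ∩ U β)
  θ : ∀ α β γ, TensorIso (L α β) (L β γ) (L α γ) (U α ∩ U β ∩ U γ)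
  assoc : ∀ α β γ δ x, x ∈ U α → x ∈ U β → x ∈ U γ → x ∈ U δ → ∀ a b c,
    (θ α γ δ).mul x ((θ α β γ).mul x a b) c = (θ α β δ).mul x a ((θ β γ δ).mul x b c)
  F : I → PreForm X 2
  F_form : ∀ α, IsForm (U α) (F α)
  /-- `F_β - F_α = c₁(∇^{L_{αβ}})` where `c₁(∇) = -(1/2πi) R^∇`, and `R^∇ = i dξ` for a unit
  length section `s` with `∇ log s = i ξ`. -/
  F_sub : ∀ α β (O : Set X) (s : ∀ x, (L α β).Fib x) (ξ : PreForm X 1),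
    DOpen O → O ⊆ U α ∩ U β → (L α β).IsUnitSection O s ξ →
    FormEq O (F β - F α) (-(1 / (2 * Real.pi)) • d ξ)

/-- An isomorphism of gerbes with connection: on a common refinement `W` of the two coverings,
line bundles with connection `N_κ` over `W_κ`, and isomorphisms
`N_κ ⊗ L'_{κμ} ≅ M_{κμ} ≅ L_{κμ} ⊗ N_μ`, i.e. `L'_{κμ} ≅ N_κ⁻¹ ⊗ L_{κμ} ⊗ N_μ`, compatible with
connections and with `θ`, `θ'`, such that `F'_κ = F_κ + c₁(∇^{N_κ})`. -/
structure GerbeIso {X : Type u} [DiffeologicalSpace X] (G G' : Gerbe X) where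
  K : Type u
  W : K → Set X
  W_open : ∀ κ, DOpen (W κ)
  W_cover : ∀ x, ∃ κ, x ∈ W κ
  r : K → G.I
  r' : K → G'.I
  W_subset : ∀ κ, W κ ⊆ G.U (r κ) ∩ G'.U (r' κ)
  N : ∀ κ, LineBundle X (W κ)
  M : ∀ κ μ, LineBundle X (W κ ∩ W μ)
  left : ∀ κ μ, TensorIso (N κ) (G'.L (r' κ) (r' μ)) (M κ μ) (W κ ∩ W μ)
  right : ∀ κ μ, TensorIso (G.L (r κ) (r μ)) (N μ) (M κ μ) (W κ ∩ W μ)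
  /-- If `a ↦ a'` and `b ↦ b'` then `a b ↦ a' b'`. -/
  compat : ∀ κ μ ν x, x ∈ W κ → x ∈ W μ → x ∈ W ν → ∀ a b a' b' n₁ n₂ n₃,
    (right κ μ).mul x a n₂ = (left κ μ).mul x n₁ a' →
    (right μ ν).mul x b n₃ = (left μ ν).mul x n₂ b' →
    (right κ ν).mul x ((G.θ (r κ) (r μ) (r ν)).mul x a b) n₃ =
      (left κ ν).mul x n₁ ((G'.θ (r' κ) (r' μ) (r' ν)).mul x a' b')
  F_eq : ∀ κ (O : Set X) (s : ∀ x, (N κ).Fib x) (ξ : PreForm X 1),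
    DOpen O → O ⊆ W κ → (N κ).IsUnitSection O s ξ →
    FormEq O (G'.F (r' κ)) (G.F (r κ) + (-(1 / (2 * Real.pi))) • d ξ)

/-- `Gerbe(X)`: isomorphism classes of gerbes with connection. -/
def GerbeClass (X : Type u) [DiffeologicalSpace X] : Type (u + 1) :=
  Quot fun G G' : Gerbe X => Nonempty (GerbeIso G G')

/-- `G''` is the product `G ⊗ G'` (formed on a common refinement of the coverings). -/
structure GerbeProduct {X : Type u} [DiffeologicalSpace X] (G G' G'' : Gerbe X) where
  r : G''.I → G.I
  r' : G''.I → G'.I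
  U_subset : ∀ κ, G''.U κ ⊆ G.U (r κ) ∩ G'.U (r' κ)
  iso : ∀ κ μ, TensorIso (G.L (r κ) (r μ)) (G'.L (r' κ) (r' μ)) (G''.L κ μ) (G''.U κ ∩ G''.U μ)
  compat : ∀ κ μ ν x, x ∈ G''.U κ → x ∈ G''.U μ → x ∈ G''.U ν → ∀ a b a' b',
    (G''.θ κ μ ν).mul x ((iso κ μ).mul x a a') ((iso μ ν).mul x b b') =
      (iso κ ν).mul x ((G.θ (r κ) (r μ) (r ν)).mul x a b)
        ((G'.θ (r' κ) (r' μ) (r' ν)).mul x a' b')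
  F_eq : ∀ κ, FormEq (G''.U κ) (G''.F κ) (G.F (r κ) + G'.F (r' κ))

/-! ### Deligne cohomology in the Čech picture

The complex `𝒦ᵖ` is `U(1) → Ω¹ → ⋯ → Ωᵖ` with first differential `(1/2πi) d log`.  The total
differential of the Čech double complex is `δ + (-1)ᵖ d` on Čech degree `p`; cochains are
alternating. -/

/-- Čech 1-cocycles of `𝒦¹` on some open covering. -/
structure Cocycle1 (X : Type u) [DiffeologicalSpace X] where
  I : Type u
  U : I → Set X
  U_open : ∀ i, DOpen (U i)
  U_cover : ∀ x, ∃ i, x ∈ U i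
  u : I → I → X → Circle
  u_smooth : ∀ i j, SmoothOn (U i ∩ U j) fun x => (u i j x : ℂ)
  A : I → PreForm X 1
  A_form : ∀ i, IsForm (U i) (A i)
  u_self : ∀ i, ∀ x ∈ U i, u i i x = 1
  u_swap : ∀ i j, ∀ x ∈ U i ∩ U j, u j i x = (u i j x)⁻¹
  cocycle_u : ∀ i j k x, x ∈ U i → x ∈ U j → x ∈ U k → u j k x * (u i k x)⁻¹ * u i j x = 1
  cocycle_A : ∀ i j, FormEq (U i ∩ U j)
    (-((1 / (2 * Real.pi)) • dlog fun x => (u i j x : ℂ)) + (A j - A i)) 0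

/-- Čech 2-cocycles of `𝒦²` on some open covering. -/
structure Cocycle2 (X : Type u) [DiffeologicalSpace X] where
  I : Type u
  U : I → Set X
  U_open : ∀ i, DOpen (U i)
  U_cover : ∀ x, ∃ i, x ∈ U i
  θ : I → I → I → X → Circle
  θ_smooth : ∀ i j k, SmoothOn (U i ∩ U j ∩ U k) fun x => (θ i j k x : ℂ)
  a : I → I → PreForm X 1
  a_form : ∀ i j, IsForm (U i ∩ U j) (a i j)
  f : I → PreForm X 2
  f_form : ∀ i, IsForm (U i) (f i)
  θ_self : ∀ i j, ∀ x ∈ U i ∩ U j, θ i i j x = 1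
  θ_swap₁ : ∀ i j k, ∀ x ∈ U i ∩ U j ∩ U k, θ j i k x = (θ i j k x)⁻¹
  θ_swap₂ : ∀ i j k, ∀ x ∈ U i ∩ U j ∩ U k, θ i k j x = (θ i j k x)⁻¹
  a_self : ∀ i, FormEq (U i) (a i i) 0
  a_swap : ∀ i j, FormEq (U i ∩ U j) (a j i) (-a i j)
  cocycle_θ : ∀ i j k l x, x ∈ U i → x ∈ U j → x ∈ U k → x ∈ U l →
    θ j k l x * (θ i k l x)⁻¹ * θ i j l x * (θ i j k x)⁻¹ = 1
  cocycle_a : ∀ i j k, FormEq (U i ∩ U j ∩ U k)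
    ((1 / (2 * Real.pi)) • (dlog fun x => (θ i j k x : ℂ)) + (a j k - a i k + a i j)) 0
  cocycle_f : ∀ i j, FormEq (U i ∩ U j) (-d (a i j) + (f j - f i)) 0

section Deligne

variable {X : Type u} [DiffeologicalSpace X]

/-- The restrictions of two cocycles to a common refinement `W` differ by the total differential
of `h ∈ C⁰(W, U(1))`. -/
structure Cohomologous1 (c c' : Cocycle1 X) where
  K : Type u
  W : K → Set X
  W_open : ∀ κ, DOpen (W κ)
  W_cover : ∀ x, ∃ κ, x ∈ W κ
  r : K → c.I
  r' : K → c'.I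
  W_subset : ∀ κ, W κ ⊆ c.U (r κ) ∩ c'.U (r' κ)
  h : K → X → Circle
  h_smooth : ∀ κ, SmoothOn (W κ) fun x => (h κ x : ℂ)
  u_eq : ∀ κ μ, ∀ x ∈ W κ ∩ W μ,
    c.u (r κ) (r μ) x * (c'.u (r' κ) (r' μ) x)⁻¹ = h μ x * (h κ x)⁻¹
  A_eq : ∀ κ, FormEq (W κ) (c.A (r κ) - c'.A (r' κ))
    ((1 / (2 * Real.pi)) • dlog fun x => (h κ x : ℂ))

/-- The restrictions of two cocycles to a common refinement `W` differ by the total differential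
of `(h, β) ∈ C¹(W, U(1)) ⊕ C⁰(W, Ω¹)`. -/
structure Cohomologous2 (c c' : Cocycle2 X) where
  K : Type u
  W : K → Set X
  W_open : ∀ κ, DOpen (W κ)
  W_cover : ∀ x, ∃ κ, x ∈ W κ
  r : K → c.I
  r' : K → c'.I
  W_subset : ∀ κ, W κ ⊆ c.U (r κ) ∩ c'.U (r' κ)
  h : K → K → X → Circle
  h_smooth : ∀ κ μ, SmoothOn (W κ ∩ W μ) fun x => (h κ μ x : ℂ)
  h_self : ∀ κ, ∀ x ∈ W κ, h κ κ x = 1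
  h_swap : ∀ κ μ, ∀ x ∈ W κ ∩ W μ, h μ κ x = (h κ μ x)⁻¹
  β : K → PreForm X 1
  β_form : ∀ κ, IsForm (W κ) (β κ)
  θ_eq : ∀ κ μ ν, ∀ x ∈ W κ ∩ W μ ∩ W ν,
    c.θ (r κ) (r μ) (r ν) x * (c'.θ (r' κ) (r' μ) (r' ν) x)⁻¹ =
      h μ ν x * (h κ ν x)⁻¹ * h κ μ x
  a_eq : ∀ κ μ, FormEq (W κ ∩ W μ) (c.a (r κ) (r μ) - c'.a (r' κ) (r' μ))
    (-((1 / (2 * Real.pi)) • dlog fun x => (h κ μ x : ℂ)) + (β μ - β κ))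
  f_eq : ∀ κ, FormEq (W κ) (c.f (r κ) - c'.f (r' κ)) (d (β κ))

variable (X) in
/-- `H¹(X, 𝒦¹)`, the colimit of Čech cohomology over all open coverings. -/
def H1 : Type (u + 1) := Quot fun c c' : Cocycle1 X => Nonempty (Cohomologous1 c c')

variable (X) in
/-- `H²(X, 𝒦²)`, the colimit of Čech cohomology over all open coverings. -/
def H2 : Type (u + 1) := Quot fun c c' : Cocycle2 X => Nonempty (Cohomologous2 c c')

def H1.mk (c : Cocycle1 X) : H1 X := Quot.mk _ c

def H2.mk (c : Cocycle2 X) : H2 X := Quot.mk _ c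

/-- `c''` is the sum of `c` and `c'` on a common refinement. -/
def IsSum1 (c c' c'' : Cocycle1 X) : Prop :=
  ∃ (r : c''.I → c.I) (r' : c''.I → c'.I),
    (∀ κ, c''.U κ ⊆ c.U (r κ) ∩ c'.U (r' κ)) ∧
    (∀ κ μ, ∀ x ∈ c''.U κ ∩ c''.U μ,
      c''.u κ μ x = c.u (r κ) (r μ) x * c'.u (r' κ) (r' μ) x) ∧
    ∀ κ, FormEq (c''.U κ) (c''.A κ) (c.A (r κ) + c'.A (r' κ))

/-- `c''` is the sum of `c` and `c'` on a common refinement. -/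
def IsSum2 (c c' c'' : Cocycle2 X) : Prop :=
  ∃ (r : c''.I → c.I) (r' : c''.I → c'.I),
    (∀ κ, c''.U κ ⊆ c.U (r κ) ∩ c'.U (r' κ)) ∧
    (∀ κ μ ν, ∀ x ∈ c''.U κ ∩ c''.U μ ∩ c''.U ν,
      c''.θ κ μ ν x = c.θ (r κ) (r μ) (r ν) x * c'.θ (r' κ) (r' μ) (r' ν) x) ∧
    (∀ κ μ, FormEq (c''.U κ ∩ c''.U μ) (c''.a κ μ)
      (c.a (r κ) (r μ) + c'.a (r' κ) (r' μ))) ∧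
    ∀ κ, FormEq (c''.U κ) (c''.f κ) (c.f (r κ) + c'.f (r' κ))

/-! Pullback along smooth maps. -/

variable {Y : Type u} [DiffeologicalSpace Y] {φ : Y → X}

theorem DOpen.preimage (hφ : DSmooth φ) {V : Set X} (hV : DOpen V) : DOpen (φ ⁻¹' V) :=
  isOpen_iff_preimages_plots.2 fun n p hp =>
    isOpen_iff_preimages_plots.1 hV n (φ ∘ p) (hφ n p hp)

theorem SmoothOn.pullback (hφ : DSmooth φ) {V : Set X} {g : X → ℂ} (hg : SmoothOn V g) :
    SmoothOn (φ ⁻¹' V) fun y => g (φ y) :=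
  fun n p hp => hg n (φ ∘ p) (hφ n p hp)

theorem IsForm.pullback (hφ : DSmooth φ) {k : ℕ} {V : Set X} {ξ : PreForm X k}
    (hξ : IsForm V ξ) : IsForm (φ ⁻¹' V) (ξ.pullback φ) :=
  ⟨fun n p hp => hξ.smooth n (φ ∘ p) (hφ n p hp),
    fun m n p f hp hf w hw => hξ.natural m n (φ ∘ p) f (hφ n p hp) hf w hw⟩

theorem FormEq.pullback (hφ : DSmooth φ) {k : ℕ} {V : Set X} {ξ η : PreForm X k}
    (h : FormEq V ξ η) : FormEq (φ ⁻¹' V) (ξ.pullback φ) (η.pullback φ) :=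
  fun n p hp w hw => h n (φ ∘ p) (hφ n p hp) w hw

/-- The pulled back cocycle `φ* c`. -/
def Cocycle2.pullback (c : Cocycle2 X) (φ : Y → X) (hφ : DSmooth φ) : Cocycle2 Y where
  I := c.I
  U i := φ ⁻¹' c.U i
  U_open i := (c.U_open i).preimage hφ
  U_cover y := c.U_cover (φ y)
  θ i j k y := c.θ i j k (φ y)
  θ_smooth i j k := (c.θ_smooth i j k).pullback hφ
  a i j := (c.a i j).pullback φ
  a_form i j := (c.a_form i j).pullback hφ
  f i := (c.f i).pullback φ
  f_form i := (c.f_form i).pullback hφ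
  θ_self i j y hy := c.θ_self i j (φ y) hy
  θ_swap₁ i j k y hy := c.θ_swap₁ i j k (φ y) hy
  θ_swap₂ i j k y hy := c.θ_swap₂ i j k (φ y) hy
  a_self i := (c.a_self i).pullback hφ
  a_swap i j := (c.a_swap i j).pullback hφ
  cocycle_θ i j k l y := c.cocycle_θ i j k l (φ y)
  cocycle_a i j k := (c.cocycle_a i j k).pullback hφ
  cocycle_f i j := (c.cocycle_f i j).pullback hφ

/-- The pullback `φ* : H²(X, 𝒦²) → H²(Y, 𝒦²)`. -/
def H2.pullback (φ : Y → X) (hφ : DSmooth φ) : H2 X → H2 Y :=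
  Quot.map (fun c => c.pullback φ hφ) fun _ _ ⟨b⟩ => ⟨{
    K := b.K
    W := fun κ => φ ⁻¹' b.W κ
    W_open := fun κ => (b.W_open κ).preimage hφ
    W_cover := fun y => b.W_cover (φ y)
    r := b.r
    r' := b.r'
    W_subset := fun κ _ hy => b.W_subset κ hy
    h := fun κ μ y => b.h κ μ (φ y)
    h_smooth := fun κ μ => (b.h_smooth κ μ).pullback hφ
    h_self := fun κ y hy => b.h_self κ (φ y) hy
    h_swap := fun κ μ y hy => b.h_swap κ μ (φ y) hy
    β := fun κ => (b.β κ).pullback φ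
    β_form := fun κ => (b.β_form κ).pullback hφ
    θ_eq := fun κ μ ν y hy => b.θ_eq κ μ ν (φ y) hy
    a_eq := fun κ μ => (b.a_eq κ μ).pullback hφ
    f_eq := fun κ => (b.f_eq κ).pullback hφ }⟩

end Deligne

/-! ### Subdivisions of the circle -/

/-- A strictly monotone map `t : ℤ/n → S¹`, `n ≥ 1`, of cyclically ordered sets, together with the
lengths of the arcs `[t(i), t(i+1)]`, the circle having total length one. -/
structure Subdivision where
  n : ℕ
  [neZero : NeZero n]
  t : ZMod n → Circle
  len : ZMod n → ℝ
  len_pos : ∀ i, 0 < len i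
  sum_len : ∑ i, len i = 1
  t_succ : ∀ i, t (i + 1) = t i * Circle.exp (2 * Real.pi * len i)

attribute [instance] Subdivision.neZero

/-- The point of the arc `[t(i), t(i+1)]` at distance `τ ∈ [0, len i]` from `t(i)`. -/
def Subdivision.point (P : Subdivision) (i : ZMod P.n) (τ : ℝ) : Circle :=
  P.t i * Circle.exp (2 * Real.pi * τ)

/-- `(Q, s')` refines `(P, s)` via the monotone map `r : ℤ/n → ℤ/m`: `t = t' ∘ r`, and
`s' = s(j)` on `[r(j), r(j+1)) = {r(j), …, r(j) + k(j)}`. -/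
structure IsRefinement {I : Type u} (P : Subdivision) (s : ZMod P.n → I)
    (Q : Subdivision) (s' : ZMod Q.n → I) (r : ZMod P.n → ZMod Q.n) (k : ZMod P.n → ℕ) : Prop where
  t_eq : ∀ j, Q.t (r j) = P.t j
  r_succ : ∀ j, r (j + 1) = r j + (k j : ZMod Q.n) + 1
  sum_k : ∑ j, (k j + 1) = Q.n
  label : ∀ j, ∀ l ≤ k j, s' (r j + (l : ZMod Q.n)) = s j

/-! ### Integration over the fibre in Deligne cohomology -/

section FibreIntegral

variable {X : Type u} [DiffeologicalSpace X]

/-- The inclusion `ℝⁿ → ℝⁿ⁺¹`, `v ↦ (v, 0)`. -/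
def appendZero (n : ℕ) : Euc n →L[ℝ] Euc (n + 1) :=
  LinearMap.toContinuousLinearMap
    { toFun := fun v => WithLp.toLp 2 (Fin.snoc (α := fun _ => ℝ) v.ofLp 0)
      map_add' := fun v w => by
        ext i
        refine Fin.lastCases ?_ (fun j => ?_) i <;> simp
      map_smul' := fun a v => by
        ext i
        refine Fin.lastCases ?_ (fun j => ?_) i <;> simp }

/-- `∫ i_{∂t} ξ dt` over the arc of length `ℓ` starting at `z`, for a form `ξ` on `X × S¹`. -/
def fibreIntegral {k : ℕ} (z : Circle) (ℓ : ℝ) (ξ : PreForm (X × Circle) (k + 1)) :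
    PreForm X k := fun n p w =>
  ∫ τ in (0 : ℝ)..ℓ,
    ((ξ (n + 1)
        (fun y => (p (WithLp.toLp 2 fun j => y (Fin.castSucc j)),
          z * Circle.exp (2 * Real.pi * y (Fin.last n))))
        (WithLp.toLp 2 (Fin.snoc (α := fun _ => ℝ) w.ofLp τ))).curryLeft
      (EuclideanSpace.single (Fin.last n) 1)).compContinuousLinearMap (appendZero n)

/-- The `U(1)`-valued part of the fibre integral of a 2-cocycle: for two labellings `s`, `s'` of
the arcs of `Q`,
`∏ᵢ exp(2πi ∫_{[t(i),t(i+1)]} a_{s(i)s'(i)}) θ_{s(i)s'(i)s'(i+1)} θ_{s(i)s(i+1)s'(i+1)}⁻¹`,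
the values of `θ` being taken at `(x, t(i+1))`. -/
def fibreTransition (c : Cocycle2 (X × Circle)) (Q : Subdivision) (s s' : ZMod Q.n → c.I)
    (x : X) : Circle :=
  ∏ i, Circle.exp (2 * Real.pi *
        ∫ τ in (0 : ℝ)..Q.len i, alongCurve (c.a (s i) (s' i)) (fun τ' => (x, Q.point i τ')) τ) *
      c.θ (s i) (s' i) (s' (i + 1)) (x, Q.t (i + 1)) *
      (c.θ (s i) (s (i + 1)) (s' (i + 1)) (x, Q.t (i + 1)))⁻¹

/-- The Čech cocycle `e` on `X` is an integral over the fibre of the Čech cocycle `c` on `X × S¹`: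
the arcs of a subdivision `P j` are labelled by `s j` such that
`U_j × [t(i), t(i+1)] ⊆ U_{s(i)}`; the 1-forms are
`∑ᵢ -∫_{[t(i),t(i+1)]} i_{∂t} f_{s(i)} dt - ∑ᵢ a_{s(i)s(i+1)}|_{t(i+1)}`, and the transition
functions are computed on a common refinement of the subdivisions. -/
def IsFibreIntegral (c : Cocycle2 (X × Circle)) (e : Cocycle1 X) : Prop :=
  ∃ (P : e.I → Subdivision) (s : ∀ j, ZMod (P j).n → c.I),
    (∀ j, ∀ x ∈ e.U j, ∀ i, ∀ τ ∈ Icc 0 ((P j).len i), (x, (P j).point i τ) ∈ c.U (s j i)) ∧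
    (∀ j, FormEq (e.U j) (e.A j)
      (-(∑ i, fibreIntegral ((P j).t i) ((P j).len i) (c.f (s j i)))
        - ∑ i, (c.a (s j i) (s j (i + 1))).pullback fun x => (x, (P j).t (i + 1)))) ∧
    ∀ j j', ∀ x ∈ e.U j ∩ e.U j', ∀ (Q : Subdivision) (s₁ s₂ : ZMod Q.n → c.I) r₁ k₁ r₂ k₂,
      IsRefinement (P j) (s j) Q s₁ r₁ k₁ → IsRefinement (P j') (s j') Q s₂ r₂ k₂ →
      e.u j j' x = fibreTransition c Q s₁ s₂ x

/-- `J` is the integration over the fibre `∫_{S¹} : H²(X × S¹, 𝒦²) → H¹(X, 𝒦¹)`. -/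
def IsFibreIntegration (J : H2 (X × Circle) → H1 X) : Prop :=
  (∀ c : Cocycle2 (X × Circle), ∃ e, IsFibreIntegral c e) ∧
    ∀ (c : Cocycle2 (X × Circle)) e, IsFibreIntegral c e → J (H2.mk c) = H1.mk e

end FibreIntegral

/-! ### From geometric objects to Deligne cohomology -/

section CechRep

variable {X : Type u} [DiffeologicalSpace X]

/-- The cocycle of a line bundle with connection for unit length sections `s_j`: transition
functions `U_{jk} = s_j / s_k` and forms `-(1/2πi) ∇ log s_j`. -/
def LineBundle.HasCocycle (L : LineBundle X (univ : Set X)) (e : Cocycle1 X) : Prop :=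
  ∃ s : e.I → ∀ x, L.Fib x,
    (∀ j, L.IsUnitSection (e.U j) (s j) (-((2 * Real.pi) • e.A j))) ∧
    ∀ j k, ∀ x ∈ e.U j ∩ e.U k, s j x = e.u j k x • s k x

/-- The cocycle `(θ_{κμν}, (1/2πi) ∇ log s_{κμ}, -F_κ)` of a gerbe with connection, for unit length
sections `s_{κμ}` of the `L_{κμ}` on a refinement of the covering on which these bundles are
trivial; `θ_{κμν}` is identified with the function `θ_{κμν} / (s_{κμ} s_{μν} s_{νκ})`, which is
`s_{κν} / (s_{κμ} · s_{μν})` in terms of the product. -/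
def Gerbe.HasCocycle (G : Gerbe X) (c : Cocycle2 X) : Prop :=
  ∃ r : c.I → G.I, (∀ κ, c.U κ ⊆ G.U (r κ)) ∧
    ∃ s : ∀ κ μ x, (G.L (r κ) (r μ)).Fib x,
      (∀ κ μ, (G.L (r κ) (r μ)).IsUnitSection (c.U κ ∩ c.U μ) (s κ μ)
        ((2 * Real.pi) • c.a κ μ)) ∧
      (∀ κ μ ν, ∀ x ∈ c.U κ ∩ c.U μ ∩ c.U ν,
        c.θ κ μ ν x • (G.θ (r κ) (r μ) (r ν)).mul x (s κ μ x) (s μ ν x) = s κ ν x) ∧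
      ∀ κ, FormEq (c.U κ) (c.f κ) (-G.F (r κ))

/-- `l` is the isomorphism `Line(X) ≅ H¹(X, 𝒦¹)`: every line bundle with connection has a
cocycle, `l` takes its class to the class of any of its cocycles, and `l` takes tensor products
to sums. -/
def IsLineIso (l : LineClass X ≃ H1 X) : Prop :=
  (∀ L : LineBundle X (univ : Set X), ∃ e, L.HasCocycle e) ∧
  (∀ (L : LineBundle X (univ : Set X)) e, L.HasCocycle e → l (Quot.mk _ L) = H1.mk e) ∧
  ∀ L L' L'' : LineBundle X (univ : Set X), Nonempty (TensorIso L L' L'' univ) →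
    ∀ e e' e'', IsSum1 e e' e'' → l (Quot.mk _ L) = H1.mk e → l (Quot.mk _ L') = H1.mk e' →
      l (Quot.mk _ L'') = H1.mk e''

/-- `g` is the isomorphism `Gerbe(X) ≅ H²(X, 𝒦²)`: every gerbe with connection has a cocycle,
`g` takes its class to the class of any of its cocycles, and `g` takes products to sums. -/
def IsGerbeClassIso (g : GerbeClass X ≃ H2 X) : Prop :=
  (∀ G : Gerbe X, ∃ c, G.HasCocycle c) ∧
  (∀ (G : Gerbe X) c, G.HasCocycle c → g (Quot.mk _ G) = H2.mk c) ∧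
  ∀ G G' G'' : Gerbe X, Nonempty (GerbeProduct G G' G'') →
    ∀ c c' c'', IsSum2 c c' c'' → g (Quot.mk _ G) = H2.mk c → g (Quot.mk _ G') = H2.mk c' →
      g (Quot.mk _ G'') = H2.mk c''

end CechRep

/-! ### Geometric transgression of gerbes with connection -/

section Transgression

variable {E : Type v} [NormedAddCommGroup E] [NormedSpace ℝ E]
  {B : Type u} [TopologicalSpace B] [ChartedSpace E B]

/-- The open set `V(t, s) ⊆ LB` of all loops with `γ([t(i), t(i+1)]) ⊆ U_{s(i-1)} ∩ U_{s(i)}`. -/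
def loopSet (G : Gerbe (Mfd E B)) (P : Subdivision) (s : ZMod P.n → G.I) : Set (Loop E B) :=
  {γ | ∀ i, ∀ τ ∈ Icc 0 (P.len i), ev (γ, P.point i τ) ∈ G.U (s (i - 1)) ∩ G.U (s i)}

/-- Elements of the total spaces of all the `L_{αβ}`. -/
def Gerbe.Elt {X : Type u} [DiffeologicalSpace X] (G : Gerbe X) : Type u :=
  Σ (q : G.I × G.I) (x : X), (G.L q.1 q.2).Fib x

def Gerbe.elt {X : Type u} [DiffeologicalSpace X] (G : Gerbe X) {α β : G.I} {x : X}
    (v : (G.L α β).Fib x) : G.Elt := ⟨(α, β), x, v⟩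

/-- The elements `1` of the trivial bundles `L_{αα}`: the nonzero idempotents. -/
def Gerbe.IsOne {X : Type u} [DiffeologicalSpace X] (G : Gerbe X) (w : G.Elt) : Prop :=
  ∃ (α : G.I) (x : X) (e : (G.L α α).Fib x),
    e ≠ 0 ∧ (G.θ α α α).mul x e e = e ∧ w = G.elt e

/-- The line bundle with connection `T` over `LB` is glued from the local pieces
`⨂_{i ∈ ℤ/n} L_{s(i)s(i+1)}(γ(t(i+1)))` over the sets `V(t, s)`. -/
structure IsGlued (G : Gerbe (Mfd E B)) (T : LineBundle (Loop E B) (univ : Set (Loop E B))) where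
  /-- The identification of the local pieces with the restriction of `T` to `V(t, s)`, written as a
  multilinear map; off `V(t, s)` it plays no role. -/
  m : ∀ (P : Subdivision) (s : ZMod P.n → G.I) (γ : Loop E B),
    MultilinearMap ℂ (fun i : ZMod P.n => (G.L (s i) (s (i + 1))).Fib (ev (γ, P.t (i + 1))))
      (T.Fib γ)
  /-- It is isometric. -/
  norm_m : ∀ P s, ∀ γ ∈ loopSet G P s, ∀ v, ‖m P s γ v‖ = ∏ i, ‖v i‖
  /-- It is smooth: local smooth unit length sections of the `L_{s(i)s(i+1)}` give smooth unit
  length sections. -/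
  smooth_m : ∀ (P : Subdivision) (s : ZMod P.n → G.I) (O : ZMod P.n → Set (Mfd E B))
    (e : ∀ i x, (G.L (s i) (s (i + 1))).Fib x),
    (∀ i, DOpen (O i) ∧ O i ⊆ G.U (s i) ∩ G.U (s (i + 1)) ∧
      (G.L (s i) (s (i + 1))).IsSmoothUnit (O i) (e i)) →
    T.IsSmoothUnit (loopSet G P s ∩ {γ | ∀ i, ev (γ, P.t (i + 1)) ∈ O i})
      (fun γ => m P s γ fun i => e i (ev (γ, P.t (i + 1))))
  /-- Transition map for a refinement: the additional factors are `1 ∈ L_{αα}`. -/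
  refine_m : ∀ (P Q : Subdivision) (s : ZMod P.n → G.I) (s' : ZMod Q.n → G.I) r k,
    IsRefinement P s Q s' r k → ∀ γ ∈ loopSet G P s, ∀ v v',
      (∀ j, G.elt (v' (r j + (k j : ZMod Q.n))) = G.elt (v j)) →
      (∀ j, ∀ l < k j, G.IsOne (G.elt (v' (r j + (l : ZMod Q.n))))) →
      m Q s' γ v' = m P s γ v
  /-- Transition map for a change of the labels.  With `w i` of unit length in `L_{s(i)s'(i)}` at
  `γ(t(i))` and `w' i` its parallel transport along `γ|[t(i), t(i+1)]`, one has `⨂ v ↦ ⨂ v'` if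
  `v i = (w' i) (v' i) (w (i+1))⁻¹` for all `i`. -/
  relabel_m : ∀ (P : Subdivision) (s s' : ZMod P.n → G.I),
    ∀ γ ∈ loopSet G P s ∩ loopSet G P s', ∀ v v',
    ∀ (w : ∀ i, (G.L (s i) (s' i)).Fib (ev (γ, P.t i)))
      (w' : ∀ i, (G.L (s i) (s' i)).Fib (ev (γ, P.t (i + 1)))),
      (∀ i, ‖w i‖ = 1) →
      (∀ i, (G.L (s i) (s' i)).Transports (fun τ => ev (γ, P.point i τ)) 0 (P.len i)
        ⟨_, w i⟩ ⟨_, w' i⟩) →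
      (∀ i, (G.θ (s i) (s (i + 1)) (s' (i + 1))).mul _ (v i) (w (i + 1)) =
        (G.θ (s i) (s' i) (s' (i + 1))).mul _ (w' i) (v' i)) →
      m P s' γ v' = m P s γ v
  /-- The connection of `T`: parallel transport along a path `Γ : [a, b] → V(t, s)` is
  `⨂ᵢ ‖_{Γᵢ} · ∏ᵢ exp(2πi ∫ Γ* F_{s(i)})`, the integral being over `[a, b] × [t(i), t(i+1)]`
  oriented with the circle direction first. -/
  transport_m : ∀ (P : Subdivision) (s : ZMod P.n → G.I) (Γ : ℝ → Loop E B) (a b : ℝ),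
    IsCurve Γ → a ≤ b → (∀ x ∈ Icc a b, Γ x ∈ loopSet G P s) → ∀ v v',
    (∀ i, (G.L (s i) (s (i + 1))).Transports (fun x => ev (Γ x, P.t (i + 1))) a b
      ⟨_, v i⟩ ⟨_, v' i⟩) →
    T.Transports Γ a b ⟨Γ a, m P s (Γ a) v⟩
      ⟨Γ b, Circle.exp (2 * Real.pi * ∑ i, ∫ x in a..b, ∫ τ in (0 : ℝ)..P.len i,
          alongSurface (G.F (s i)) (fun x' τ' => ev (Γ x', P.point i τ')) x τ) •
        m P s (Γ b) v'⟩

/-- `T : Gerbe(B) → Line(LB)` is the geometric transgression: for every gerbe with connection the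
local pieces glue to a line bundle with connection over `LB`, and `T` takes the class of the
gerbe to the class of any line bundle so obtained. -/
def IsTransgression (T : GerbeClass (Mfd E B) → LineClass (Loop E B)) : Prop :=
  (∀ G : Gerbe (Mfd E B), ∃ L, Nonempty (IsGlued G L)) ∧
  ∀ (G : Gerbe (Mfd E B)) L, Nonempty (IsGlued G L) → T (Quot.mk _ G) = Quot.mk _ L

end Transgression

end GerbeTransgression

end

open GerbeTransgression

/-!
# Transgression of gerbes and integration over the fibre

All spaces are treated as diffeological spaces, and functions and forms are evaluated on plots; the
loop space needs no manifold structure. A function `g` of modulus one has the logarithmic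
derivative `dlog g`, and a local unit section `s` of a line bundle with `∇ s = i ξ s` is handled
through its connection form `ξ`.

*Classification.* The frames of a line bundle give a Čech 1-cocycle, and gluing trivial bundles
reverses this; isomorphisms correspond to coboundaries (`cohomologous_of_iso`,
`iso_of_cohomologous`), hence `lineEquiv`. For gerbes one needs a covering such that the `L_{αβ}`
have sections on double intersections. It exists on a manifold by paracompactness
(`exists_small_refinement`), and the sections can be made alternating by ordering the indices and
dividing sections (`Gerbe.exists_triv`). Comparing the sections `s_{jk} n_k` and `n_j s'_{jk}` of
the bundles of an isomorphism of gerbes gives a coboundary (`cohomologous_of_sections`); conversely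
a cocycle defines a gerbe with trivial bundles (`gerbeOf`), hence `gerbeEquiv`.

*Integration over the fibre.* The transition functions are products `arcProd` of holonomies
`exp(2πi ∫ bᵢ)` over the arcs of a subdivision and of factors at the points of division, and the
forms are sums `arcForm`. Stokes' formula for an arc (`fderiv_arcInt`) gives the logarithmic
derivative of such a product (`unitOn_arcProd`). Adding logarithmic derivatives to the `bᵢ` only
moves factors between points of division (`arcProd_gauge`), which yields the cocycle identity
(`fibreTransition_mul`) and the effect of a coboundary (`Cohomologous2.fibreTransition_mul`);
refinements of the subdivision do not matter (`arcProd_refine`, `arcForm_refine`). So the cocycle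
`fibreCocycle`, indexed by all labelled subdivisions, is a fibre integral, and any fibre integrals
of cohomologous cocycles are cohomologous (`IsFibreIntegral.cohomologous`).

*Transgression.* Let `c` be a cocycle of the gerbe with sections `s_{κμ}`, and let `T` be a
transgression. The elements `⨂ᵢ s_{κ(i)κ(i+1)}` of the local pieces define local unit sections
of `T`. By the rules for changes of the labels and for parallel transport, their transition
functions and connection forms are exactly those of the fibre integral of `ev* c`
(`IsGlued.hasCocycle`). This shows both that the class of `T` is determined by that of the gerbe and
that `l ∘ T = ∫ ∘ ev* ∘ g`.

It remains to show that a transgression exists. Choose the cocycle such that the `U_κ` with label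
`α` cover `U_α`, for all `α` (`Gerbe.exists_full_sections`), and let `L` be a line bundle with the
cocycle `fibreCocycle (ev* c)` and sections `σ`. Over the loops in `V(P, s)` the labels `s` lift
locally to labels `κ` of the cocycle on a refinement of `P` (`exists_lift`). An element `⨂ v` of the
local piece is then sent to the product of its coordinates with respect to the `s_{κμ}` times the
section `σ` for `κ` (`fillMap`, `glueMap`). This does not depend on the lift, and it is compatible
with changes of the labels (`fillMap_relabel`), refinements (`fillMap_insert`) and parallel
transport (`transports_glueMap`), so that `L` is a transgression.
-/

noncomputable section

set_option linter.unusedSectionVars false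

namespace GerbeTransgression

/-! ### Smooth functions and forms on D-open sets -/

section FormCalculus

variable {X : Type u} [DiffeologicalSpace X] {k : ℕ} {V V' : Set X}

theorem DOpen.plot (hV : DOpen V) {n : ℕ} {p : Euc n → X} (hp : IsPlot p) : IsOpen (p ⁻¹' V) :=
  isOpen_iff_preimages_plots.1 hV n p hp

theorem dOpen_iff : DOpen V ↔ ∀ (n : ℕ) (p : Euc n → X), IsPlot p → IsOpen (p ⁻¹' V) :=
  isOpen_iff_preimages_plots

theorem DOpen.inter (h : DOpen V) (h' : DOpen V') : DOpen (V ∩ V') :=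
  dOpen_iff.2 fun _ _ hp => (h.plot hp).inter (h'.plot hp)

theorem DOpen.iInter {ι : Type*} [Finite ι] {O : ι → Set X} (h : ∀ i, DOpen (O i)) :
    DOpen (⋂ i, O i) :=
  dOpen_iff.2 fun _ p hp => by
    rw [preimage_iInter]
    exact isOpen_iInter_of_finite fun i => (h i).plot hp

theorem single_one_eq (τ : ℝ) :
    (EuclideanSpace.single 0 τ : Euc 1) = τ • EuclideanSpace.single 0 1 := by
  ext i
  fin_cases i
  simp

theorem contDiff_single_one : ContDiff ℝ ∞ fun τ : ℝ => (EuclideanSpace.single 0 τ : Euc 1) := by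
  have e := funext single_one_eq
  rw [e]
  exact contDiff_id.smul contDiff_const

theorem hasDerivAt_single_one (τ : ℝ) :
    HasDerivAt (fun τ : ℝ => (EuclideanSpace.single 0 τ : Euc 1)) (EuclideanSpace.single 0 1) τ := by
  have := (hasDerivAt_id τ).smul_const (EuclideanSpace.single 0 1 : Euc 1)
  rw [one_smul] at this
  exact this.congr_of_eventuallyEq (Filter.Eventually.of_forall single_one_eq)

theorem IsCurve.isOpen_preimage {c : ℝ → X} (hc : IsCurve c) (hV : DOpen V) :
    IsOpen (c ⁻¹' V) := by
  have h := hV.plot hc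
  have h2 := contDiff_single_one.continuous
  convert h.preimage h2 using 1
  ext τ
  simp

theorem SmoothOn.mono {g : X → ℂ} (h : SmoothOn V g) (hV : V' ⊆ V) : SmoothOn V' g :=
  fun n p hp => (h n p hp).mono (preimage_mono hV)

theorem SmoothOn.congr {g g' : X → ℂ} (h : SmoothOn V g) (hg : ∀ x ∈ V, g' x = g x) :
    SmoothOn V g' :=
  fun n p hp => (h n p hp).congr fun w hw => hg (p w) hw

theorem SmoothOn.mul {g g' : X → ℂ} (h : SmoothOn V g) (h' : SmoothOn V g') :
    SmoothOn V fun x => g x * g' x :=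
  fun n p hp => (h n p hp).mul (h' n p hp)

theorem SmoothOn.conj {g : X → ℂ} (h : SmoothOn V g) :
    SmoothOn V fun x => starRingEnd ℂ (g x) :=
  fun n p hp => (Complex.conjCLE.contDiff (n := ∞)).comp_contDiffOn (h n p hp)

theorem SmoothOn.const (z : ℂ) : SmoothOn V fun _ => z := fun _ _ _ => contDiffOn_const

theorem SmoothOn.prod {ι : Type*} (s : Finset ι) {g : ι → X → ℂ} (h : ∀ i ∈ s, SmoothOn V (g i)) :
    SmoothOn V fun x => ∏ i ∈ s, g i x :=
  fun n p hp => contDiffOn_prod fun i hi => h i hi n p hp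

theorem SmoothOn.of_local {g : X → ℂ}
    (h : ∀ x ∈ V, ∃ O, DOpen O ∧ x ∈ O ∧ SmoothOn (V ∩ O) g) : SmoothOn V g := by
  intro n p hp w hw
  obtain ⟨O, hO, hx, hg⟩ := h (p w) hw
  exact (hg n p hp w ⟨hw, hx⟩).mono_of_mem_nhdsWithin
    (Filter.inter_mem self_mem_nhdsWithin (mem_nhdsWithin_of_mem_nhds ((hO.plot hp).mem_nhds hx)))

theorem SmoothOn.contDiffAt {g : X → ℂ} (h : SmoothOn V g) (hV : DOpen V) {n : ℕ}
    {p : Euc n → X} (hp : IsPlot p) {w : Euc n} (hw : p w ∈ V) :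
    ContDiffAt ℝ ∞ (fun w => g (p w)) w :=
  (h n p hp).contDiffAt ((hV.plot hp).mem_nhds hw)

theorem SmoothOn.differentiableAt {g : X → ℂ} (h : SmoothOn V g) (hV : DOpen V) {n : ℕ}
    {p : Euc n → X} (hp : IsPlot p) {w : Euc n} (hw : p w ∈ V) :
    DifferentiableAt ℝ (fun w => g (p w)) w :=
  (h.contDiffAt hV hp hw).differentiableAt (by simp)

/-! Agreement of forms on a set. -/

section FormEq

variable {ξ η ζ ξ' η' : PreForm X k}

theorem FormEq.refl (V : Set X) (ξ : PreForm X k) : FormEq V ξ ξ := fun _ _ _ _ _ => rfl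

theorem FormEq.symm (h : FormEq V ξ η) : FormEq V η ξ := fun n p hp w hw => (h n p hp w hw).symm

theorem FormEq.trans (h : FormEq V ξ η) (h' : FormEq V η ζ) : FormEq V ξ ζ :=
  fun n p hp w hw => (h n p hp w hw).trans (h' n p hp w hw)

theorem FormEq.mono (h : FormEq V ξ η) (hV : V' ⊆ V) : FormEq V' ξ η :=
  fun n p hp w hw => h n p hp w (hV hw)

theorem FormEq.add (h : FormEq V ξ η) (h' : FormEq V ξ' η') : FormEq V (ξ + ξ') (η + η') :=
  fun n p hp w hw => congrArg₂ (· + ·) (h n p hp w hw) (h' n p hp w hw)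

theorem FormEq.sub (h : FormEq V ξ η) (h' : FormEq V ξ' η') : FormEq V (ξ - ξ') (η - η') :=
  fun n p hp w hw => congrArg₂ (· - ·) (h n p hp w hw) (h' n p hp w hw)

theorem FormEq.smul (c : ℝ) (h : FormEq V ξ η) : FormEq V (c • ξ) (c • η) :=
  fun n p hp w hw => congrArg (fun z => c • z) (h n p hp w hw)

theorem FormEq.of_local (h : ∀ x ∈ V, ∃ O, x ∈ O ∧ FormEq (V ∩ O) ξ η) : FormEq V ξ η := by
  intro n p hp w hw
  obtain ⟨O, hx, hg⟩ := h (p w) hw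
  exact hg n p hp w ⟨hw, hx⟩

theorem FormEq.d (h : FormEq V ξ η) (hV : DOpen V) :
    FormEq V (GerbeTransgression.d ξ) (GerbeTransgression.d η) := by
  intro n p hp w hw
  refine Filter.EventuallyEq.extDeriv_eq ?_
  filter_upwards [(hV.plot hp).mem_nhds hw] with w' hw'
  exact h n p hp w' hw'

end FormEq

theorem preForm_sum_apply {ι : Type*} (s : Finset ι) (ξ : ι → PreForm X k) (n : ℕ)
    (p : Euc n → X) (w : Euc n) : (∑ i ∈ s, ξ i) n p w = ∑ i ∈ s, ξ i n p w := by
  classical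
  induction s using Finset.induction_on with
  | empty => rfl
  | insert a s ha ih => rw [Finset.sum_insert ha, Finset.sum_insert ha, ← ih]; rfl

/-! The conditions defining a form are local and stable under linear combinations. -/

section IsForm

variable {ξ η : PreForm X k}

theorem IsForm.mono (h : IsForm V ξ) (hV : V' ⊆ V) : IsForm V' ξ :=
  ⟨fun n p hp => (h.smooth n p hp).mono (preimage_mono hV),
    fun m n p f hp hf w hw => h.natural m n p f hp hf w (hV hw)⟩

theorem IsForm.congr (h : IsForm V ξ) (he : FormEq V η ξ) : IsForm V η :=
  ⟨fun n p hp => (h.smooth n p hp).congr fun w hw => he n p hp w hw,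
    fun m n p f hp hf w hw => by
      rw [he n p hp _ hw, he m (p ∘ f) (isPlot_reparam hp hf) w hw]
      exact h.natural m n p f hp hf w hw⟩

theorem IsForm.of_local (h : ∀ x ∈ V, ∃ O, DOpen O ∧ x ∈ O ∧ IsForm (V ∩ O) ξ) : IsForm V ξ := by
  refine ⟨fun n p hp w hw => ?_, fun m n p f hp hf w hw => ?_⟩
  · obtain ⟨O, hO, hx, hg⟩ := h (p w) hw
    exact (hg.smooth n p hp w ⟨hw, hx⟩).mono_of_mem_nhdsWithin
      (Filter.inter_mem self_mem_nhdsWithin (mem_nhdsWithin_of_mem_nhds ((hO.plot hp).mem_nhds hx)))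
  · obtain ⟨O, hO, hx, hg⟩ := h (p (f w)) hw
    exact hg.natural m n p f hp hf w ⟨hw, hx⟩

theorem IsForm.add (h : IsForm V ξ) (h' : IsForm V η) : IsForm V (ξ + η) :=
  ⟨fun n p hp => (h.smooth n p hp).add (h'.smooth n p hp), fun m n p f hp hf w hw => by
    simp only [Pi.add_apply, h.natural m n p f hp hf w hw, h'.natural m n p f hp hf w hw]
    rfl⟩

theorem IsForm.smul (c : ℝ) (h : IsForm V ξ) : IsForm V (c • ξ) :=
  ⟨fun n p hp => (h.smooth n p hp).const_smul c, fun m n p f hp hf w hw => by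
    simp only [Pi.smul_apply, h.natural m n p f hp hf w hw]
    rfl⟩

theorem IsForm.neg (h : IsForm V ξ) : IsForm V (-ξ) := by
  have := h.smul (-1)
  rwa [neg_one_smul ℝ ξ] at this

theorem IsForm.sub (h : IsForm V ξ) (h' : IsForm V η) : IsForm V (ξ - η) := by
  rw [sub_eq_add_neg]
  exact h.add h'.neg

theorem isForm_zero : IsForm V (0 : PreForm X k) :=
  ⟨fun _ _ _ => contDiffOn_const, fun _ _ _ _ _ _ _ _ => rfl⟩

theorem IsForm.sum {ι : Type*} (s : Finset ι) {ξ : ι → PreForm X k}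
    (h : ∀ i ∈ s, IsForm V (ξ i)) : IsForm V (∑ i ∈ s, ξ i) := by
  classical
  induction s using Finset.induction_on with
  | empty => simpa using isForm_zero
  | insert a s ha ih =>
    rw [Finset.sum_insert ha]
    exact (h a (by simp)).add (ih fun i hi => h i (by simp [hi]))

theorem IsForm.differentiableAt (h : IsForm V ξ) (hV : DOpen V) {n : ℕ} {p : Euc n → X}
    (hp : IsPlot p) {w : Euc n} (hw : p w ∈ V) : DifferentiableAt ℝ (ξ n p) w :=
  ((h.smooth n p hp).contDiffAt ((hV.plot hp).mem_nhds hw)).differentiableAt (by simp)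

theorem d_add (hV : DOpen V) (h : IsForm V ξ) (h' : IsForm V η) :
    FormEq V (d (ξ + η)) (d ξ + d η) := fun n p hp w hw => by
  simp only [d, Pi.add_apply]
  exact extDeriv_add (h.differentiableAt hV hp hw) (h'.differentiableAt hV hp hw)

theorem d_smul (c : ℝ) (ξ : PreForm X k) : d (c • ξ) = c • d ξ := by
  funext n p w
  exact extDeriv_smul c (ξ n p)

theorem d_neg (ξ : PreForm X k) : d (-ξ) = -d ξ := by
  rw [← neg_one_smul ℝ ξ, d_smul, neg_one_smul ℝ (d ξ)]

end IsForm

/-! ### Functions of modulus one and their logarithmic derivatives -/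

/-- A smooth function of modulus one on `V`. -/
structure UnitOn (V : Set X) (g : X → ℂ) : Prop where
  smooth : SmoothOn V g
  norm : ∀ x ∈ V, ‖g x‖ = 1

section UnitOn

variable {g g' : X → ℂ}

theorem UnitOn.mono (h : UnitOn V g) (hV : V' ⊆ V) : UnitOn V' g :=
  ⟨h.smooth.mono hV, fun x hx => h.norm x (hV hx)⟩

theorem UnitOn.mul (h : UnitOn V g) (h' : UnitOn V g') : UnitOn V fun x => g x * g' x :=
  ⟨h.smooth.mul h'.smooth, fun x hx => by rw [norm_mul, h.norm x hx, h'.norm x hx, one_mul]⟩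

theorem UnitOn.conj (h : UnitOn V g) : UnitOn V fun x => starRingEnd ℂ (g x) :=
  ⟨h.smooth.conj, fun x hx => by rw [RCLike.norm_conj, h.norm x hx]⟩

theorem unitOn_one : UnitOn V fun _ : X => (1 : ℂ) := ⟨SmoothOn.const 1, fun _ _ => norm_one⟩

theorem unitOn_circle {g : X → Circle} (h : SmoothOn V fun x => (g x : ℂ)) :
    UnitOn V fun x => (g x : ℂ) := ⟨h, fun _ _ => Circle.norm_coe _⟩

theorem conj_mul_self_of_norm {z : ℂ} (h : ‖z‖ = 1) : starRingEnd ℂ z * z = 1 := by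
  rw [Complex.conj_mul', h]; simp

theorem dlog_apply (g : X → ℂ) (n : ℕ) (p : Euc n → X) (w : Euc n) (v : Fin 1 → Euc n) :
    dlog g n p w v =
      (starRingEnd ℂ (g (p w)) * fderiv ℝ (fun w' => g (p w')) w (v 0)).im := by
  simp [dlog]

theorem isForm_dlog_of_smoothOn (hV : DOpen V) (h : SmoothOn V g) : IsForm V (dlog g) := by
  constructor
  · intro n p hp
    have h1 := h n p hp
    have h2 := ((contDiffOn_infty_iff_fderiv_of_isOpen (hV.plot hp)).1 h1).2
    have h3 := (ContDiffOn.smul (h.conj n p hp) h2)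
    have h4 : ContDiffOn ℝ ∞ (fun w => Complex.imCLM ∘L
      (starRingEnd ℂ (g (p w)) • fderiv ℝ (fun w' => g (p w')) w)) (p ⁻¹' V) :=
      contDiffOn_const.clm_comp h3
    exact (ContinuousAlternatingMap.ofSubsingletonLIE (𝕜 := ℝ) (E := Euc n) (F := ℝ)
      (0 : Fin 1)).toContinuousLinearEquiv.contDiff.comp_contDiffOn h4
  · intro m n p f hp hf w hw
    ext v
    have e := fderiv_comp (𝕜 := ℝ) w (g := fun w => g (p w)) (f := f)
      (h.differentiableAt hV hp hw) (hf.differentiable (by simp) w)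
    have e2 : (fun w' => g ((p ∘ f) w')) = (fun w => g (p w)) ∘ f := rfl
    rw [ContinuousAlternatingMap.compContinuousLinearMap_apply, dlog_apply, dlog_apply, e2, e]
    rfl

theorem UnitOn.isForm_dlog (h : UnitOn V g) (hV : DOpen V) : IsForm V (dlog g) :=
  isForm_dlog_of_smoothOn hV h.smooth

theorem dlog_congr (hV : DOpen V) (h : ∀ x ∈ V, g x = g' x) : FormEq V (dlog g) (dlog g') := by
  intro n p hp w hw
  have e : (fun w => g (p w)) =ᶠ[𝓝 w] fun w => g' (p w) := by
    filter_upwards [(hV.plot hp).mem_nhds hw] with w' hw'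
    exact h _ hw'
  simp only [dlog, e.fderiv_eq, h _ hw]

theorem dlog_const (z : ℂ) : dlog (fun _ : X => z) = 0 := by
  funext n p w
  ext v
  rw [dlog_apply]
  simp

theorem dlog_mul (hV : DOpen V) (h : UnitOn V g) (h' : UnitOn V g') :
    FormEq V (dlog fun x => g x * g' x) (dlog g + dlog g') := by
  intro n p hp w hw
  ext v
  have e := fderiv_fun_mul (h.smooth.differentiableAt hV hp hw) (h'.smooth.differentiableAt hV hp hw)
  simp only [Pi.add_apply, ContinuousAlternatingMap.add_apply, dlog_apply]
  rw [e]
  have h1 := conj_mul_self_of_norm (h.norm _ hw)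
  have h2 := conj_mul_self_of_norm (h'.norm _ hw)
  rw [← Complex.add_im]
  congr 1
  simp only [add_apply, smul_apply, map_mul, smul_eq_mul]
  linear_combination
    (starRingEnd ℂ (g' (p w)) * fderiv ℝ (fun w' => g' (p w')) w (v 0)) * h1 +
      (starRingEnd ℂ (g (p w)) * fderiv ℝ (fun w' => g (p w')) w (v 0)) * h2

theorem dlog_conj (hV : DOpen V) (h : UnitOn V g) :
    FormEq V (dlog fun x => starRingEnd ℂ (g x)) (-dlog g) := by
  have h1 := dlog_mul hV h.conj h
  have h2 : FormEq V (dlog fun x => starRingEnd ℂ (g x) * g x) (dlog fun _ : X => (1 : ℂ)) :=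
    dlog_congr hV fun x hx => conj_mul_self_of_norm (h.norm x hx)
  rw [dlog_const] at h2
  intro n p hp w hw
  have := (h1 n p hp w hw).symm.trans (h2 n p hp w hw)
  exact eq_neg_of_add_eq_zero_left this

theorem dlog_prod (hV : DOpen V) {ι : Type*} (s : Finset ι) {g : ι → X → ℂ}
    (h : ∀ i ∈ s, UnitOn V (g i)) :
    UnitOn V (fun x => ∏ i ∈ s, g i x) ∧
      FormEq V (dlog fun x => ∏ i ∈ s, g i x) (∑ i ∈ s, dlog (g i)) := by
  classical
  induction s using Finset.induction_on with
  | empty =>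
    simp only [Finset.prod_empty, Finset.sum_empty, dlog_const]
    exact ⟨unitOn_one, FormEq.refl _ _⟩
  | insert a s ha ih =>
    simp only [Finset.prod_insert ha, Finset.sum_insert ha]
    obtain ⟨h1, h2⟩ := ih fun i hi => h i (by simp [hi])
    exact ⟨(h a (by simp)).mul h1,
      (dlog_mul hV (h a (by simp)) h1).trans ((FormEq.refl _ _).add h2)⟩

/-- The form `(1/i) d log g` is closed, being locally the differential of an argument of `g`. -/
theorem d_dlog (hV : DOpen V) (h : UnitOn V g) : FormEq V (d (dlog g)) 0 := by
  intro n p hp w hw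
  set G : Euc n → ℂ := fun w' => g (p w') with hG
  -- a smooth argument of `G` near `w`, normalised to vanish at `w`
  set φ : Euc n → ℝ := fun w' => (Complex.log (starRingEnd ℂ (G w) * G w')).im with hφ
  have hone : starRingEnd ℂ (G w) * G w = 1 := conj_mul_self_of_norm (h.norm _ hw)
  have hslit : (starRingEnd ℂ (G w) * G w) ∈ Complex.slitPlane := by
    rw [hone]; exact Complex.one_mem_slitPlane
  have hGc : ∀ w', p w' ∈ V → ContDiffAt ℝ ∞ G w' :=
    fun w' hw' => h.smooth.contDiffAt hV hp hw'
  have hlog : ∀ w', p w' ∈ V → starRingEnd ℂ (G w) * G w' ∈ Complex.slitPlane →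
      ContDiffAt ℝ ∞ φ w' := by
    intro w' hw' hs
    have h1 : ContDiffAt ℝ ∞ (fun w' => starRingEnd ℂ (G w) * G w') w' :=
      contDiffAt_const.mul (hGc w' hw')
    have h2 : ContDiffAt ℝ ∞ Complex.log (starRingEnd ℂ (G w) * G w') :=
      ((Complex.contDiffAt_log (n := ∞) hs).restrict_scalars ℝ)
    exact (Complex.imCLM.contDiff.contDiffAt).comp w' (h2.comp w' h1)
  have hev : ∀ᶠ w' in 𝓝 w, p w' ∈ V ∧ starRingEnd ℂ (G w) * G w' ∈ Complex.slitPlane := by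
    refine Filter.Eventually.and ((hV.plot hp).mem_nhds hw) ?_
    have hc : ContinuousAt (fun w' => starRingEnd ℂ (G w) * G w') w :=
      continuousAt_const.mul (hGc w hw).continuousAt
    exact hc.preimage_mem_nhds (Complex.isOpen_slitPlane.mem_nhds hslit)
  have hee : dlog g n p =ᶠ[𝓝 w] extDeriv fun w' =>
      ContinuousAlternatingMap.constOfIsEmpty ℝ (Euc n) (Fin 0) (φ w') := by
    filter_upwards [hev] with w' ⟨hw', hs⟩
    rw [extDeriv_constOfIsEmpty]
    have h1 : HasFDerivAt (fun w' => starRingEnd ℂ (G w) * G w')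
        (starRingEnd ℂ (G w) • fderiv ℝ G w') w' :=
      ((hGc w' hw').differentiableAt (by simp)).hasFDerivAt.const_mul _
    have h0 := ((Complex.hasDerivAt_log hs).hasFDerivAt.restrictScalars ℝ).comp w' h1
    have h2 := Complex.imCLM.hasFDerivAt.comp w' h0
    have h3 : fderiv ℝ φ w' = _ := h2.fderiv
    rw [h3]
    simp only [dlog]
    congr 2
    have hu : ‖starRingEnd ℂ (G w) * G w'‖ = 1 := by
      rw [norm_mul, RCLike.norm_conj, h.norm _ hw, h.norm _ hw', one_mul]
    have hne : starRingEnd ℂ (G w) * G w' ≠ 0 := by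
      intro h0; rw [h0] at hu; simp at hu
    have hone' := conj_mul_self_of_norm (h.norm _ hw')
    ext v
    simp only [ContinuousLinearMap.comp_apply, smul_apply, smul_eq_mul,
      ContinuousLinearMap.coe_restrictScalars', ContinuousLinearMap.toSpanSingleton_apply]
    have hc : (starRingEnd ℂ (G w) * G w')⁻¹ * starRingEnd ℂ (G w) = starRingEnd ℂ (G w') := by
      rw [inv_mul_eq_iff_eq_mul₀ hne]
      linear_combination -starRingEnd ℂ (G w) * hone'
    linear_combination -(fderiv ℝ G w' v) * hc
  have := hee.extDeriv_eq
  simp only [d]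
  rw [this]
  refine extDeriv_extDeriv_apply (r := ∞) ?_ ?_
  · exact (ContinuousAlternatingMap.constOfIsEmptyLIE ℝ (Euc n) ℝ
      (Fin 0)).toContinuousLinearEquiv.contDiff.contDiffAt.comp w (hlog w hw hslit)
  · simp only [minSmoothness_of_isRCLikeNormedField]
    exact WithTop.coe_le_coe.2 le_top

end UnitOn

/-! ### Curves -/

section Curves

theorem isCurve_comp_plot {n : ℕ} {p : Euc n → X} (hp : IsPlot p) {f : ℝ → Euc n}
    (hf : ContDiff ℝ ∞ f) : IsCurve fun τ => p (f τ) := by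
  have h0 : ContDiff ℝ ∞ fun w : Euc 1 => w 0 := by fun_prop
  exact isPlot_reparam hp (hf.comp h0)

theorem fderiv_comp_coord {n : ℕ} {f : ℝ → Euc n} {f' : Euc n} {τ : ℝ} (hf : HasDerivAt f f' τ) :
    fderiv ℝ (fun w : Euc 1 => f (w 0)) (EuclideanSpace.single 0 τ) (EuclideanSpace.single 0 1)
      = f' := by
  have h1 : HasFDerivAt (fun w : Euc 1 => w 0)
      (EuclideanSpace.proj (0 : Fin 1) : Euc 1 →L[ℝ] ℝ) (EuclideanSpace.single 0 τ) :=
    (EuclideanSpace.proj (0 : Fin 1) : Euc 1 →L[ℝ] ℝ).hasFDerivAt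
  have h3 : HasFDerivAt f (ContinuousLinearMap.toSpanSingleton ℝ f')
      ((EuclideanSpace.single (0 : Fin 1) τ : Euc 1) 0) := by
    simpa using hf.hasFDerivAt
  have h4 := HasFDerivAt.comp (f := fun w : Euc 1 => w 0) (EuclideanSpace.single 0 τ) h3 h1
  have h5 := h4.fderiv
  simp only [Function.comp_def] at h5
  rw [h5]
  simp

/-- Along a curve in the domain of a plot, a 1-form is evaluated in the plot. -/
theorem IsForm.alongCurve_plot {ξ : PreForm X 1} (h : IsForm V ξ) {n : ℕ} {p : Euc n → X}
    (hp : IsPlot p) {f : ℝ → Euc n} (hf : ContDiff ℝ ∞ f) {f' : Euc n} {τ : ℝ}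
    (hf' : HasDerivAt f f' τ) (hw : p (f τ) ∈ V) :
    alongCurve ξ (fun τ => p (f τ)) τ = ξ n p (f τ) fun _ => f' := by
  have h0 : ContDiff ℝ ∞ fun w : Euc 1 => f (w 0) := hf.comp (by fun_prop)
  have := h.natural 1 n p (fun w => f (w 0)) hp h0 (EuclideanSpace.single 0 τ) (by simpa using hw)
  simp only [alongCurve]
  have e : (fun w : Euc 1 => p (f (w 0))) = p ∘ fun w : Euc 1 => f (w 0) := rfl
  rw [e, this, ContinuousAlternatingMap.compContinuousLinearMap_apply]
  simp only [Function.comp_def, fderiv_comp_coord hf']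
  simp

theorem FormEq.alongCurve {ξ η : PreForm X 1} (h : FormEq V ξ η) {c : ℝ → X} (hc : IsCurve c)
    {τ : ℝ} (hτ : c τ ∈ V) :
    GerbeTransgression.alongCurve ξ c τ = GerbeTransgression.alongCurve η c τ := by
  simp only [GerbeTransgression.alongCurve]
  rw [h 1 _ hc _ (by simpa using hτ)]

theorem IsForm.contDiffOn_alongCurve {ξ : PreForm X 1} (h : IsForm V ξ) {c : ℝ → X}
    (hc : IsCurve c) : ContDiffOn ℝ ∞ (alongCurve ξ c) (c ⁻¹' V) := by
  have h1 := h.smooth 1 _ hc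
  have h3 := h1.comp contDiff_single_one.contDiffOn (s := c ⁻¹' V) (fun τ hτ => by simpa using hτ)
  exact (ContinuousAlternatingMap.apply ℝ (Euc 1) ℝ
    (fun _ : Fin 1 => EuclideanSpace.single 0 1)).contDiff.comp_contDiffOn h3

/-- Along a curve `c`, the function `g` satisfies `(g ∘ c)' = i (dlog g)(c') (g ∘ c)`. -/
theorem UnitOn.hasDerivAt_curve {g : X → ℂ} (h : UnitOn V g) (hV : DOpen V) {c : ℝ → X}
    (hc : IsCurve c) {τ : ℝ} (hτ : c τ ∈ V) :
    HasDerivAt (fun τ => g (c τ)) (Complex.I * alongCurve (dlog g) c τ * g (c τ)) τ := by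
  have h1 := (h.smooth.differentiableAt hV hc (w := EuclideanSpace.single 0 τ)
    (by simpa using hτ)).hasFDerivAt
  have h3 := h1.comp_hasDerivAt τ (hasDerivAt_single_one τ)
  have e : ((fun w : Euc 1 => g (c (w 0))) ∘ fun τ : ℝ => (EuclideanSpace.single 0 τ : Euc 1)) =
      fun τ => g (c τ) := by
    funext τ; simp
  rw [e] at h3
  set D := (fderiv ℝ (fun w : Euc 1 => g (c (w 0))) (EuclideanSpace.single 0 τ))
    (EuclideanSpace.single 0 1) with hD
  suffices heq : Complex.I * alongCurve (dlog g) c τ * g (c τ) = D by rw [heq]; exact h3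
  simp only [alongCurve, dlog_apply]
  rw [← hD]
  simp only [PiLp.single_apply, if_true]
  have hn : ‖g (c τ)‖ = 1 := h.norm _ hτ
  have hone := conj_mul_self_of_norm hn
  -- the derivative of `|g|² = 1` vanishes, so that `conj g * g'` is imaginary
  have hre : (starRingEnd ℂ (g (c τ)) * D).re = 0 := by
    have h4 : HasDerivAt (fun τ => ‖g (c τ)‖ ^ 2) (2 * inner ℝ (g (c τ)) D) τ := by
      simpa using h3.norm_sq
    have h5 : (fun τ => ‖g (c τ)‖ ^ 2) =ᶠ[𝓝 τ] fun _ => 1 := by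
      filter_upwards [(IsCurve.isOpen_preimage hc hV).mem_nhds hτ] with τ' hτ'
      rw [h.norm _ hτ', one_pow]
    have h6 := h4.congr_of_eventuallyEq h5.symm
    have h7 := h6.unique (hasDerivAt_const τ (1 : ℝ))
    have h8 : inner ℝ (g (c τ)) D = 0 := by linarith
    rw [Complex.inner] at h8
    rw [mul_comm]
    exact h8
  have him : Complex.I * ((starRingEnd ℂ (g (c τ)) * D).im : ℂ) = starRingEnd ℂ (g (c τ)) * D := by
    apply Complex.ext <;> simp at hre ⊢
    · linarith
  rw [him]
  linear_combination D * hone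

end Curves

end FormCalculus

/-! ### Unit length sections of line bundles -/

section RankOne

variable {F : Type*} [NormedAddCommGroup F] [InnerProductSpace ℂ F]

theorem eq_inner_smul_of_finrank_eq_one (h : Module.finrank ℂ F = 1) {u : F} (hu : ‖u‖ = 1)
    (v : F) : v = inner ℂ u v • u := by
  have hne : u ≠ 0 := by rintro rfl; simp at hu
  obtain ⟨c, rfl⟩ := (finrank_eq_one_iff_of_nonzero' u hne).1 h v
  rw [inner_smul_right, inner_self_eq_norm_sq_to_K, hu]
  simp

theorem inner_mul_inner_of_finrank_eq_one (h : Module.finrank ℂ F = 1) {u : F} (hu : ‖u‖ = 1)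
    (v w : F) : inner ℂ v w = inner ℂ v u * inner ℂ u w := by
  conv_lhs => rw [eq_inner_smul_of_finrank_eq_one h hu w]
  rw [inner_smul_right, mul_comm]

theorem norm_inner_of_finrank_eq_one (h : Module.finrank ℂ F = 1) {u : F} (hu : ‖u‖ = 1)
    (v : F) : ‖inner ℂ u v‖ = ‖v‖ := by
  conv_rhs => rw [eq_inner_smul_of_finrank_eq_one h hu v]
  rw [norm_smul, hu, mul_one]

theorem exists_unit_of_finrank_eq_one (h : Module.finrank ℂ F = 1) : ∃ u : F, ‖u‖ = 1 := by
  have : Nontrivial F := Module.nontrivial_of_finrank_pos (R := ℂ) (by omega)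
  exact exists_norm_eq F zero_le_one

theorem inner_self_of_norm {u : F} (hu : ‖u‖ = 1) : inner ℂ u u = (1 : ℂ) := by
  rw [inner_self_eq_norm_sq_to_K, hu]; simp

end RankOne

namespace LineBundle

variable {X : Type u} [DiffeologicalSpace X] {W O O' : Set X} {L : LineBundle X W}
  {s s' : ∀ x, L.Fib x} {ξ ξ' : PreForm X 1}

theorem IsSmoothUnit.mono (h : L.IsSmoothUnit O s) (hO : O' ⊆ O) : L.IsSmoothUnit O' s :=
  ⟨fun x hx => h.1 x (hO hx), fun a => (h.2 a).mono (inter_subset_inter_left _ hO)⟩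

theorem IsSmoothUnit.congr (h : L.IsSmoothUnit O s) (hs : ∀ x ∈ O, s' x = s x) :
    L.IsSmoothUnit O s' :=
  ⟨fun x hx => by rw [hs x hx, h.1 x hx], fun a => (h.2 a).congr fun x hx => by rw [hs x hx.1]⟩

theorem IsSmoothUnit.of_local
    (h : ∀ x ∈ O, ∃ V, DOpen V ∧ x ∈ V ∧ L.IsSmoothUnit (O ∩ V) s) : L.IsSmoothUnit O s := by
  refine ⟨fun x hx => ?_, fun a => SmoothOn.of_local fun x hx => ?_⟩
  · obtain ⟨V, -, hxV, hV⟩ := h x hx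
    exact hV.1 x ⟨hx, hxV⟩
  · obtain ⟨V, hVo, hxV, hV⟩ := h x hx.1
    exact ⟨V, hVo, hxV, (hV.2 a).mono fun y hy => ⟨⟨hy.1.1, hy.2⟩, hy.1.2⟩⟩

theorem IsSmoothUnit.unitOn_frame (h : L.IsSmoothUnit O s) (a : L.ι) :
    UnitOn (O ∩ L.dom a) fun x => inner ℂ (L.frame a x) (s x) :=
  ⟨h.2 a, fun x hx => by
    rw [norm_inner_of_finrank_eq_one (L.rank_one x (L.dom_subset a hx.2)) (L.norm_frame a x hx.2),
      h.1 x hx.1]⟩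

theorem isSmoothUnit_frame (L : LineBundle X W) (a : L.ι) : L.IsSmoothUnit (L.dom a) (L.frame a) :=
  ⟨L.norm_frame a, fun b => by rw [inter_comm]; exact (L.smooth_trans a b).mono (by
    rw [inter_comm])⟩

theorem isUnitSection_frame (L : LineBundle X W) (a : L.ι) :
    L.IsUnitSection (L.dom a) (L.frame a) (L.conn a) := by
  refine ⟨L.isSmoothUnit_frame a, fun b n p hp w hw => ?_⟩
  have := L.conn_trans a b n p hp w hw
  simp only [Pi.add_apply, Pi.sub_apply] at this ⊢
  rw [← this]
  abel

theorem IsSmoothUnit.ratio (hO : O ⊆ W) (h : L.IsSmoothUnit O s) (h' : L.IsSmoothUnit O s') :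
    UnitOn O fun x => inner ℂ (s' x) (s x) := by
  refine ⟨SmoothOn.of_local fun x hx => ?_, fun x hx => ?_⟩
  · obtain ⟨a, ha⟩ := L.dom_cover x (hO hx)
    refine ⟨L.dom a, L.dom_open a, ha, ((h'.2 a).conj.mul (h.2 a)).congr fun y hy => ?_⟩
    rw [inner_mul_inner_of_finrank_eq_one (L.rank_one y (hO hy.1)) (L.norm_frame a y hy.2),
      inner_conj_symm]
  · rw [norm_inner_of_finrank_eq_one (L.rank_one x (hO hx)) (h'.1 x hx), h.1 x hx]

theorem IsSmoothUnit.smul {g : X → ℂ} (hg : UnitOn O g) (h : L.IsSmoothUnit O s) :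
    L.IsSmoothUnit O fun x => g x • s x :=
  ⟨fun x hx => by rw [norm_smul, hg.norm x hx, h.1 x hx, one_mul], fun a =>
    ((hg.smooth.mono inter_subset_left).mul (h.2 a)).congr fun x _ => by rw [inner_smul_right]⟩

theorem IsUnitSection.mono (h : L.IsUnitSection O s ξ) (hO : O' ⊆ O) : L.IsUnitSection O' s ξ :=
  ⟨h.1.mono hO, fun a => (h.2 a).mono (inter_subset_inter_left _ hO)⟩

theorem IsUnitSection.congr_form (h : L.IsUnitSection O s ξ) (hξ : FormEq O ξ' ξ) :
    L.IsUnitSection O s ξ' :=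
  ⟨h.1, fun a => (hξ.mono inter_subset_left).trans (h.2 a)⟩

theorem IsUnitSection.congr (h : L.IsUnitSection O s ξ) (hO : DOpen O)
    (hs : ∀ x ∈ O, s' x = s x) : L.IsUnitSection O s' ξ :=
  ⟨h.1.congr hs, fun a => (h.2 a).trans ((FormEq.refl _ _).add
    (dlog_congr (hO.inter (L.dom_open a)) fun x hx => by rw [hs x hx.1]))⟩

theorem IsUnitSection.of_local
    (h : ∀ x ∈ O, ∃ V, DOpen V ∧ x ∈ V ∧ L.IsUnitSection (O ∩ V) s ξ) :
    L.IsUnitSection O s ξ := by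
  refine ⟨IsSmoothUnit.of_local fun x hx => ?_, fun a => FormEq.of_local fun x hx => ?_⟩
  · obtain ⟨V, hVo, hxV, hV⟩ := h x hx
    exact ⟨V, hVo, hxV, hV.1⟩
  · obtain ⟨V, hVo, hxV, hV⟩ := h x hx.1
    exact ⟨V, hxV, (hV.2 a).mono fun y hy => ⟨⟨hy.1.1, hy.2⟩, hy.1.2⟩⟩

theorem IsUnitSection.smul {g : X → ℂ} (hO : DOpen O) (hg : UnitOn O g)
    (h : L.IsUnitSection O s ξ) : L.IsUnitSection O (fun x => g x • s x) (ξ + dlog g) := by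
  refine ⟨h.1.smul hg, fun a n p hp w hw => ?_⟩
  have h1 := h.2 a n p hp w hw
  have h2 := dlog_mul (hO.inter (L.dom_open a)) (hg.mono inter_subset_left) (h.1.unitOn_frame a)
    n p hp w hw
  simp only [Pi.add_apply, inner_smul_right] at h1 h2 ⊢
  rw [h1, h2]
  abel

theorem IsUnitSection.eq_smul (hOW : O ⊆ W) (h' : L.IsSmoothUnit O s') {x : X} (hx : x ∈ O)
    (v : L.Fib x) : v = (inner ℂ (s' x) v : ℂ) • s' x :=
  eq_inner_smul_of_finrank_eq_one (L.rank_one x (hOW hx)) (h'.1 x hx) v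

/-- Two unit sections differ by a function of modulus one, and their connection forms by its
logarithmic derivative. -/
theorem IsUnitSection.compare (hO : DOpen O) (hOW : O ⊆ W) (h : L.IsUnitSection O s ξ)
    (h' : L.IsUnitSection O s' ξ') :
    FormEq O ξ (ξ' + dlog fun x => inner ℂ (s' x) (s x)) := by
  refine FormEq.of_local fun x hx => ?_
  obtain ⟨a, ha⟩ := L.dom_cover x (hOW hx)
  refine ⟨L.dom a, ha, fun n p hp w hw => ?_⟩
  have hOa := hO.inter (L.dom_open a)
  have h1 := h.2 a n p hp w hw
  have h2 := h'.2 a n p hp w hw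
  have h3 := dlog_mul hOa ((h.1.ratio hOW h'.1).mono inter_subset_left) (h'.1.unitOn_frame a)
    n p hp w hw
  have h4 := dlog_congr (g := fun x => inner ℂ (L.frame a x) (s x))
    (g' := fun x => inner ℂ (s' x) (s x) * inner ℂ (L.frame a x) (s' x)) hOa (fun y hy => by
      rw [inner_mul_inner_of_finrank_eq_one (L.rank_one y (hOW hy.1)) (h'.1.1 y hy.1), mul_comm])
    n p hp w hw
  simp only [Pi.add_apply] at *
  rw [h1, h2, h4, h3]
  abel

theorem IsUnitSection.form_unique (hOW : O ⊆ W) (h : L.IsUnitSection O s ξ)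
    (h' : L.IsUnitSection O s ξ') : FormEq O ξ ξ' := by
  refine FormEq.of_local fun x hx => ?_
  obtain ⟨a, ha⟩ := L.dom_cover x (hOW hx)
  exact ⟨L.dom a, ha, (h.2 a).trans (h'.2 a).symm⟩

theorem IsUnitSection.isForm (hO : DOpen O) (hOW : O ⊆ W) (h : L.IsUnitSection O s ξ) :
    IsForm O ξ := by
  refine IsForm.of_local fun x hx => ?_
  obtain ⟨a, ha⟩ := L.dom_cover x (hOW hx)
  exact ⟨L.dom a, L.dom_open a, ha, (((L.conn_form a).mono inter_subset_right).add
    ((h.1.unitOn_frame a).isForm_dlog (hO.inter (L.dom_open a)))).congr (h.2 a)⟩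

/-- Every smooth unit section has a connection form. -/
theorem IsSmoothUnit.exists_form (hO : DOpen O) (hOW : O ⊆ W) (h : L.IsSmoothUnit O s) :
    ∃ ξ, L.IsUnitSection O s ξ := by
  classical
  refine ⟨fun n p w => if hx : p w ∈ W then
    (L.conn (L.dom_cover _ hx).choose +
      dlog fun x => inner ℂ (L.frame (L.dom_cover _ hx).choose x) (s x)) n p w else 0,
    h, fun a n p hp w hw => ?_⟩
  have hx : p w ∈ W := hOW hw.1
  simp only [dif_pos hx]
  generalize hb : (L.dom_cover _ hx).choose = b
  have hbx : p w ∈ L.dom b := hb ▸ (L.dom_cover _ hx).choose_spec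
  have hOb := (hO.inter (L.dom_open a)).inter (L.dom_open b)
  have h1 := L.conn_trans a b n p hp w ⟨hw.2, hbx⟩
  have h3 := dlog_mul hOb (((L.isSmoothUnit_frame a).unitOn_frame b).mono
    (V' := O ∩ L.dom a ∩ L.dom b) (fun y hy => ⟨hy.1.2, hy.2⟩))
    ((h.unitOn_frame a).mono inter_subset_left) n p hp w ⟨hw, hbx⟩
  have h4 := dlog_congr (g := fun x => inner ℂ (L.frame b x) (s x))
    (g' := fun x => inner ℂ (L.frame b x) (L.frame a x) * inner ℂ (L.frame a x) (s x)) hOb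
    (fun y hy => inner_mul_inner_of_finrank_eq_one (L.rank_one y (hOW hy.1.1))
      (L.norm_frame a y hy.1.2) _ _) n p hp w ⟨hw, hbx⟩
  simp only [Pi.add_apply, Pi.sub_apply] at *
  rw [h4, h3, ← h1]
  abel

/-- The trivial line bundle on `W` with the connection form `ξ`. -/
def triv (W : Set X) (hW : DOpen W) (ξ : PreForm X 1) (hξ : IsForm W ξ) : LineBundle X W where
  Fib _ := ℂ
  rank_one _ _ := Module.finrank_self ℂ
  ι := PUnit
  dom _ := W
  dom_open _ := hW
  dom_subset _ := subset_rfl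
  dom_cover _ hx := ⟨⟨⟩, hx⟩
  frame _ _ := (1 : ℂ)
  norm_frame _ _ _ := norm_one
  smooth_trans _ _ := SmoothOn.const _
  conn _ := ξ
  conn_form _ := hξ
  conn_trans _ _ n p hp w hw := by
    rw [dlog_const]
    simp

section Triv

variable {hW : DOpen W} {hξ : IsForm W ξ}

theorem isUnitSection_triv_one : (triv W hW ξ hξ).IsUnitSection W (fun _ => (1 : ℂ)) ξ :=
  (triv W hW ξ hξ).isUnitSection_frame ⟨⟩

theorem isUnitSection_triv {g : X → ℂ} (hO : DOpen O) (hOW : O ⊆ W) (hg : UnitOn O g) :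
    (triv W hW ξ hξ).IsUnitSection O g (ξ + dlog g) :=
  ((isUnitSection_triv_one.mono hOW).smul hO hg).congr hO fun x _ => (mul_one (g x)).symm

theorem unitOn_of_triv {g : ∀ x, (triv W hW ξ hξ).Fib x} {η : PreForm X 1} (hOW : O ⊆ W)
    (h : (triv W hW ξ hξ).IsUnitSection O g η) :
    UnitOn O (fun x => (g x : ℂ)) ∧ FormEq O η (ξ + dlog fun x => (g x : ℂ)) := by
  have key : ∀ z : ℂ, inner ℂ (1 : ℂ) z = z := fun z => by simp
  have e : ∀ x, inner ℂ ((triv W hW ξ hξ).frame ⟨⟩ x) (g x) = g x := fun x => key (g x)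
  have e2 : O ∩ (triv W hW ξ hξ).dom ⟨⟩ = O := inter_eq_left.2 hOW
  have h1 := h.1.2 ⟨⟩
  have h2 := h.2 ⟨⟩
  rw [e2] at h1 h2
  have e3 : (fun x => inner ℂ ((triv W hW ξ hξ).frame ⟨⟩ x) (g x)) = fun x => (g x : ℂ) := funext e
  exact ⟨⟨e3 ▸ h1, h.1.1⟩, e3 ▸ h2⟩

end Triv

end LineBundle

open LineBundle

/-! Division of sections. -/

section Quotient

variable {X : Type u} [DiffeologicalSpace X] {W₁ W₂ W₃ V O : Set X} {L₁ : LineBundle X W₁}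
  {L₂ : LineBundle X W₂} {L₃ : LineBundle X W₃}

/-- Unit sections can be divided: given `s₂` and `s₃` there is a unit section `s₁` with `s₁ ⊗ s₂ =
s₃`. -/
theorem TensorIso.exists_left (T : TensorIso L₁ L₂ L₃ V) (hO : DOpen O) (hOV : O ⊆ V)
    (h₁ : O ⊆ W₁) (h₃ : O ⊆ W₃) {s₂ : ∀ x, L₂.Fib x} {s₃ : ∀ x, L₃.Fib x} {ξ₂ ξ₃ : PreForm X 1}
    (hs₂ : L₂.IsUnitSection O s₂ ξ₂) (hs₃ : L₃.IsUnitSection O s₃ ξ₃) :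
    ∃ s₁ : ∀ x, L₁.Fib x, L₁.IsUnitSection O s₁ (ξ₃ - ξ₂) ∧
      ∀ x ∈ O, T.mul x (s₁ x) (s₂ x) = s₃ x := by
  have hex : ∀ x, ∃ v : L₁.Fib x, x ∈ O → T.mul x v (s₂ x) = s₃ x := by
    intro x
    by_cases hx : x ∈ O
    · obtain ⟨u, hu⟩ := exists_unit_of_finrank_eq_one (L₁.rank_one x (h₁ hx))
      have hn : ‖T.mul x u (s₂ x)‖ = 1 := by rw [T.norm_mul x (hOV hx), hu, hs₂.1.1 x hx, one_mul]
      refine ⟨(inner ℂ (T.mul x u (s₂ x)) (s₃ x) : ℂ) • u, fun _ => ?_⟩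
      rw [map_smul, LinearMap.smul_apply]
      exact (eq_inner_smul_of_finrank_eq_one (L₃.rank_one x (h₃ hx)) hn _).symm
    · exact ⟨0, fun h => absurd h hx⟩
  choose s₁ hs₁ using hex
  refine ⟨s₁, IsUnitSection.of_local fun x hx => ?_, hs₁⟩
  -- locally `s₁` is the frame of `L₁` times the ratio of `s₃` and `frame ⊗ s₂`
  obtain ⟨a, ha⟩ := L₁.dom_cover x (h₁ hx)
  have hOa := hO.inter (L₁.dom_open a)
  have hf : L₁.IsUnitSection (O ∩ L₁.dom a) (L₁.frame a) (L₁.conn a) :=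
    (L₁.isUnitSection_frame a).mono inter_subset_right
  have hm := T.parallel _ _ _ _ _ hOa (inter_subset_left.trans hOV) hf (hs₂.mono inter_subset_left)
  have h3 := hs₃.mono (inter_subset_left (s := O) (t := L₁.dom a))
  have hc := h3.compare hOa (inter_subset_left.trans h₃) hm
  refine ⟨L₁.dom a, L₁.dom_open a, ha, ?_⟩
  refine ((hf.smul hOa (h3.1.ratio (inter_subset_left.trans h₃) hm.1)).congr hOa ?_).congr_form ?_
  · intro y hy
    have hn : ‖s₂ y‖ = 1 := hs₂.1.1 y hy.1
    rw [← sub_eq_zero, ← norm_eq_zero, ← mul_one ‖_‖, ← hn, ← T.norm_mul y (hOV hy.1), map_sub,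
      LinearMap.sub_apply, hs₁ y hy.1, map_smul, LinearMap.smul_apply, norm_eq_zero, sub_eq_zero]
    exact IsUnitSection.eq_smul (inter_subset_left.trans h₃) hm.1 hy _
  · intro n p hp w hw
    have := hc n p hp w hw
    simp only [Pi.add_apply, Pi.sub_apply] at *
    rw [this]
    abel

theorem TensorIso.mul_left_cancel (T : TensorIso L₁ L₂ L₃ V) {x : X} (hx : x ∈ V)
    {a : L₁.Fib x} (ha : a ≠ 0) {b b' : L₂.Fib x} (h : T.mul x a b = T.mul x a b') : b = b' := by
  have := T.norm_mul x hx a (b - b')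
  rw [map_sub, h, sub_self, norm_zero, eq_comm, mul_eq_zero, norm_eq_zero, norm_eq_zero] at this
  exact sub_eq_zero.1 (this.resolve_left ha)

theorem TensorIso.mul_right_cancel (T : TensorIso L₁ L₂ L₃ V) {x : X} (hx : x ∈ V)
    {b : L₂.Fib x} (hb : b ≠ 0) {a a' : L₁.Fib x} (h : T.mul x a b = T.mul x a' b) : a = a' := by
  have := T.norm_mul x hx (a - a') b
  rw [map_sub, LinearMap.sub_apply, h, sub_self, norm_zero, eq_comm, mul_eq_zero, norm_eq_zero,
    norm_eq_zero] at this
  exact sub_eq_zero.1 (this.resolve_right hb)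

end Quotient

/-! ### Parallel transport -/

section Parallel

/-- `exp(-i ∫ A)` solves `y' = -i A y` on `[a, b]`. As `A` is only continuous on `[a, b]`, it is
first extended by constants to a continuous function on `ℝ`. -/
theorem hasDerivWithinAt_exp_integral {a b : ℝ} {A : ℝ → ℝ} (hA : ContinuousOn A (Icc a b)) :
    ∀ τ ∈ Icc a b, HasDerivWithinAt (fun τ => (Circle.exp (-∫ t in a..τ, A t) : ℂ))
      (-Complex.I * A τ * Circle.exp (-∫ t in a..τ, A t)) (Icc a b) τ := by
  intro τ hτ
  have hab : a ≤ b := hτ.1.trans hτ.2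
  set A' : ℝ → ℝ := IccExtend hab ((Icc a b).domRestrict A) with hA'
  have hc : Continuous A' := (continuousOn_iff_continuous_domRestrict.1 hA).Icc_extend'
  have heq : ∀ t ∈ Icc a b, A' t = A t := fun t ht => by
    rw [hA', IccExtend_of_mem hab _ ht]; rfl
  have hint : ∀ t ∈ Icc a b, ∫ x in a..t, A x = ∫ x in a..t, A' x := fun t ht =>
    intervalIntegral.integral_congr fun x hx => by
      rw [uIcc_of_le ht.1] at hx
      exact (heq x ⟨hx.1, hx.2.trans ht.2⟩).symm
  have h1 : HasDerivAt (fun t => -∫ x in a..t, A' x) (-A' τ) τ :=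
    (hc.integral_hasStrictDerivAt a τ).hasDerivAt.neg
  have h2 : HasDerivAt (fun t => (Circle.exp (-∫ x in a..t, A' x) : ℂ))
      (-Complex.I * A' τ * Circle.exp (-∫ x in a..τ, A' x)) τ := by
    simp only [Circle.coe_exp]
    have h3 := (h1.ofReal_comp.mul_const Complex.I).cexp
    suffices heq : -Complex.I * A' τ * Complex.exp (↑(-∫ x in a..τ, A' x) * Complex.I) =
      Complex.exp (↑(-∫ x in a..τ, A' x) * Complex.I) * (↑(-A' τ) * Complex.I) by
      rw [heq]; exact h3
    push_cast
    ring
  rw [heq τ hτ, ← hint τ hτ] at h2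
  refine h2.hasDerivWithinAt.congr (fun t ht => ?_) ?_
  · rw [hint t ht]
  · rw [hint τ hτ]

/-- A solution of `y' = -i A y` on `[a, b]` is determined by its initial value. -/
theorem eq_exp_integral_of_hasDerivWithinAt {a b : ℝ} {A : ℝ → ℝ} (hA : ContinuousOn A (Icc a b))
    {y : ℝ → ℂ}
    (hy : ∀ τ ∈ Icc a b, HasDerivWithinAt y (-Complex.I * A τ * y τ) (Icc a b) τ) :
    ∀ τ ∈ Icc a b, y τ = Circle.exp (-∫ t in a..τ, A t) * y a := by
  intro τ hτ
  have hab : a ≤ b := hτ.1.trans hτ.2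
  have hE := hasDerivWithinAt_exp_integral hA
  set E : ℝ → ℂ := fun τ => (Circle.exp (-∫ t in a..τ, A t) : ℂ) with hEdef
  have hone : ∀ t, starRingEnd ℂ (E t) * E t = 1 := fun t =>
    conj_mul_self_of_norm (Circle.norm_coe _)
  have hz : ∀ t ∈ Icc a b, HasDerivWithinAt (fun t => starRingEnd ℂ (E t) * y t) 0 (Icc a b) t := by
    intro t ht
    have h1 := (Complex.conjCLE : ℂ →L[ℝ] ℂ).hasFDerivAt.comp_hasDerivWithinAt t (hE t ht)
    have h2 : HasDerivWithinAt (fun t => starRingEnd ℂ (E t))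
      (starRingEnd ℂ (-Complex.I * A t * E t)) (Icc a b) t := h1
    have h3 := h2.mul (hy t ht)
    suffices heq : (0 : ℂ) = starRingEnd ℂ (-Complex.I * A t * E t) * y t +
      starRingEnd ℂ (E t) * (-Complex.I * A t * y t) by
      rw [heq]; exact h3
    simp only [map_mul, map_neg, Complex.conj_I, Complex.conj_ofReal]
    ring
  have hconst := constant_of_has_deriv_right_zero
    (fun t ht => (hz t ht).continuousWithinAt)
    (fun t ht => ((hz t ⟨ht.1, ht.2.le⟩).mono_of_mem_nhdsWithin
      (Icc_mem_nhdsGE_of_mem ht))) τ hτ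
  have hEa : E a = 1 := by simp [hEdef]
  rw [hEa, map_one, one_mul] at hconst
  change y τ = E τ * y a
  rw [← hconst]
  linear_combination -y τ * hone τ

variable {X : Type u} [DiffeologicalSpace X] {W : Set X} {L : LineBundle X W} {c : ℝ → X}
  {a b : ℝ} {σ : ∀ τ, L.Fib (c τ)}

/-- The equation for parallel sections does not depend on the local unit section. -/
theorem hasDerivWithinAt_inner_change {O : Set X} {s s' : ∀ x, L.Fib x} {ξ ξ' : PreForm X 1}
    (hc : IsCurve c) (hO : DOpen O) (hOW : O ⊆ W) (h : L.IsUnitSection O s ξ)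
    (h' : L.IsUnitSection O s' ξ') {S : Set ℝ} {τ : ℝ} (hcτ : c τ ∈ O)
    (hd : HasDerivWithinAt (fun τ' => (inner ℂ (s (c τ')) (σ τ') : ℂ))
      (-Complex.I * (alongCurve ξ c τ : ℂ) * inner ℂ (s (c τ)) (σ τ)) S τ) :
    HasDerivWithinAt (fun τ' => (inner ℂ (s' (c τ')) (σ τ') : ℂ))
      (-Complex.I * (alongCurve ξ' c τ : ℂ) * inner ℂ (s' (c τ)) (σ τ)) S τ := by
  have hg : UnitOn O fun x => inner ℂ (s' x) (s x) := h.1.ratio hOW h'.1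
  have h1 := (hg.hasDerivAt_curve hO hc hcτ).hasDerivWithinAt (s := S)
  have h2 := h1.mul hd
  have hprod : ∀ τ', c τ' ∈ O → (inner ℂ (s' (c τ')) (σ τ') : ℂ) =
      inner ℂ (s' (c τ')) (s (c τ')) * inner ℂ (s (c τ')) (σ τ') := fun τ' hτ' =>
    inner_mul_inner_of_finrank_eq_one (L.rank_one _ (hOW hτ')) (h.1.1 _ hτ') _ _
  have hform : alongCurve ξ c τ = alongCurve ξ' c τ +
      alongCurve (dlog fun x => inner ℂ (s' x) (s x)) c τ :=
    (h.compare hO hOW h').alongCurve hc hcτ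
  have hev : (fun τ' => (inner ℂ (s' (c τ')) (σ τ') : ℂ)) =ᶠ[𝓝[S] τ]
      fun τ' => inner ℂ (s' (c τ')) (s (c τ')) * inner ℂ (s (c τ')) (σ τ') := by
    filter_upwards [mem_nhdsWithin_of_mem_nhds ((hc.isOpen_preimage hO).mem_nhds hcτ)] with τ' hτ'
    exact hprod τ' hτ'
  have h3 := h2.congr_of_eventuallyEq hev (hprod τ hcτ)
  refine h3.congr_deriv ?_
  rw [hprod τ hcτ, hform]
  push_cast
  ring

theorem isParallel_of_section (hc : IsCurve c)
    (h : ∀ τ ∈ Icc a b, ∃ (O : Set X) (s : ∀ x, L.Fib x) (ξ : PreForm X 1), DOpen O ∧ O ⊆ W ∧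
      L.IsUnitSection O s ξ ∧ c τ ∈ O ∧
      HasDerivWithinAt (fun τ' => (inner ℂ (s (c τ')) (σ τ') : ℂ))
      (-Complex.I * (alongCurve ξ c τ : ℂ) * inner ℂ (s (c τ)) (σ τ)) (Icc a b) τ) :
    L.IsParallel c a b σ := by
  intro τ hτ
  obtain ⟨O, s, ξ, hO, hOW, hs, hcτ, hd⟩ := h τ hτ
  refine ⟨hOW hcτ, fun k hk => ?_⟩
  exact hasDerivWithinAt_inner_change hc (hO.inter (L.dom_open k)) (inter_subset_left.trans hOW)
    (hs.mono inter_subset_left) ((L.isUnitSection_frame k).mono inter_subset_right) ⟨hcτ, hk⟩ hd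

theorem LineBundle.IsParallel.hasDerivWithinAt (h : L.IsParallel c a b σ) (hc : IsCurve c)
    {O : Set X} {s : ∀ x, L.Fib x} {ξ : PreForm X 1} (hO : DOpen O) (hOW : O ⊆ W)
    (hs : L.IsUnitSection O s ξ) {τ : ℝ} (hτ : τ ∈ Icc a b) (hcτ : c τ ∈ O) :
    HasDerivWithinAt (fun τ' => (inner ℂ (s (c τ')) (σ τ') : ℂ))
      (-Complex.I * (alongCurve ξ c τ : ℂ) * inner ℂ (s (c τ)) (σ τ)) (Icc a b) τ := by
  obtain ⟨k, hk⟩ := L.dom_cover _ (hOW hcτ)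
  exact hasDerivWithinAt_inner_change hc (hO.inter (L.dom_open k)) (inter_subset_left.trans hOW)
    ((L.isUnitSection_frame k).mono inter_subset_right) (hs.mono inter_subset_left) ⟨hcτ, hk⟩
    ((h τ hτ).2 k hk)

/-- Parallel transport in terms of a unit section along the whole curve. -/
theorem LineBundle.IsParallel.eq_exp (h : L.IsParallel c a b σ) (hc : IsCurve c)
    {O : Set X} {s : ∀ x, L.Fib x} {ξ : PreForm X 1} (hO : DOpen O) (hOW : O ⊆ W)
    (hs : L.IsUnitSection O s ξ) (hcO : ∀ τ ∈ Icc a b, c τ ∈ O) :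
    ∀ τ ∈ Icc a b, (inner ℂ (s (c τ)) (σ τ) : ℂ) =
      Circle.exp (-∫ t in a..τ, alongCurve ξ c t) * inner ℂ (s (c a)) (σ a) :=
  eq_exp_integral_of_hasDerivWithinAt (A := alongCurve ξ c)
    (((hs.isForm hO hOW).contDiffOn_alongCurve hc).continuousOn.mono hcO)
    fun _ hτ => h.hasDerivWithinAt hc hO hOW hs hτ (hcO _ hτ)

theorem isParallel_exp_smul (hc : IsCurve c)
    {O : Set X} {s : ∀ x, L.Fib x} {ξ : PreForm X 1} (hO : DOpen O) (hOW : O ⊆ W)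
    (hs : L.IsUnitSection O s ξ) (hcO : ∀ τ ∈ Icc a b, c τ ∈ O) (z : ℂ) :
    L.IsParallel c a b fun τ =>
      ((Circle.exp (-∫ t in a..τ, alongCurve ξ c t) : ℂ) * z) • s (c τ) := by
  refine isParallel_of_section hc fun τ hτ => ⟨O, s, ξ, hO, hOW, hs, hcO τ hτ, ?_⟩
  have h1 := (hasDerivWithinAt_exp_integral (A := alongCurve ξ c)
    (((hs.isForm hO hOW).contDiffOn_alongCurve hc).continuousOn.mono hcO) τ hτ).mul_const z
  have hin : ∀ t ∈ Icc a b, (inner ℂ (s (c t))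
      (((Circle.exp (-∫ t in a..t, alongCurve ξ c t) : ℂ) * z) • s (c t)) : ℂ) =
      (Circle.exp (-∫ t in a..t, alongCurve ξ c t) : ℂ) * z := fun t ht => by
    rw [inner_smul_right, inner_self_of_norm (hs.1.1 _ (hcO t ht)), mul_one]
  refine (h1.congr hin (hin τ hτ)).congr_deriv ?_
  rw [hin τ hτ]
  ring

/-- Restriction of a parallel section to a subinterval, shifted to the origin. -/
theorem LineBundle.IsParallel.shift (h : L.IsParallel c a b σ) {o ℓ : ℝ} (ho : a ≤ o)
    (hb : o + ℓ ≤ b) (hc : IsCurve c) :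
    L.IsParallel (fun τ => c (o + τ)) 0 ℓ (fun τ => σ (o + τ)) := by
  intro τ hτ
  have hm : ∀ t ∈ Icc 0 ℓ, o + t ∈ Icc a b := fun t ht =>
    ⟨by linarith [ht.1], by linarith [ht.2]⟩
  refine ⟨(h (o + τ) (hm τ hτ)).1, fun k hk => ?_⟩
  have h1 := (h (o + τ) (hm τ hτ)).2 k hk
  have h2 : HasDerivWithinAt (fun t : ℝ => o + t) 1 (Icc 0 ℓ) τ := by
    simpa using ((hasDerivAt_id τ).const_add o).hasDerivWithinAt (s := Icc 0 ℓ)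
  have h3 := h1.scomp τ h2 hm
  rw [one_smul] at h3
  have e : alongCurve (L.conn k) (fun τ => c (o + τ)) τ = alongCurve (L.conn k) c (o + τ) := by
    have h4 := (L.conn_form k).alongCurve_plot (p := fun w : Euc 1 => c (w 0)) hc
      (f := fun t => EuclideanSpace.single 0 (o + t)) (f' := EuclideanSpace.single 0 1) (τ := τ)
      (contDiff_single_one.comp (contDiff_const.add contDiff_id))
      (by
        have h5 := (hasDerivAt_single_one (o + τ)).scomp τ ((hasDerivAt_id τ).const_add o)
        rw [one_smul] at h5
        exact h5)
      (by simpa using hk)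
    simpa [alongCurve] using h4
  rw [e]
  exact h3

end Parallel

open LineBundle

/-! ### Line bundles and Čech 1-cocycles -/

section Circle

/-- The point `z / |z|` of the circle (and `1` for `z = 0`). -/
def circleOf (z : ℂ) : Circle := Circle.exp (Complex.arg z)

theorem coe_circleOf {z : ℂ} (h : ‖z‖ = 1) : (circleOf z : ℂ) = z := by
  have := Complex.norm_mul_exp_arg_mul_I z
  rwa [h, Complex.ofReal_one, one_mul] at this

theorem inner_circle (a b : Circle) : inner ℂ (a : ℂ) (b : ℂ) = ((a⁻¹ * b : Circle) : ℂ) := by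
  rw [Circle.coe_mul, Circle.coe_inv_eq_conj, RCLike.inner_apply, mul_comm]

theorem inner_circle_smul {F : Type*} [NormedAddCommGroup F] [InnerProductSpace ℂ F]
    (a b : Circle) (v w : F) :
    inner ℂ (a • v) (b • w) = ((a⁻¹ * b : Circle) : ℂ) * inner ℂ v w := by
  rw [Circle.smul_def, Circle.smul_def, inner_smul_left, inner_smul_right, Circle.coe_mul,
    Circle.coe_inv_eq_conj, mul_assoc]

theorem exists_linearIsometryEquiv {F F' : Type*} [NormedAddCommGroup F] [InnerProductSpace ℂ F]
    [NormedAddCommGroup F'] [InnerProductSpace ℂ F'] (h : Module.finrank ℂ F = 1)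
    (h' : Module.finrank ℂ F' = 1) {u : F} {u' : F'} (hu : ‖u‖ = 1) (hu' : ‖u'‖ = 1) :
    ∃ φ : F ≃ₗᵢ[ℂ] F', φ u = u' := by
  have : FiniteDimensional ℂ F := Module.finite_of_finrank_pos (by omega)
  have : FiniteDimensional ℂ F' := Module.finite_of_finrank_pos (by omega)
  let f : F →ₗᵢ[ℂ] F' :=
    { toLinearMap := (innerₛₗ ℂ u).smulRight u'
      norm_map' := fun v => by
        simp [norm_smul, hu', norm_inner_of_finrank_eq_one h hu] }
  refine ⟨f.toLinearIsometryEquiv (by omega), ?_⟩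
  simp [f, hu]

end Circle

section LineIso

variable {X : Type u} [DiffeologicalSpace X]

theorem Cocycle1.u_mul (e : Cocycle1 X) {i j k : e.I} {x : X} (hi : x ∈ e.U i) (hj : x ∈ e.U j)
    (hk : x ∈ e.U k) : e.u i j x * e.u j k x = e.u i k x := by
  have := e.cocycle_u i j k x hi hj hk
  rw [mul_right_comm, mul_inv_eq_one, mul_comm] at this
  exact this

/-- The line bundle with connection glued from trivial bundles by a cocycle. -/
def lineOf (e : Cocycle1 X) : LineBundle X univ where
  Fib _ := ℂ
  rank_one _ _ := Module.finrank_self ℂ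
  ι := e.I
  dom := e.U
  dom_open := e.U_open
  dom_subset _ := subset_univ _
  dom_cover x _ := e.U_cover x
  frame i x := (e.u i (e.U_cover x).choose x : ℂ)
  norm_frame _ _ _ := Circle.norm_coe _
  smooth_trans i j := (e.u_smooth i j).congr fun x hx => by
    rw [inner_circle, ← e.u_mul hx.1 hx.2 (e.U_cover x).choose_spec,
      mul_comm (e.u i j x), inv_mul_cancel_left]
  conn i := -((2 * Real.pi) • e.A i)
  conn_form i := ((e.A_form i).smul _).neg
  conn_trans i j := by
    have h1 := dlog_congr (g := fun x => inner ℂ (e.u j (e.U_cover x).choose x : ℂ)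
      (e.u i (e.U_cover x).choose x : ℂ)) (g' := fun x => (e.u i j x : ℂ))
      ((e.U_open i).inter (e.U_open j)) fun x hx => by
        rw [inner_circle, ← e.u_mul hx.1 hx.2 (e.U_cover x).choose_spec,
          mul_comm (e.u i j x), inv_mul_cancel_left]
    intro n p hp w hw
    rw [h1 n p hp w hw]
    have h2 := e.cocycle_A i j n p hp w hw
    simp only [Pi.add_apply, Pi.sub_apply, Pi.neg_apply, Pi.smul_apply, Pi.zero_apply] at h2 ⊢
    have h3 := congrArg (fun z => (2 * Real.pi) • z) h2
    simp only [smul_add, smul_neg, smul_smul, smul_sub, smul_zero] at h3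
    rw [mul_one_div_cancel (by positivity), one_smul] at h3
    linear_combination (norm := module) h3

theorem hasCocycle_lineOf (e : Cocycle1 X) : (lineOf e).HasCocycle e := by
  refine ⟨(lineOf e).frame, (lineOf e).isUnitSection_frame, fun j k x hx => ?_⟩
  change (e.u j (e.U_cover x).choose x : ℂ) = e.u j k x • (e.u k (e.U_cover x).choose x : ℂ)
  rw [← e.u_mul hx.1 hx.2 (e.U_cover x).choose_spec, Circle.coe_mul]
  rfl

/-- The frames of a line bundle have the cocycle with transition functions `s_i / s_j` and with the
forms `-ξ_i / 2π`, where `∇ s_i = i ξ_i s_i`. -/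
theorem LineBundle.exists_hasCocycle (L : LineBundle X univ) : ∃ e, L.HasCocycle e := by
  have hsub : ∀ O : Set X, O ⊆ univ := fun O => subset_univ O
  have hu : ∀ i j, UnitOn (L.dom i ∩ L.dom j) fun x => inner ℂ (L.frame j x) (L.frame i x) :=
    fun i j => ((L.isSmoothUnit_frame i).mono inter_subset_left).ratio (hsub _)
      ((L.isSmoothUnit_frame j).mono inter_subset_right)
  have hc : ∀ i j, ∀ x ∈ L.dom i ∩ L.dom j,
      (circleOf (inner ℂ (L.frame j x) (L.frame i x)) : ℂ) = inner ℂ (L.frame j x) (L.frame i x) :=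
    fun i j x hx => coe_circleOf ((hu i j).norm x hx)
  refine ⟨{ I := L.ι
            U := L.dom
            U_open := L.dom_open
            U_cover := fun x => L.dom_cover x (mem_univ x)
            u := fun i j x => circleOf (inner ℂ (L.frame j x) (L.frame i x))
            u_smooth := fun i j => (hu i j).smooth.congr (hc i j)
            A := fun i => -((1 / (2 * Real.pi)) • L.conn i)
            A_form := fun i => ((L.conn_form i).smul _).neg
            u_self := ?_, u_swap := ?_, cocycle_u := ?_, cocycle_A := ?_ }, L.frame, ?_, ?_⟩
  · intro i x hx
    apply Circle.ext
    rw [hc i i x ⟨hx, hx⟩, inner_self_of_norm (L.norm_frame i x hx)]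
    rfl
  · intro i j x hx
    apply Circle.ext
    rw [Circle.coe_inv_eq_conj, hc i j x hx, hc j i x hx.symm, inner_conj_symm]
  · intro i j k x hi hj hk
    rw [mul_right_comm, mul_inv_eq_one]
    apply Circle.ext
    rw [Circle.coe_mul, hc j k x ⟨hj, hk⟩, hc i j x ⟨hi, hj⟩, hc i k x ⟨hi, hk⟩,
      ← inner_mul_inner_of_finrank_eq_one (L.rank_one x trivial) (L.norm_frame j x hj)]
  · intro i j n p hp w hw
    have h1 := L.conn_trans i j n p hp w hw
    have h2 := dlog_congr ((L.dom_open i).inter (L.dom_open j)) (hc i j) n p hp w hw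
    simp only [Pi.add_apply, Pi.sub_apply, Pi.neg_apply, Pi.smul_apply, Pi.zero_apply] at h1 ⊢
    rw [h2, ← h1]
    module
  · intro j
    have e : -((2 * Real.pi) • -((1 / (2 * Real.pi)) • L.conn j)) = L.conn j := by
      rw [smul_neg, neg_neg, smul_smul, mul_one_div_cancel (by positivity), one_smul]
    simp only [e]
    exact L.isUnitSection_frame j
  · intro j k x hx
    rw [Circle.smul_def, hc j k x hx]
    exact eq_inner_smul_of_finrank_eq_one (L.rank_one x trivial) (L.norm_frame k x hx.2) _

theorem two_pi_ne_zero : 2 * Real.pi ≠ 0 := by positivity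

theorem two_pi_smul_injective {M : Type*} [AddCommGroup M] [Module ℝ M] :
    Function.Injective fun v : M => (2 * Real.pi) • v :=
  fun v w h => by
    have := congrArg (fun z => (1 / (2 * Real.pi)) • z) h
    simpa only [smul_smul, one_div_mul_cancel two_pi_ne_zero, one_smul]
      using this

/-- The cocycles of isomorphic line bundles `L`, `L'` with sections `s_i`, `s'_j` differ by the
coboundary of the functions `s'_j / φ(s_i)`. -/
theorem cohomologous_of_iso {L L' : LineBundle X univ} {e e' : Cocycle1 X} (h : L.HasCocycle e)
    (h' : L'.HasCocycle e') (hφ : LineBundle.Iso L L') : Nonempty (Cohomologous1 e e') := by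
  obtain ⟨s, hs, hsu⟩ := h
  obtain ⟨s', hs', hsu'⟩ := h'
  obtain ⟨φ, hφ⟩ := hφ
  have hsub : ∀ O : Set X, O ⊆ univ := fun O => subset_univ O
  have hφs : ∀ i, L'.IsUnitSection (e.U i) (fun x => φ x (s i x)) (-((2 * Real.pi) • e.A i)) :=
    fun i => hφ _ _ _ (e.U_open i) (hs i)
  have hu : ∀ κ : e.I × e'.I, UnitOn (e.U κ.1 ∩ e'.U κ.2) fun x =>
      inner ℂ (φ x (s κ.1 x)) (s' κ.2 x) := fun κ =>
    ((hs' κ.2).1.mono inter_subset_right).ratio (hsub _) ((hφs κ.1).1.mono inter_subset_left)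
  have hc : ∀ κ : e.I × e'.I, ∀ x ∈ e.U κ.1 ∩ e'.U κ.2,
      (circleOf (inner ℂ (φ x (s κ.1 x)) (s' κ.2 x)) : ℂ) = inner ℂ (φ x (s κ.1 x)) (s' κ.2 x) :=
    fun κ x hx => coe_circleOf ((hu κ).norm x hx)
  refine ⟨{ K := e.I × e'.I
            W := fun κ => e.U κ.1 ∩ e'.U κ.2
            W_open := fun κ => (e.U_open _).inter (e'.U_open _)
            W_cover := fun x => by
              obtain ⟨i, hi⟩ := e.U_cover x
              obtain ⟨j, hj⟩ := e'.U_cover x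
              exact ⟨(i, j), hi, hj⟩
            r := Prod.fst
            r' := Prod.snd
            W_subset := fun κ => subset_rfl
            h := fun κ x => circleOf (inner ℂ (φ x (s κ.1 x)) (s' κ.2 x))
            h_smooth := fun κ => (hu κ).smooth.congr (hc κ)
            u_eq := ?_, A_eq := ?_ }⟩
  · intro κ μ x hx
    rw [mul_inv_eq_iff_eq_mul]
    have key : circleOf (inner ℂ (φ x (s κ.1 x)) (s' κ.2 x)) =
        ((e.u κ.1 μ.1 x)⁻¹ * e'.u κ.2 μ.2 x) * circleOf (inner ℂ (φ x (s μ.1 x)) (s' μ.2 x)) := by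
      apply Circle.ext
      rw [Circle.coe_mul, hc κ x hx.1, hc μ x hx.2, hsu κ.1 μ.1 x ⟨hx.1.1, hx.2.1⟩,
        hsu' κ.2 μ.2 x ⟨hx.1.2, hx.2.2⟩, ← inner_circle_smul, Circle.smul_def, map_smul,
        ← Circle.smul_def]
    rw [key]
    apply Additive.ofMul.injective
    simp only [ofMul_mul, ofMul_inv]
    abel
  · intro κ n p hp w hw
    have hO := (e.U_open κ.1).inter (e'.U_open κ.2)
    have h1 := ((hs' κ.2).mono inter_subset_right).compare hO (hsub _)
      ((hφs κ.1).mono inter_subset_left) n p hp w hw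
    have h2 := dlog_congr hO (hc κ) n p hp w hw
    simp only [Pi.add_apply, Pi.sub_apply, Pi.neg_apply, Pi.smul_apply] at h1 ⊢
    apply two_pi_smul_injective
    simp only
    rw [h2, smul_smul, mul_one_div_cancel two_pi_ne_zero, one_smul, smul_sub]
    linear_combination (norm := module) h1

/-- A coboundary `h` gives an isomorphism, which takes `s_{r(κ)}` to `h_κ⁻¹ s'_{r'(κ)}` over `W_κ`. -/
theorem iso_of_cohomologous {L L' : LineBundle X univ} {e e' : Cocycle1 X} (h : L.HasCocycle e)
    (h' : L'.HasCocycle e') (b : Cohomologous1 e e') : LineBundle.Iso L L' := by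
  obtain ⟨s, hs, hsu⟩ := h
  obtain ⟨s', hs', hsu'⟩ := h'
  have hsub : ∀ O : Set X, O ⊆ univ := fun O => subset_univ O
  have hn' : ∀ κ x, x ∈ b.W κ → ‖(b.h κ x)⁻¹ • s' (b.r' κ) x‖ = 1 := fun κ x hx => by
    rw [Circle.smul_def, norm_smul, Circle.norm_coe, one_mul,
      (hs' _).1.1 x (b.W_subset κ hx).2]
  have hex : ∀ x, ∃ φ : L.Fib x ≃ₗᵢ[ℂ] L'.Fib x, ∀ κ, x ∈ b.W κ →
      φ (s (b.r κ) x) = (b.h κ x)⁻¹ • s' (b.r' κ) x := by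
    intro x
    obtain ⟨μ, hμ⟩ := b.W_cover x
    obtain ⟨φ, hφ⟩ := exists_linearIsometryEquiv (L.rank_one x trivial) (L'.rank_one x trivial)
      ((hs (b.r μ)).1.1 x (b.W_subset μ hμ).1) (hn' μ x hμ)
    refine ⟨φ, fun κ hκ => ?_⟩
    have hκ2 := b.W_subset κ hκ
    have hμ2 := b.W_subset μ hμ
    have h1 := b.u_eq κ μ x ⟨hκ, hμ⟩
    rw [hsu _ _ x ⟨hκ2.1, hμ2.1⟩, hsu' _ _ x ⟨hκ2.2, hμ2.2⟩, Circle.smul_def, map_smul, hφ,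
      ← Circle.smul_def, smul_smul, smul_smul]
    congr 1
    rw [mul_inv_eq_iff_eq_mul] at h1
    rw [h1]
    apply Additive.ofMul.injective
    simp only [ofMul_mul, ofMul_inv]
    abel
  choose φ hφ using hex
  refine ⟨φ, fun O σ ξ hO hσ => IsUnitSection.of_local fun x hx => ?_⟩
  obtain ⟨κ, hκ⟩ := b.W_cover x
  refine ⟨b.W κ, b.W_open κ, hκ, ?_⟩
  have hOκ := hO.inter (b.W_open κ)
  have h1 : L.IsUnitSection (O ∩ b.W κ) (s (b.r κ)) _ :=
    (hs (b.r κ)).mono fun y hy => (b.W_subset κ hy.2).1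
  have h2 : L'.IsUnitSection (O ∩ b.W κ) (s' (b.r' κ)) _ :=
    (hs' (b.r' κ)).mono fun y hy => (b.W_subset κ hy.2).2
  have hσ' := hσ.mono (inter_subset_left (s := O) (t := b.W κ))
  have hg := hσ'.1.ratio (hsub _) h1.1
  have hb := (unitOn_circle (b.h_smooth κ)).mono (inter_subset_right (s := O) (t := b.W κ))
  have hgb := hg.mul hb.conj
  refine ((h2.smul hOκ hgb).congr hOκ fun y hy => ?_).congr_form fun n p hp w hw => ?_
  · conv_lhs => rw [IsUnitSection.eq_smul (hsub _) h1.1 hy (σ y)]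
    rw [map_smul, hφ y κ hy.2, Circle.smul_def, smul_smul, Circle.coe_inv_eq_conj]
  · have e1 := hσ'.compare hOκ (hsub _) h1 n p hp w hw
    have e2 := dlog_mul hOκ hg hb.conj n p hp w hw
    have e3 := dlog_conj hOκ hb n p hp w hw
    have e4 := congrArg (fun z => (2 * Real.pi) • z) (b.A_eq κ n p hp w hw.2)
    rw [Pi.smul_apply, Pi.smul_apply, Pi.smul_apply, smul_smul, mul_one_div_cancel two_pi_ne_zero, one_smul] at e4
    simp only [Pi.add_apply, Pi.sub_apply, Pi.neg_apply, Pi.smul_apply,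
      smul_sub] at *
    rw [e1, e2, e3]
    linear_combination (norm := module) -e4

/-- Every cocycle is cohomologous to itself. -/
def Cohomologous1.refl (e : Cocycle1 X) : Cohomologous1 e e where
  K := e.I
  W := e.U
  W_open := e.U_open
  W_cover := e.U_cover
  r := id
  r' := id
  W_subset _ := by simp
  h _ _ := 1
  h_smooth _ := SmoothOn.const _
  u_eq κ μ x _ := by simp
  A_eq κ n p hp w hw := by
    have : dlog (fun _ : X => ((1 : Circle) : ℂ)) = 0 := dlog_const _
    rw [this]
    simp

theorem lineIso_refl (L : LineBundle X univ) : LineBundle.Iso L L :=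
  ⟨fun _ => LinearIsometryEquiv.refl _ _, fun _ _ _ _ h => h⟩

/-- The sum of two cocycles on the common refinement of their coverings. -/
def Cocycle1.add (c c' : Cocycle1 X) : Cocycle1 X where
  I := c.I × c'.I
  U κ := c.U κ.1 ∩ c'.U κ.2
  U_open κ := (c.U_open _).inter (c'.U_open _)
  U_cover x := by
    obtain ⟨i, hi⟩ := c.U_cover x
    obtain ⟨j, hj⟩ := c'.U_cover x
    exact ⟨(i, j), hi, hj⟩
  u κ μ x := c.u κ.1 μ.1 x * c'.u κ.2 μ.2 x
  u_smooth κ μ := by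
    simp only [Circle.coe_mul]
    exact ((c.u_smooth _ _).mono fun x hx => ⟨hx.1.1, hx.2.1⟩).mul
      ((c'.u_smooth _ _).mono fun x hx => ⟨hx.1.2, hx.2.2⟩)
  A κ := c.A κ.1 + c'.A κ.2
  A_form κ := ((c.A_form _).mono inter_subset_left).add ((c'.A_form _).mono inter_subset_right)
  u_self κ x hx := by rw [c.u_self _ x hx.1, c'.u_self _ x hx.2, one_mul]
  u_swap κ μ x hx := by
    rw [c.u_swap _ _ x ⟨hx.1.1, hx.2.1⟩, c'.u_swap _ _ x ⟨hx.1.2, hx.2.2⟩, mul_inv]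
  cocycle_u κ μ ν x h1 h2 h3 := by
    have e1 := c.u_mul h1.1 h2.1 h3.1
    have e2 := c'.u_mul h1.2 h2.2 h3.2
    rw [mul_right_comm, mul_inv_eq_one, ← e1, ← e2]
    ac_rfl
  cocycle_A κ μ n p hp w hw := by
    have hO := ((c.U_open κ.1).inter (c'.U_open κ.2)).inter ((c.U_open μ.1).inter (c'.U_open μ.2))
    have h1 := c.cocycle_A κ.1 μ.1 n p hp w ⟨hw.1.1, hw.2.1⟩
    have h2 := c'.cocycle_A κ.2 μ.2 n p hp w ⟨hw.1.2, hw.2.2⟩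
    have h3 := dlog_mul hO ((unitOn_circle (c.u_smooth κ.1 μ.1)).mono
      fun x hx => ⟨hx.1.1, hx.2.1⟩) ((unitOn_circle (c'.u_smooth κ.2 μ.2)).mono
      fun x hx => ⟨hx.1.2, hx.2.2⟩) n p hp w hw
    simp only [Circle.coe_mul, Pi.add_apply, Pi.sub_apply, Pi.neg_apply, Pi.smul_apply,
      Pi.zero_apply] at *
    rw [h3]
    linear_combination (norm := module) h1 + h2

/-- Addition in `H¹(X, 𝒦¹)`. -/
def H1.add : H1 X → H1 X → H1 X := by
  refine Quot.map₂ Cocycle1.add ?_ ?_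
  · rintro c e e' ⟨b⟩
    refine ⟨{ K := c.I × b.K
              W := fun κ => c.U κ.1 ∩ b.W κ.2
              W_open := fun κ => (c.U_open _).inter (b.W_open _)
              W_cover := fun x => by
                obtain ⟨i, hi⟩ := c.U_cover x
                obtain ⟨j, hj⟩ := b.W_cover x
                exact ⟨(i, j), hi, hj⟩
              r := fun κ => (κ.1, b.r κ.2)
              r' := fun κ => (κ.1, b.r' κ.2)
              W_subset := fun κ x hx => ⟨⟨hx.1, (b.W_subset _ hx.2).1⟩, hx.1, (b.W_subset _ hx.2).2⟩
              h := fun κ => b.h κ.2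
              h_smooth := fun κ => (b.h_smooth _).mono inter_subset_right
              u_eq := fun κ μ x hx => by
                simp only [Cocycle1.add]
                rw [mul_inv, mul_mul_mul_comm, mul_inv_cancel, one_mul,
                  b.u_eq _ _ x ⟨hx.1.2, hx.2.2⟩]
              A_eq := fun κ n p hp w hw => by
                have := b.A_eq κ.2 n p hp w hw.2
                simp only [Cocycle1.add, Pi.add_apply, Pi.sub_apply, Pi.smul_apply] at *
                rw [← this]
                abel }⟩
  · rintro e e' c ⟨b⟩
    refine ⟨{ K := b.K × c.I
              W := fun κ => b.W κ.1 ∩ c.U κ.2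
              W_open := fun κ => (b.W_open _).inter (c.U_open _)
              W_cover := fun x => by
                obtain ⟨i, hi⟩ := c.U_cover x
                obtain ⟨j, hj⟩ := b.W_cover x
                exact ⟨(j, i), hj, hi⟩
              r := fun κ => (b.r κ.1, κ.2)
              r' := fun κ => (b.r' κ.1, κ.2)
              W_subset := fun κ x hx => ⟨⟨(b.W_subset _ hx.1).1, hx.2⟩, (b.W_subset _ hx.1).2, hx.2⟩
              h := fun κ => b.h κ.1
              h_smooth := fun κ => (b.h_smooth _).mono inter_subset_left
              u_eq := fun κ μ x hx => by
                simp only [Cocycle1.add]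
                rw [mul_inv, mul_mul_mul_comm, mul_inv_cancel, mul_one,
                  b.u_eq _ _ x ⟨hx.1.1, hx.2.1⟩]
              A_eq := fun κ n p hp w hw => by
                have := b.A_eq κ.1 n p hp w hw.1
                simp only [Cocycle1.add, Pi.add_apply, Pi.sub_apply, Pi.smul_apply] at *
                rw [← this]
                abel }⟩

/-- A sum of cocycles formed on any common refinement of their coverings represents the sum of the
classes. -/
theorem IsSum1.mk_eq {c c' c'' : Cocycle1 X} (h : IsSum1 c c' c'') :
    H1.mk c'' = (H1.mk c).add (H1.mk c') := by
  obtain ⟨r, r', hU, hu, hA⟩ := h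
  refine Quot.sound ⟨{ K := c''.I
                       W := c''.U
                       W_open := c''.U_open
                       W_cover := c''.U_cover
                       r := id
                       r' := fun κ => (r κ, r' κ)
                       W_subset := fun κ x hx => ⟨hx, hU κ hx⟩
                       h := fun _ _ => 1
                       h_smooth := fun _ => SmoothOn.const _
                       u_eq := fun κ μ x hx => by
                        simp [Cocycle1.add, hu κ μ x hx]
                       A_eq := fun κ n p hp w hw => by
                        have h0 : dlog (fun _ : X => ((1 : Circle) : ℂ)) = 0 := dlog_const _
                        have := hA κ n p hp w hw
                        simp only [Cocycle1.add, id, h0, Pi.add_apply, Pi.sub_apply,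
                          Pi.smul_apply, Pi.zero_apply, smul_zero] at *
                        rw [this, sub_self] }⟩

theorem TensorIso.isSum1 {L L' L'' : LineBundle X univ} (T : TensorIso L L' L'' univ)
    {e e' : Cocycle1 X} (h : L.HasCocycle e) (h' : L'.HasCocycle e') :
    L''.HasCocycle (e.add e') := by
  obtain ⟨s, hs, hsu⟩ := h
  obtain ⟨s', hs', hsu'⟩ := h'
  refine ⟨fun κ x => T.mul x (s κ.1 x) (s' κ.2 x), fun κ => ?_, fun κ μ x hx => ?_⟩
  · have := T.parallel _ _ _ _ _ ((e.U_open κ.1).inter (e'.U_open κ.2)) (subset_univ _)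
      ((hs κ.1).mono inter_subset_left) ((hs' κ.2).mono inter_subset_right)
    rw [← neg_add, ← smul_add] at this
    exact this
  · simp only [Cocycle1.add]
    rw [hsu _ _ x ⟨hx.1.1, hx.2.1⟩, hsu' _ _ x ⟨hx.1.2, hx.2.2⟩]
    simp only [Circle.smul_def, map_smul, LinearMap.smul_apply, smul_smul, Circle.coe_mul]
    rw [mul_comm]

variable (X) in
/-- The isomorphism `Line(X) ≅ H¹(X, 𝒦¹)`. -/
def lineEquiv : LineClass X ≃ H1 X where
  toFun := Quot.lift (fun L => H1.mk L.exists_hasCocycle.choose) fun L L' h =>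
    Quot.sound (cohomologous_of_iso L.exists_hasCocycle.choose_spec
      L'.exists_hasCocycle.choose_spec h)
  invFun := Quot.map lineOf fun e e' ⟨b⟩ =>
    iso_of_cohomologous (hasCocycle_lineOf e) (hasCocycle_lineOf e') b
  left_inv := by
    rintro ⟨L⟩
    exact Quot.sound (iso_of_cohomologous (hasCocycle_lineOf _) L.exists_hasCocycle.choose_spec
      (Cohomologous1.refl _))
  right_inv := by
    rintro ⟨e⟩
    exact Quot.sound (cohomologous_of_iso (lineOf e).exists_hasCocycle.choose_spec
      (hasCocycle_lineOf e) (lineIso_refl _))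

theorem lineEquiv_mk {L : LineBundle X univ} {e : Cocycle1 X} (h : L.HasCocycle e) :
    lineEquiv X (Quot.mk _ L) = H1.mk e :=
  Quot.sound (cohomologous_of_iso L.exists_hasCocycle.choose_spec h (lineIso_refl _))

theorem isLineIso_lineEquiv : IsLineIso (lineEquiv X) := by
  refine ⟨LineBundle.exists_hasCocycle, fun L e h => lineEquiv_mk h, ?_⟩
  rintro L L' L'' ⟨T⟩ e e' e'' hsum h h'
  have hL := L.exists_hasCocycle.choose_spec
  have hL' := L'.exists_hasCocycle.choose_spec
  rw [lineEquiv_mk (T.isSum1 hL hL'), hsum.mk_eq, ← h, ← h', lineEquiv_mk hL, lineEquiv_mk hL']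
  rfl

end LineIso

open LineBundle

/-! ### Fine coverings of manifolds -/

section Refinement

/-- A D-open subset of a manifold is open. Plots are defined on all of `ℝⁿ`, so the inverse of a
chart is composed with a diffeomorphism of `ℝⁿ` onto a ball to obtain a plot. -/
theorem isOpen_of_dOpen {E : Type v} [NormedAddCommGroup E] [NormedSpace ℝ E]
    [FiniteDimensional ℝ E] {B : Type u} [TopologicalSpace B] [ChartedSpace E B]
    [IsManifold 𝓘(ℝ, E) ∞ B] {V : Set B} (hV : DOpen (X := Mfd E B) V) : IsOpen V := by
  rw [isOpen_iff_mem_nhds]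
  intro x hx
  -- `b` maps `ℝⁿ` onto a ball in the chart, and `p` is the resulting plot
  set φ := chartAt E x
  set y₀ := toEuclidean (φ x) with hy₀
  have hΩ : IsOpen (toEuclidean.symm ⁻¹' φ.target) :=
    φ.open_target.preimage toEuclidean.symm.continuous
  have hy₀Ω : y₀ ∈ toEuclidean.symm ⁻¹' φ.target := by
    simp only [mem_preimage, hy₀, ContinuousLinearEquiv.symm_apply_apply]
    exact φ.map_source (mem_chart_source E x)
  obtain ⟨ε, hε, hball⟩ := Metric.isOpen_iff.1 hΩ y₀ hy₀Ω
  set b := OpenPartialHomeomorph.univBall y₀ ε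
  have hb : ∀ w, b w ∈ Metric.ball y₀ ε := fun w => by
    have h : b w ∈ b.target := b.map_source (by simp [b])
    rwa [OpenPartialHomeomorph.univBall_target y₀ hε] at h
  set p : Euc (Module.finrank ℝ E) → B := fun w => φ.symm (toEuclidean.symm (b w)) with hp
  have hplot : ContMDiff 𝓘(ℝ, Euc (Module.finrank ℝ E)) 𝓘(ℝ, E) ∞ p := by
    have h1 : ContMDiff 𝓘(ℝ, Euc (Module.finrank ℝ E)) 𝓘(ℝ, E) ∞
        fun w => toEuclidean.symm (b w) :=
      (toEuclidean.symm.contDiff.comp OpenPartialHomeomorph.contDiff_univBall).contMDiff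
    exact (contMDiffOn_chart_symm (I := 𝓘(ℝ, E)) (n := ∞) (x := x)).comp_contMDiff h1
      fun w => hball (hb w)
  have hopen : IsOpen (p ⁻¹' V) := hV.plot (X := Mfd E B) (p := p) hplot
  have hq : ContinuousAt (fun y => b.symm (toEuclidean (φ y))) x := by
    refine ContinuousAt.comp (g := b.symm) ?_
      (toEuclidean.continuous.continuousAt.comp (φ.continuousAt (mem_chart_source E x)))
    refine b.symm.continuousAt ?_
    change y₀ ∈ b.target
    rw [OpenPartialHomeomorph.univBall_target y₀ hε]
    exact Metric.mem_ball_self hε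
  have hpq : ∀ᶠ y in 𝓝 x, p (b.symm (toEuclidean (φ y))) = y := by
    have h1 : ∀ᶠ y in 𝓝 x, toEuclidean (φ y) ∈ Metric.ball y₀ ε :=
      (toEuclidean.continuous.continuousAt.comp
        (φ.continuousAt (mem_chart_source E x))).preimage_mem_nhds (Metric.ball_mem_nhds _ hε)
    filter_upwards [h1, φ.open_source.mem_nhds (mem_chart_source E x)] with y hy hys
    rw [hp]
    simp only
    rw [b.right_inv (by rwa [OpenPartialHomeomorph.univBall_target y₀ hε]),
      ContinuousLinearEquiv.symm_apply_apply, φ.left_inv hys]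
  have hxV : p (b.symm (toEuclidean (φ x))) ∈ V := by rwa [hpq.self_of_nhds]
  filter_upwards [hq.preimage_mem_nhds (hopen.mem_nhds hxV), hpq] with y hy hy2
  rw [← hy2]
  exact hy

theorem dOpen_of_isOpen {E : Type v} [NormedAddCommGroup E] [NormedSpace ℝ E]
    {B : Type u} [TopologicalSpace B] [ChartedSpace E B] {V : Set B} (hV : IsOpen V) :
    DOpen (X := Mfd E B) V :=
  dOpen_iff.2 fun n p hp => by
    have h : ∀ q : Euc n → B, ContMDiff 𝓘(ℝ, Euc n) 𝓘(ℝ, E) ∞ q → IsOpen (q ⁻¹' V) :=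
      fun q hq => hV.preimage hq.continuous
    exact h p hp

/-- Every open covering of a paracompact Hausdorff space has a refinement, indexed by the points of
the space, whose double intersections are small. -/
theorem exists_small_refinement {B : Type u} [TopologicalSpace B] [T2Space B] [ParacompactSpace B]
    {K : Type*} (W : K → Set B) (hW : ∀ κ, IsOpen (W κ)) (hcov : ∀ x, ∃ κ, x ∈ W κ)
    (S : K → K → Set B → Prop) (hmono : ∀ κ μ O O', S κ μ O → O' ⊆ O → S κ μ O')
    (hempty : ∀ κ μ, S κ μ ∅)
    (hloc : ∀ κ μ, ∀ x ∈ W κ ∩ W μ, ∃ O, IsOpen O ∧ x ∈ O ∧ S κ μ O) :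
    ∃ (W' : B → Set B) (ρ : B → K), (∀ x, IsOpen (W' x) ∧ x ∈ W' x ∧ W' x ⊆ W (ρ x)) ∧
      ∀ x y, S (ρ x) (ρ y) (W' x ∩ W' y) := by
  obtain ⟨v, hvo, hvc, hvf, hvW⟩ := precise_refinement W hW (by
    rw [eq_univ_iff_forall]
    exact fun x => mem_iUnion.2 (hcov x))
  obtain ⟨u, huc, huo, huv⟩ := exists_iUnion_eq_closure_subset hvo hvf.point_finite hvc
  have hex : ∀ x, ∃ κ, x ∈ u κ := fun x => mem_iUnion.1 (huc ▸ mem_univ x)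
  choose ρ hρ using hex
  -- `u` shrinks the locally finite covering `v`, with closures contained in the `v κ`; near `x`
  -- only the indices of the finite set `F` matter, the neighbourhood `V` of `x` lies in `u (ρ x)`,
  -- and it avoids `closure (u κ)` whenever `x` is not in this set
  choose! O hOo hxO hSO using hloc
  have hnb : ∀ x, ∃ V, IsOpen V ∧ x ∈ V ∧ ∃ F : Set K, (∀ κ z, z ∈ V → z ∈ u κ → κ ∈ F) ∧
      V ⊆ u (ρ x) ∧ (∀ κ ∈ F, x ∉ closure (u κ) → V ⊆ (closure (u κ))ᶜ) ∧
      ∀ κ ∈ F, ∀ μ ∈ F, x ∈ W κ ∩ W μ → V ⊆ O κ μ x := by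
    intro x
    obtain ⟨N, hN, hfin⟩ := hvf x
    have hcl : ∀ κ, u κ ⊆ v κ := fun κ => subset_closure.trans (huv κ)
    set F : Set K := {κ | (v κ ∩ N).Nonempty} with hF
    have e1 : ∀ᶠ z in 𝓝 x, ∀ κ ∈ F, x ∉ closure (u κ) → z ∈ (closure (u κ))ᶜ := by
      refine (Filter.eventually_all_finite hfin).2 fun κ _ => ?_
      by_cases h : x ∈ closure (u κ)
      · exact Filter.Eventually.of_forall fun z h' => absurd h h'
      · filter_upwards [isClosed_closure.isOpen_compl.mem_nhds h] with z hz _ using hz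
    have e2 : ∀ᶠ z in 𝓝 x, ∀ κ ∈ F, ∀ μ ∈ F, x ∈ W κ ∩ W μ → z ∈ O κ μ x := by
      refine (Filter.eventually_all_finite hfin).2 fun κ _ =>
        (Filter.eventually_all_finite hfin).2 fun μ _ => ?_
      by_cases h : x ∈ W κ ∩ W μ
      · filter_upwards [(hOo κ μ x h).mem_nhds (hxO κ μ x h)] with z hz _ using hz
      · exact Filter.Eventually.of_forall fun z h' => absurd h' h
    have e3 := hN
    have e4 := (huo (ρ x)).mem_nhds (hρ x)
    obtain ⟨V, hV, hVo, hxV⟩ := eventually_nhds_iff.1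
      (e1.and (e2.and (Filter.Eventually.and e3 e4)))
    exact ⟨V, hVo, hxV, F, fun κ z hz hzu => ⟨z, hcl κ hzu, (hV z hz).2.2.1⟩,
      fun z hz => (hV z hz).2.2.2, fun κ hκ hx z hz => (hV z hz).1 κ hκ hx,
      fun κ hκ μ hμ hx z hz => (hV z hz).2.1 κ hκ μ hμ hx⟩
  choose W' hW'o hxW' F hF hW'u hW'c hW'O using hnb
  have huW : ∀ κ, closure (u κ) ⊆ W κ := fun κ => (huv κ).trans (hvW κ)
  refine ⟨W', ρ, fun x => ⟨hW'o x, hxW' x, (hW'u x).trans (subset_closure.trans (huW _))⟩,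
    fun x y => ?_⟩
  rcases (W' x ∩ W' y).eq_empty_or_nonempty with h | ⟨z, hzx, hzy⟩
  · rw [h]; exact hempty _ _
  -- if `W' x` meets `W' y ⊆ u (ρ y)`, then `x` must lie in `closure (u (ρ y)) ⊆ W (ρ y)`
  · have hyF : ρ y ∈ F x := hF x _ z hzx (hW'u y hzy)
    have hxF : ρ x ∈ F x := hF x _ x (hxW' x) (hρ x)
    have hxy : x ∈ W (ρ x) ∩ W (ρ y) := by
      refine ⟨huW _ (subset_closure (hρ x)), huW _ ?_⟩
      by_contra hcon
      exact hW'c x _ hyF hcon hzx (subset_closure (hW'u y hzy))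
    exact hmono _ _ _ _ (hSO _ _ x hxy) (inter_subset_left.trans (hW'O x _ hxF _ hyF hxy))

end Refinement

/-! ### Trivialisations of gerbes and their cocycles -/

section Trivialization

variable {X : Type u} [DiffeologicalSpace X]

/-- An idempotent of unit length in `L_{αα}` acts as the identity from the left. -/
theorem Gerbe.one_mul {G : Gerbe X} {α β : G.I} {x : X} (hα : x ∈ G.U α) (hβ : x ∈ G.U β)
    {e : (G.L α α).Fib x} (he : e ≠ 0) (hee : (G.θ α α α).mul x e e = e)
    (v : (G.L α β).Fib x) : (G.θ α α β).mul x e v = v := by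
  have h := G.assoc α α α β x hα hα hα hβ e e v
  rw [hee] at h
  exact ((G.θ α α β).mul_left_cancel ⟨⟨hα, hα⟩, hβ⟩ he h).symm

theorem Gerbe.mul_one {G : Gerbe X} {α β : G.I} {x : X} (hα : x ∈ G.U α) (hβ : x ∈ G.U β)
    {e : (G.L β β).Fib x} (he : e ≠ 0) (hee : (G.θ β β β).mul x e e = e)
    (v : (G.L α β).Fib x) : (G.θ α β β).mul x v e = v := by
  have h := G.assoc α β β β x hα hβ hβ hβ v e e
  rw [hee] at h
  exact (G.θ α β β).mul_right_cancel ⟨⟨hα, hβ⟩, hβ⟩ he h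

/-- The idempotent is unique. -/
theorem Gerbe.idem_unique {G : Gerbe X} {α : G.I} {x : X} (hα : x ∈ G.U α)
    {e e' : (G.L α α).Fib x} (he : e ≠ 0) (hee : (G.θ α α α).mul x e e = e) (he' : e' ≠ 0)
    (hee' : (G.θ α α α).mul x e' e' = e') : e = e' := by
  rw [← Gerbe.mul_one hα hα he' hee' e, Gerbe.one_mul hα hα he hee e']

/-- Unit sections `s_{κμ}` of the `L_{r(κ)r(μ)}` on the double intersections of a refinement `W` of
the covering of the gerbe, with `s_{κκ} = 1` and `s_{μκ} = s_{κμ}⁻¹`. -/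
structure Gerbe.Triv (G : Gerbe X) {K : Type u} (W : K → Set X) (r : K → G.I) where
  subset : ∀ κ, W κ ⊆ G.U (r κ)
  s : ∀ κ μ x, (G.L (r κ) (r μ)).Fib x
  ξ : K → K → PreForm X 1
  unit : ∀ κ μ, (G.L (r κ) (r μ)).IsUnitSection (W κ ∩ W μ) (s κ μ) (ξ κ μ)
  mul_self : ∀ κ, ∀ x ∈ W κ, (G.θ (r κ) (r κ) (r κ)).mul x (s κ κ x) (s κ κ x) = s κ κ x
  mul_swap : ∀ κ μ, ∀ x ∈ W κ ∩ W μ,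
    (G.θ (r κ) (r μ) (r κ)).mul x (s κ μ x) (s μ κ x) = s κ κ x

namespace Gerbe.Triv

variable {G : Gerbe X} {K : Type u} {W : K → Set X} {r : K → G.I} (t : G.Triv W r)

theorem ne_zero {κ μ : K} {x : X} (h : x ∈ W κ) (h' : x ∈ W μ) : t.s κ μ x ≠ 0 :=
  norm_ne_zero_iff.1 (by rw [(t.unit κ μ).1.1 x ⟨h, h'⟩]; exact one_ne_zero)

theorem one_mul {κ : K} {β : G.I} {x : X} (h : x ∈ W κ) (hβ : x ∈ G.U β)
    (v : (G.L (r κ) β).Fib x) : (G.θ (r κ) (r κ) β).mul x (t.s κ κ x) v = v :=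
  Gerbe.one_mul (t.subset κ h) hβ (t.ne_zero h h) (t.mul_self κ x h) v

theorem mul_one {κ : K} {β : G.I} {x : X} (h : x ∈ W κ) (hβ : x ∈ G.U β)
    (v : (G.L β (r κ)).Fib x) : (G.θ β (r κ) (r κ)).mul x v (t.s κ κ x) = v :=
  Gerbe.mul_one hβ (t.subset κ h) (t.ne_zero h h) (t.mul_self κ x h) v

/-- The function `s_{κν} / (s_{κμ} s_{μν})`. -/
def θ (κ μ ν : K) (x : X) : Circle :=
  circleOf (inner ℂ ((G.θ (r κ) (r μ) (r ν)).mul x (t.s κ μ x) (t.s μ ν x)) (t.s κ ν x))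

theorem unit_mul (κ μ ν : K) (hW : ∀ κ, DOpen (W κ)) :
    (G.L (r κ) (r ν)).IsUnitSection (W κ ∩ W μ ∩ W ν)
      (fun x => (G.θ (r κ) (r μ) (r ν)).mul x (t.s κ μ x) (t.s μ ν x)) (t.ξ κ μ + t.ξ μ ν) :=
  (G.θ (r κ) (r μ) (r ν)).parallel _ _ _ _ _ (((hW κ).inter (hW μ)).inter (hW ν))
    (fun _ hx => ⟨⟨t.subset κ hx.1.1, t.subset μ hx.1.2⟩, t.subset ν hx.2⟩)
    ((t.unit κ μ).mono fun _ hx => hx.1) ((t.unit μ ν).mono fun _ hx => ⟨hx.1.2, hx.2⟩)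

theorem sub₃ (t : G.Triv W r) (κ μ ν : K) : W κ ∩ W μ ∩ W ν ⊆ G.U (r κ) ∩ G.U (r ν) :=
  fun _ hx => ⟨t.subset κ hx.1.1, t.subset ν hx.2⟩

theorem unit₃ (κ μ ν : K) :
    (G.L (r κ) (r ν)).IsUnitSection (W κ ∩ W μ ∩ W ν) (t.s κ ν) (t.ξ κ ν) :=
  (t.unit κ ν).mono fun _ hx => ⟨hx.1.1, hx.2⟩

theorem coe_θ (t : G.Triv W r) (hW : ∀ κ, DOpen (W κ)) {κ μ ν : K} {x : X} (hx : x ∈ W κ ∩ W μ ∩ W ν) :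
    (t.θ κ μ ν x : ℂ) =
      inner ℂ ((G.θ (r κ) (r μ) (r ν)).mul x (t.s κ μ x) (t.s μ ν x)) (t.s κ ν x) :=
  coe_circleOf (((t.unit₃ κ μ ν).1.ratio (t.sub₃ κ μ ν) (t.unit_mul κ μ ν hW).1).norm x hx)

theorem θ_smul (t : G.Triv W r) (hW : ∀ κ, DOpen (W κ)) {κ μ ν : K} {x : X} (hx : x ∈ W κ ∩ W μ ∩ W ν) :
    t.θ κ μ ν x • (G.θ (r κ) (r μ) (r ν)).mul x (t.s κ μ x) (t.s μ ν x) = t.s κ ν x := by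
  rw [Circle.smul_def, t.coe_θ hW hx]
  exact (IsUnitSection.eq_smul (t.sub₃ κ μ ν) (t.unit_mul κ μ ν hW).1 hx _).symm

end Gerbe.Triv

theorem circle_smul_right_injective {F : Type*} [NormedAddCommGroup F] [InnerProductSpace ℂ F]
    {z w : Circle} {v : F} (hv : v ≠ 0) (h : z • v = w • v) : z = w :=
  Circle.ext (smul_left_injective ℂ hv h)

variable {W₁ W₂ W₃ V : Set X} {L₁ : LineBundle X W₁} {L₂ : LineBundle X W₂}
  {L₃ : LineBundle X W₃} in
theorem TensorIso.smul_mul (T : TensorIso L₁ L₂ L₃ V) {x : X} (z : Circle) (a : L₁.Fib x)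
    (b : L₂.Fib x) : T.mul x (z • a) b = z • T.mul x a b := by
  rw [Circle.smul_def, map_smul, LinearMap.smul_apply, ← Circle.smul_def]

variable {W₁ W₂ W₃ V : Set X} {L₁ : LineBundle X W₁} {L₂ : LineBundle X W₂}
  {L₃ : LineBundle X W₃} in
theorem TensorIso.mul_smul (T : TensorIso L₁ L₂ L₃ V) {x : X} (z : Circle) (a : L₁.Fib x)
    (b : L₂.Fib x) : T.mul x a (z • b) = z • T.mul x a b := by
  rw [Circle.smul_def, map_smul, ← Circle.smul_def]

variable {G : Gerbe X} {K : Type u} {W : K → Set X} {r : K → G.I} in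
theorem Gerbe.Triv.mul_eq (t : G.Triv W r) (hW : ∀ κ, DOpen (W κ)) {κ μ ν : K} {x : X}
    (hκ : x ∈ W κ) (hμ : x ∈ W μ) (hν : x ∈ W ν) :
    (G.θ (r κ) (r μ) (r ν)).mul x (t.s κ μ x) (t.s μ ν x) = (t.θ κ μ ν x)⁻¹ • t.s κ ν x := by
  rw [← t.θ_smul hW ⟨⟨hκ, hμ⟩, hν⟩, inv_smul_smul]

variable {G : Gerbe X} {K : Type u} {W : K → Set X} {r : K → G.I} in
/-- The Čech cocycle of a trivialisation. -/
def Gerbe.Triv.cocycle (t : G.Triv W r) (hW : ∀ κ, DOpen (W κ)) (hcov : ∀ x, ∃ κ, x ∈ W κ) :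
    Cocycle2 X where
  I := K
  U := W
  U_open := hW
  U_cover := hcov
  θ := t.θ
  θ_smooth κ μ ν := ((t.unit₃ κ μ ν).1.ratio (t.sub₃ κ μ ν) (t.unit_mul κ μ ν hW).1).smooth.congr
    fun _ hx => t.coe_θ hW hx
  a κ μ := (1 / (2 * Real.pi)) • t.ξ κ μ
  a_form κ μ := ((t.unit κ μ).isForm ((hW κ).inter (hW μ))
    (inter_subset_inter (t.subset κ) (t.subset μ))).smul _
  f κ := -G.F (r κ)
  f_form κ := ((G.F_form (r κ)).mono (t.subset κ)).neg
  θ_self κ μ x hx := by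
    refine circle_smul_right_injective (t.ne_zero hx.1 hx.2) ?_
    have h := t.θ_smul hW (κ := κ) (μ := κ) (ν := μ) ⟨⟨hx.1, hx.1⟩, hx.2⟩
    rw [t.one_mul hx.1 (t.subset μ hx.2)] at h
    exact h.trans (one_smul _ _).symm
  θ_swap₁ κ μ ν x hx := by
    have h := t.mul_eq hW hx.1.2 hx.1.1 hx.2
    rw [← t.θ_smul hW hx, TensorIso.mul_smul, ← G.assoc (r μ) (r κ) (r μ) (r ν) x
      (t.subset _ hx.1.2) (t.subset _ hx.1.1) (t.subset _ hx.1.2) (t.subset _ hx.2),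
      t.mul_swap μ κ x ⟨hx.1.2, hx.1.1⟩, t.one_mul hx.1.2 (t.subset _ hx.2)] at h
    rw [circle_smul_right_injective (t.ne_zero hx.1.2 hx.2) h, inv_inv]
  θ_swap₂ κ μ ν x hx := by
    have h := t.mul_eq hW hx.1.1 hx.2 hx.1.2
    rw [← t.θ_smul hW hx, TensorIso.smul_mul, G.assoc (r κ) (r μ) (r ν) (r μ) x
      (t.subset _ hx.1.1) (t.subset _ hx.1.2) (t.subset _ hx.2) (t.subset _ hx.1.2),
      t.mul_swap μ ν x ⟨hx.1.2, hx.2⟩, t.mul_one hx.1.2 (t.subset _ hx.1.1)] at h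
    rw [circle_smul_right_injective (t.ne_zero hx.1.1 hx.1.2) h, inv_inv]
  a_self κ n p hp w hw := by
    have h1 := (t.unit_mul κ κ κ hW).congr (((hW κ).inter (hW κ)).inter (hW κ))
      fun x hx => (t.mul_self κ x hx.2).symm
    have h2 := h1.form_unique (t.sub₃ κ κ κ) (t.unit₃ κ κ κ) n p hp w ⟨⟨hw, hw⟩, hw⟩
    simp only [Pi.add_apply, Pi.smul_apply, Pi.zero_apply] at *
    rw [add_eq_left.1 h2, smul_zero]
  a_swap κ μ n p hp w hw := by
    have h1 := (t.unit_mul κ μ κ hW).congr (((hW κ).inter (hW μ)).inter (hW κ))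
      fun x hx => (t.mul_swap κ μ x hx.1).symm
    have h2 := h1.form_unique (t.sub₃ κ μ κ) (t.unit₃ κ μ κ) n p hp w ⟨hw, hw.1⟩
    have h3 := (t.unit_mul κ κ κ hW).congr (((hW κ).inter (hW κ)).inter (hW κ))
      fun x hx => (t.mul_self κ x hx.2).symm
    have h4 := h3.form_unique (t.sub₃ κ κ κ) (t.unit₃ κ κ κ) n p hp w ⟨⟨hw.1, hw.1⟩, hw.1⟩
    simp only [Pi.add_apply, Pi.smul_apply, Pi.neg_apply] at *
    rw [add_eq_left.1 h4] at h2
    rw [eq_neg_of_add_eq_zero_right h2, smul_neg]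
  cocycle_θ κ μ ν l x hκ hμ hν hl := by
    have h := G.assoc (r κ) (r μ) (r ν) (r l) x (t.subset _ hκ) (t.subset _ hμ) (t.subset _ hν)
      (t.subset _ hl) (t.s κ μ x) (t.s μ ν x) (t.s ν l x)
    rw [t.mul_eq hW hκ hμ hν, t.mul_eq hW hμ hν hl, TensorIso.smul_mul, TensorIso.mul_smul,
      t.mul_eq hW hκ hν hl, t.mul_eq hW hκ hμ hl, smul_smul, smul_smul] at h
    have h2 := circle_smul_right_injective (t.ne_zero hκ hl) h
    have h3 := congrArg Additive.ofMul h2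
    apply Additive.ofMul.injective
    simp only [ofMul_mul, ofMul_inv, ofMul_one] at h3 ⊢
    linear_combination (norm := module) h3
  cocycle_a κ μ ν n p hp w hw := by
    have hO := ((hW κ).inter (hW μ)).inter (hW ν)
    have h1 := (t.unit₃ κ μ ν).compare hO (t.sub₃ κ μ ν) (t.unit_mul κ μ ν hW) n p hp w hw
    have h2 := dlog_congr hO (fun x hx => t.coe_θ hW hx) n p hp w hw
    simp only [Pi.add_apply, Pi.smul_apply, Pi.sub_apply, Pi.zero_apply] at *
    rw [h2]
    linear_combination (norm := module) -(1 / (2 * Real.pi)) • h1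
  cocycle_f κ μ n p hp w hw := by
    have h := G.F_sub (r κ) (r μ) (W κ ∩ W μ) (t.s κ μ) (t.ξ κ μ) ((hW κ).inter (hW μ))
      (fun x hx => ⟨t.subset _ hx.1, t.subset _ hx.2⟩) (t.unit κ μ) n p hp w hw
    rw [d_smul]
    simp only [Pi.add_apply, Pi.smul_apply, Pi.sub_apply, Pi.neg_apply, Pi.zero_apply] at *
    linear_combination (norm := module) -h

variable {G : Gerbe X} {K : Type u} {W : K → Set X} {r : K → G.I} in
theorem Gerbe.Triv.hasCocycle (t : G.Triv W r) (hW : ∀ κ, DOpen (W κ))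
    (hcov : ∀ x, ∃ κ, x ∈ W κ) : G.HasCocycle (t.cocycle hW hcov) := by
  refine ⟨r, t.subset, t.s, fun κ μ => ?_, fun κ μ ν x hx => t.θ_smul hW hx,
    fun κ => FormEq.refl _ _⟩
  have e : (2 * Real.pi) • (t.cocycle hW hcov).a κ μ = t.ξ κ μ := by
    simp only [Gerbe.Triv.cocycle]
    rw [smul_smul, mul_one_div_cancel two_pi_ne_zero, one_smul]
  rw [e]
  exact t.unit κ μ

/-- If the bundles `L_{r(κ)r(μ)}` have unit sections, then these can be chosen alternating. -/
theorem Gerbe.exists_triv (G : Gerbe X) {K : Type u} (W : K → Set X) (r : K → G.I)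
    (hW : ∀ κ, DOpen (W κ)) (hr : ∀ κ, W κ ⊆ G.U (r κ))
    (h : ∀ κ μ, ∃ s ξ, (G.L (r κ) (r μ)).IsUnitSection (W κ ∩ W μ) s ξ) :
    Nonempty (G.Triv W r) := by
  classical
  choose σ ζ hσ using h
  have hne : ∀ κ μ x, x ∈ W κ → x ∈ W μ → σ κ μ x ≠ 0 := fun κ μ x h h' =>
    norm_ne_zero_iff.1 (by rw [(hσ κ μ).1.1 x ⟨h, h'⟩]; exact one_ne_zero)
  -- the section `e` with `e σ = σ` is idempotent
  have hone : ∀ κ, ∃ e : ∀ x, (G.L (r κ) (r κ)).Fib x, ∃ ξ,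
      (G.L (r κ) (r κ)).IsUnitSection (W κ) e ξ ∧
      ∀ x ∈ W κ, (G.θ (r κ) (r κ) (r κ)).mul x (e x) (e x) = e x := by
    intro κ
    have hσκ := (hσ κ κ).mono (O' := W κ) (by rw [inter_self])
    obtain ⟨e, he, hmul⟩ := (G.θ (r κ) (r κ) (r κ)).exists_left (hW κ)
      (fun x hx => ⟨⟨hr κ hx, hr κ hx⟩, hr κ hx⟩) (fun x hx => ⟨hr κ hx, hr κ hx⟩)
      (fun x hx => ⟨hr κ hx, hr κ hx⟩) hσκ hσκ
    refine ⟨e, _, he, fun x hx => ?_⟩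
    have h1 := G.assoc (r κ) (r κ) (r κ) (r κ) x (hr κ hx) (hr κ hx) (hr κ hx) (hr κ hx) (e x)
      (e x) (σ κ κ x)
    rw [hmul x hx, hmul x hx] at h1
    exact (G.θ (r κ) (r κ) (r κ)).mul_right_cancel ⟨⟨hr κ hx, hr κ hx⟩, hr κ hx⟩
      (hne κ κ x hx hx) (h1.trans (hmul x hx).symm)
  choose e ξe he hee using hone
  have hene : ∀ κ x, x ∈ W κ → e κ x ≠ 0 := fun κ x h =>
    norm_ne_zero_iff.1 (by rw [(he κ).1.1 x h]; exact one_ne_zero)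
  -- the left inverse `τ` of `σ_{μκ}` is also a right inverse
  have hinv : ∀ κ μ, ∃ τ : ∀ x, (G.L (r κ) (r μ)).Fib x, ∃ ξ,
      (G.L (r κ) (r μ)).IsUnitSection (W κ ∩ W μ) τ ξ ∧
      (∀ x ∈ W κ ∩ W μ, (G.θ (r κ) (r μ) (r κ)).mul x (τ x) (σ μ κ x) = e κ x) ∧
      ∀ x ∈ W κ ∩ W μ, (G.θ (r μ) (r κ) (r μ)).mul x (σ μ κ x) (τ x) = e μ x := by
    intro κ μ
    obtain ⟨τ, hτ, hmul⟩ := (G.θ (r κ) (r μ) (r κ)).exists_left ((hW κ).inter (hW μ))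
      (fun x hx => ⟨⟨hr κ hx.1, hr μ hx.2⟩, hr κ hx.1⟩) (fun x hx => ⟨hr κ hx.1, hr μ hx.2⟩)
      (fun x hx => ⟨hr κ hx.1, hr κ hx.1⟩) ((hσ μ κ).mono (by rw [inter_comm]))
      ((he κ).mono inter_subset_left)
    refine ⟨τ, _, hτ, hmul, fun x hx => ?_⟩
    have h1 := hr κ hx.1
    have h2 := hr μ hx.2
    have h3 := G.assoc (r μ) (r κ) (r μ) (r κ) x h2 h1 h2 h1 (σ μ κ x) (τ x) (σ μ κ x)
    rw [hmul x hx, Gerbe.mul_one h2 h1 (hene κ x hx.1) (hee κ x hx.1)] at h3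
    refine (G.θ (r μ) (r μ) (r κ)).mul_right_cancel ⟨⟨h2, h2⟩, h1⟩ (hne μ κ x hx.2 hx.1) ?_
    rw [h3, Gerbe.one_mul h2 h1 (hene μ x hx.2) (hee μ x hx.2)]
  choose τ ξτ hτ hτl hτr using hinv
  -- for a linear order of the indices, take `σ` above the diagonal, its inverse below and the
  -- idempotent on the diagonal
  let _ : LinearOrder K := linearOrderOfSTO WellOrderingRel
  have hall : ∀ κ μ, ∃ s : ∀ x, (G.L (r κ) (r μ)).Fib x, ∃ ξ,
      (G.L (r κ) (r μ)).IsUnitSection (W κ ∩ W μ) s ξ ∧ (κ < μ → s = σ κ μ) ∧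
      (μ < κ → s = τ κ μ) ∧ (∀ h : μ = κ, s = h ▸ e κ) := by
    intro κ μ
    rcases lt_trichotomy κ μ with h | rfl | h
    · exact ⟨_, _, hσ κ μ, fun _ => rfl, fun h' => absurd h' h.asymm, fun h' => absurd h' h.ne'⟩
    · exact ⟨_, _, (he κ).mono inter_subset_left, fun h => absurd h (lt_irrefl _),
        fun h => absurd h (lt_irrefl _), fun _ => rfl⟩
    · exact ⟨_, _, hτ κ μ, fun h' => absurd h' h.asymm, fun _ => rfl, fun h' => absurd h' h.ne⟩
  choose s ξ hs h1 h2 h3 using hall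
  have hself : ∀ κ, s κ κ = e κ := fun κ => h3 κ κ rfl
  refine ⟨⟨hr, s, ξ, hs, fun κ x hx => ?_, fun κ μ x hx => ?_⟩⟩
  · rw [hself]; exact hee κ x hx
  · rw [hself]
    rcases lt_trichotomy κ μ with h | rfl | h
    · rw [h1 κ μ h, h2 μ κ h]; exact hτr μ κ x hx.symm
    · rw [hself]; exact hee κ x hx.1
    · rw [h2 κ μ h, h1 μ κ h]; exact hτl κ μ x hx

end Trivialization

open LineBundle

/-! ### Gerbes with connection and degree two Deligne cohomology -/

section Restrict

variable {X : Type u} [DiffeologicalSpace X] {W V : Set X}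

/-- The restriction of a line bundle with connection to a smaller open set. -/
def LineBundle.restrict (L : LineBundle X W) (V : Set X) (hV : DOpen V) (hVW : V ⊆ W) :
    LineBundle X V where
  Fib := L.Fib
  rank_one x hx := L.rank_one x (hVW hx)
  ι := L.ι
  dom a := L.dom a ∩ V
  dom_open a := (L.dom_open a).inter hV
  dom_subset _ := inter_subset_right
  dom_cover x hx := by
    obtain ⟨a, ha⟩ := L.dom_cover x (hVW hx)
    exact ⟨a, ha, hx⟩
  frame := L.frame
  norm_frame a x hx := L.norm_frame a x hx.1
  smooth_trans a b := (L.smooth_trans a b).mono (inter_subset_inter inter_subset_left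
    inter_subset_left)
  conn := L.conn
  conn_form a := (L.conn_form a).mono inter_subset_left
  conn_trans a b := (L.conn_trans a b).mono (inter_subset_inter inter_subset_left
    inter_subset_left)

theorem LineBundle.isUnitSection_restrict {L : LineBundle X W} {hV : DOpen V} {hVW : V ⊆ W}
    {O : Set X} (hO : O ⊆ V) {s : ∀ x, L.Fib x} {ξ : PreForm X 1} :
    (L.restrict V hV hVW).IsUnitSection O s ξ ↔ L.IsUnitSection O s ξ := by
  have e : ∀ a, O ∩ (L.dom a ∩ V) = O ∩ L.dom a := fun a => by
    rw [inter_comm (L.dom a), ← inter_assoc, inter_eq_left.2 hO]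
  refine and_congr (and_congr Iff.rfl (forall_congr' fun a => ?_)) (forall_congr' fun a => ?_)
  · change SmoothOn (O ∩ (L.dom a ∩ V)) _ ↔ _
    rw [e a]; rfl
  · change FormEq (O ∩ (L.dom a ∩ V)) _ _ ↔ _
    rw [e a]; rfl

theorem LineBundle.isUnitSection_empty (L : LineBundle X W) :
    L.IsUnitSection ∅ (fun _ => 0) 0 := by
  refine ⟨⟨fun _ h => absurd h (notMem_empty _), fun a n p _ w hw => ?_⟩, fun a n p _ w hw => ?_⟩
  · simp at hw
  · simp at hw

theorem LineBundle.exists_local_section (L : LineBundle X W) {x : X} (hx : x ∈ W) :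
    ∃ O, DOpen O ∧ x ∈ O ∧ ∃ s ξ, L.IsUnitSection O s ξ := by
  obtain ⟨a, ha⟩ := L.dom_cover x hx
  exact ⟨L.dom a, L.dom_open a, ha, _, _, L.isUnitSection_frame a⟩

/-- The product of a tensor product isomorphism, with the target restricted. -/
def TensorIso.restrict {W₁ W₂ W₃ V' : Set X} {L₁ : LineBundle X W₁} {L₂ : LineBundle X W₂}
    {L₃ : LineBundle X W₃} (T : TensorIso L₁ L₂ L₃ V') (V : Set X) (hV : DOpen V) (hV' : V ⊆ V')
    (h₃ : V ⊆ W₃) : TensorIso L₁ L₂ (L₃.restrict V hV h₃) V where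
  mul := T.mul
  norm_mul x hx := T.norm_mul x (hV' hx)
  parallel O s₁ s₂ ξ₁ ξ₂ hO hOV hs₁ hs₂ :=
    (isUnitSection_restrict hOV).2 (T.parallel O s₁ s₂ ξ₁ ξ₂ hO (hOV.trans hV') hs₁ hs₂)

/-- An isomorphism `triv ⊗ triv ≅ triv` given by a `U(1)`-valued function. -/
def TensorIso.triv {W₁ W₂ W₃ V : Set X} {ξ₁ ξ₂ ξ₃ : PreForm X 1} {h₁ : DOpen W₁}
    {h₂ : DOpen W₂} {h₃ : DOpen W₃} {hξ₁ : IsForm W₁ ξ₁} {hξ₂ : IsForm W₂ ξ₂} {hξ₃ : IsForm W₃ ξ₃}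
    (hV₁ : V ⊆ W₁) (hV₂ : V ⊆ W₂) (hV₃ : V ⊆ W₃) (g : X → Circle)
    (hg : SmoothOn V fun x => (g x : ℂ))
    (h : FormEq V (ξ₃ + dlog fun x => (g x : ℂ)) (ξ₁ + ξ₂)) :
    TensorIso (LineBundle.triv W₁ h₁ ξ₁ hξ₁) (LineBundle.triv W₂ h₂ ξ₂ hξ₂)
      (LineBundle.triv W₃ h₃ ξ₃ hξ₃) V where
  mul x := (g x : ℂ) • LinearMap.mul ℂ ℂ
  norm_mul x hx a b := by
    have h : ∀ a b : ℂ, ‖(g x : ℂ) * (a * b)‖ = ‖a‖ * ‖b‖ := fun a b => by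
      rw [_root_.norm_mul, Circle.norm_coe, one_mul, _root_.norm_mul]
    exact h a b
  parallel O s₁ s₂ η₁ η₂ hO hOV hs₁ hs₂ := by
    obtain ⟨u₁, e₁⟩ := unitOn_of_triv (hOV.trans hV₁) hs₁
    obtain ⟨u₂, e₂⟩ := unitOn_of_triv (hOV.trans hV₂) hs₂
    have ug := (unitOn_circle hg).mono hOV
    refine (isUnitSection_triv hO (hOV.trans hV₃) (ug.mul (u₁.mul u₂))).congr_form ?_
    intro n p hp w hw
    have h1 := dlog_mul hO ug (u₁.mul u₂) n p hp w hw
    have h2 := dlog_mul hO u₁ u₂ n p hp w hw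
    have h3 := h n p hp w (hOV hw)
    have h4 := e₁ n p hp w hw
    have h5 := e₂ n p hp w hw
    simp only [Pi.add_apply] at *
    rw [h1, h2, h4, h5]
    linear_combination (norm := module) -h3

/-- The isomorphism `triv ⊗ L ≅ L` for the trivial connection. -/
def TensorIso.scalarLeft {W₁ W₂ V : Set X} (L : LineBundle X W₂) {hV : DOpen V} {hVW : V ⊆ W₂}
    {h₁ : DOpen W₁} (hV₁ : V ⊆ W₁) :
    TensorIso (LineBundle.triv W₁ h₁ 0 isForm_zero) L (L.restrict V hV hVW) V where
  mul x := (LinearMap.lsmul ℂ (L.Fib x) : ℂ →ₗ[ℂ] _)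
  norm_mul x hx a b := by
    have h : ∀ a : ℂ, ‖a • b‖ = ‖a‖ * ‖b‖ := fun a => norm_smul a b
    exact h a
  parallel O s₁ s₂ η₁ η₂ hO hOV hs₁ hs₂ := by
    obtain ⟨u₁, e₁⟩ := unitOn_of_triv (hOV.trans hV₁) hs₁
    refine ((isUnitSection_restrict hOV).2 (hs₂.smul hO u₁)).congr_form ?_
    intro n p hp w hw
    have h4 := e₁ n p hp w hw
    simp only [Pi.add_apply, Pi.zero_apply] at *
    rw [h4]
    module

/-- The isomorphism `triv ⊗ triv ≅ L` given by a unit section. -/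
def TensorIso.ofSection {W₁ W₂ W₃ V : Set X} (L : LineBundle X W₃) {hV : DOpen V} {hVW : V ⊆ W₃}
    {h₁ : DOpen W₁} {h₂ : DOpen W₂} (hV₁ : V ⊆ W₁) (hV₂ : V ⊆ W₂) {ξ : PreForm X 1}
    {hξ : IsForm W₁ ξ} {s : ∀ x, L.Fib x} (hs : L.IsUnitSection V s ξ) :
    TensorIso (LineBundle.triv W₁ h₁ ξ hξ) (LineBundle.triv W₂ h₂ 0 isForm_zero)
      (L.restrict V hV hVW) V where
  mul x := (LinearMap.mul ℂ ℂ).compr₂ (LinearMap.toSpanSingleton ℂ (L.Fib x) (s x))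
  norm_mul x hx a b := by
    have h : ∀ a b : ℂ, ‖(a * b) • s x‖ = ‖a‖ * ‖b‖ := fun a b => by
      rw [norm_smul, hs.1.1 x hx, mul_one, _root_.norm_mul]
    exact h a b
  parallel O s₁ s₂ η₁ η₂ hO hOV hs₁ hs₂ := by
    obtain ⟨u₁, e₁⟩ := unitOn_of_triv (hOV.trans hV₁) hs₁
    obtain ⟨u₂, e₂⟩ := unitOn_of_triv (hOV.trans hV₂) hs₂
    refine ((isUnitSection_restrict hOV).2 ((hs.mono hOV).smul hO (u₁.mul u₂))).congr_form ?_
    intro n p hp w hw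
    have h2 := dlog_mul hO u₁ u₂ n p hp w hw
    have h4 := e₁ n p hp w hw
    have h5 := e₂ n p hp w hw
    simp only [Pi.add_apply, Pi.zero_apply] at *
    rw [h2, h4, h5]
    module

end Restrict

section GerbeEquiv

variable {X : Type u} [DiffeologicalSpace X]

/-- The identity of a gerbe, formed on `U_α ∩ U_{α'}` with `N_{αα'} = L_{αα'}`. -/
def GerbeIso.refl (G : Gerbe X) : GerbeIso G G where
  K := G.I × G.I
  W κ := G.U κ.1 ∩ G.U κ.2
  W_open κ := (G.U_open _).inter (G.U_open _)
  W_cover x := by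
    obtain ⟨α, hα⟩ := G.U_cover x
    exact ⟨(α, α), hα, hα⟩
  r := Prod.fst
  r' := Prod.snd
  W_subset _ := subset_rfl
  N κ := G.L κ.1 κ.2
  M κ μ := (G.L κ.1 μ.2).restrict (G.U κ.1 ∩ G.U κ.2 ∩ (G.U μ.1 ∩ G.U μ.2))
    (((G.U_open _).inter (G.U_open _)).inter ((G.U_open _).inter (G.U_open _)))
    fun _ hx => ⟨hx.1.1, hx.2.2⟩
  left κ μ := (G.θ κ.1 κ.2 μ.2).restrict _ _ (fun _ hx => ⟨hx.1, hx.2.2⟩) _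
  right κ μ := (G.θ κ.1 μ.1 μ.2).restrict _ _ (fun _ hx => ⟨⟨hx.1.1, hx.2.1⟩, hx.2.2⟩) _
  compat κ μ ν x hκ hμ hν a b a' b' n₁ n₂ n₃ h h' := by
    change (G.θ κ.1 μ.1 μ.2).mul x a n₂ = (G.θ κ.1 κ.2 μ.2).mul x n₁ a' at h
    change (G.θ μ.1 ν.1 ν.2).mul x b n₃ = (G.θ μ.1 μ.2 ν.2).mul x n₂ b' at h'
    change (G.θ κ.1 ν.1 ν.2).mul x ((G.θ κ.1 μ.1 ν.1).mul x a b) n₃ =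
      (G.θ κ.1 κ.2 ν.2).mul x n₁ ((G.θ κ.2 μ.2 ν.2).mul x a' b')
    rw [G.assoc _ _ _ _ x hκ.1 hμ.1 hν.1 hν.2, h', ← G.assoc _ _ _ _ x hκ.1 hμ.1 hμ.2 hν.2, h,
      G.assoc _ _ _ _ x hκ.1 hκ.2 hμ.2 hν.2]
  F_eq κ O s ξ hO hOW hs n p hp w hw := by
    have := G.F_sub _ _ O s ξ hO hOW hs n p hp w hw
    simp only [Pi.add_apply, Pi.sub_apply, Pi.smul_apply] at *
    rw [← this]
    abel

/-- Unit sections of the line bundles `N_κ` of an isomorphism of gerbes identify the cocycles of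
the two gerbes up to a coboundary: `h` compares the sections `s_{jk} n_k` and `n_j s'_{jk}`. -/
theorem cohomologous_of_sections {G G' : Gerbe X} (Φ : GerbeIso G G') (c c' : Cocycle2 X)
    {J : Type u} (O : J → Set X) (hO : ∀ j, DOpen (O j)) (hcov : ∀ x, ∃ j, x ∈ O j)
    (κ : J → Φ.K) (i : J → c.I) (i' : J → c'.I)
    (hsub : ∀ j, O j ⊆ Φ.W (κ j)) (hsubc : ∀ j, O j ⊆ c.U (i j) ∩ c'.U (i' j))
    (s : ∀ j k x, (G.L (Φ.r (κ j)) (Φ.r (κ k))).Fib x)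
    (hs : ∀ j k, (G.L (Φ.r (κ j)) (Φ.r (κ k))).IsUnitSection (O j ∩ O k) (s j k)
      ((2 * Real.pi) • c.a (i j) (i k)))
    (hsθ : ∀ j k l, ∀ x ∈ O j ∩ O k ∩ O l, c.θ (i j) (i k) (i l) x •
      (G.θ (Φ.r (κ j)) (Φ.r (κ k)) (Φ.r (κ l))).mul x (s j k x) (s k l x) = s j l x)
    (hf : ∀ j, FormEq (O j) (c.f (i j)) (-G.F (Φ.r (κ j))))
    (s' : ∀ j k x, (G'.L (Φ.r' (κ j)) (Φ.r' (κ k))).Fib x)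
    (hs' : ∀ j k, (G'.L (Φ.r' (κ j)) (Φ.r' (κ k))).IsUnitSection (O j ∩ O k) (s' j k)
      ((2 * Real.pi) • c'.a (i' j) (i' k)))
    (hsθ' : ∀ j k l, ∀ x ∈ O j ∩ O k ∩ O l, c'.θ (i' j) (i' k) (i' l) x •
      (G'.θ (Φ.r' (κ j)) (Φ.r' (κ k)) (Φ.r' (κ l))).mul x (s' j k x) (s' k l x) = s' j l x)
    (hf' : ∀ j, FormEq (O j) (c'.f (i' j)) (-G'.F (Φ.r' (κ j))))
    (hn : ∀ j, ∃ n η, (Φ.N (κ j)).IsUnitSection (O j) n η) : Nonempty (Cohomologous2 c c') := by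
  choose n η hn using hn
  have hW : ∀ j k, O j ∩ O k ⊆ Φ.W (κ j) ∩ Φ.W (κ k) := fun j k =>
    inter_subset_inter (hsub j) (hsub k)
  have hR : ∀ j k, (Φ.M (κ j) (κ k)).IsUnitSection (O j ∩ O k)
      (fun x => (Φ.right (κ j) (κ k)).mul x (s j k x) (n k x)) _ := fun j k =>
    (Φ.right (κ j) (κ k)).parallel _ _ _ _ _ ((hO j).inter (hO k)) (hW j k) (hs j k)
      ((hn k).mono inter_subset_right)
  have hL : ∀ j k, (Φ.M (κ j) (κ k)).IsUnitSection (O j ∩ O k)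
      (fun x => (Φ.left (κ j) (κ k)).mul x (n j x) (s' j k x)) _ := fun j k =>
    (Φ.left (κ j) (κ k)).parallel _ _ _ _ _ ((hO j).inter (hO k)) (hW j k)
      ((hn j).mono inter_subset_left) (hs' j k)
  have hu := fun j k => (hL j k).1.ratio (hW j k) (hR j k).1
  -- the ratio of `n_j s'_{jk}` and `s_{jk} n_k` in the bundle `M_{jk}`
  set h : J → J → X → Circle := fun j k x =>
    circleOf (inner ℂ ((Φ.right (κ j) (κ k)).mul x (s j k x) (n k x))
      ((Φ.left (κ j) (κ k)).mul x (n j x) (s' j k x))) with hh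
  have hc : ∀ j k, ∀ x ∈ O j ∩ O k, (h j k x : ℂ) =
      inner ℂ ((Φ.right (κ j) (κ k)).mul x (s j k x) (n k x))
        ((Φ.left (κ j) (κ k)).mul x (n j x) (s' j k x)) :=
    fun j k x hx => coe_circleOf ((hu j k).norm x hx)
  have hmul : ∀ j k, ∀ x ∈ O j ∩ O k,
      h j k x • (Φ.right (κ j) (κ k)).mul x (s j k x) (n k x) =
        (Φ.left (κ j) (κ k)).mul x (n j x) (s' j k x) := fun j k x hx => by
    rw [Circle.smul_def, hc j k x hx]
    exact (IsUnitSection.eq_smul (hW j k) (hR j k).1 hx _).symm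
  have hθ : ∀ j k l, ∀ x ∈ O j ∩ O k ∩ O l,
      c.θ (i j) (i k) (i l) x * (c'.θ (i' j) (i' k) (i' l) x)⁻¹ =
        h k l x * (h j l x)⁻¹ * h j k x := by
    intro j k l x hx
    have hjk : x ∈ O j ∩ O k := hx.1
    have hkl : x ∈ O k ∩ O l := ⟨hx.1.2, hx.2⟩
    have hjl : x ∈ O j ∩ O l := ⟨hx.1.1, hx.2⟩
    -- compatibility of the isomorphism with the products, applied to `h_{jk} s_{jk}` and `h_{kl}
    -- s_{kl}`, compares `n_j s'_{jl}` and `s_{jl} n_l` in two ways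
    have h1 := Φ.compat (κ j) (κ k) (κ l) x (hsub j hx.1.1) (hsub k hx.1.2) (hsub l hx.2)
      (h j k x • s j k x) (h k l x • s k l x) (s' j k x) (s' k l x) (n j x) (n k x) (n l x)
      (by rw [TensorIso.smul_mul, hmul j k x hjk]) (by rw [TensorIso.smul_mul, hmul k l x hkl])
    have e1 : (G.θ (Φ.r (κ j)) (Φ.r (κ k)) (Φ.r (κ l))).mul x (s j k x) (s k l x) =
        (c.θ (i j) (i k) (i l) x)⁻¹ • s j l x := by rw [← hsθ j k l x hx, inv_smul_smul]
    have e2 : (G'.θ (Φ.r' (κ j)) (Φ.r' (κ k)) (Φ.r' (κ l))).mul x (s' j k x) (s' k l x) =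
        (c'.θ (i' j) (i' k) (i' l) x)⁻¹ • s' j l x := by rw [← hsθ' j k l x hx, inv_smul_smul]
    rw [TensorIso.smul_mul, TensorIso.mul_smul, e1, e2, TensorIso.mul_smul, ← hmul j l x hjl,
      smul_smul, smul_smul, smul_smul, TensorIso.smul_mul] at h1
    have hne : (Φ.right (κ j) (κ l)).mul x (s j l x) (n l x) ≠ 0 :=
      norm_ne_zero_iff.1 (by rw [(hR j l).1.1 x hjl]; exact one_ne_zero)
    have h2 := congrArg Additive.ofMul (circle_smul_right_injective hne h1)
    apply Additive.ofMul.injective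
    simp only [ofMul_mul, ofMul_inv] at h2 ⊢
    linear_combination (norm := module) -h2
  -- with `j = k = l` the cocycle relation yields the normalisation of `h`
  have hθjjj : ∀ j, ∀ x ∈ O j, h j j x = 1 := fun j x hx => by
    have h1 := hθ j j j x ⟨⟨hx, hx⟩, hx⟩
    rw [c.θ_self _ _ x ⟨(hsubc j hx).1, (hsubc j hx).1⟩,
      c'.θ_self _ _ x ⟨(hsubc j hx).2, (hsubc j hx).2⟩, mul_inv_cancel, mul_inv_cancel, one_mul]
      at h1
    exact h1.symm
  refine ⟨{ K := J
            W := O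
            W_open := hO
            W_cover := hcov
            r := i
            r' := i'
            W_subset := hsubc
            h := h
            h_smooth := fun j k => (hu j k).smooth.congr (hc j k)
            h_self := hθjjj
            h_swap := fun j k x hx => ?_
            β := fun j => -((1 / (2 * Real.pi)) • η j)
            β_form := fun j =>
              (((hn j).isForm (hO j) (hsub j)).smul _).neg
            θ_eq := hθ
            a_eq := fun j k m p hp w hw => ?_
            f_eq := fun j m p hp w hw => ?_ }⟩
  · have h1 := hθ j k j x ⟨hx, hx.1⟩
    have hj := hsubc j hx.1
    have hk := hsubc k hx.2
    rw [c.θ_swap₂ _ _ _ x ⟨⟨hj.1, hj.1⟩, hk.1⟩, c'.θ_swap₂ _ _ _ x ⟨⟨hj.2, hj.2⟩, hk.2⟩,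
      c.θ_self _ _ x ⟨hj.1, hk.1⟩, c'.θ_self _ _ x ⟨hj.2, hk.2⟩, hθjjj j x hx.1] at h1
    simp only [inv_one, mul_one] at h1
    exact eq_inv_of_mul_eq_one_left h1.symm
  · have h1 := (hL j k).compare ((hO j).inter (hO k)) (hW j k) (hR j k) m p hp w hw
    have h2 := dlog_congr ((hO j).inter (hO k)) (hc j k) m p hp w hw
    apply two_pi_smul_injective
    simp only [Pi.add_apply, Pi.sub_apply, Pi.neg_apply, Pi.smul_apply, smul_add, smul_sub,
      smul_neg, smul_smul, mul_one_div_cancel two_pi_ne_zero, one_smul] at *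
    rw [h2]
    linear_combination (norm := module) -h1
  · have h1 := Φ.F_eq (κ j) (O j) (n j) (η j) (hO j) (hsub j) (hn j) m p hp w hw
    have h2 := hf j m p hp w hw
    have h3 := hf' j m p hp w hw
    rw [d_neg, d_smul]
    simp only [Pi.add_apply, Pi.sub_apply, Pi.neg_apply, Pi.smul_apply] at *
    rw [h2, h3, h1]
    module

/-- Two cocycles of the same gerbe are cohomologous. -/
theorem Gerbe.HasCocycle.cohomologous {G : Gerbe X} {c c' : Cocycle2 X} (h : G.HasCocycle c)
    (h' : G.HasCocycle c') : Nonempty (Cohomologous2 c c') := by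
  obtain ⟨r, hr, s, hs, hsθ, hf⟩ := h
  obtain ⟨r', hr', s', hs', hsθ', hf'⟩ := h'
  -- both coverings are refined further, such that the bundles `L_{r(i)r'(i')}` of the identity
  -- isomorphism have frames
  refine cohomologous_of_sections (GerbeIso.refl G) c c'
    (J := Σ q : c.I × c'.I, (G.L (r q.1) (r' q.2)).ι)
    (fun j => c.U j.1.1 ∩ c'.U j.1.2 ∩ (G.L (r j.1.1) (r' j.1.2)).dom j.2)
    (fun j => ((c.U_open _).inter (c'.U_open _)).inter (LineBundle.dom_open _ _))
    (fun x => ?_) (fun j => (r j.1.1, r' j.1.2)) (fun j => j.1.1) (fun j => j.1.2)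
    (fun j => inter_subset_left.trans (inter_subset_inter (hr _) (hr' _)))
    (fun j => inter_subset_left)
    (fun j k => s j.1.1 k.1.1)
    (fun j k => (hs _ _).mono (inter_subset_inter (fun _ h => h.1.1) (fun _ h => h.1.1)))
    (fun j k l x hx => hsθ _ _ _ x ⟨⟨hx.1.1.1.1, hx.1.2.1.1⟩, hx.2.1.1⟩)
    (fun j => (hf _).mono fun _ h => h.1.1)
    (fun j k => s' j.1.2 k.1.2)
    (fun j k => (hs' _ _).mono (inter_subset_inter (fun _ h => h.1.2) (fun _ h => h.1.2)))
    (fun j k l x hx => hsθ' _ _ _ x ⟨⟨hx.1.1.1.2, hx.1.2.1.2⟩, hx.2.1.2⟩)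
    (fun j => (hf' _).mono fun _ h => h.1.2)
    fun j => ⟨_, _, ((G.L (r j.1.1) (r' j.1.2)).isUnitSection_frame j.2).mono inter_subset_right⟩
  obtain ⟨i, hi⟩ := c.U_cover x
  obtain ⟨i', hi'⟩ := c'.U_cover x
  obtain ⟨b, hb⟩ := (G.L (r i) (r' i')).dom_cover x ⟨hr _ hi, hr' _ hi'⟩
  exact ⟨⟨(i, i'), b⟩, ⟨hi, hi'⟩, hb⟩

/-! The gerbe of a cocycle. -/

theorem Cocycle2.θ_assoc (c : Cocycle2 X) {i j k l : c.I} {x : X} (hi : x ∈ c.U i) (hj : x ∈ c.U j)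
    (hk : x ∈ c.U k) (hl : x ∈ c.U l) :
    (c.θ i k l x)⁻¹ * (c.θ i j k x)⁻¹ = (c.θ i j l x)⁻¹ * (c.θ j k l x)⁻¹ := by
  have h := congrArg Additive.ofMul (c.cocycle_θ i j k l x hi hj hk hl)
  apply Additive.ofMul.injective
  simp only [ofMul_mul, ofMul_inv, ofMul_one] at h ⊢
  linear_combination (norm := module) h

/-- The gerbe with trivial bundles `L_{ij}` given by a cocycle. -/
def gerbeOf (c : Cocycle2 X) : Gerbe X where
  I := c.I
  U := c.U
  U_open := c.U_open
  U_cover := c.U_cover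
  L i j := triv (c.U i ∩ c.U j) ((c.U_open i).inter (c.U_open j)) ((2 * Real.pi) • c.a i j)
    ((c.a_form i j).smul _)
  θ i j k := TensorIso.triv
    (fun _ hx => hx.1) (fun _ hx => ⟨hx.1.2, hx.2⟩) (fun _ hx => ⟨hx.1.1, hx.2⟩)
    (fun x => (c.θ i j k x)⁻¹) (by
      simp only [Circle.coe_inv_eq_conj]
      exact (c.θ_smooth i j k).conj) (by
      intro n p hp w hw
      have hO := ((c.U_open i).inter (c.U_open j)).inter (c.U_open k)
      have h1 := dlog_conj hO (unitOn_circle (c.θ_smooth i j k)) n p hp w hw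
      have h2 := congrArg (fun z => (2 * Real.pi) • z) (c.cocycle_a i j k n p hp w hw)
      simp only [Circle.coe_inv_eq_conj, Pi.add_apply, Pi.sub_apply, Pi.neg_apply, Pi.smul_apply,
        Pi.zero_apply, smul_add, smul_sub, smul_zero, smul_smul,
        mul_one_div_cancel two_pi_ne_zero, one_smul] at *
      rw [h1]
      linear_combination (norm := module) -h2)
  assoc i j k l x hi hj hk hl := by
    have h := congrArg (fun z : Circle => (z : ℂ)) (c.θ_assoc hi hj hk hl)
    -- stated over `ℂ`, to which the fibres of the trivial bundles are definitionally equal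
    have key : ∀ a b e : ℂ, ((c.θ i k l x)⁻¹ : Circle) * ((((c.θ i j k x)⁻¹ : Circle) * (a * b)) * e) =
        ((c.θ i j l x)⁻¹ : Circle) * (a * (((c.θ j k l x)⁻¹ : Circle) * (b * e))) := by
      intro a b e
      simp only [Circle.coe_mul] at h
      linear_combination a * b * e * h
    exact key
  F i := -c.f i
  F_form i := (c.f_form i).neg
  F_sub i j O s ξ hO hOU hs n p hp w hw := by
    obtain ⟨hu, hξ⟩ := unitOn_of_triv hOU hs
    have h1 := (hξ.d hO n p hp w hw).trans (d_add hO (((c.a_form i j).smul _).mono hOU)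
      (hu.isForm_dlog hO) n p hp w hw)
    have h2 := d_dlog hO hu n p hp w hw
    have h3 := c.cocycle_f i j n p hp w (hOU hw)
    rw [d_smul] at h1
    simp only [Pi.add_apply, Pi.sub_apply, Pi.neg_apply, Pi.smul_apply, Pi.zero_apply] at *
    rw [h1, h2, add_zero, smul_smul, neg_mul, one_div_mul_cancel two_pi_ne_zero]
    linear_combination (norm := module) -h3

theorem hasCocycle_gerbeOf (c : Cocycle2 X) : (gerbeOf c).HasCocycle c := by
  refine ⟨id, fun _ => subset_rfl, fun _ _ _ => (1 : ℂ), fun i j => isUnitSection_triv_one,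
    fun i j k x _ => ?_, fun i n p hp w hw => ?_⟩
  · have key : ∀ z : Circle, (z : ℂ) * (((z⁻¹ : Circle) : ℂ) * (1 * 1)) = 1 := fun z => by
      rw [mul_one, mul_one, ← Circle.coe_mul, mul_inv_cancel, Circle.coe_one]
    exact key _
  · simp [gerbeOf]

/-- A coboundary `(h, β)` gives an isomorphism with trivial bundles `N_κ` with connection form
`-2π β_κ`. -/
def Cohomologous2.gerbeIso {c c' : Cocycle2 X} (b : Cohomologous2 c c') :
    GerbeIso (gerbeOf c) (gerbeOf c') where
  K := b.K
  W := b.W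
  W_open := b.W_open
  W_cover := b.W_cover
  r := b.r
  r' := b.r'
  W_subset := b.W_subset
  N κ := triv (b.W κ) (b.W_open κ) ((-(2 * Real.pi)) • b.β κ) ((b.β_form κ).smul _)
  M κ μ := triv (b.W κ ∩ b.W μ) ((b.W_open κ).inter (b.W_open μ))
    ((-(2 * Real.pi)) • b.β κ + (2 * Real.pi) • c'.a (b.r' κ) (b.r' μ))
    ((((b.β_form κ).smul _).mono inter_subset_left).add
      (((c'.a_form _ _).smul _).mono fun _ hx => ⟨(b.W_subset κ hx.1).2, (b.W_subset μ hx.2).2⟩))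
  left κ μ := TensorIso.triv inter_subset_left
    (fun _ hx => ⟨(b.W_subset κ hx.1).2, (b.W_subset μ hx.2).2⟩) subset_rfl (fun _ => 1)
    (SmoothOn.const _) (by
      intro n p hp w hw
      have h0 : dlog (fun _ : X => ((1 : Circle) : ℂ)) = 0 := dlog_const _
      rw [h0, add_zero])
  right κ μ := TensorIso.triv
    (fun _ hx => ⟨(b.W_subset κ hx.1).1, (b.W_subset μ hx.2).1⟩) inter_subset_right subset_rfl
    (fun x => (b.h κ μ x)⁻¹) (by
      simp only [Circle.coe_inv_eq_conj]
      exact (b.h_smooth κ μ).conj) (by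
      intro n p hp w hw
      have h1 := dlog_conj ((b.W_open κ).inter (b.W_open μ)) (unitOn_circle (b.h_smooth κ μ))
        n p hp w hw
      have h2 := congrArg (fun z => (2 * Real.pi) • z) (b.a_eq κ μ n p hp w hw)
      simp only [Circle.coe_inv_eq_conj, Pi.add_apply, Pi.sub_apply, Pi.neg_apply, Pi.smul_apply,
        smul_add, smul_sub, smul_neg, smul_smul, mul_one_div_cancel two_pi_ne_zero, one_smul] at *
      rw [h1]
      linear_combination (norm := module) -h2)
  compat κ μ ν x hκ hμ hν := by
    have h := congrArg (fun z : Circle => (z : ℂ)) (b.θ_eq κ μ ν x ⟨⟨hκ, hμ⟩, hν⟩)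
    set t := c.θ (b.r κ) (b.r μ) (b.r ν) x with ht
    set t' := c'.θ (b.r' κ) (b.r' μ) (b.r' ν) x with ht'
    have h' : ((b.h κ ν x)⁻¹ * t⁻¹ : Circle) =
        (b.h κ μ x)⁻¹ * (b.h μ ν x)⁻¹ * t'⁻¹ := by
      have h := congrArg Additive.ofMul (b.θ_eq κ μ ν x ⟨⟨hκ, hμ⟩, hν⟩)
      apply Additive.ofMul.injective
      simp only [ofMul_mul, ofMul_inv] at h ⊢
      linear_combination (norm := module) -h
    have h'' := congrArg (fun z : Circle => (z : ℂ)) h'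
    simp only [Circle.coe_mul] at h''
    have key : ∀ a e a' e' n₁ n₂ n₃ : ℂ,
        ((b.h κ μ x)⁻¹ : Circle) * (a * n₂) = ((1 : Circle) : ℂ) * (n₁ * a') →
        ((b.h μ ν x)⁻¹ : Circle) * (e * n₃) = ((1 : Circle) : ℂ) * (n₂ * e') →
        ((b.h κ ν x)⁻¹ : Circle) * (((t⁻¹ : Circle) * (a * e)) * n₃) =
          ((1 : Circle) : ℂ) * (n₁ * ((t'⁻¹ : Circle) * (a' * e'))) := by
      intro a e a' e' n₁ n₂ n₃ h1 h2
      rw [Circle.coe_one, _root_.one_mul] at *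
      linear_combination a * e * n₃ * h'' + (t'⁻¹ : Circle) * e' * h1 +
        (t'⁻¹ : Circle) * ((b.h κ μ x)⁻¹ : Circle) * a * h2
    exact key
  F_eq κ O s ξ hO hOW hs n p hp w hw := by
    obtain ⟨hu, hξ⟩ := unitOn_of_triv hOW hs
    have h1 := (hξ.d hO n p hp w hw).trans (d_add hO (((b.β_form κ).smul _).mono hOW)
      (hu.isForm_dlog hO) n p hp w hw)
    have h2 := d_dlog hO hu n p hp w hw
    have h3 := b.f_eq κ n p hp w (hOW hw)
    rw [d_smul] at h1
    simp only [gerbeOf, Pi.add_apply, Pi.sub_apply, Pi.neg_apply, Pi.smul_apply,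
      Pi.zero_apply] at *
    rw [h1, h2, add_zero, smul_smul, neg_mul_neg, one_div_mul_cancel two_pi_ne_zero]
    linear_combination (norm := module) h3

/-- A gerbe is isomorphic to the one given by its cocycle. -/
theorem Gerbe.HasCocycle.gerbeIso {G : Gerbe X} {c : Cocycle2 X} (h : G.HasCocycle c) :
    Nonempty (GerbeIso (gerbeOf c) G) := by
  obtain ⟨r, hr, s, hs, hsθ, hf⟩ := h
  refine ⟨{ K := c.I
            W := c.U
            W_open := c.U_open
            W_cover := c.U_cover
            r := id
            r' := r
            W_subset := fun κ x hx => ⟨hx, hr κ hx⟩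
            N := fun κ => triv (c.U κ) (c.U_open κ) 0 isForm_zero
            M := fun κ μ => (G.L (r κ) (r μ)).restrict (c.U κ ∩ c.U μ)
              ((c.U_open κ).inter (c.U_open μ)) (inter_subset_inter (hr κ) (hr μ))
            left := fun κ μ => TensorIso.scalarLeft _ inter_subset_left
            right := fun κ μ => TensorIso.ofSection _ subset_rfl inter_subset_right (hs κ μ)
            compat := fun κ μ ν x hκ hμ hν => ?_
            F_eq := fun κ O σ ξ hO hOW hσ n p hp w hw => ?_ }⟩
  · have h1 := hsθ κ μ ν x ⟨⟨hκ, hμ⟩, hν⟩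
    have h2 := G.assoc (r κ) (r κ) (r μ) (r ν)
    have key : ∀ (a b : ℂ) (a' : (G.L (r κ) (r μ)).Fib x) (b' : (G.L (r μ) (r ν)).Fib x)
        (n₁ n₂ n₃ : ℂ), (a * n₂) • s κ μ x = n₁ • a' → (b * n₃) • s μ ν x = n₂ • b' →
        ((((c.θ κ μ ν x)⁻¹ : Circle) * (a * b)) * n₃) • s κ ν x =
          n₁ • (G.θ (r κ) (r μ) (r ν)).mul x a' b' := by
      intro a b a' b' n₁ n₂ n₃ e1 e2
      have e3 : n₁ • (G.θ (r κ) (r μ) (r ν)).mul x a' b' =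
          (G.θ (r κ) (r μ) (r ν)).mul x (n₁ • a') b' := by rw [map_smul, LinearMap.smul_apply]
      have e4 : (G.θ (r κ) (r μ) (r ν)).mul x ((a * n₂) • s κ μ x) b' =
          a • (G.θ (r κ) (r μ) (r ν)).mul x (s κ μ x) (n₂ • b') := by
        rw [map_smul, LinearMap.smul_apply, map_smul, smul_smul]
      have e5 : (G.θ (r κ) (r μ) (r ν)).mul x (s κ μ x) (s μ ν x) =
          (((c.θ κ μ ν x)⁻¹ : Circle) : ℂ) • s κ ν x := by
        rw [← h1, ← Circle.smul_def, inv_smul_smul]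
      rw [e3, ← e1, e4, ← e2, map_smul, e5, smul_smul, smul_smul]
      congr 1
      ring
    exact key
  · obtain ⟨hu, hξ⟩ := unitOn_of_triv hOW hσ
    have h1 := hξ.d hO n p hp w hw
    have h2 := d_dlog hO hu n p hp w hw
    have h3 := hf κ n p hp w (hOW hw)
    rw [zero_add] at h1
    simp only [gerbeOf, id, Pi.add_apply, Pi.neg_apply, Pi.smul_apply, Pi.zero_apply] at *
    rw [h1, h2, smul_zero, add_zero, h3, neg_neg]

/-- Every cocycle is cohomologous to itself. -/
theorem Cohomologous2.nonempty_refl (c : Cocycle2 X) : Nonempty (Cohomologous2 c c) :=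
  (hasCocycle_gerbeOf c).cohomologous (hasCocycle_gerbeOf c)

/-! Addition of cocycles. -/

/-- The sum of two cocycles, on the common refinement of their coverings. -/
def Cocycle2.add (c c' : Cocycle2 X) : Cocycle2 X where
  I := c.I × c'.I
  U κ := c.U κ.1 ∩ c'.U κ.2
  U_open κ := (c.U_open _).inter (c'.U_open _)
  U_cover x := by
    obtain ⟨i, hi⟩ := c.U_cover x
    obtain ⟨j, hj⟩ := c'.U_cover x
    exact ⟨(i, j), hi, hj⟩
  θ κ μ ν x := c.θ κ.1 μ.1 ν.1 x * c'.θ κ.2 μ.2 ν.2 x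
  θ_smooth κ μ ν := by
    simp only [Circle.coe_mul]
    exact ((c.θ_smooth _ _ _).mono fun x hx => ⟨⟨hx.1.1.1, hx.1.2.1⟩, hx.2.1⟩).mul
      ((c'.θ_smooth _ _ _).mono fun x hx => ⟨⟨hx.1.1.2, hx.1.2.2⟩, hx.2.2⟩)
  a κ μ := c.a κ.1 μ.1 + c'.a κ.2 μ.2
  a_form κ μ := ((c.a_form _ _).mono fun x hx => ⟨hx.1.1, hx.2.1⟩).add
    ((c'.a_form _ _).mono fun x hx => ⟨hx.1.2, hx.2.2⟩)
  f κ := c.f κ.1 + c'.f κ.2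
  f_form κ := ((c.f_form _).mono inter_subset_left).add ((c'.f_form _).mono inter_subset_right)
  θ_self κ μ x hx := by
    rw [c.θ_self _ _ x ⟨hx.1.1, hx.2.1⟩, c'.θ_self _ _ x ⟨hx.1.2, hx.2.2⟩, one_mul]
  θ_swap₁ κ μ ν x hx := by
    rw [c.θ_swap₁ _ _ _ x ⟨⟨hx.1.1.1, hx.1.2.1⟩, hx.2.1⟩,
      c'.θ_swap₁ _ _ _ x ⟨⟨hx.1.1.2, hx.1.2.2⟩, hx.2.2⟩, mul_inv]
  θ_swap₂ κ μ ν x hx := by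
    rw [c.θ_swap₂ _ _ _ x ⟨⟨hx.1.1.1, hx.1.2.1⟩, hx.2.1⟩,
      c'.θ_swap₂ _ _ _ x ⟨⟨hx.1.1.2, hx.1.2.2⟩, hx.2.2⟩, mul_inv]
  a_self κ n p hp w hw := by
    have h1 := c.a_self κ.1 n p hp w hw.1
    have h2 := c'.a_self κ.2 n p hp w hw.2
    simp only [Pi.add_apply, Pi.zero_apply] at *
    rw [h1, h2, add_zero]
  a_swap κ μ n p hp w hw := by
    have h1 := c.a_swap κ.1 μ.1 n p hp w ⟨hw.1.1, hw.2.1⟩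
    have h2 := c'.a_swap κ.2 μ.2 n p hp w ⟨hw.1.2, hw.2.2⟩
    simp only [Pi.add_apply, Pi.neg_apply] at *
    rw [h1, h2, neg_add]
  cocycle_θ i j k l x hi hj hk hl := by
    have h1 := c.cocycle_θ i.1 j.1 k.1 l.1 x hi.1 hj.1 hk.1 hl.1
    have h2 := c'.cocycle_θ i.2 j.2 k.2 l.2 x hi.2 hj.2 hk.2 hl.2
    have h := congrArg Additive.ofMul (congrArg₂ (· * ·) h1 h2)
    apply Additive.ofMul.injective
    simp only [ofMul_mul, ofMul_inv, ofMul_one, add_zero] at h ⊢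
    linear_combination (norm := module) h
  cocycle_a i j k n p hp w hw := by
    have hO := (((c.U_open i.1).inter (c'.U_open i.2)).inter
      ((c.U_open j.1).inter (c'.U_open j.2))).inter ((c.U_open k.1).inter (c'.U_open k.2))
    have h1 := c.cocycle_a i.1 j.1 k.1 n p hp w ⟨⟨hw.1.1.1, hw.1.2.1⟩, hw.2.1⟩
    have h2 := c'.cocycle_a i.2 j.2 k.2 n p hp w ⟨⟨hw.1.1.2, hw.1.2.2⟩, hw.2.2⟩
    have h3 := dlog_mul hO ((unitOn_circle (c.θ_smooth i.1 j.1 k.1)).mono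
      fun x hx => ⟨⟨hx.1.1.1, hx.1.2.1⟩, hx.2.1⟩) ((unitOn_circle (c'.θ_smooth i.2 j.2 k.2)).mono
      fun x hx => ⟨⟨hx.1.1.2, hx.1.2.2⟩, hx.2.2⟩) n p hp w hw
    simp only [Circle.coe_mul, Pi.add_apply, Pi.sub_apply, Pi.smul_apply, Pi.zero_apply] at *
    rw [h3]
    linear_combination (norm := module) h1 + h2
  cocycle_f i j n p hp w hw := by
    have hO := ((c.U_open i.1).inter (c'.U_open i.2)).inter
      ((c.U_open j.1).inter (c'.U_open j.2))
    have h1 := c.cocycle_f i.1 j.1 n p hp w ⟨hw.1.1, hw.2.1⟩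
    have h2 := c'.cocycle_f i.2 j.2 n p hp w ⟨hw.1.2, hw.2.2⟩
    have h3 := d_add hO ((c.a_form i.1 j.1).mono fun x hx => ⟨hx.1.1, hx.2.1⟩)
      ((c'.a_form i.2 j.2).mono fun x hx => ⟨hx.1.2, hx.2.2⟩) n p hp w hw
    simp only [Pi.add_apply, Pi.sub_apply, Pi.neg_apply, Pi.zero_apply] at *
    rw [h3]
    linear_combination (norm := module) h1 + h2

/-- Addition in `H²(X, 𝒦²)`. -/
def H2.add : H2 X → H2 X → H2 X := by
  refine Quot.map₂ Cocycle2.add ?_ ?_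
  · rintro c e e' ⟨b⟩
    refine ⟨{ K := c.I × b.K
              W := fun κ => c.U κ.1 ∩ b.W κ.2
              W_open := fun κ => (c.U_open _).inter (b.W_open _)
              W_cover := fun x => by
                obtain ⟨i, hi⟩ := c.U_cover x
                obtain ⟨j, hj⟩ := b.W_cover x
                exact ⟨(i, j), hi, hj⟩
              r := fun κ => (κ.1, b.r κ.2)
              r' := fun κ => (κ.1, b.r' κ.2)
              W_subset := fun κ x hx => ⟨⟨hx.1, (b.W_subset _ hx.2).1⟩, hx.1, (b.W_subset _ hx.2).2⟩
              h := fun κ μ => b.h κ.2 μ.2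
              h_smooth := fun κ μ => (b.h_smooth _ _).mono
                (inter_subset_inter inter_subset_right inter_subset_right)
              h_self := fun κ x hx => b.h_self _ x hx.2
              h_swap := fun κ μ x hx => b.h_swap _ _ x ⟨hx.1.2, hx.2.2⟩
              β := fun κ => b.β κ.2
              β_form := fun κ => (b.β_form _).mono inter_subset_right
              θ_eq := fun κ μ ν x hx => by
                simp only [Cocycle2.add]
                rw [mul_inv, mul_mul_mul_comm, mul_inv_cancel, one_mul,
                  b.θ_eq _ _ _ x ⟨⟨hx.1.1.2, hx.1.2.2⟩, hx.2.2⟩]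
              a_eq := fun κ μ n p hp w hw => by
                have := b.a_eq κ.2 μ.2 n p hp w ⟨hw.1.2, hw.2.2⟩
                simp only [Cocycle2.add, Pi.add_apply, Pi.sub_apply] at *
                rw [add_sub_add_left_eq_sub, this]
              f_eq := fun κ n p hp w hw => by
                have := b.f_eq κ.2 n p hp w hw.2
                simp only [Cocycle2.add, Pi.add_apply, Pi.sub_apply] at *
                rw [add_sub_add_left_eq_sub, this] }⟩
  · rintro e e' c ⟨b⟩
    refine ⟨{ K := b.K × c.I
              W := fun κ => b.W κ.1 ∩ c.U κ.2
              W_open := fun κ => (b.W_open _).inter (c.U_open _)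
              W_cover := fun x => by
                obtain ⟨i, hi⟩ := c.U_cover x
                obtain ⟨j, hj⟩ := b.W_cover x
                exact ⟨(j, i), hj, hi⟩
              r := fun κ => (b.r κ.1, κ.2)
              r' := fun κ => (b.r' κ.1, κ.2)
              W_subset := fun κ x hx => ⟨⟨(b.W_subset _ hx.1).1, hx.2⟩, (b.W_subset _ hx.1).2, hx.2⟩
              h := fun κ μ => b.h κ.1 μ.1
              h_smooth := fun κ μ => (b.h_smooth _ _).mono
                (inter_subset_inter inter_subset_left inter_subset_left)
              h_self := fun κ x hx => b.h_self _ x hx.1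
              h_swap := fun κ μ x hx => b.h_swap _ _ x ⟨hx.1.1, hx.2.1⟩
              β := fun κ => b.β κ.1
              β_form := fun κ => (b.β_form _).mono inter_subset_left
              θ_eq := fun κ μ ν x hx => by
                simp only [Cocycle2.add]
                rw [mul_inv, mul_mul_mul_comm, mul_inv_cancel, mul_one,
                  b.θ_eq _ _ _ x ⟨⟨hx.1.1.1, hx.1.2.1⟩, hx.2.1⟩]
              a_eq := fun κ μ n p hp w hw => by
                have := b.a_eq κ.1 μ.1 n p hp w ⟨hw.1.1, hw.2.1⟩
                simp only [Cocycle2.add, Pi.add_apply, Pi.sub_apply] at *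
                rw [add_sub_add_right_eq_sub, this]
              f_eq := fun κ n p hp w hw => by
                have := b.f_eq κ.1 n p hp w hw.1
                simp only [Cocycle2.add, Pi.add_apply, Pi.sub_apply] at *
                rw [add_sub_add_right_eq_sub, this] }⟩

/-- A sum of cocycles formed on any common refinement of their coverings represents the sum of the
classes. -/
theorem IsSum2.mk_eq {c c' c'' : Cocycle2 X} (h : IsSum2 c c' c'') :
    H2.mk c'' = (H2.mk c).add (H2.mk c') := by
  obtain ⟨r, r', hU, hθ, ha, hf⟩ := h
  refine Quot.sound ⟨{ K := c''.I
                       W := c''.U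
                       W_open := c''.U_open
                       W_cover := c''.U_cover
                       r := id
                       r' := fun κ => (r κ, r' κ)
                       W_subset := fun κ x hx => ⟨hx, hU κ hx⟩
                       h := fun _ _ _ => 1
                       h_smooth := fun _ _ => SmoothOn.const _
                       h_self := fun _ _ _ => rfl
                       h_swap := fun _ _ _ _ => inv_one.symm
                       β := fun _ => 0
                       β_form := fun _ => isForm_zero
                       θ_eq := fun κ μ ν x hx => by
                        simp [Cocycle2.add, hθ κ μ ν x hx]
                       a_eq := fun κ μ n p hp w hw => by
                        have h0 : dlog (fun _ : X => ((1 : Circle) : ℂ)) = 0 := dlog_const _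
                        have := ha κ μ n p hp w hw
                        simp only [Cocycle2.add, id, h0, Pi.add_apply, Pi.sub_apply, Pi.neg_apply,
                          Pi.zero_apply, smul_zero] at *
                        rw [this]
                        simp
                       f_eq := fun κ n p hp w hw => by
                        have h0 : d (0 : PreForm X 1) = 0 := by
                          rw [← zero_smul ℝ (0 : PreForm X 1), d_smul, zero_smul]
                        have := hf κ n p hp w hw
                        simp only [Cocycle2.add, id, h0, Pi.add_apply, Pi.sub_apply,
                          Pi.zero_apply] at *
                        rw [this, sub_self] }⟩

end GerbeEquiv

section Manifold

variable {E : Type v} [NormedAddCommGroup E] [NormedSpace ℝ E] [FiniteDimensional ℝ E]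
  {B : Type u} [TopologicalSpace B] [T2Space B] [ParacompactSpace B] [ChartedSpace E B]
  [IsManifold 𝓘(ℝ, E) ∞ B]

/-- A property of open sets which is local and passes to smaller sets can be arranged on all double
intersections of a refinement. -/
theorem exists_fine_covering {K : Type u} (W : K → Set (Mfd E B)) (hW : ∀ κ, DOpen (W κ))
    (hcov : ∀ x, ∃ κ, x ∈ W κ) (S : K → K → Set (Mfd E B) → Prop)
    (hmono : ∀ κ μ O O', S κ μ O → O' ⊆ O → S κ μ O') (hempty : ∀ κ μ, S κ μ ∅)
    (hloc : ∀ κ μ, ∀ x ∈ W κ ∩ W μ, ∃ O, DOpen O ∧ x ∈ O ∧ S κ μ O) :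
    ∃ (J : Type u) (W' : J → Set (Mfd E B)) (ρ : J → K), (∀ j, DOpen (W' j)) ∧
      (∀ x, ∃ j, x ∈ W' j) ∧ (∀ j, W' j ⊆ W (ρ j)) ∧ ∀ j k, S (ρ j) (ρ k) (W' j ∩ W' k) := by
  obtain ⟨W', ρ, h1, h2⟩ := exists_small_refinement (B := B) W (fun κ => isOpen_of_dOpen (hW κ))
    hcov S hmono hempty fun κ μ x hx => by
      obtain ⟨O, hO, hxO, hS⟩ := hloc κ μ x hx
      exact ⟨O, isOpen_of_dOpen hO, hxO, hS⟩
  exact ⟨B, W', ρ, fun j => dOpen_of_isOpen (h1 j).1, fun x => ⟨x, (h1 x).2.1⟩,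
    fun j => (h1 j).2.2, h2⟩

theorem exists_section_mono {X : Type u} [DiffeologicalSpace X] {W O O' : Set X}
    {L : LineBundle X W} (h : ∃ s ξ, L.IsUnitSection O s ξ) (hO : O' ⊆ O) :
    ∃ s ξ, L.IsUnitSection O' s ξ := by
  obtain ⟨s, ξ, hs⟩ := h
  exact ⟨s, ξ, hs.mono hO⟩

/-- On a manifold there is a refinement on whose double intersections the `L_{αβ}` have unit
sections. -/
theorem Gerbe.exists_hasCocycle (G : Gerbe (Mfd E B)) : ∃ c, G.HasCocycle c := by
  obtain ⟨J, W, ρ, hW, hcov, hsub, hS⟩ := exists_fine_covering G.U G.U_open G.U_cover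
    (fun κ μ O => ∃ s ξ, (G.L κ μ).IsUnitSection O s ξ)
    (fun κ μ O O' h hO => exists_section_mono h hO)
    (fun κ μ => ⟨_, _, LineBundle.isUnitSection_empty _⟩)
    (fun κ μ x hx => (G.L κ μ).exists_local_section hx)
  obtain ⟨t⟩ := G.exists_triv W ρ hW hsub hS
  exact ⟨_, t.hasCocycle hW hcov⟩

theorem Gerbe.Triv.unit' {X : Type u} [DiffeologicalSpace X] {G : Gerbe X} {K : Type u}
    {W : K → Set X} {r : K → G.I} (t : G.Triv W r) (hW : ∀ κ, DOpen (W κ))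
    (hcov : ∀ x, ∃ κ, x ∈ W κ) (κ μ : K) :
    (G.L (r κ) (r μ)).IsUnitSection (W κ ∩ W μ) (t.s κ μ)
      ((2 * Real.pi) • (t.cocycle hW hcov).a κ μ) := by
  have e : (2 * Real.pi) • (t.cocycle hW hcov).a κ μ = t.ξ κ μ := by
    simp only [Gerbe.Triv.cocycle]
    rw [smul_smul, mul_one_div_cancel two_pi_ne_zero, one_smul]
  rw [e]
  exact t.unit κ μ

/-- The classes of the cocycles of isomorphic gerbes agree. -/
theorem mk_eq_of_gerbeIso {G G' : Gerbe (Mfd E B)} (Φ : GerbeIso G G') {c c' : Cocycle2 (Mfd E B)}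
    (h : G.HasCocycle c) (h' : G'.HasCocycle c') : H2.mk c = H2.mk c' := by
  obtain ⟨J, W, ρ, hW, hcov, hsub, hS⟩ := exists_fine_covering Φ.W Φ.W_open Φ.W_cover
    (fun κ μ O => (∃ s ξ, (G.L (Φ.r κ) (Φ.r μ)).IsUnitSection O s ξ) ∧
      (∃ s ξ, (G'.L (Φ.r' κ) (Φ.r' μ)).IsUnitSection O s ξ) ∧
      ∃ s ξ, (Φ.N κ).IsUnitSection O s ξ)
    (fun κ μ O O' h hO => ⟨exists_section_mono h.1 hO, exists_section_mono h.2.1 hO,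
      exists_section_mono h.2.2 hO⟩)
    (fun κ μ => ⟨⟨_, _, LineBundle.isUnitSection_empty _⟩,
      ⟨_, _, LineBundle.isUnitSection_empty _⟩, ⟨_, _, LineBundle.isUnitSection_empty _⟩⟩)
    (fun κ μ x hx => by
      have hκ := Φ.W_subset κ hx.1
      have hμ := Φ.W_subset μ hx.2
      obtain ⟨O₁, h₁, hx₁, hs₁⟩ := (G.L (Φ.r κ) (Φ.r μ)).exists_local_section ⟨hκ.1, hμ.1⟩
      obtain ⟨O₂, h₂, hx₂, hs₂⟩ := (G'.L (Φ.r' κ) (Φ.r' μ)).exists_local_section ⟨hκ.2, hμ.2⟩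
      obtain ⟨O₃, h₃, hx₃, hs₃⟩ := (Φ.N κ).exists_local_section hx.1
      exact ⟨O₁ ∩ (O₂ ∩ O₃), h₁.inter (h₂.inter h₃), ⟨hx₁, hx₂, hx₃⟩,
        exists_section_mono hs₁ inter_subset_left,
        exists_section_mono hs₂ (inter_subset_right.trans inter_subset_left),
        exists_section_mono hs₃ (inter_subset_right.trans inter_subset_right)⟩)
  obtain ⟨t⟩ := G.exists_triv W (fun j => Φ.r (ρ j)) hW
    (fun j x hx => (Φ.W_subset _ (hsub j hx)).1) fun j k => (hS j k).1
  obtain ⟨t'⟩ := G'.exists_triv W (fun j => Φ.r' (ρ j)) hW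
    (fun j x hx => (Φ.W_subset _ (hsub j hx)).2) fun j k => (hS j k).2.1
  have e1 : H2.mk c = H2.mk (t.cocycle hW hcov) :=
    Quot.sound (h.cohomologous (t.hasCocycle hW hcov))
  have e2 : H2.mk (t'.cocycle hW hcov) = H2.mk c' :=
    Quot.sound ((t'.hasCocycle hW hcov).cohomologous h')
  rw [e1, ← e2]
  exact Quot.sound (cohomologous_of_sections Φ _ _ W hW hcov ρ id id hsub
    (fun j x hx => ⟨hx, hx⟩) t.s (t.unit' hW hcov) (fun j k l x hx => t.θ_smul hW hx)
    (fun j => FormEq.refl _ _) t'.s (t'.unit' hW hcov) (fun j k l x hx => t'.θ_smul hW hx)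
    (fun j => FormEq.refl _ _) fun j => exists_section_mono (hS j j).2.2 (by rw [inter_self]))

variable (E B) in
/-- The isomorphism `Gerbe(B) ≅ H²(B, 𝒦²)`. -/
def gerbeEquiv : GerbeClass (Mfd E B) ≃ H2 (Mfd E B) where
  toFun := Quot.lift (fun G => H2.mk G.exists_hasCocycle.choose) fun G G' ⟨Φ⟩ =>
    mk_eq_of_gerbeIso Φ G.exists_hasCocycle.choose_spec G'.exists_hasCocycle.choose_spec
  invFun := Quot.map gerbeOf fun c c' ⟨b⟩ => ⟨b.gerbeIso⟩
  left_inv := by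
    rintro ⟨G⟩
    exact Quot.sound G.exists_hasCocycle.choose_spec.gerbeIso
  right_inv := by
    rintro ⟨c⟩
    exact Quot.sound ((gerbeOf c).exists_hasCocycle.choose_spec.cohomologous (hasCocycle_gerbeOf c))

theorem gerbeEquiv_mk {G : Gerbe (Mfd E B)} {c : Cocycle2 (Mfd E B)} (h : G.HasCocycle c) :
    gerbeEquiv E B (Quot.mk _ G) = H2.mk c :=
  Quot.sound (G.exists_hasCocycle.choose_spec.cohomologous h)

/-- If `s` and `s'` trivialise `G` and `G'` on the same covering, then the sections `s ⊗ s'`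
trivialise `G ⊗ G'`, and their cocycle is the sum of the two cocycles. -/
theorem GerbeProduct.exists_isSum2 {G G' G'' : Gerbe (Mfd E B)} (P : GerbeProduct G G' G'') :
    ∃ c c' c'', G.HasCocycle c ∧ G'.HasCocycle c' ∧ G''.HasCocycle c'' ∧ IsSum2 c c' c'' := by
  obtain ⟨J, W, ρ, hW, hcov, hsub, hS⟩ := exists_fine_covering G''.U G''.U_open G''.U_cover
    (fun κ μ O => (∃ s ξ, (G.L (P.r κ) (P.r μ)).IsUnitSection O s ξ) ∧
      (∃ s ξ, (G'.L (P.r' κ) (P.r' μ)).IsUnitSection O s ξ))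
    (fun κ μ O O' h hO => ⟨exists_section_mono h.1 hO, exists_section_mono h.2 hO⟩)
    (fun κ μ => ⟨⟨_, _, LineBundle.isUnitSection_empty _⟩,
      ⟨_, _, LineBundle.isUnitSection_empty _⟩⟩)
    (fun κ μ x hx => by
      have hκ := P.U_subset κ hx.1
      have hμ := P.U_subset μ hx.2
      obtain ⟨O₁, h₁, hx₁, hs₁⟩ := (G.L (P.r κ) (P.r μ)).exists_local_section ⟨hκ.1, hμ.1⟩
      obtain ⟨O₂, h₂, hx₂, hs₂⟩ := (G'.L (P.r' κ) (P.r' μ)).exists_local_section ⟨hκ.2, hμ.2⟩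
      exact ⟨O₁ ∩ O₂, h₁.inter h₂, ⟨hx₁, hx₂⟩, exists_section_mono hs₁ inter_subset_left,
        exists_section_mono hs₂ inter_subset_right⟩)
  obtain ⟨t⟩ := G.exists_triv W (fun j => P.r (ρ j)) hW
    (fun j x hx => (P.U_subset _ (hsub j hx)).1) fun j k => (hS j k).1
  obtain ⟨t'⟩ := G'.exists_triv W (fun j => P.r' (ρ j)) hW
    (fun j x hx => (P.U_subset _ (hsub j hx)).2) fun j k => (hS j k).2
  have hcompat := fun j k l x (hj : x ∈ W j) (hk : x ∈ W k) (hl : x ∈ W l) =>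
    P.compat (ρ j) (ρ k) (ρ l) x (hsub j hj) (hsub k hk) (hsub l hl)
  let t'' : G''.Triv W ρ :=
    { subset := hsub
      s := fun j k x => (P.iso (ρ j) (ρ k)).mul x (t.s j k x) (t'.s j k x)
      ξ := fun j k => t.ξ j k + t'.ξ j k
      unit := fun j k => (P.iso (ρ j) (ρ k)).parallel _ _ _ _ _ ((hW j).inter (hW k))
        (inter_subset_inter (hsub j) (hsub k)) (t.unit j k) (t'.unit j k)
      mul_self := fun j x hx => by
        rw [hcompat j j j x hx hx hx, t.mul_self j x hx, t'.mul_self j x hx]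
      mul_swap := fun j k x hx => by
        rw [hcompat j k j x hx.1 hx.2 hx.1, t.mul_swap j k x hx, t'.mul_swap j k x hx] }
  refine ⟨_, _, _, t.hasCocycle hW hcov, t'.hasCocycle hW hcov, t''.hasCocycle hW hcov,
    id, id, fun j x hx => ⟨hx, hx⟩, fun j k l x hx => ?_, fun j k n p hp w hw => ?_,
    fun j n p hp w hw => ?_⟩
  · have h1 := t''.mul_eq hW hx.1.1 hx.1.2 hx.2
    have h2 : (G''.θ (ρ j) (ρ k) (ρ l)).mul x (t''.s j k x) (t''.s k l x) =
        ((t.θ j k l x)⁻¹ * (t'.θ j k l x)⁻¹) • t''.s j l x := by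
      simp only [t'']
      rw [hcompat j k l x hx.1.1 hx.1.2 hx.2, t.mul_eq hW hx.1.1 hx.1.2 hx.2,
        t'.mul_eq hW hx.1.1 hx.1.2 hx.2, TensorIso.smul_mul, TensorIso.mul_smul, smul_smul]
    have h3 := circle_smul_right_injective (t''.ne_zero hx.1.1 hx.2) (h1.symm.trans h2)
    rw [← mul_inv, inv_inj] at h3
    exact h3
  · simp only [Gerbe.Triv.cocycle, t'', id, Pi.add_apply, Pi.smul_apply, smul_add]
  · have h1 := P.F_eq (ρ j) n p hp w (hsub j hw)
    simp only [Gerbe.Triv.cocycle, id, Pi.add_apply, Pi.neg_apply] at *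
    rw [h1, neg_add]

theorem isGerbeClassIso_gerbeEquiv : IsGerbeClassIso (gerbeEquiv E B) := by
  refine ⟨Gerbe.exists_hasCocycle, fun G c h => gerbeEquiv_mk h, ?_⟩
  rintro G G' G'' ⟨P⟩ c c' c'' hsum h h'
  obtain ⟨e, e', e'', he, he', he'', hsum'⟩ := P.exists_isSum2
  rw [gerbeEquiv_mk he'', hsum'.mk_eq, hsum.mk_eq, ← h, ← h', gerbeEquiv_mk he,
    gerbeEquiv_mk he']

end Manifold

/-! ### Subdivisions of the circle and their refinements -/

theorem circle_exp_add (x y : ℝ) :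
    Circle.exp (2 * Real.pi * (x + y)) =
      Circle.exp (2 * Real.pi * x) * Circle.exp (2 * Real.pi * y) := by
  rw [mul_add, Circle.exp_add]

/-- Points of `ℝ` at distance less than one are determined by their images on the circle. -/
theorem eq_of_circle_exp_eq {x y : ℝ} (h : Circle.exp (2 * Real.pi * x) =
    Circle.exp (2 * Real.pi * y)) (hxy : |x - y| < 1) : x = y := by
  obtain ⟨m, hm⟩ := Circle.exp_eq_exp.1 h
  have h1 : x = y + m := by
    have h2 : 2 * Real.pi * x = 2 * Real.pi * (y + m) := by rw [hm]; ring
    exact mul_left_cancel₀ two_pi_ne_zero h2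
  have h3 : |(m : ℝ)| < 1 := by rwa [h1, add_sub_cancel_left] at hxy
  have h4 : m = 0 := by
    rw [← Int.cast_abs] at h3
    exact Int.abs_lt_one_iff.1 (by exact_mod_cast h3)
  rw [h1, h4, Int.cast_zero, add_zero]

theorem exists_circle_exp (z : Circle) : ∃ x ∈ Ico (0 : ℝ) 1, Circle.exp (2 * Real.pi * x) = z := by
  refine ⟨Int.fract (Complex.arg z / (2 * Real.pi)), ⟨Int.fract_nonneg _, Int.fract_lt_one _⟩, ?_⟩
  rw [← Circle.exp_arg z, Circle.exp_eq_exp, Circle.exp_arg]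
  refine ⟨-⌊Complex.arg z / (2 * Real.pi)⌋, ?_⟩
  rw [Int.fract, mul_sub, mul_div_cancel₀ _ two_pi_ne_zero]
  push_cast
  ring

namespace Subdivision

variable (P Q : Subdivision)

/-- The total length of the `m` arcs from `t(i)` to `t(i + m)`. -/
def arcSum (i : ZMod P.n) (m : ℕ) : ℝ := ∑ l ∈ Finset.range m, P.len (i + (l : ZMod P.n))

theorem arcSum_succ (i : ZMod P.n) (m : ℕ) :
    P.arcSum i (m + 1) = P.arcSum i m + P.len (i + (m : ZMod P.n)) :=
  Finset.sum_range_succ _ _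

theorem arcSum_zero (i : ZMod P.n) : P.arcSum i 0 = 0 := Finset.sum_range_zero _

theorem arcSum_one (i : ZMod P.n) : P.arcSum i 1 = P.len i := by
  rw [arcSum_succ, arcSum_zero, zero_add, Nat.cast_zero, add_zero]

theorem arcSum_mono (i : ZMod P.n) {m m' : ℕ} (h : m ≤ m') : P.arcSum i m ≤ P.arcSum i m' :=
  Finset.sum_le_sum_of_subset_of_nonneg (Finset.range_mono h) fun _ _ _ => (P.len_pos _).le

theorem arcSum_lt (i : ZMod P.n) {m m' : ℕ} (h : m < m') : P.arcSum i m < P.arcSum i m' :=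
  lt_of_lt_of_le (by rw [arcSum_succ]; exact lt_add_of_pos_right _ (P.len_pos _))
    (P.arcSum_mono i h)

theorem arcSum_nonneg (i : ZMod P.n) (m : ℕ) : 0 ≤ P.arcSum i m :=
  Finset.sum_nonneg fun _ _ => (P.len_pos _).le

theorem arcSum_n (i : ZMod P.n) : P.arcSum i P.n = 1 := by
  rw [← P.sum_len, arcSum]
  refine Finset.sum_bij' (fun l _ => i + (l : ZMod P.n)) (fun j _ => (j - i).val) ?_ ?_ ?_ ?_ ?_
  · simp
  · intro j _
    exact Finset.mem_range.2 (ZMod.val_lt _)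
  · intro l hl
    simp only [add_sub_cancel_left]
    exact ZMod.val_cast_of_lt (Finset.mem_range.1 hl)
  · intro j _
    rw [ZMod.natCast_zmod_val, add_sub_cancel]
  · intro l _
    rfl

theorem arcSum_le_one (i : ZMod P.n) {m : ℕ} (h : m ≤ P.n) : P.arcSum i m ≤ 1 := by
  rw [← P.arcSum_n i]
  exact P.arcSum_mono i h

theorem len_le_one (i : ZMod P.n) : P.len i ≤ 1 := by
  rw [← P.arcSum_one]
  exact P.arcSum_le_one i (Nat.one_le_iff_ne_zero.2 (NeZero.ne _))

theorem t_add (i : ZMod P.n) (m : ℕ) :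
    P.t (i + (m : ZMod P.n)) = P.t i * Circle.exp (2 * Real.pi * P.arcSum i m) := by
  induction m with
  | zero => simp [arcSum_zero]
  | succ m ih =>
    rw [Nat.cast_succ, ← add_assoc, P.t_succ, ih, arcSum_succ, circle_exp_add, mul_assoc]

theorem point_zero (i : ZMod P.n) : P.point i 0 = P.t i := by simp [point]

theorem point_len (i : ZMod P.n) : P.point i (P.len i) = P.t (i + 1) := (P.t_succ i).symm

theorem point_add (i : ZMod P.n) (m : ℕ) (τ : ℝ) :
    P.point (i + (m : ZMod P.n)) τ = P.point i (P.arcSum i m + τ) := by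
  rw [point, t_add, point, circle_exp_add, mul_assoc]

/-- The half-open arcs `[t(i), t(i+1))` are disjoint. -/
theorem eq_of_point_eq {i j : ZMod P.n} {τ τ' : ℝ} (hτ : τ ∈ Ico 0 (P.len i))
    (hτ' : τ' ∈ Ico 0 (P.len j)) (h : P.point i τ = P.point j τ') : i = j := by
  set m := (j - i).val with hm
  have hj : j = i + (m : ZMod P.n) := by rw [hm, ZMod.natCast_zmod_val, add_sub_cancel]
  have hmn : m < P.n := ZMod.val_lt _
  rw [hj] at hτ'
  rw [hj, point_add, point, point, mul_right_inj] at h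
  have h1 : P.arcSum i m + τ' < P.arcSum i (m + 1) := by
    rw [arcSum_succ]
    exact add_lt_add_right hτ'.2 _
  have h2 : P.arcSum i (m + 1) ≤ 1 := P.arcSum_le_one i hmn
  have h3 := P.arcSum_nonneg i m
  have h4 : τ = P.arcSum i m + τ' := eq_of_circle_exp_eq h (by
    rw [abs_lt]
    constructor <;> linarith [hτ.1, hτ.2, hτ'.1, P.len_le_one i])
  rcases Nat.eq_zero_or_pos m with h0 | h0
  · rw [hj, h0, Nat.cast_zero, add_zero]
  · have h5 := P.arcSum_mono i h0
    rw [arcSum_one] at h5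
    linarith [hτ.2, hτ'.1]

theorem t_injective : Function.Injective P.t := fun i j h =>
  P.eq_of_point_eq (τ := 0) (τ' := 0) ⟨le_rfl, P.len_pos i⟩ ⟨le_rfl, P.len_pos j⟩ (by
    rw [point_zero, point_zero, h])

/-- The subdivision `Q` refines `P`; the arc `j` of `P` is divided into the arcs
`r(j), …, r(j) + k(j)` of `Q`. -/
@[ext]
structure Refinement (P Q : Subdivision) where
  r : ZMod P.n → ZMod Q.n
  k : ZMod P.n → ℕ
  t_eq : ∀ j, Q.t (r j) = P.t j
  r_succ : ∀ j, r (j + 1) = r j + (k j : ZMod Q.n) + 1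
  k_lt : ∀ j, k j < Q.n

/-- A refinement exists as soon as all points of division of `P` are points of division of `Q`. -/
def Refinement.ofSubset {P Q : Subdivision} (h : ∀ j, ∃ i, Q.t i = P.t j) : Refinement P Q where
  r j := (h j).choose
  k j := ((h (j + 1)).choose - (h j).choose - 1).val
  t_eq j := (h j).choose_spec
  r_succ j := by rw [ZMod.natCast_zmod_val]; ring
  k_lt j := ZMod.val_lt _

namespace Refinement

variable {P Q} {Q' : Subdivision} (R : Refinement P Q)

instance : Subsingleton (Refinement P Q) where
  allEq R R' := by
    have hr : R.r = R'.r := funext fun j => Q.t_injective ((R.t_eq j).trans (R'.t_eq j).symm)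
    refine Refinement.ext hr (funext fun j => ?_)
    have h1 := R.r_succ j
    rw [hr, R'.r_succ j, add_left_inj, add_right_inj] at h1
    rw [← ZMod.val_cast_of_lt (R.k_lt j), ← ZMod.val_cast_of_lt (R'.k_lt j), h1]

theorem len_eq (j : ZMod P.n) : P.len j = Q.arcSum (R.r j) (R.k j + 1) := by
  have h1 := Q.t_add (R.r j) (R.k j + 1)
  rw [Nat.cast_succ, ← add_assoc, ← R.r_succ, R.t_eq, R.t_eq, P.t_succ, mul_right_inj] at h1
  refine eq_of_circle_exp_eq h1 ?_
  have h2 := P.len_pos j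
  have h3 := P.len_le_one j
  have h4 := Q.arcSum_lt (R.r j) (Nat.succ_pos (R.k j))
  have h5 := Q.arcSum_le_one (R.r j) (R.k_lt j)
  rw [arcSum_zero] at h4
  rw [abs_lt]
  constructor <;> linarith

/-- The arcs of `Q` inside the arcs of `P`. -/
def toFun (q : Σ j, Fin (R.k j + 1)) : ZMod Q.n := R.r q.1 + ((q.2 : ℕ) : ZMod Q.n)

/-- Starting from `r(0)`, the arcs of `Q` are reached one by one. -/
theorem toFun_surjective : Function.Surjective R.toFun := by
  have h : ∀ m : ℕ, ∃ q, R.toFun q = R.r 0 + (m : ZMod Q.n) := by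
    intro m
    induction m with
    | zero => exact ⟨⟨0, 0⟩, by simp [toFun]⟩
    | succ m ih =>
      obtain ⟨⟨j, l, hl⟩, hq⟩ := ih
      simp only [toFun] at hq
      rcases Nat.lt_or_ge l (R.k j) with h | h
      · refine ⟨⟨j, l + 1, by omega⟩, ?_⟩
        simp only [toFun]
        rw [Nat.cast_succ, Nat.cast_succ, ← add_assoc, hq, add_assoc]
      · have hlk : l = R.k j := by omega
        refine ⟨⟨j + 1, 0⟩, ?_⟩
        simp only [toFun]
        rw [R.r_succ, ← hlk, hq]
        simp [add_assoc]
  intro i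
  obtain ⟨q, hq⟩ := h (i - R.r 0).val
  exact ⟨q, by rw [hq, ZMod.natCast_zmod_val, add_sub_cancel]⟩

/-- An arc of `Q` occurring twice would make the sum of all lengths, which is one, exceed the total
length one of the arcs of `Q`. -/
theorem toFun_injective : Function.Injective R.toFun := by
  set g := Function.surjInv R.toFun_surjective with hg
  have hfg : ∀ i, R.toFun (g i) = i := Function.surjInv_eq _
  have hginj : Function.Injective g := Function.injective_surjInv _
  have h1 : ∑ q, Q.len (R.toFun q) = 1 := by
    rw [Fintype.sum_sigma, ← P.sum_len]
    refine Finset.sum_congr rfl fun j _ => ?_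
    rw [R.len_eq, arcSum, Finset.sum_range]
    rfl
  have h2 : ∑ q ∈ Finset.univ.image g, Q.len (R.toFun q) = 1 := by
    rw [Finset.sum_image hginj.injOn, ← Q.sum_len]
    exact Finset.sum_congr rfl fun i _ => by rw [hfg]
  have h3 : Function.Surjective g := by
    intro q
    by_contra hq
    have hq' : q ∉ Finset.univ.image g := fun h => by
      obtain ⟨i, -, hi⟩ := Finset.mem_image.1 h
      exact hq ⟨i, hi⟩
    have := Finset.sum_lt_sum_of_subset (f := fun q => Q.len (R.toFun q))
      (Finset.subset_univ (Finset.univ.image g)) (Finset.mem_univ q) hq' (Q.len_pos _)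
      fun _ _ _ => (Q.len_pos _).le
    rw [h1, h2] at this
    exact lt_irrefl _ this
  intro q q' h
  obtain ⟨i, rfl⟩ := h3 q
  obtain ⟨i', rfl⟩ := h3 q'
  rw [hfg, hfg] at h
  rw [h]

/-- Each arc of `Q` lies in exactly one arc of `P`. -/
def equiv : (Σ j, Fin (R.k j + 1)) ≃ ZMod Q.n :=
  Equiv.ofBijective R.toFun ⟨R.toFun_injective, R.toFun_surjective⟩

/-- The arc of `P` containing the arc `i` of `Q`. -/
def idx (i : ZMod Q.n) : ZMod P.n := (R.equiv.symm i).1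

theorem idx_add (j : ZMod P.n) {l : ℕ} (hl : l ≤ R.k j) :
    R.idx (R.r j + (l : ZMod Q.n)) = j := by
  have : R.r j + (l : ZMod Q.n) = R.equiv ⟨j, l, Nat.lt_succ_of_le hl⟩ := rfl
  rw [idx, this, Equiv.symm_apply_apply]

theorem idx_r (j : ZMod P.n) : R.idx (R.r j) = j := by
  simpa using R.idx_add j (Nat.zero_le _)

theorem exists_eq_add (i : ZMod Q.n) :
    ∃ l ≤ R.k (R.idx i), i = R.r (R.idx i) + (l : ZMod Q.n) := by
  refine ⟨(R.equiv.symm i).2, Nat.lt_succ_iff.1 (R.equiv.symm i).2.2, ?_⟩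
  conv_lhs => rw [← R.equiv.apply_symm_apply i]
  rfl

/-- The successor of an arc of `Q` lies in the same arc of `P`, or it is the first of the next. -/
theorem idx_succ (i : ZMod Q.n) : R.idx (i + 1) = R.idx i ∨
    i = R.r (R.idx i) + (R.k (R.idx i) : ZMod Q.n) ∧ i + 1 = R.r (R.idx i + 1) ∧
      R.idx (i + 1) = R.idx i + 1 := by
  obtain ⟨l, hl, hi⟩ := R.exists_eq_add i
  set j := R.idx i with hj
  rcases hl.lt_or_eq with h | h
  · left
    rw [hi, add_assoc, ← Nat.cast_succ, R.idx_add j h]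
  · right
    have h2 : i + 1 = R.r (j + 1) := by rw [R.r_succ, ← h, ← hi]
    exact ⟨by rw [← h]; exact hi, h2, by rw [h2, R.idx_r]⟩

theorem idx_last (j : ZMod P.n) : R.idx (R.r j + (R.k j : ZMod Q.n)) = j := R.idx_add j le_rfl

theorem idx_last_succ (j : ZMod P.n) : R.idx (R.r j + (R.k j : ZMod Q.n) + 1) = j + 1 := by
  rw [← R.r_succ, R.idx_r]

theorem t_last_succ (j : ZMod P.n) : Q.t (R.r j + (R.k j : ZMod Q.n) + 1) = P.t (j + 1) := by
  rw [← R.r_succ, R.t_eq]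

theorem point_add_eq (j : ZMod P.n) (l : ℕ) (τ : ℝ) :
    Q.point (R.r j + (l : ZMod Q.n)) τ = P.point j (Q.arcSum (R.r j) l + τ) := by
  rw [point_add, point, R.t_eq, point]

/-- The arc `i` of `Q` starts at distance `o` from the beginning of the arc of `P` containing it. -/
theorem exists_offset (i : ZMod Q.n) : ∃ o, 0 ≤ o ∧ o + Q.len i ≤ P.len (R.idx i) ∧
    ∀ τ, Q.point i τ = P.point (R.idx i) (o + τ) := by
  obtain ⟨l, hl, hi⟩ := R.exists_eq_add i
  refine ⟨Q.arcSum (R.r (R.idx i)) l, Q.arcSum_nonneg _ _, ?_, fun τ => ?_⟩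
  · rw [R.len_eq (R.idx i)]
    conv_lhs => rw [hi]
    rw [R.idx_add _ hl, ← arcSum_succ]
    exact Q.arcSum_mono _ (Nat.succ_le_succ hl)
  · conv_lhs => rw [hi]
    exact R.point_add_eq _ l τ

theorem prod_eq {M : Type*} [CommMonoid M] (F : ZMod Q.n → M) :
    ∏ i, F i = ∏ j, ∏ l ∈ Finset.range (R.k j + 1), F (R.r j + (l : ZMod Q.n)) := by
  rw [← R.equiv.prod_comp, Fintype.prod_sigma]
  exact Finset.prod_congr rfl fun j _ =>
    (Finset.prod_range (f := fun l => F (R.r j + (l : ZMod Q.n)))).symm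

theorem sum_eq {M : Type*} [AddCommMonoid M] (F : ZMod Q.n → M) :
    ∑ i, F i = ∑ j, ∑ l ∈ Finset.range (R.k j + 1), F (R.r j + (l : ZMod Q.n)) := by
  rw [← R.equiv.sum_comp, Fintype.sum_sigma]
  exact Finset.sum_congr rfl fun j _ =>
    (Finset.sum_range (f := fun l => F (R.r j + (l : ZMod Q.n)))).symm

theorem sum_k : ∑ j, (R.k j + 1) = Q.n := by
  have h := Fintype.card_congr R.equiv
  rw [Fintype.card_sigma, ZMod.card] at h
  simpa using h

theorem isRefinement {I : Type u} (s : ZMod P.n → I) :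
    IsRefinement P s Q (s ∘ R.idx) R.r R.k :=
  ⟨R.t_eq, R.r_succ, R.sum_k, fun j l hl => by rw [Function.comp_apply, R.idx_add j hl]⟩

theorem exists_trans (R : Refinement P Q) (S : Refinement Q Q') : Nonempty (Refinement P Q') :=
  ⟨ofSubset fun j => ⟨S.r (R.r j), by rw [S.t_eq, R.t_eq]⟩⟩

theorem idx_trans (R : Refinement P Q) (S : Refinement Q Q') (T : Refinement P Q') (i : ZMod Q'.n) :
    T.idx i = R.idx (S.idx i) := by
  obtain ⟨o₁, h₁, h₁', e₁⟩ := T.exists_offset i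
  obtain ⟨o₂, h₂, h₂', e₂⟩ := S.exists_offset i
  obtain ⟨o₃, h₃, h₃', e₃⟩ := R.exists_offset (S.idx i)
  have hl := Q'.len_pos i
  refine P.eq_of_point_eq (τ := o₁ + 0) (τ' := o₃ + (o₂ + 0)) ⟨by linarith, by linarith⟩
    ⟨by linarith, by linarith⟩ ?_
  rw [← e₁, ← e₃, ← e₂]

theorem idx_self (R : Refinement P P) (i : ZMod P.n) : R.idx i = i := by
  have : R = ofSubset fun j => ⟨j, rfl⟩ := Subsingleton.elim _ _
  have h1 : R.r i = i := P.t_injective (R.t_eq i)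
  conv_lhs => rw [← h1]
  exact R.idx_r i

end Refinement

end Subdivision

/-- The refinements of labelled subdivisions are those of the subdivisions, with the labels carried
along. -/
theorem IsRefinement.exists_refinement {I : Type u} {P Q : Subdivision} {s : ZMod P.n → I}
    {s' : ZMod Q.n → I} {r : ZMod P.n → ZMod Q.n} {k : ZMod P.n → ℕ}
    (h : IsRefinement P s Q s' r k) :
    ∃ R : P.Refinement Q, R.r = r ∧ R.k = k ∧ s' = s ∘ R.idx := by
  have hk : ∀ j, k j < Q.n := fun j => by
    rw [← h.sum_k]
    exact Finset.single_le_sum (f := fun j => k j + 1) (fun _ _ => Nat.zero_le _)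
      (Finset.mem_univ j)
  let R : P.Refinement Q := ⟨r, k, h.t_eq, h.r_succ, hk⟩
  refine ⟨R, rfl, rfl, funext fun i => ?_⟩
  obtain ⟨l, hl, hi⟩ := R.exists_eq_add i
  rw [Function.comp_apply]
  conv_lhs => rw [hi]
  exact h.label _ l hl

namespace Subdivision

/-- There are subdivisions through given points with arcs as short as required. -/
theorem exists_through (F : Finset Circle) {ε : ℝ} (hε : 0 < ε) :
    ∃ Q : Subdivision, (∀ z ∈ F, ∃ i, Q.t i = z) ∧ ∀ i, Q.len i < ε := by
  classical
  choose x hx hxz using exists_circle_exp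
  -- take the given points together with the `N`-th roots of unity
  obtain ⟨N, hN⟩ := exists_nat_gt (1 / ε)
  have hN0 : (0 : ℝ) < N := lt_trans (by positivity) hN
  set A : Finset ℝ := F.image x ∪ (Finset.range N).image fun l : ℕ => (l : ℝ) / N with hA
  have hA01 : ∀ y ∈ A, y ∈ Ico (0 : ℝ) 1 := by
    intro y hy
    rcases Finset.mem_union.1 hy with h | h
    · obtain ⟨z, -, rfl⟩ := Finset.mem_image.1 h
      exact hx z
    · obtain ⟨l, hl, rfl⟩ := Finset.mem_image.1 h
      refine ⟨by positivity, (div_lt_one hN0).2 ?_⟩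
      exact_mod_cast Finset.mem_range.1 hl
  have h0A : (0 : ℝ) ∈ A := Finset.mem_union_right _ (Finset.mem_image.2
    ⟨0, Finset.mem_range.2 (by exact_mod_cast hN0), by simp⟩)
  obtain ⟨m, hm⟩ : ∃ m, A.card = m + 1 := Nat.exists_eq_succ_of_ne_zero
    (Finset.card_ne_zero_of_mem h0A)
  set a := A.orderEmbOfFin hm with ha
  have haA : ∀ i, a i ∈ A := A.orderEmbOfFin_mem hm
  have hsurj : ∀ y ∈ A, ∃ i, a i = y := fun y hy => by
    have : y ∈ Set.range a := by rw [ha, Finset.range_orderEmbOfFin]; exact hy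
    exact this
  -- the points in increasing order, followed by `1`
  set b : ℕ → ℝ := fun l => if h : l < m + 1 then a ⟨l, h⟩ else 1 with hb
  have hba : ∀ i : Fin (m + 1), b i = a i := fun i => dif_pos i.2
  have hblast : b (m + 1) = 1 := by simp [hb]
  have hb0 : b 0 = 0 := by
    obtain ⟨i, hi⟩ := hsurj 0 h0A
    have h1 : a 0 ≤ a i := a.monotone (Fin.zero_le i)
    have h2 := (hA01 _ (haA 0)).1
    have h3 := hba 0
    simp only [Fin.val_zero] at h3
    rw [h3]
    linarith
  have hlt : ∀ l < m + 1, b l < b (l + 1) := by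
    intro l hl
    have h1 := hba ⟨l, hl⟩
    simp only at h1
    rw [h1]
    rcases Nat.lt_or_ge (l + 1) (m + 1) with h | h
    · have h2 := hba ⟨l + 1, h⟩
      simp only at h2
      rw [h2]
      exact a.strictMono (Fin.mk_lt_mk.2 (Nat.lt_succ_self l))
    · have h2 : l + 1 = m + 1 := by omega
      rw [h2, hblast]
      exact (hA01 _ (haA _)).2
  have hmesh : ∀ l < m + 1, b (l + 1) - b l < ε := by
    intro l hl
    by_contra hcon
    push Not at hcon
    have hbl := hba ⟨l, hl⟩
    simp only at hbl
    have hb01 := hA01 _ (haA ⟨l, hl⟩)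
    rw [← hbl] at hb01
    have hle1 : b (l + 1) ≤ 1 := by
      rcases Nat.lt_or_ge (l + 1) (m + 1) with h | h
      · have h2 := hba ⟨l + 1, h⟩
        simp only at h2
        rw [h2]
        exact (hA01 _ (haA _)).2.le
      · have h2 : l + 1 = m + 1 := by omega
        rw [h2, hblast]
    set q := ⌊b l * N⌋₊ + 1 with hq
    have hq1 : b l * N < q := by rw [hq]; push_cast; exact Nat.lt_floor_add_one _
    have hq2 : (q : ℝ) ≤ b l * N + 1 := by
      rw [hq]; push_cast
      linarith [Nat.floor_le (mul_nonneg hb01.1 hN0.le)]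
    have hεN : 1 < ε * N := by rwa [div_lt_iff₀' hε] at hN
    have hq3 : (q : ℝ) / N < b (l + 1) := by
      rw [div_lt_iff₀ hN0]
      nlinarith
    have hqN : q < N := by
      have : (q : ℝ) / N < 1 := hq3.trans_le hle1
      rw [div_lt_one hN0] at this
      exact_mod_cast this
    obtain ⟨i, hi⟩ := hsurj ((q : ℝ) / N) (Finset.mem_union_right _ (Finset.mem_image.2
      ⟨q, Finset.mem_range.2 hqN, rfl⟩))
    have h1 : b l < a i := by rw [hi, lt_div_iff₀ hN0]; exact hq1
    rw [hbl] at h1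
    have h2 : l < (i : ℕ) := Fin.lt_def.1 (a.lt_iff_lt.1 h1)
    have h3 : b (l + 1) ≤ a i := by
      have h4 := hba ⟨l + 1, by omega⟩
      simp only at h4
      rw [h4]
      exact a.monotone (Fin.mk_le_of_le_val h2)
    rw [hi] at h3
    linarith
  refine ⟨{ n := m + 1
            t := fun i : Fin (m + 1) => Circle.exp (2 * Real.pi * b i)
            len := fun i : Fin (m + 1) => b (i + 1) - b i
            len_pos := fun i : Fin (m + 1) => sub_pos.2 (hlt _ i.2)
            sum_len := ?_
            t_succ := ?_ }, fun z hz => ?_, fun i : Fin (m + 1) => hmesh _ i.2⟩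
  · change ∑ i : Fin (m + 1), (b (i + 1) - b i) = 1
    rw [← Finset.sum_range (f := fun l => b (l + 1) - b l), Finset.sum_range_sub, hblast, hb0,
      sub_zero]
  · change ∀ i : Fin (m + 1), Circle.exp (2 * Real.pi * b (i + 1 : Fin (m + 1))) =
      Circle.exp (2 * Real.pi * b i) * Circle.exp (2 * Real.pi * (b (i + 1) - b i))
    intro i
    rw [← circle_exp_add, add_sub_cancel]
    rcases Nat.lt_or_ge ((i : ℕ) + 1) (m + 1) with h | h
    · rw [Fin.val_add_one_of_lt (Fin.lt_def.2 (by simp; omega))]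
    · have h2 : i = Fin.last m := Fin.ext (by simp; omega)
      rw [h2, Fin.last_add_one]
      simp [hblast, hb0]
  · obtain ⟨i, hi⟩ := hsurj (x z) (Finset.mem_union_left _ (Finset.mem_image_of_mem x hz))
    refine ⟨i, ?_⟩
    change Circle.exp (2 * Real.pi * b i) = z
    rw [hba, hi, hxz]

theorem exists_common_refinement (P P' : Subdivision) {ε : ℝ} (hε : 0 < ε) :
    ∃ Q : Subdivision, Nonempty (P.Refinement Q) ∧ Nonempty (P'.Refinement Q) ∧
      ∀ i, Q.len i < ε := by
  classical
  obtain ⟨Q, hQ, hlen⟩ := exists_through (Finset.univ.image P.t ∪ Finset.univ.image P'.t) hε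
  exact ⟨Q, ⟨.ofSubset fun j => hQ _ (by simp)⟩, ⟨.ofSubset fun j => hQ _ (by simp)⟩, hlen⟩

end Subdivision

/-! ### Integrals depending smoothly on parameters -/

section Parametric

variable {H F : Type} [NormedAddCommGroup H] [NormedSpace ℝ H] [NormedAddCommGroup F]
  [NormedSpace ℝ F] {Ω : Set (H × ℝ)} {a b : ℝ}

theorem isOpen_forall_mem_Icc {H : Type*} [TopologicalSpace H] {Ω : Set (H × ℝ)} (hΩ : IsOpen Ω)
    (a b : ℝ) : IsOpen {x | ∀ τ ∈ Icc a b, (x, τ) ∈ Ω} := by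
  rw [isOpen_iff_mem_nhds]
  intro x hx
  obtain ⟨u, v, hu, -, hxu, hv, huv⟩ := generalized_tube_lemma (isCompact_singleton (x := x))
    (isCompact_Icc (a := a) (b := b)) hΩ (by rintro ⟨y, τ⟩ ⟨rfl, hτ⟩; exact hx τ hτ)
  filter_upwards [hu.mem_nhds (hxu rfl)] with y hy τ hτ
  exact huv ⟨hy, hv hτ⟩

theorem continuousOn_slice {G : H × ℝ → F} (hG : ContinuousOn G Ω) {x : H}
    (hx : ∀ τ ∈ Icc a b, (x, τ) ∈ Ω) : ContinuousOn (fun τ => G (x, τ)) (Icc a b) :=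
  hG.comp (by fun_prop) hx

/-- Differentiation under the integral sign over a compact interval, for an integrand which is
smooth on an open set containing the segment `{x} × [a, b]`. -/
theorem hasFDerivAt_integral_of_contDiffOn (hΩ : IsOpen Ω) {G : H × ℝ → F}
    (hG : ContDiffOn ℝ ∞ G Ω) (hab : a ≤ b) {x : H} (hx : ∀ τ ∈ Icc a b, (x, τ) ∈ Ω) :
    HasFDerivAt (fun x => ∫ τ in a..b, G (x, τ))
      (∫ τ in a..b, (fderiv ℝ G (x, τ)).comp (ContinuousLinearMap.inl ℝ H ℝ)) x := by
  set G' : H × ℝ → H →L[ℝ] F := fun q => (fderiv ℝ G q).comp (ContinuousLinearMap.inl ℝ H ℝ)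
    with hG'
  have hG'c : ContinuousOn G' Ω :=
    (hG.continuousOn_fderiv_of_isOpen hΩ (by simp)).clm_comp continuousOn_const
  obtain ⟨M, hM⟩ := (isCompact_Icc.image_of_continuousOn
    (continuousOn_slice hG'c hx)).isBounded.exists_norm_le
  set Ω' : Set (H × ℝ) := Ω ∩ (fun q => ‖G' q‖) ⁻¹' Iio (M + 1) with hΩ'
  have hΩ'o : IsOpen Ω' := hG'c.norm.isOpen_inter_preimage hΩ isOpen_Iio
  have hxΩ' : ∀ τ ∈ Icc a b, (x, τ) ∈ Ω' := fun τ hτ =>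
    ⟨hx τ hτ, (hM _ ⟨τ, hτ, rfl⟩).trans_lt (lt_add_one M)⟩
  have hs := (isOpen_forall_mem_Icc hΩ'o a b).mem_nhds hxΩ'
  have hIoc : Set.uIoc a b ⊆ Icc a b := by
    rw [uIoc_of_le hab]
    exact Ioc_subset_Icc_self
  refine intervalIntegral.hasFDerivAt_integral_of_dominated_of_fderiv_le (𝕜 := ℝ)
    (F := fun x τ => G (x, τ)) (F' := fun x τ => G' (x, τ)) (bound := fun _ => M + 1) hs ?_ ?_ ?_
    ?_ ?_ ?_
  · filter_upwards [hs] with y hy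
    exact ((continuousOn_slice hG.continuousOn fun τ hτ => (hy τ hτ).1).aestronglyMeasurable
      measurableSet_Icc).mono_set hIoc
  · exact (continuousOn_slice hG.continuousOn hx).intervalIntegrable_of_Icc hab
  · exact ((continuousOn_slice hG'c hx).aestronglyMeasurable measurableSet_Icc).mono_set hIoc
  · exact Filter.Eventually.of_forall fun τ hτ y hy => (hy τ (hIoc hτ)).2.le
  · exact intervalIntegrable_const
  · refine Filter.Eventually.of_forall fun τ hτ y hy => ?_
    have h1 := ((hG.contDiffAt (hΩ.mem_nhds (hy τ (hIoc hτ)).1)).differentiableAt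
      (by simp)).hasFDerivAt
    exact h1.comp y ((hasFDerivAt_id y).prodMk (hasFDerivAt_const τ y))

theorem contDiffOn_integral (hΩ : IsOpen Ω) {G : H × ℝ → F}
    (hG : ContDiffOn ℝ ∞ G Ω) (hab : a ≤ b) :
    ContDiffOn ℝ ∞ (fun x => ∫ τ in a..b, G (x, τ)) {x | ∀ τ ∈ Icc a b, (x, τ) ∈ Ω} := by
  refine contDiffOn_infty.2 fun n => ?_
  have hV := isOpen_forall_mem_Icc hΩ a b
  induction n generalizing F with
  | zero =>
    exact contDiffOn_zero.2 fun x hx =>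
      (hasFDerivAt_integral_of_contDiffOn hΩ hG hab hx).continuousAt.continuousWithinAt
  | succ n ih =>
    rw [Nat.cast_succ, contDiffOn_succ_iff_fderiv_of_isOpen hV]
    refine ⟨fun x hx => (hasFDerivAt_integral_of_contDiffOn hΩ hG
      hab hx).differentiableAt.differentiableWithinAt, fun h => by simp at h, ?_⟩
    refine (ih (G := fun q => (fderiv ℝ G q).comp (ContinuousLinearMap.inl ℝ H ℝ)) ?_).congr
      fun x hx => (hasFDerivAt_integral_of_contDiffOn hΩ hG hab hx).fderiv
    exact (hG.fderiv_of_isOpen hΩ (by simp)).clm_comp contDiffOn_const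

end Parametric

/-! ### Integration of forms along an arc -/

section ArcIntegral

variable {X : Type u} [DiffeologicalSpace X]

/-- The point `(w, τ) ∈ ℝⁿ⁺¹`. -/
def snocE {n : ℕ} (w : Euc n) (τ : ℝ) : Euc (n + 1) :=
  WithLp.toLp 2 (Fin.snoc (α := fun _ => ℝ) w.ofLp τ)

/-- The last basis vector of `ℝⁿ⁺¹`. -/
def lastE (n : ℕ) : Euc (n + 1) := EuclideanSpace.single (Fin.last n) 1

theorem snocE_eq {n : ℕ} (w : Euc n) (τ : ℝ) : snocE w τ = appendZero n w + τ • lastE n := by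
  ext i
  refine Fin.lastCases ?_ (fun j => ?_) i
  · simp [snocE, appendZero, lastE]
  · simp [snocE, appendZero, lastE, (Fin.castSucc_lt_last j).ne]

theorem snocE_castSucc {n : ℕ} (w : Euc n) (τ : ℝ) (j : Fin n) :
    snocE w τ (Fin.castSucc j) = w j := by simp [snocE]

theorem snocE_last {n : ℕ} (w : Euc n) (τ : ℝ) : snocE w τ (Fin.last n) = τ := by simp [snocE]

theorem contDiff_snocE {n : ℕ} : ContDiff ℝ ∞ fun q : Euc n × ℝ => snocE q.1 q.2 := by
  simp only [snocE_eq]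
  exact ((appendZero n).contDiff.comp contDiff_fst).add (contDiff_snd.smul contDiff_const)

theorem hasDerivAt_snocE {n : ℕ} (w : Euc n) (τ : ℝ) :
    HasDerivAt (fun τ => snocE w τ) (lastE n) τ := by
  simp only [snocE_eq]
  simpa using ((hasDerivAt_id τ).smul_const (lastE n)).const_add (appendZero n w)

theorem hasFDerivAt_snocE {n : ℕ} (w : Euc n) (τ : ℝ) :
    HasFDerivAt (fun w => snocE w τ) (appendZero n) w := by
  simp only [snocE_eq]
  exact (appendZero n).hasFDerivAt.add_const _

/-- The plot `(w, τ) ↦ (p(w), z e^{2πiτ})` of `X × S¹`. -/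
def cyl {n : ℕ} (z : Circle) (p : Euc n → X) : Euc (n + 1) → X × Circle := fun y =>
  (p (WithLp.toLp 2 fun j => y (Fin.castSucc j)), z * Circle.exp (2 * Real.pi * y (Fin.last n)))

theorem cyl_snocE {n : ℕ} (z : Circle) (p : Euc n → X) (w : Euc n) (τ : ℝ) :
    cyl z p (snocE w τ) = (p w, z * Circle.exp (2 * Real.pi * τ)) := by
  simp only [cyl, snocE_castSucc, snocE_last]

theorem isPlot_circle {n : ℕ} (z : Circle) {f : Euc n → ℝ} (hf : ContDiff ℝ ∞ f) :
    IsPlot fun w => z * Circle.exp (f w) := by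
  have h : ContMDiff 𝓘(ℝ, Euc n) (𝓡 1) ∞ fun w => z * Circle.exp (f w) :=
    contMDiff_const.mul (contMDiff_circleExp.comp hf.contMDiff)
  exact h

theorem isPlot_cyl {n : ℕ} (z : Circle) {p : Euc n → X} (hp : IsPlot p) : IsPlot (cyl z p) :=
  ⟨isPlot_reparam hp (f := fun y : Euc (n + 1) => (WithLp.toLp 2 fun j => y (Fin.castSucc j) :
    Euc n)) (by fun_prop), isPlot_circle z (by fun_prop)⟩

theorem isCurve_arc (x : X) (z : Circle) :
    IsCurve fun τ => (x, z * Circle.exp (2 * Real.pi * τ)) :=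
  ⟨isPlot_const, isPlot_circle z (by fun_prop)⟩

theorem dSmooth_prodMk (z : Circle) : DSmooth fun x : X => (x, z) :=
  fun _ _ hp => ⟨hp, isPlot_const⟩

/-- The points `x` for which the arc of length `ℓ` from `(x, z)` lies in `U`. -/
def arcSet (z : Circle) (ℓ : ℝ) (U : Set (X × Circle)) : Set X :=
  {x | ∀ τ ∈ Icc 0 ℓ, (x, z * Circle.exp (2 * Real.pi * τ)) ∈ U}

variable {U : Set (X × Circle)} {z : Circle} {ℓ : ℝ}

theorem isOpen_cyl (hU : DOpen U) (z : Circle) {n : ℕ} {p : Euc n → X} (hp : IsPlot p) :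
    IsOpen {q : Euc n × ℝ | cyl z p (snocE q.1 q.2) ∈ U} :=
  (hU.plot (isPlot_cyl z hp)).preimage contDiff_snocE.continuous

theorem mem_arcSet_iff {n : ℕ} {p : Euc n → X} {w : Euc n} :
    p w ∈ arcSet z ℓ U ↔ ∀ τ ∈ Icc 0 ℓ, (w, τ) ∈ {q : Euc n × ℝ | cyl z p (snocE q.1 q.2) ∈ U} := by
  simp only [arcSet, mem_ofPred_eq, cyl_snocE]

theorem dOpen_arcSet (hU : DOpen U) (z : Circle) (ℓ : ℝ) : DOpen (arcSet z ℓ U) :=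
  dOpen_iff.2 fun n p hp => by
    have : p ⁻¹' arcSet z ℓ U =
        {w | ∀ τ ∈ Icc 0 ℓ, (w, τ) ∈ {q : Euc n × ℝ | cyl z p (snocE q.1 q.2) ∈ U}} :=
      Set.ext fun w => mem_arcSet_iff
    rw [this]
    exact isOpen_forall_mem_Icc (isOpen_cyl hU z hp) 0 ℓ

/-- `η ↦ i_{∂τ} η`, restricted to `ℝⁿ`. -/
def contractLast (n k : ℕ) :
    (Euc (n + 1)) [⋀^Fin (k + 1)]→L[ℝ] ℝ →L[ℝ] (Euc n) [⋀^Fin k]→L[ℝ] ℝ :=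
  (ContinuousAlternatingMap.compContinuousLinearMapCLM (appendZero n)).comp
    ((ContinuousLinearMap.apply ℝ _ (lastE n)).comp
      (ContinuousAlternatingMap.curryLeftLI (𝕜 := ℝ) (E := Euc (n + 1)) (F := ℝ)
        (n := k)).toContinuousLinearMap)

theorem contractLast_apply {n k : ℕ} (η : (Euc (n + 1)) [⋀^Fin (k + 1)]→L[ℝ] ℝ)
    (v : Fin k → Euc n) :
    contractLast n k η v = η (Matrix.vecCons (lastE n) fun i => appendZero n (v i)) := rfl

theorem fibreIntegral_apply {k : ℕ} (z : Circle) (ℓ : ℝ) (ξ : PreForm (X × Circle) (k + 1)) {n : ℕ}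
    (p : Euc n → X) (w : Euc n) : fibreIntegral z ℓ ξ n p w =
      ∫ τ in (0 : ℝ)..ℓ, contractLast n k (ξ (n + 1) (cyl z p) (snocE w τ)) := rfl

section

variable {k : ℕ} {ξ : PreForm (X × Circle) (k + 1)}

theorem IsForm.contDiffOn_contractLast (h : IsForm U ξ) {n : ℕ} {p : Euc n → X} (hp : IsPlot p) :
    ContDiffOn ℝ ∞ (fun q : Euc n × ℝ => contractLast n k (ξ (n + 1) (cyl z p) (snocE q.1 q.2)))
      {q | cyl z p (snocE q.1 q.2) ∈ U} :=
  (contractLast n k).contDiff.comp_contDiffOn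
    ((h.smooth (n + 1) _ (isPlot_cyl z hp)).comp contDiff_snocE.contDiffOn fun _ hq => hq)

theorem IsForm.intervalIntegrable_contractLast (h : IsForm U ξ) {n : ℕ} {p : Euc n → X}
    (hp : IsPlot p) (hℓ : 0 ≤ ℓ) {w : Euc n} (hw : p w ∈ arcSet z ℓ U) :
    IntervalIntegrable (fun τ => contractLast n k (ξ (n + 1) (cyl z p) (snocE w τ)))
      MeasureTheory.volume 0 ℓ :=
  (continuousOn_slice (h.contDiffOn_contractLast hp).continuousOn
    (mem_arcSet_iff.1 hw)).intervalIntegrable_of_Icc hℓ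

/-- The fibre integral of a form is a form. -/
theorem IsForm.fibreIntegral (hU : DOpen U) (h : IsForm U ξ) (hℓ : 0 ≤ ℓ) :
    IsForm (arcSet z ℓ U) (fibreIntegral z ℓ ξ) where
  smooth n p hp := by
    have := contDiffOn_integral (isOpen_cyl hU z hp) (h.contDiffOn_contractLast hp) hℓ
    exact this.mono fun w hw => mem_arcSet_iff.1 hw
  natural m n p f hp hf w hw := by
    have hint := h.intervalIntegrable_contractLast hp hℓ hw
    rw [fibreIntegral_apply, fibreIntegral_apply]
    have e := (ContinuousAlternatingMap.compContinuousLinearMapCLM (ι := Fin k) (F := ℝ)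
      (fderiv ℝ f w)).intervalIntegral_comp_comm hint
    refine Eq.trans (intervalIntegral.integral_congr fun τ hτ => ?_) e
    rw [uIcc_of_le hℓ] at hτ
    set F : Euc (m + 1) → Euc (n + 1) := fun y =>
      snocE (f (WithLp.toLp 2 fun j => y (Fin.castSucc j))) (y (Fin.last m)) with hF
    have hFs : ContDiff ℝ ∞ F := contDiff_snocE.comp
      ((hf.comp (by fun_prop)).prodMk (by fun_prop))
    have hcyl : cyl z (p ∘ f) = cyl z p ∘ F := by
      funext y
      simp only [hF, Function.comp_apply, cyl_snocE]
      rfl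
    have hFw : ∀ w τ, F (snocE w τ) = snocE (f w) τ := fun w τ => by
      simp only [hF, snocE_castSucc, snocE_last]
    have h1 := h.natural (m + 1) (n + 1) _ F (isPlot_cyl z hp) hFs (snocE w τ) (by
      rw [hFw]; exact mem_arcSet_iff.1 hw τ hτ)
    rw [hFw] at h1
    have hFd := (hFs.differentiable (by simp) (snocE w τ)).hasFDerivAt
    have hlast : fderiv ℝ F (snocE w τ) (lastE m) = lastE n := by
      have h2 := hFd.comp_hasDerivAt τ (hasDerivAt_snocE w τ)
      have h3 : (F ∘ fun τ => snocE w τ) = fun τ => snocE (f w) τ := funext fun τ => hFw w τ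
      rw [h3] at h2
      exact h2.unique (hasDerivAt_snocE (f w) τ)
    have happ : ∀ v, fderiv ℝ F (snocE w τ) (appendZero m v) = appendZero n (fderiv ℝ f w v) := by
      intro v
      have h2 := hFd.comp w (hasFDerivAt_snocE w τ)
      have h3 : (F ∘ fun w => snocE w τ) = fun w => snocE (f w) τ := funext fun w => hFw w τ
      rw [h3] at h2
      have h4 := (hasFDerivAt_snocE (f w) τ).comp w
        (hf.differentiable (by simp) w).hasFDerivAt
      have h5 := congrArg (fun T : Euc m →L[ℝ] Euc (n + 1) => T v) (h2.unique h4)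
      exact h5
    rw [hcyl, h1]
    ext v
    rw [contractLast_apply, ContinuousAlternatingMap.compContinuousLinearMap_apply]
    change _ = contractLast n k _ fun i => fderiv ℝ f w (v i)
    rw [contractLast_apply]
    congr 1
    funext i
    refine Fin.cases ?_ (fun j => ?_) i
    · simp [hlast]
    · simp [happ]

/-- The integrand of the fibre integral over a shifted arc. -/
theorem IsForm.contractLast_shift (h : IsForm U ξ) {n : ℕ} {p : Euc n → X} (hp : IsPlot p)
    (o τ : ℝ) {w : Euc n} (hw : (p w, z * Circle.exp (2 * Real.pi * (o + τ))) ∈ U) :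
    contractLast n k (ξ (n + 1) (cyl (z * Circle.exp (2 * Real.pi * o)) p) (snocE w τ)) =
      contractLast n k (ξ (n + 1) (cyl z p) (snocE w (o + τ))) := by
  have hcyl : cyl (z * Circle.exp (2 * Real.pi * o)) p =
      cyl z p ∘ fun y => y + o • lastE n := by
    funext y
    simp only [cyl, Function.comp_apply, lastE]
    refine Prod.ext (congrArg p ?_) ?_
    · ext j
      simp [(Fin.castSucc_lt_last j).ne]
    · have h2 : (y + o • lastE n) (Fin.last n) = o + y (Fin.last n) := by
        simp [lastE, add_comm]
      simp only [lastE] at h2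
      rw [h2, circle_exp_add, mul_assoc]
  have hs : snocE w τ + o • lastE n = snocE w (o + τ) := by
    rw [snocE_eq, snocE_eq, add_smul]
    abel
  have h1 := h.natural (n + 1) (n + 1) _ (fun y => y + o • lastE n) (isPlot_cyl z hp)
    (by fun_prop) (snocE w τ) (by rw [hs, cyl_snocE]; exact hw)
  rw [hcyl, h1, hs]
  congr 1
  ext v
  simp [fderiv_add_const]

end

/-! Integrals of 1-forms over an arc. -/

/-- `∫ b` over the arc of length `ℓ` in `{x} × S¹` starting at `z`. -/
def arcInt (z : Circle) (ℓ : ℝ) (b : PreForm (X × Circle) 1) (x : X) : ℝ :=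
  ∫ τ in (0 : ℝ)..ℓ, alongCurve b (fun τ' => (x, z * Circle.exp (2 * Real.pi * τ'))) τ

variable {b b' : PreForm (X × Circle) 1} {x : X}

theorem IsForm.alongCurve_arc (h : IsForm U b) {n : ℕ} {p : Euc n → X} (hp : IsPlot p) {w : Euc n}
    {τ : ℝ} (hw : (p w, z * Circle.exp (2 * Real.pi * τ)) ∈ U) :
    alongCurve b (fun τ' => (p w, z * Circle.exp (2 * Real.pi * τ'))) τ =
      b (n + 1) (cyl z p) (snocE w τ) fun _ => lastE n := by
  have h1 := h.alongCurve_plot (isPlot_cyl z hp) (f := fun τ => snocE w τ)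
    (contDiff_snocE.comp (contDiff_const.prodMk contDiff_id)) (hasDerivAt_snocE w τ)
    (by rw [cyl_snocE]; exact hw)
  simpa only [cyl_snocE] using h1

theorem IsForm.continuousOn_alongCurve (h : IsForm U b) (hx : x ∈ arcSet z ℓ U) :
    ContinuousOn (alongCurve b fun τ' => (x, z * Circle.exp (2 * Real.pi * τ'))) (Icc 0 ℓ) :=
  (h.contDiffOn_alongCurve (isCurve_arc x z)).continuousOn.mono fun τ hτ => hx τ hτ

theorem IsForm.intervalIntegrable_alongCurve (h : IsForm U b) (hℓ : 0 ≤ ℓ)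
    (hx : x ∈ arcSet z ℓ U) : IntervalIntegrable
      (alongCurve b fun τ' => (x, z * Circle.exp (2 * Real.pi * τ'))) MeasureTheory.volume 0 ℓ :=
  (h.continuousOn_alongCurve hx).intervalIntegrable_of_Icc hℓ

theorem arcInt_congr (h : FormEq U b b') (hℓ : 0 ≤ ℓ) (hx : x ∈ arcSet z ℓ U) :
    arcInt z ℓ b x = arcInt z ℓ b' x :=
  intervalIntegral.integral_congr fun τ hτ => by
    rw [uIcc_of_le hℓ] at hτ
    exact h.alongCurve (isCurve_arc x z) (hx τ hτ)

theorem alongCurve_add (b b' : PreForm X 1) (c : ℝ → X) (τ : ℝ) :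
    alongCurve (b + b') c τ = alongCurve b c τ + alongCurve b' c τ := rfl

theorem alongCurve_smul (r : ℝ) (b : PreForm X 1) (c : ℝ → X) (τ : ℝ) :
    alongCurve (r • b) c τ = r * alongCurve b c τ := rfl

theorem arcInt_add (h : IsForm U b) (h' : IsForm U b') (hℓ : 0 ≤ ℓ) (hx : x ∈ arcSet z ℓ U) :
    arcInt z ℓ (b + b') x = arcInt z ℓ b x + arcInt z ℓ b' x := by
  simp only [arcInt, alongCurve_add]
  exact intervalIntegral.integral_add (h.intervalIntegrable_alongCurve hℓ hx)
    (h'.intervalIntegrable_alongCurve hℓ hx)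

theorem arcInt_smul (r : ℝ) (b : PreForm (X × Circle) 1) :
    arcInt z ℓ (r • b) x = r * arcInt z ℓ b x := by
  simp only [arcInt, alongCurve_smul]
  exact intervalIntegral.integral_const_mul _ _

/-- The integral of a 1-form over an arc depends smoothly on `x ∈ X`. -/
theorem contDiffOn_arcInt (hU : DOpen U) (h : IsForm U b) (hℓ : 0 ≤ ℓ) {n : ℕ} {p : Euc n → X}
    (hp : IsPlot p) {w : Euc n} (hw : p w ∈ arcSet z ℓ U) :
    HasFDerivAt (fun w => arcInt z ℓ b (p w))
      (∫ τ in (0 : ℝ)..ℓ, (fderiv ℝ (fun q : Euc n × ℝ =>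
        b (n + 1) (cyl z p) (snocE q.1 q.2) fun _ => lastE n) (w, τ)).comp
          (ContinuousLinearMap.inl ℝ (Euc n) ℝ)) w ∧
    ContDiffAt ℝ ∞ (fun w => arcInt z ℓ b (p w)) w := by
  set Ω := {q : Euc n × ℝ | cyl z p (snocE q.1 q.2) ∈ U} with hΩ
  have hΩo : IsOpen Ω := isOpen_cyl hU z hp
  have hG : ContDiffOn ℝ ∞ (fun q : Euc n × ℝ =>
      b (n + 1) (cyl z p) (snocE q.1 q.2) fun _ => lastE n) Ω :=
    (ContinuousAlternatingMap.apply ℝ (Euc (n + 1)) ℝ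
      (fun _ : Fin 1 => lastE n)).contDiff.comp_contDiffOn
      ((h.smooth (n + 1) _ (isPlot_cyl z hp)).comp contDiff_snocE.contDiffOn fun _ hq => hq)
  have hw' := mem_arcSet_iff.1 hw
  have heq : (fun w => arcInt z ℓ b (p w)) =ᶠ[𝓝 w] fun w =>
      ∫ τ in (0 : ℝ)..ℓ, b (n + 1) (cyl z p) (snocE w τ) fun _ => lastE n := by
    filter_upwards [((dOpen_arcSet hU z ℓ).plot hp).mem_nhds hw] with w hw
    refine intervalIntegral.integral_congr fun τ hτ => ?_
    rw [uIcc_of_le hℓ] at hτ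
    exact h.alongCurve_arc hp (hw τ hτ)
  exact ⟨(hasFDerivAt_integral_of_contDiffOn hΩo hG hℓ hw').congr_of_eventuallyEq heq,
    ((contDiffOn_integral hΩo hG hℓ).contDiffAt
      ((isOpen_forall_mem_Icc hΩo 0 ℓ).mem_nhds hw')).congr_of_eventuallyEq heq⟩

/-- The derivative of `x ↦ ∫ b` over an arc (Stokes' theorem): the boundary terms minus the fibre
integral of `db`. -/
theorem fderiv_arcInt (hU : DOpen U) (h : IsForm U b) (hℓ : 0 ≤ ℓ) {n : ℕ} {p : Euc n → X}
    (hp : IsPlot p) {w : Euc n} (hw : p w ∈ arcSet z ℓ U) (v : Euc n) :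
    fderiv ℝ (fun w => arcInt z ℓ b (p w)) w v =
      (-fibreIntegral z ℓ (d b) + b.pullback (fun x => (x, z * Circle.exp (2 * Real.pi * ℓ)))
        - b.pullback fun x => (x, z)) n p w fun _ => v := by
  set β := b (n + 1) (cyl z p) with hβ
  have hw' := mem_arcSet_iff.1 hw
  have hβd : ∀ τ ∈ Icc 0 ℓ, HasFDerivAt β (fderiv ℝ β (snocE w τ)) (snocE w τ) := fun τ hτ =>
    (h.differentiableAt hU (isPlot_cyl z hp) (hw' τ hτ)).hasFDerivAt
  -- the boundary terms
  have hbd : ∀ τ ∈ Icc 0 ℓ, b n (fun w => (p w, z * Circle.exp (2 * Real.pi * τ))) w (fun _ => v) =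
      β (snocE w τ) fun _ => appendZero n v := by
    intro τ hτ
    have h1 := h.natural n (n + 1) _ (fun w => snocE w τ) (isPlot_cyl z hp)
      (contDiff_snocE.comp (contDiff_id.prodMk contDiff_const)) w (hw' τ hτ)
    have h2 : cyl z p ∘ (fun w => snocE w τ) = fun w => (p w, z * Circle.exp (2 * Real.pi * τ)) :=
      funext fun w => cyl_snocE z p w τ
    rw [h2, (hasFDerivAt_snocE w τ).fderiv] at h1
    rw [h1]
    rfl
  -- derivatives of the components
  have hcomp : ∀ τ ∈ Icc 0 ℓ, ∀ e : Fin 1 → Euc (n + 1), HasFDerivAt (fun y => β y e)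
      ((ContinuousAlternatingMap.apply ℝ (Euc (n + 1)) ℝ e).comp (fderiv ℝ β (snocE w τ)))
      (snocE w τ) := fun τ hτ e =>
    (ContinuousAlternatingMap.apply ℝ (Euc (n + 1)) ℝ e).hasFDerivAt.comp _ (hβd τ hτ)
  have hext : ∀ τ ∈ Icc 0 ℓ, contractLast n 1 (d b (n + 1) (cyl z p) (snocE w τ)) (fun _ => v) =
      fderiv ℝ β (snocE w τ) (lastE n) (fun _ => appendZero n v) -
        fderiv ℝ β (snocE w τ) (appendZero n v) fun _ => lastE n := by
    intro τ hτ
    rw [contractLast_apply]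
    simp only [d]
    rw [extDeriv_apply (hβd τ hτ).differentiableAt, Fin.sum_univ_two]
    rw [(hcomp τ hτ _).fderiv, (hcomp τ hτ _).fderiv]
    simp only [Fin.val_zero, pow_zero, one_smul, Fin.val_one, pow_one, neg_smul,
      ContinuousLinearMap.comp_apply, Matrix.cons_val_zero, Matrix.cons_val_one]
    rw [sub_eq_add_neg]
    refine congrArg₂ (fun a b : ℝ => a + -b) ?_ ?_
    · refine congrArg (fderiv ℝ β (snocE w τ) (lastE n)) ?_
      funext i
      fin_cases i
      rfl
    · refine congrArg (fderiv ℝ β (snocE w τ) (appendZero n v)) ?_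
      funext i
      fin_cases i
      rfl
  -- continuity of the integrands
  have hc1 : ContinuousOn (fun τ => fderiv ℝ β (snocE w τ)) (Icc 0 ℓ) := by
    have h1 := (h.smooth (n + 1) _ (isPlot_cyl z hp)).continuousOn_fderiv_of_isOpen
      (hU.plot (isPlot_cyl z hp)) (by simp)
    exact h1.comp (contDiff_snocE.comp (contDiff_const.prodMk contDiff_id)).continuous.continuousOn
      fun τ hτ => hw' τ hτ
  have hc2 : ∀ e e', ContinuousOn (fun τ => fderiv ℝ β (snocE w τ) e e') (Icc 0 ℓ) := fun e e' =>
    (ContinuousAlternatingMap.apply ℝ (Euc (n + 1)) ℝ e').continuous.comp_continuousOn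
      (hc1.clm_apply continuousOn_const)
  have hi := fun e e' => (hc2 e e').intervalIntegrable_of_Icc hℓ (μ := MeasureTheory.volume)
  -- the derivative in the direction of the arc integrates to the boundary terms
  have hftc : ∫ τ in (0 : ℝ)..ℓ, fderiv ℝ β (snocE w τ) (lastE n) (fun _ => appendZero n v) =
      β (snocE w ℓ) (fun _ => appendZero n v) - β (snocE w 0) fun _ => appendZero n v := by
    refine intervalIntegral.integral_eq_sub_of_hasDerivAt
      (f := fun τ => β (snocE w τ) fun _ => appendZero n v) (fun τ hτ => ?_) (hi _ _)
    rw [uIcc_of_le hℓ] at hτ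
    exact (hcomp τ hτ _).comp_hasDerivAt τ (hasDerivAt_snocE w τ)
  obtain ⟨h1, -⟩ := contDiffOn_arcInt hU h hℓ hp hw
  have hs0 : (fun x : X => (x, z)) = fun x => (x, z * Circle.exp (2 * Real.pi * 0)) := by
    simp
  rw [h1.fderiv]
  simp only [Pi.add_apply, Pi.sub_apply, Pi.neg_apply, ContinuousAlternatingMap.add_apply,
    ContinuousAlternatingMap.sub_apply, ContinuousAlternatingMap.neg_apply, hs0]
  have e1 : b.pullback (fun x : X => (x, z * Circle.exp (2 * Real.pi * ℓ))) n p w (fun _ => v) =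
      β (snocE w ℓ) fun _ => appendZero n v := hbd ℓ ⟨hℓ, le_rfl⟩
  have e2 : b.pullback (fun x : X => (x, z * Circle.exp (2 * Real.pi * 0))) n p w (fun _ => v) =
      β (snocE w 0) fun _ => appendZero n v := hbd 0 ⟨le_rfl, hℓ⟩
  have hdc : ContinuousOn (fun τ => contractLast n 1 (d b (n + 1) (cyl z p) (snocE w τ)))
      (Icc 0 ℓ) :=
    (contractLast n 1).continuous.comp_continuousOn
      ((ContinuousAlternatingMap.alternatizeUncurryFinCLM ℝ (Euc (n + 1)) ℝ
        (n := 1)).continuous.comp_continuousOn hc1)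
  have e3 : fibreIntegral z ℓ (d b) n p w (fun _ => v) =
      ∫ τ in (0 : ℝ)..ℓ, (fderiv ℝ β (snocE w τ) (lastE n) (fun _ => appendZero n v) -
        fderiv ℝ β (snocE w τ) (appendZero n v) fun _ => lastE n) := by
    rw [fibreIntegral_apply]
    have h2 := (ContinuousAlternatingMap.apply ℝ (Euc n) ℝ
      fun _ : Fin 1 => v).intervalIntegral_comp_comm (hdc.intervalIntegrable_of_Icc hℓ
        (μ := MeasureTheory.volume))
    refine Eq.trans h2.symm (intervalIntegral.integral_congr fun τ hτ => ?_)
    rw [uIcc_of_le hℓ] at hτ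
    exact hext τ hτ
  -- the derivative along `X` is the derivative of the integrand of `arcInt`
  have hD : ∀ τ ∈ Icc 0 ℓ, (fderiv ℝ (fun q : Euc n × ℝ =>
      b (n + 1) (cyl z p) (snocE q.1 q.2) fun _ => lastE n) (w, τ)).comp
        (ContinuousLinearMap.inl ℝ (Euc n) ℝ) =
      ((ContinuousAlternatingMap.apply ℝ (Euc (n + 1)) ℝ fun _ : Fin 1 => lastE n).comp
        (fderiv ℝ β (snocE w τ))).comp (appendZero n) := by
    intro τ hτ
    have h2 := (hcomp τ hτ fun _ => lastE n).comp w (hasFDerivAt_snocE w τ)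
    have h3 : DifferentiableAt ℝ (fun q : Euc n × ℝ => β (snocE q.1 q.2) fun _ => lastE n) (w, τ) :=
      DifferentiableAt.comp (g := fun y => β y fun _ => lastE n)
        (f := fun q : Euc n × ℝ => snocE q.1 q.2) (w, τ)
        (hcomp τ hτ fun _ => lastE n).differentiableAt
        (contDiff_snocE.differentiable (by simp) _)
    have h4 : HasFDerivAt (fun w : Euc n => β (snocE w τ) fun _ => lastE n) _ w :=
      HasFDerivAt.comp (g := fun q : Euc n × ℝ => β (snocE q.1 q.2) fun _ => lastE n)
        (f := fun w : Euc n => (w, τ)) w h3.hasFDerivAt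
        ((hasFDerivAt_id w).prodMk (hasFDerivAt_const τ w))
    exact h4.unique h2
  rw [e1, e2, e3, intervalIntegral.integral_sub (hi _ _) (hi _ _), hftc,
    intervalIntegral.integral_congr (g := fun τ =>
      ((ContinuousAlternatingMap.apply ℝ (Euc (n + 1)) ℝ fun _ : Fin 1 => lastE n).comp
        (fderiv ℝ β (snocE w τ))).comp (appendZero n)) (fun τ hτ => by
          rw [uIcc_of_le hℓ] at hτ
          exact hD τ hτ)]
  have hint : IntervalIntegrable (fun τ =>
      ((ContinuousAlternatingMap.apply ℝ (Euc (n + 1)) ℝ fun _ : Fin 1 => lastE n).comp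
        (fderiv ℝ β (snocE w τ))).comp (appendZero n)) MeasureTheory.volume 0 ℓ :=
    ((continuousOn_const.clm_comp hc1).clm_comp continuousOn_const).intervalIntegrable_of_Icc hℓ
  rw [ContinuousLinearMap.intervalIntegral_apply hint]
  simp only [ContinuousLinearMap.comp_apply, ContinuousAlternatingMap.apply_apply]
  ring

theorem coe_circle_exp (r : ℝ) : (Circle.exp (2 * Real.pi * r) : ℂ) =
    Complex.exp (2 * Real.pi * r * Complex.I) := by
  rw [Circle.coe_exp]
  push_cast
  rfl

theorem hasDerivAt_circle_exp (r : ℝ) :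
    HasDerivAt (fun r : ℝ => (Circle.exp r : ℂ)) ((Circle.exp r : ℂ) * Complex.I) r := by
  simp only [Circle.coe_exp]
  simpa using (((hasDerivAt_id r).ofReal_comp).mul_const Complex.I).cexp

theorem unitOn_exp_arcInt (hU : DOpen U) (h : IsForm U b) (hℓ : 0 ≤ ℓ) :
    UnitOn (arcSet z ℓ U) fun x => (Circle.exp (2 * Real.pi * arcInt z ℓ b x) : ℂ) := by
  refine ⟨fun n p hp w hw => ?_, fun x _ => Circle.norm_coe _⟩
  obtain ⟨-, h2⟩ := contDiffOn_arcInt hU h hℓ hp hw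
  simp only [coe_circle_exp]
  refine ContDiffAt.contDiffWithinAt ?_
  refine ContDiffAt.cexp (ContDiffAt.mul (contDiffAt_const.mul ?_) contDiffAt_const)
  exact Complex.ofRealCLM.contDiff.contDiffAt.comp w h2

/-- The logarithmic derivative of `exp(2πi ∫ b)`. -/
theorem dlog_exp_arcInt (hU : DOpen U) (h : IsForm U b) (hℓ : 0 ≤ ℓ) :
    FormEq (arcSet z ℓ U)
      (dlog fun x => (Circle.exp (2 * Real.pi * arcInt z ℓ b x) : ℂ))
      ((2 * Real.pi) • (-fibreIntegral z ℓ (d b)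
        + b.pullback (fun x => (x, z * Circle.exp (2 * Real.pi * ℓ)))
        - b.pullback fun x => (x, z))) := by
  intro n p hp w hw
  ext v
  have hv : v = fun _ => v 0 := funext fun i => by rw [Subsingleton.elim i 0]
  obtain ⟨h1, -⟩ := contDiffOn_arcInt hU h hℓ hp hw
  have h2 := HasFDerivAt.comp (f := fun w => 2 * Real.pi * arcInt z ℓ b (p w)) w
    (hasDerivAt_circle_exp (2 * Real.pi * arcInt z ℓ b (p w))).hasFDerivAt
    (h1.differentiableAt.hasFDerivAt.const_mul (2 * Real.pi))
  have h3 : fderiv ℝ (fun w => (Circle.exp (2 * Real.pi * arcInt z ℓ b (p w)) : ℂ)) w (v 0) =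
      (2 * Real.pi * fderiv ℝ (fun w => arcInt z ℓ b (p w)) w (v 0) : ℝ) •
        ((Circle.exp (2 * Real.pi * arcInt z ℓ b (p w)) : ℂ) * Complex.I) :=
    congrArg (fun T : Euc n →L[ℝ] ℂ => T (v 0)) h2.fderiv
  rw [dlog_apply, h3, fderiv_arcInt hU h hℓ hp hw, mul_smul_comm, ← mul_assoc,
    conj_mul_self_of_norm (Circle.norm_coe _), one_mul, Complex.smul_im, Complex.I_im, smul_eq_mul,
    mul_one]
  conv_rhs => rw [hv]
  rfl

/-- The holonomy of `(1/i) d log g` along an arc. -/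
theorem exp_arcInt_dlog {g : X × Circle → Circle} (hU : DOpen U)
    (hg : SmoothOn U fun y => (g y : ℂ)) (hℓ : 0 ≤ ℓ) {x : X} (hx : x ∈ arcSet z ℓ U) :
    Circle.exp (arcInt z ℓ (dlog fun y => (g y : ℂ)) x) =
      g (x, z * Circle.exp (2 * Real.pi * ℓ)) * (g (x, z))⁻¹ := by
  have hgu := unitOn_circle hg
  have hc := (hgu.isForm_dlog hU).continuousOn_alongCurve hx
  have h1 := eq_exp_integral_of_hasDerivWithinAt hc.neg
    (y := fun τ => (g (x, z * Circle.exp (2 * Real.pi * τ)) : ℂ)) (fun τ hτ => by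
      have := (hgu.hasDerivAt_curve hU (isCurve_arc x z) (hx τ hτ)).hasDerivWithinAt
        (s := Icc 0 ℓ)
      simpa using this) ℓ ⟨hℓ, le_rfl⟩
  rw [eq_mul_inv_iff_mul_eq]
  refine Circle.ext ?_
  rw [Circle.coe_mul, h1]
  simp [arcInt]

/-! Subdivision of an arc. -/

theorem IsForm.alongCurve_arc_shift (h : IsForm U b) (o : ℝ) {τ : ℝ}
    (hx : (x, z * Circle.exp (2 * Real.pi * (o + τ))) ∈ U) :
    alongCurve b (fun τ' => (x, z * Circle.exp (2 * Real.pi * o) *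
      Circle.exp (2 * Real.pi * τ'))) τ =
    alongCurve b (fun τ' => (x, z * Circle.exp (2 * Real.pi * τ'))) (o + τ) := by
  have hf : HasDerivAt (fun τ => (EuclideanSpace.single 0 (o + τ) : Euc 1))
      (EuclideanSpace.single 0 1) τ := (hasDerivAt_single_one (o + τ)).comp_const_add o τ
  have h1 := h.alongCurve_plot (isCurve_arc x z) (f := fun τ => EuclideanSpace.single 0 (o + τ))
    (contDiff_single_one.comp (contDiff_const.add contDiff_id)) hf (by simpa using hx)
  simp only [PiLp.single_apply, if_true] at h1
  have e : ∀ τ', z * Circle.exp (2 * Real.pi * o) * Circle.exp (2 * Real.pi * τ') =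
      z * Circle.exp (2 * Real.pi * (o + τ')) := fun τ' => by rw [circle_exp_add, _root_.mul_assoc]
  simp only [e]
  exact h1

theorem arcSet_arcSum_subset (Q : Subdivision) (i : ZMod Q.n) {m m' : ℕ} (h : m ≤ m') :
    arcSet (Q.t i) (Q.arcSum i m') U ⊆ arcSet (Q.t i) (Q.arcSum i m) U :=
  fun _ hx τ hτ => hx τ ⟨hτ.1, hτ.2.trans (Q.arcSum_mono i h)⟩

/-- The integral over `m` successive arcs is the sum of the integrals over these arcs. -/
theorem arcInt_arcSum (h : IsForm U b) (Q : Subdivision) (i : ZMod Q.n) (m : ℕ)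
    (hx : x ∈ arcSet (Q.t i) (Q.arcSum i m) U) :
    arcInt (Q.t i) (Q.arcSum i m) b x =
      ∑ l ∈ Finset.range m, arcInt (Q.t (i + (l : ZMod Q.n))) (Q.len (i + (l : ZMod Q.n))) b x := by
  induction m with
  | zero => simp [arcInt, Q.arcSum_zero]
  | succ m ih =>
    have hc := h.continuousOn_alongCurve hx
    have hle := Q.arcSum_mono i (Nat.le_succ m)
    have h0 := Q.arcSum_nonneg i m
    rw [Finset.sum_range_succ, ← ih (arcSet_arcSum_subset Q i (Nat.le_succ m) hx)]
    simp only [arcInt]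
    rw [← intervalIntegral.integral_add_adjacent_intervals
      ((hc.mono (Icc_subset_Icc_right hle)).intervalIntegrable_of_Icc h0)
      ((hc.mono (Icc_subset_Icc_left h0)).intervalIntegrable_of_Icc hle), add_right_inj]
    have e := intervalIntegral.integral_comp_add_left (a := 0) (b := Q.len (i + (m : ZMod Q.n)))
      (alongCurve b fun τ' => (x, Q.t i * Circle.exp (2 * Real.pi * τ'))) (Q.arcSum i m)
    rw [add_zero, ← Q.arcSum_succ] at e
    rw [← e]
    refine intervalIntegral.integral_congr fun τ hτ => ?_
    rw [uIcc_of_le (Q.len_pos _).le] at hτ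
    simp only [Q.t_add]
    exact (h.alongCurve_arc_shift _ (hx _ ⟨add_nonneg h0 hτ.1, by
      rw [Q.arcSum_succ]; exact add_le_add_right hτ.2 _⟩)).symm

/-- The fibre integral over `m` successive arcs is the sum of the fibre integrals over these arcs. -/
theorem fibreIntegral_arcSum {k : ℕ} {ξ : PreForm (X × Circle) (k + 1)} (h : IsForm U ξ)
    (Q : Subdivision) (i : ZMod Q.n) (m : ℕ) :
    FormEq (arcSet (Q.t i) (Q.arcSum i m) U) (fibreIntegral (Q.t i) (Q.arcSum i m) ξ)
      (∑ l ∈ Finset.range m,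
        fibreIntegral (Q.t (i + (l : ZMod Q.n))) (Q.len (i + (l : ZMod Q.n))) ξ) := by
  intro n p hp w hw
  induction m with
  | zero =>
    rw [fibreIntegral_apply, Q.arcSum_zero, intervalIntegral.integral_same,
      Finset.sum_range_zero]
    rfl
  | succ m ih =>
    have hc : ContinuousOn (fun τ => contractLast n k (ξ (n + 1) (cyl (Q.t i) p) (snocE w τ)))
        (Icc 0 (Q.arcSum i (m + 1))) :=
      continuousOn_slice (h.contDiffOn_contractLast hp).continuousOn (mem_arcSet_iff.1 hw)
    have hle := Q.arcSum_mono i (Nat.le_succ m)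
    have h0 := Q.arcSum_nonneg i m
    rw [Finset.sum_range_succ, Pi.add_apply, Pi.add_apply, Pi.add_apply,
      ← ih (arcSet_arcSum_subset Q i (Nat.le_succ m) hw)]
    rw [fibreIntegral_apply, fibreIntegral_apply, fibreIntegral_apply,
      ← intervalIntegral.integral_add_adjacent_intervals
      ((hc.mono (Icc_subset_Icc_right hle)).intervalIntegrable_of_Icc h0)
      ((hc.mono (Icc_subset_Icc_left h0)).intervalIntegrable_of_Icc hle), add_right_inj]
    have e := intervalIntegral.integral_comp_add_left (a := 0) (b := Q.len (i + (m : ZMod Q.n)))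
      (fun τ => contractLast n k (ξ (n + 1) (cyl (Q.t i) p) (snocE w τ))) (Q.arcSum i m)
    rw [add_zero, ← Q.arcSum_succ] at e
    rw [← e]
    refine intervalIntegral.integral_congr fun τ hτ => ?_
    rw [uIcc_of_le (Q.len_pos _).le] at hτ
    simp only [Q.t_add]
    exact (h.contractLast_shift hp _ _ (hw _ ⟨add_nonneg h0 hτ.1, by
      rw [Q.arcSum_succ]; exact add_le_add_right hτ.2 _⟩)).symm

section

variable {k : ℕ} {ξ η : PreForm (X × Circle) (k + 1)}

theorem fibreIntegral_congr (h : FormEq U ξ η) (hℓ : 0 ≤ ℓ) :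
    FormEq (arcSet z ℓ U) (fibreIntegral z ℓ ξ) (fibreIntegral z ℓ η) := by
  intro n p hp w hw
  rw [fibreIntegral_apply, fibreIntegral_apply]
  refine intervalIntegral.integral_congr fun τ hτ => ?_
  rw [uIcc_of_le hℓ] at hτ
  rw [h (n + 1) _ (isPlot_cyl z hp) _ (mem_arcSet_iff.1 hw τ hτ)]

theorem fibreIntegral_neg (ξ : PreForm (X × Circle) (k + 1)) :
    fibreIntegral z ℓ (-ξ) = -fibreIntegral z ℓ ξ := by
  funext n p w
  simp only [Pi.neg_apply, fibreIntegral_apply, map_neg, intervalIntegral.integral_neg]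

theorem fibreIntegral_add (h : IsForm U ξ) (h' : IsForm U η) (hℓ : 0 ≤ ℓ) :
    FormEq (arcSet z ℓ U) (fibreIntegral z ℓ (ξ + η))
      (fibreIntegral z ℓ ξ + fibreIntegral z ℓ η) := by
  intro n p hp w hw
  simp only [Pi.add_apply, fibreIntegral_apply, map_add]
  exact intervalIntegral.integral_add (h.intervalIntegrable_contractLast hp hℓ hw)
    (h'.intervalIntegrable_contractLast hp hℓ hw)

theorem fibreIntegral_sub (h : IsForm U ξ) (h' : IsForm U η) (hℓ : 0 ≤ ℓ) :
    FormEq (arcSet z ℓ U) (fibreIntegral z ℓ (ξ - η))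
      (fibreIntegral z ℓ ξ - fibreIntegral z ℓ η) := by
  rw [sub_eq_add_neg, sub_eq_add_neg, ← fibreIntegral_neg]
  exact fibreIntegral_add h h'.neg hℓ

end

/-- A Lebesgue number for the restriction of an open covering of `X × S¹` to `{x} × S¹`. -/
theorem exists_lebesgue {ι : Type*} {O : ι → Set (X × Circle)} (hO : ∀ i, DOpen (O i))
    (hcov : ∀ y, ∃ i, y ∈ O i) (x : X) : ∃ ε > 0, ∀ τ : ℝ, ∃ i, ∀ τ', |τ' - τ| < ε →
      (x, Circle.exp (2 * Real.pi * τ')) ∈ O i := by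
  set c : ℝ → X × Circle := fun τ => (x, Circle.exp (2 * Real.pi * τ)) with hcdef
  have hc : IsCurve c := by simpa using isCurve_arc x 1
  obtain ⟨ε, hε, h⟩ := lebesgue_number_lemma_of_metric (isCompact_Icc (a := (0 : ℝ)) (b := 1))
    (c := fun i => c ⁻¹' O i) (fun i => hc.isOpen_preimage (hO i)) fun τ _ =>
      mem_iUnion.2 (hcov (c τ))
  refine ⟨ε, hε, fun τ => ?_⟩
  obtain ⟨i, hi⟩ := h (Int.fract τ) ⟨Int.fract_nonneg τ, (Int.fract_lt_one τ).le⟩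
  refine ⟨i, fun τ' hτ' => ?_⟩
  have h1 : c (τ' - ⌊τ⌋) = c τ' := by
    simp only [hcdef]
    refine Prod.ext rfl (Circle.exp_eq_exp.2 ⟨-⌊τ⌋, ?_⟩)
    push_cast
    ring
  have h2 := hi (show τ' - ⌊τ⌋ ∈ Metric.ball (Int.fract τ) ε by
    rw [Metric.mem_ball, Real.dist_eq, Int.fract]
    convert hτ' using 2
    ring)
  rw [mem_preimage, h1] at h2
  exact h2

end ArcIntegral

/-! ### Products and sums over the arcs of a subdivision -/

section ArcProd

variable {X : Type u} [DiffeologicalSpace X] (Q : Subdivision)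

theorem Subdivision.prod_shift {M : Type*} [CommMonoid M] (F : ZMod Q.n → M) :
    ∏ i, F (i + 1) = ∏ i, F i := Equiv.prod_comp (Equiv.addRight (1 : ZMod Q.n)) F

theorem Subdivision.sum_shift {M : Type*} [AddCommMonoid M] (F : ZMod Q.n → M) :
    ∑ i, F (i + 1) = ∑ i, F i := Equiv.sum_comp (Equiv.addRight (1 : ZMod Q.n)) F

/-- The points `x` for which the `i`-th arc of `{x} × S¹` lies in `U i`, for all `i`. -/
def arcDom (U : ZMod Q.n → Set (X × Circle)) : Set X :=
  {x | ∀ i, x ∈ arcSet (Q.t i) (Q.len i) (U i)}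

/-- `∏ᵢ exp(2πi ∫_{[t(i),t(i+1)]} bᵢ) gᵢ(x, t(i+1))`. -/
def arcProd (b : ZMod Q.n → PreForm (X × Circle) 1) (g : ZMod Q.n → X × Circle → Circle) (x : X) :
    Circle :=
  ∏ i, Circle.exp (2 * Real.pi * arcInt (Q.t i) (Q.len i) (b i) x) * g i (x, Q.t (i + 1))

/-- `-∑ᵢ ∫_{[t(i),t(i+1)]} fᵢ - ∑ᵢ aᵢ|_{t(i+1)}`. -/
def arcForm (f : ZMod Q.n → PreForm (X × Circle) 2) (a : ZMod Q.n → PreForm (X × Circle) 1) :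
    PreForm X 1 :=
  -(∑ i, fibreIntegral (Q.t i) (Q.len i) (f i)) - ∑ i, (a i).pullback fun x => (x, Q.t (i + 1))

variable {Q} {U V : ZMod Q.n → Set (X × Circle)} {b b' : ZMod Q.n → PreForm (X × Circle) 1}
  {g g' h : ZMod Q.n → X × Circle → Circle} {x : X}

theorem dOpen_arcDom (hU : ∀ i, DOpen (U i)) : DOpen (arcDom Q U) := by
  have : arcDom Q U = ⋂ i, arcSet (Q.t i) (Q.len i) (U i) := by
    ext x
    simp [arcDom]
  rw [this]
  exact DOpen.iInter fun i => dOpen_arcSet (hU i) _ _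

theorem mem_start_of_mem_arcDom (hx : x ∈ arcDom Q U) (i : ZMod Q.n) : (x, Q.t i) ∈ U i := by
  have := hx i 0 ⟨le_rfl, (Q.len_pos i).le⟩
  simpa using this

theorem mem_end_of_mem_arcDom (hx : x ∈ arcDom Q U) (i : ZMod Q.n) : (x, Q.t (i + 1)) ∈ U i := by
  rw [Q.t_succ]
  exact hx i _ ⟨(Q.len_pos i).le, le_rfl⟩

theorem arcProd_mul (hb : ∀ i, IsForm (U i) (b i)) (hb' : ∀ i, IsForm (U i) (b' i))
    (hx : x ∈ arcDom Q U) :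
    arcProd Q b g x * arcProd Q b' g' x = arcProd Q (b + b') (fun i y => g i y * g' i y) x := by
  rw [arcProd, arcProd, arcProd, ← Finset.prod_mul_distrib]
  refine Finset.prod_congr rfl fun i _ => ?_
  rw [Pi.add_apply, arcInt_add (hb i) (hb' i) (Q.len_pos i).le (hx i), circle_exp_add]
  exact mul_mul_mul_comm _ _ _ _

/-- Adding `(1/2πi) d log hᵢ` to `bᵢ` is compensated by the values of `hᵢ` at the ends of the
arcs. -/
theorem arcProd_gauge (hU : ∀ i, DOpen (U i)) (hb : ∀ i, IsForm (U i) (b i))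
    (hh : ∀ i, SmoothOn (U i) fun y => (h i y : ℂ))
    (hbb' : ∀ i, FormEq (U i) (b' i) (b i + (1 / (2 * Real.pi)) • dlog fun y => (h i y : ℂ)))
    (hx : x ∈ arcDom Q U)
    (hg : ∀ i, g i (x, Q.t (i + 1)) =
      g' i (x, Q.t (i + 1)) * h i (x, Q.t (i + 1)) * (h (i + 1) (x, Q.t (i + 1)))⁻¹) :
    arcProd Q b g x = arcProd Q b' g' x := by
  have h1 : ∀ i, Circle.exp (2 * Real.pi * arcInt (Q.t i) (Q.len i) (b' i) x) =
      Circle.exp (2 * Real.pi * arcInt (Q.t i) (Q.len i) (b i) x) *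
        (h i (x, Q.t (i + 1)) * (h i (x, Q.t i))⁻¹) := by
    intro i
    have hl := (Q.len_pos i).le
    rw [arcInt_congr (hbb' i) hl (hx i), arcInt_add (hb i)
      (((unitOn_circle (hh i)).isForm_dlog (hU i)).smul _) hl (hx i), arcInt_smul, circle_exp_add,
      ← mul_assoc (2 * Real.pi), mul_one_div_cancel two_pi_ne_zero, one_mul,
      exp_arcInt_dlog (hU i) (hh i) hl (hx i), Q.t_succ]
  -- the integral of `d log hᵢ` gives the values of `hᵢ` at both ends of the arc; by a shift of the
  -- index the inverse values at the initial points `t(i)` are collected at the points `t(i+1)`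
  have h2 := Q.prod_shift fun i => (h i (x, Q.t i))⁻¹
  calc arcProd Q b g x
      = (∏ i, Circle.exp (2 * Real.pi * arcInt (Q.t i) (Q.len i) (b i) x) *
          g' i (x, Q.t (i + 1)) * h i (x, Q.t (i + 1))) *
            ∏ i, (h (i + 1) (x, Q.t (i + 1)))⁻¹ := by
        rw [arcProd, ← Finset.prod_mul_distrib]
        refine Finset.prod_congr rfl fun i _ => ?_
        rw [hg i]
        simp only [mul_assoc]
    _ = arcProd Q b' g' x := by
        rw [h2, arcProd, ← Finset.prod_mul_distrib]
        refine Finset.prod_congr rfl fun i _ => ?_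
        rw [h1 i]
        apply Additive.ofMul.injective
        simp only [ofMul_mul, ofMul_inv]
        abel

variable {O : Set X}

/-- The logarithmic derivative of `arcProd`: by Stokes' formula an arc contributes the fibre
integral of `d bᵢ` and the values of `bᵢ` at its ends, and the latter are collected at the points of
division. -/
theorem unitOn_arcProd (hU : ∀ i, DOpen (U i)) (hb : ∀ i, IsForm (U i) (b i))
    (hg : ∀ i, SmoothOn (V i) fun y => (g i y : ℂ)) (hO : DOpen O) (hOU : O ⊆ arcDom Q U)
    (hOV : ∀ x ∈ O, ∀ i, (x, Q.t (i + 1)) ∈ V i) :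
    UnitOn O (fun x => (arcProd Q b g x : ℂ)) ∧
    FormEq O (dlog fun x => (arcProd Q b g x : ℂ))
      ((2 * Real.pi) • arcForm Q (fun i => d (b i))
        fun i => b (i + 1) - b i - (1 / (2 * Real.pi)) • dlog fun y => (g i y : ℂ)) := by
  have h1 : ∀ i, UnitOn O fun x =>
      (Circle.exp (2 * Real.pi * arcInt (Q.t i) (Q.len i) (b i) x) : ℂ) := fun i =>
    (unitOn_exp_arcInt (hU i) (hb i) (Q.len_pos i).le).mono fun x hx => hOU hx i
  have h2 : ∀ i, UnitOn O fun x => (g i (x, Q.t (i + 1)) : ℂ) := fun i =>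
    (unitOn_circle (((hg i).pullback (dSmooth_prodMk (Q.t (i + 1)))).mono fun x hx => hOV x hx i))
  have h3 := dlog_prod hO Finset.univ fun i _ => (h1 i).mul (h2 i)
  have e : (fun x => (arcProd Q b g x : ℂ)) = fun x => ∏ i,
      (Circle.exp (2 * Real.pi * arcInt (Q.t i) (Q.len i) (b i) x) : ℂ) *
        g i (x, Q.t (i + 1)) := by
    funext x
    simp only [arcProd]
    exact (map_prod Circle.coeHom _ _).trans (Finset.prod_congr rfl fun i _ => Circle.coe_mul _ _)
  rw [e]
  refine ⟨h3.1, fun n p hp w hw => ?_⟩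
  rw [h3.2 n p hp w hw]
  have h4 : ∀ i, (dlog fun x => (Circle.exp (2 * Real.pi * arcInt (Q.t i) (Q.len i) (b i) x) : ℂ) *
      g i (x, Q.t (i + 1))) n p w =
      (2 * Real.pi) • (-fibreIntegral (Q.t i) (Q.len i) (d (b i)) n p w
        + (b i).pullback (fun x => (x, Q.t (i + 1))) n p w
        - (b i).pullback (fun x => (x, Q.t i)) n p w)
      + (dlog fun y => (g i y : ℂ)).pullback (fun x => (x, Q.t (i + 1))) n p w := by
    intro i
    have h5 := dlog_mul hO (h1 i) (h2 i) n p hp w hw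
    have h6 := dlog_exp_arcInt (hU i) (hb i) (Q.len_pos i).le n p hp w (hOU hw i)
    rw [← Q.t_succ] at h6
    rw [h5, Pi.add_apply, Pi.add_apply, Pi.add_apply, h6]
    rfl
  have h7 := Q.sum_shift fun i => (b i).pullback (fun x : X => (x, Q.t i)) n p w
  rw [preForm_sum_apply]
  simp only [h4]
  simp only [arcForm, Pi.smul_apply, Pi.sub_apply, Pi.neg_apply, preForm_sum_apply]
  have h8 : ∀ i, PreForm.pullback (fun x : X => (x, Q.t (i + 1)))
      (b (i + 1) - b i - (1 / (2 * Real.pi)) • dlog fun y => (g i y : ℂ)) n p w =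
      (b (i + 1)).pullback (fun x => (x, Q.t (i + 1))) n p w
        - (b i).pullback (fun x => (x, Q.t (i + 1))) n p w
        - (1 / (2 * Real.pi)) •
          (dlog fun y => (g i y : ℂ)).pullback (fun x => (x, Q.t (i + 1))) n p w := fun i => rfl
  simp only [h8, Finset.sum_sub_distrib, Finset.sum_add_distrib, ← Finset.smul_sum,
    Finset.sum_neg_distrib, h7, smul_sub, smul_add, smul_neg, smul_smul,
    mul_one_div_cancel two_pi_ne_zero, one_smul]
  module

/-- `arcForm` is additive, up to agreement of forms on the sets which contain the arcs and the
points of division. -/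
theorem arcForm_sub {f f₁ f₂ : ZMod Q.n → PreForm (X × Circle) 2}
    {a a₁ a₂ : ZMod Q.n → PreForm (X × Circle) 1}
    (hf : ∀ i, FormEq (U i) (f i) (f₁ i - f₂ i)) (hf₁ : ∀ i, IsForm (U i) (f₁ i))
    (hf₂ : ∀ i, IsForm (U i) (f₂ i)) (ha : ∀ i, FormEq (V i) (a i) (a₁ i - a₂ i))
    (hOU : O ⊆ arcDom Q U) (hOV : ∀ x ∈ O, ∀ i, (x, Q.t (i + 1)) ∈ V i) :
    FormEq O (arcForm Q f a) (arcForm Q f₁ a₁ - arcForm Q f₂ a₂) := by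
  intro n p hp w hw
  simp only [arcForm, Pi.sub_apply, Pi.neg_apply, preForm_sum_apply]
  have h1 : ∀ i, fibreIntegral (Q.t i) (Q.len i) (f i) n p w =
      fibreIntegral (Q.t i) (Q.len i) (f₁ i) n p w -
        fibreIntegral (Q.t i) (Q.len i) (f₂ i) n p w := fun i =>
    (fibreIntegral_congr (hf i) (Q.len_pos i).le n p hp w (hOU hw i)).trans
      (fibreIntegral_sub (hf₁ i) (hf₂ i) (Q.len_pos i).le n p hp w (hOU hw i))
  have h2 : ∀ i, (a i).pullback (fun x : X => (x, Q.t (i + 1))) n p w =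
      (a₁ i).pullback (fun x : X => (x, Q.t (i + 1))) n p w -
        (a₂ i).pullback (fun x : X => (x, Q.t (i + 1))) n p w := fun i =>
    (ha i).pullback (dSmooth_prodMk _) n p hp w (hOV _ hw i)
  simp only [h1, h2, Finset.sum_sub_distrib]
  abel

theorem isForm_arcForm {f : ZMod Q.n → PreForm (X × Circle) 2}
    {a : ZMod Q.n → PreForm (X × Circle) 1} (hU : ∀ i, DOpen (U i))
    (hf : ∀ i, IsForm (U i) (f i)) (ha : ∀ i, IsForm (V i) (a i)) (hOU : O ⊆ arcDom Q U)
    (hOV : ∀ x ∈ O, ∀ i, (x, Q.t (i + 1)) ∈ V i) : IsForm O (arcForm Q f a) :=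
  (IsForm.sum _ fun i _ => ((hf i).fibreIntegral (hU i) (Q.len_pos i).le).mono
    fun _ hx => hOU hx i).neg.sub (IsForm.sum _ fun i _ =>
      ((ha i).pullback (dSmooth_prodMk _)).mono fun x hx => hOV x hx i)

end ArcProd

section Refine

variable {X : Type u} [DiffeologicalSpace X] {P Q : Subdivision} (R : P.Refinement Q)
  {U : ZMod P.n → Set (X × Circle)} {x : X}

theorem arcDom_subset_refine : arcDom P U ⊆ arcDom Q fun i => U (R.idx i) := by
  intro x hx i τ hτ
  obtain ⟨o, ho, ho', h⟩ := R.exists_offset i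
  have := hx (R.idx i) (o + τ) ⟨add_nonneg ho hτ.1, by linarith [hτ.2]⟩
  change (x, P.point (R.idx i) (o + τ)) ∈ _ at this
  rwa [← h] at this

theorem mem_arcSet_refine (hx : x ∈ arcDom P U) (j : ZMod P.n) :
    x ∈ arcSet (Q.t (R.r j)) (Q.arcSum (R.r j) (R.k j + 1)) (U j) := by
  rw [R.t_eq, ← R.len_eq]
  exact hx j

theorem mem_of_mem_arcDom_refine (hx : x ∈ arcDom P U) (j : ZMod P.n) {l : ℕ} (hl : l ≤ R.k j) :
    (x, Q.t (R.r j + (l : ZMod Q.n) + 1)) ∈ U j := by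
  have h := mem_end_of_mem_arcDom (arcDom_subset_refine R hx) (R.r j + (l : ZMod Q.n))
  simpa only [R.idx_add j hl] using h

/-- `arcProd` does not change under a refinement with the labels carried along: the factors at the
new points of division are trivial. -/
theorem arcProd_refine {b : ZMod P.n → PreForm (X × Circle) 1}
    {g : ZMod P.n → ZMod P.n → X × Circle → Circle} (hb : ∀ j, IsForm (U j) (b j))
    (hg : ∀ j, ∀ y ∈ U j, g j j y = 1) (hx : x ∈ arcDom P U) :
    arcProd Q (fun i => b (R.idx i)) (fun i => g (R.idx i) (R.idx (i + 1))) x =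
      arcProd P b (fun j => g j (j + 1)) x := by
  rw [arcProd, R.prod_eq, arcProd]
  refine Finset.prod_congr rfl fun j _ => ?_
  rw [Finset.prod_mul_distrib]
  refine congrArg₂ (· * ·) ?_ ?_
  · have h1 := arcInt_arcSum (hb j) Q (R.r j) (R.k j + 1) (mem_arcSet_refine R hx j)
    rw [R.t_eq, ← R.len_eq] at h1
    have h2 : ∀ (s : Finset ℕ) (F : ℕ → ℝ), Circle.exp (2 * Real.pi * ∑ l ∈ s, F l) =
        ∏ l ∈ s, Circle.exp (2 * Real.pi * F l) := by
      intro s F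
      induction s using Finset.induction_on with
      | empty => simp
      | insert a s ha ih => rw [Finset.sum_insert ha, Finset.prod_insert ha, circle_exp_add, ih]
    rw [h1, h2]
    refine Finset.prod_congr rfl fun l hl => ?_
    rw [R.idx_add j (Nat.lt_succ_iff.1 (Finset.mem_range.1 hl))]
  · rw [Finset.prod_range_succ, Finset.prod_eq_one fun l hl => ?_, one_mul, R.idx_last,
      R.idx_last_succ, R.t_last_succ]
    have hl' := Finset.mem_range.1 hl
    have h3 : R.idx (R.r j + (l : ZMod Q.n) + 1) = j := by
      rw [add_assoc, ← Nat.cast_succ, R.idx_add j hl']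
    rw [R.idx_add j hl'.le, h3]
    exact hg j _ (mem_of_mem_arcDom_refine R hx j hl'.le)

/-- `arcForm` does not change under a refinement with the labels carried along. -/
theorem arcForm_refine {f : ZMod P.n → PreForm (X × Circle) 2}
    {a : ZMod P.n → ZMod P.n → PreForm (X × Circle) 1} (hf : ∀ j, IsForm (U j) (f j))
    (ha : ∀ j, FormEq (U j) (a j j) 0) :
    FormEq (arcDom P U) (arcForm Q (fun i => f (R.idx i)) fun i => a (R.idx i) (R.idx (i + 1)))
      (arcForm P f fun j => a j (j + 1)) := by
  intro n p hp w hw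
  simp only [arcForm, Pi.sub_apply, Pi.neg_apply, preForm_sum_apply]
  rw [R.sum_eq, R.sum_eq]
  refine congrArg₂ (fun a b => -a - b) ?_ ?_
  · refine Finset.sum_congr rfl fun j _ => ?_
    have h1 := fibreIntegral_arcSum (hf j) Q (R.r j) (R.k j + 1) n p hp w
      (mem_arcSet_refine R hw j)
    rw [R.t_eq, ← R.len_eq] at h1
    rw [h1, preForm_sum_apply]
    refine Finset.sum_congr rfl fun l hl => ?_
    rw [R.idx_add j (Nat.lt_succ_iff.1 (Finset.mem_range.1 hl))]
  · refine Finset.sum_congr rfl fun j _ => ?_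
    rw [Finset.sum_range_succ, Finset.sum_eq_zero fun l hl => ?_, zero_add, R.idx_last,
      R.idx_last_succ, R.t_last_succ]
    have hl' := Finset.mem_range.1 hl
    have h3 : R.idx (R.r j + (l : ZMod Q.n) + 1) = j := by
      rw [add_assoc, ← Nat.cast_succ, R.idx_add j hl']
    rw [R.idx_add j hl'.le, h3]
    exact (ha j).pullback (dSmooth_prodMk _) n p hp w (mem_of_mem_arcDom_refine R hw j hl'.le)

end Refine

/-! ### The fibre integral of a cocycle -/

section FibreTransition

variable {X : Type u} [DiffeologicalSpace X] (c : Cocycle2 (X × Circle)) {Q : Subdivision}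

/-- The points `x` for which the `i`-th arc of `{x} × S¹` lies in `U_{s(i)}`. -/
def fibreDom (Q : Subdivision) (s : ZMod Q.n → c.I) : Set X := arcDom Q fun i => c.U (s i)

/-- The 1-form part of the fibre integral. -/
def fibreForm (Q : Subdivision) (s : ZMod Q.n → c.I) : PreForm X 1 :=
  arcForm Q (fun i => c.f (s i)) fun i => c.a (s i) (s (i + 1))

variable {c} {s s' s'' : ZMod Q.n → c.I} {x : X}

theorem dOpen_fibreDom : DOpen (fibreDom c Q s) := dOpen_arcDom fun i => c.U_open (s i)

theorem mem_of_mem_fibreDom (hx : x ∈ fibreDom c Q s) (i : ZMod Q.n) :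
    (x, Q.t (i + 1)) ∈ c.U (s i) ∧ (x, Q.t (i + 1)) ∈ c.U (s (i + 1)) :=
  ⟨mem_end_of_mem_arcDom hx i, mem_start_of_mem_arcDom hx (i + 1)⟩

theorem isForm_fibreForm : IsForm (fibreDom c Q s) (fibreForm c Q s) :=
  isForm_arcForm (fun i => c.U_open (s i)) (fun i => c.f_form (s i)) (fun _ => c.a_form _ _)
    subset_rfl fun _ hx i => mem_of_mem_fibreDom hx i

theorem fibreForm_refine {P : Subdivision} (R : P.Refinement Q) (s : ZMod P.n → c.I) :
    FormEq (fibreDom c P s) (fibreForm c Q (s ∘ R.idx)) (fibreForm c P s) :=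
  arcForm_refine R (U := fun j => c.U (s j)) (f := fun j => c.f (s j))
    (a := fun j j' => c.a (s j) (s j')) (fun j => c.f_form (s j)) fun j => c.a_self (s j)

theorem fibreDom_refine {P : Subdivision} (R : P.Refinement Q) (s : ZMod P.n → c.I) :
    fibreDom c P s ⊆ fibreDom c Q (s ∘ R.idx) := arcDom_subset_refine R

/-- The factor of the transition function at a point of division where the labels change from
`i`, `i'` to `j`, `j'`. -/
def Cocycle2.corner {Y : Type u} [DiffeologicalSpace Y] (c : Cocycle2 Y) (i i' j j' : c.I) (y : Y) :
    Circle := c.θ i i' j' y * (c.θ i j j' y)⁻¹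

theorem fibreTransition_eq (Q : Subdivision) (s s' : ZMod Q.n → c.I) (x : X) :
    fibreTransition c Q s s' x = arcProd Q (fun i => c.a (s i) (s' i))
      (fun i => c.corner (s i) (s' i) (s (i + 1)) (s' (i + 1))) x :=
  Finset.prod_congr rfl fun _ _ => mul_assoc _ _ _

theorem Cocycle2.θ_self_right {Y : Type u} [DiffeologicalSpace Y] (c : Cocycle2 Y) {i j : c.I}
    {y : Y} (hi : y ∈ c.U i) (hj : y ∈ c.U j) : c.θ i j j y = 1 := by
  have h := c.cocycle_θ i j j j y hi hj hj hj
  have h2 := c.θ_self j j y ⟨hj, hj⟩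
  rw [h2, one_mul, inv_mul_cancel, one_mul, inv_eq_one] at h
  exact h

theorem Cocycle2.corner_self {Y : Type u} [DiffeologicalSpace Y] (c : Cocycle2 Y) {i j : c.I}
    {y : Y} (hi : y ∈ c.U i) (hj : y ∈ c.U j) : c.corner i j i j y = 1 := by
  rw [corner, c.θ_self_right hi hj, c.θ_self i j y ⟨hi, hj⟩, inv_one, one_mul]

theorem inter_arcDom {U V : ZMod Q.n → Set (X × Circle)} :
    arcDom Q U ∩ arcDom Q V = arcDom Q fun i => U i ∩ V i :=
  Set.ext fun _ => ⟨fun h i τ hτ => ⟨h.1 i τ hτ, h.2 i τ hτ⟩,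
    fun h => ⟨fun i τ hτ => (h i τ hτ).1, fun i τ hτ => (h i τ hτ).2⟩⟩

theorem smoothOn_corner {Y : Type u} [DiffeologicalSpace Y] (c : Cocycle2 Y) (i i' j j' : c.I) :
    SmoothOn (c.U i ∩ c.U i' ∩ (c.U j ∩ c.U j')) fun y => (c.corner i i' j j' y : ℂ) := by
  simp only [Cocycle2.corner, Circle.coe_mul, Circle.coe_inv_eq_conj]
  exact ((c.θ_smooth i i' j').mono fun y hy => ⟨hy.1, hy.2.2⟩).mul
    ((c.θ_smooth i j j').mono fun y hy => ⟨⟨hy.1.1, hy.2.1⟩, hy.2.2⟩).conj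

/-- The cocycle identity for `a` at a point of division, where the labels `i`, `i'` change to `j`,
`j'`. -/
theorem dlog_corner {Y : Type u} [DiffeologicalSpace Y] (c : Cocycle2 Y) (i i' j j' : c.I) :
    FormEq (c.U i ∩ c.U i' ∩ (c.U j ∩ c.U j'))
      (c.a j j' - c.a i i' - (1 / (2 * Real.pi)) • dlog fun y => (c.corner i i' j j' y : ℂ))
      (c.a i' j' - c.a i j) := by
  intro n p hp w hw
  have hO : DOpen (c.U i ∩ c.U i' ∩ (c.U j ∩ c.U j')) :=
    ((c.U_open i).inter (c.U_open i')).inter ((c.U_open j).inter (c.U_open j'))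
  have u1 := (unitOn_circle (c.θ_smooth i i' j')).mono
    (V' := c.U i ∩ c.U i' ∩ (c.U j ∩ c.U j')) fun y hy => ⟨hy.1, hy.2.2⟩
  have u2 := (unitOn_circle (c.θ_smooth i j j')).mono
    (V' := c.U i ∩ c.U i' ∩ (c.U j ∩ c.U j')) fun y hy => ⟨⟨hy.1.1, hy.2.1⟩, hy.2.2⟩
  have h1 := c.cocycle_a i i' j' n p hp w ⟨hw.1, hw.2.2⟩
  have h2 := c.cocycle_a i j j' n p hp w ⟨⟨hw.1.1, hw.2.1⟩, hw.2.2⟩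
  have h3 := dlog_mul hO u1 u2.conj n p hp w hw
  have h4 := dlog_conj hO u2 n p hp w hw
  have h5 : (dlog fun y => (c.corner i i' j j' y : ℂ)) =
      dlog fun y => (c.θ i i' j' y : ℂ) * starRingEnd ℂ (c.θ i j j' y : ℂ) := by
    simp only [Cocycle2.corner, Circle.coe_mul, Circle.coe_inv_eq_conj]
  rw [h5]
  simp only [Pi.add_apply, Pi.sub_apply, Pi.neg_apply, Pi.smul_apply, Pi.zero_apply] at *
  rw [h3, h4]
  linear_combination (norm := module) h2 - h1

theorem mem_corner (hx : x ∈ fibreDom c Q s ∩ fibreDom c Q s') (i : ZMod Q.n) :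
    (x, Q.t (i + 1)) ∈
      c.U (s i) ∩ c.U (s' i) ∩ (c.U (s (i + 1)) ∩ c.U (s' (i + 1))) :=
  ⟨⟨(mem_of_mem_fibreDom hx.1 i).1, (mem_of_mem_fibreDom hx.2 i).1⟩,
    ⟨(mem_of_mem_fibreDom hx.1 i).2, (mem_of_mem_fibreDom hx.2 i).2⟩⟩

/-- The fibre integral satisfies the cocycle identity relating transition functions and forms. -/
theorem unitOn_fibreTransition (Q : Subdivision) (s s' : ZMod Q.n → c.I) :
    UnitOn (fibreDom c Q s ∩ fibreDom c Q s') (fun x => (fibreTransition c Q s s' x : ℂ)) ∧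
    FormEq (fibreDom c Q s ∩ fibreDom c Q s')
      (dlog fun x => (fibreTransition c Q s s' x : ℂ))
      ((2 * Real.pi) • (fibreForm c Q s' - fibreForm c Q s)) := by
  have hO : DOpen (fibreDom c Q s ∩ fibreDom c Q s') := dOpen_fibreDom.inter dOpen_fibreDom
  have hOU : fibreDom c Q s ∩ fibreDom c Q s' ⊆ arcDom Q fun i => c.U (s i) ∩ c.U (s' i) :=
    inter_arcDom.subset
  simp only [fibreTransition_eq]
  obtain ⟨h1, h2⟩ := unitOn_arcProd (Q := Q) (b := fun i => c.a (s i) (s' i))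
    (fun i => (c.U_open (s i)).inter (c.U_open (s' i)))
    (fun i => c.a_form (s i) (s' i)) (fun i => smoothOn_corner c (s i) (s' i) (s (i + 1))
      (s' (i + 1))) hO hOU fun x hx i => mem_corner hx i
  refine ⟨h1, h2.trans (FormEq.smul _ ?_)⟩
  refine arcForm_sub (U := fun i => c.U (s i) ∩ c.U (s' i)) (fun i => ?_)
    (fun i => (c.f_form (s' i)).mono inter_subset_right)
    (fun i => (c.f_form (s i)).mono inter_subset_left)
    (fun i => dlog_corner c _ _ _ _) hOU fun x hx i => mem_corner hx i
  intro n p hp w hw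
  have h3 := c.cocycle_f (s i) (s' i) n p hp w hw
  simp only [Pi.add_apply, Pi.sub_apply, Pi.neg_apply, Pi.zero_apply] at h3 ⊢
  linear_combination (norm := module) -h3

theorem fibreTransition_self (hx : x ∈ fibreDom c Q s) : fibreTransition c Q s s x = 1 := by
  rw [fibreTransition_eq]
  refine Finset.prod_eq_one fun i _ => ?_
  have h1 : arcInt (Q.t i) (Q.len i) (c.a (s i) (s i)) x = 0 := by
    rw [arcInt_congr (c.a_self (s i)) (Q.len_pos i).le (hx i)]
    simp [arcInt, alongCurve]
  have h2 := mem_of_mem_fibreDom hx i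
  simp only [h1, Cocycle2.corner, c.θ_self _ _ _ h2, c.θ_self_right h2.1 h2.2]
  simp

/-- The cocycle identity for the transition functions: the sums `a_{ss'} + a_{s's''}` and `a_{ss''}`
differ by the logarithmic derivative of `θ_{ss's''}`, a gauge transformation of the arcs. -/
theorem fibreTransition_mul (hx : x ∈ fibreDom c Q s) (hx' : x ∈ fibreDom c Q s')
    (hx'' : x ∈ fibreDom c Q s'') :
    fibreTransition c Q s s' x * fibreTransition c Q s' s'' x = fibreTransition c Q s s'' x := by
  have hU : ∀ i, DOpen (c.U (s i) ∩ c.U (s' i) ∩ c.U (s'' i)) := fun i =>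
    ((c.U_open _).inter (c.U_open _)).inter (c.U_open _)
  have hx3 : x ∈ arcDom Q fun i => c.U (s i) ∩ c.U (s' i) ∩ c.U (s'' i) := fun i τ hτ =>
    ⟨⟨hx i τ hτ, hx' i τ hτ⟩, hx'' i τ hτ⟩
  have f1 : ∀ i, IsForm (c.U (s i) ∩ c.U (s' i) ∩ c.U (s'' i)) (c.a (s i) (s' i)) := fun i =>
    (c.a_form _ _).mono inter_subset_left
  have f2 : ∀ i, IsForm (c.U (s i) ∩ c.U (s' i) ∩ c.U (s'' i)) (c.a (s' i) (s'' i)) := fun i =>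
    (c.a_form _ _).mono fun y hy => ⟨hy.1.2, hy.2⟩
  simp only [fibreTransition_eq]
  rw [arcProd_mul f1 f2 hx3]
  refine arcProd_gauge (h := fun i => c.θ (s i) (s' i) (s'' i)) hU (fun i => (f1 i).add (f2 i))
    (fun i => c.θ_smooth _ _ _) (fun i n p hp w hw => ?_) hx3 fun i => ?_
  · have h := c.cocycle_a _ _ _ n p hp w hw
    simp only [Pi.add_apply, Pi.sub_apply, Pi.smul_apply, Pi.zero_apply] at h ⊢
    linear_combination (norm := module) -h
  · obtain ⟨ha, ha'⟩ := mem_of_mem_fibreDom hx i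
    obtain ⟨hb, hb'⟩ := mem_of_mem_fibreDom hx' i
    obtain ⟨hc, hc'⟩ := mem_of_mem_fibreDom hx'' i
    have e1 := congrArg Additive.ofMul (c.cocycle_θ _ _ _ _ _ ha hb hb' hc')
    have e2 := congrArg Additive.ofMul (c.cocycle_θ _ _ _ _ _ ha ha' hb' hc')
    have e3 := congrArg Additive.ofMul (c.cocycle_θ _ _ _ _ _ ha hb hc hc')
    apply Additive.ofMul.injective
    simp only [Cocycle2.corner, ofMul_mul, ofMul_inv, ofMul_one] at e1 e2 e3 ⊢
    linear_combination (norm := module) e2 - e1 + e3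

theorem fibreTransition_refine {P : Subdivision} (R : P.Refinement Q) {s s' : ZMod P.n → c.I}
    (hx : x ∈ fibreDom c P s) (hx' : x ∈ fibreDom c P s') :
    fibreTransition c Q (s ∘ R.idx) (s' ∘ R.idx) x = fibreTransition c P s s' x := by
  rw [fibreTransition_eq, fibreTransition_eq]
  exact arcProd_refine R (U := fun j => c.U (s j) ∩ c.U (s' j))
    (b := fun j => c.a (s j) (s' j)) (g := fun j j' => c.corner (s j) (s' j) (s j') (s' j'))
    (fun j => c.a_form _ _) (fun j y hy => c.corner_self hy.1 hy.2)
    fun j τ hτ => ⟨hx j τ hτ, hx' j τ hτ⟩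

end FibreTransition

section FibreCocycle

variable {X : Type u} [DiffeologicalSpace X]

/-! ### Cohomologous cocycles have cohomologous fibre integrals -/

section Gauge

variable {c c' : Cocycle2 (X × Circle)} (b : Cohomologous2 c c') {Q : Subdivision}
  {κ μ : ZMod Q.n → b.K} {x : X}

/-- The fibre integral of the cochain `(h, β)`, for the labels `κ` of the arcs of `Q`. -/
def Cohomologous2.fibreGauge (Q : Subdivision) (κ : ZMod Q.n → b.K) (x : X) : Circle :=
  arcProd Q (fun i => b.β (κ i)) (fun i => b.h (κ i) (κ (i + 1))) x

/-- The points `x` for which the `i`-th arc of `{x} × S¹` lies in `W_{κ(i)}`. -/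
def Cohomologous2.fibreDom (Q : Subdivision) (κ : ZMod Q.n → b.K) : Set X :=
  arcDom Q fun i => b.W (κ i)

theorem Cohomologous2.fibreDom_left : b.fibreDom Q κ ⊆
    GerbeTransgression.fibreDom c Q (b.r ∘ κ) :=
  fun _ hx i τ hτ => (b.W_subset _ (hx i τ hτ)).1

theorem Cohomologous2.fibreDom_right : b.fibreDom Q κ ⊆
    GerbeTransgression.fibreDom c' Q (b.r' ∘ κ) :=
  fun _ hx i τ hτ => (b.W_subset _ (hx i τ hτ)).2

theorem Cohomologous2.mem_of_mem_fibreDom (hx : x ∈ b.fibreDom Q κ) (i : ZMod Q.n) :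
    (x, Q.t (i + 1)) ∈ b.W (κ i) ∩ b.W (κ (i + 1)) :=
  ⟨mem_end_of_mem_arcDom hx i, mem_start_of_mem_arcDom hx (i + 1)⟩

theorem Cohomologous2.dOpen_fibreDom : DOpen (b.fibreDom Q κ) :=
  dOpen_arcDom fun i => b.W_open (κ i)

theorem Cohomologous2.fibreDom_refine {P : Subdivision} (R : P.Refinement Q)
    (κ : ZMod P.n → b.K) : b.fibreDom P κ ⊆ b.fibreDom Q (κ ∘ R.idx) :=
  arcDom_subset_refine R

theorem Cohomologous2.fibreGauge_refine {P : Subdivision} (R : P.Refinement Q)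
    {κ : ZMod P.n → b.K} (hx : x ∈ b.fibreDom P κ) :
    b.fibreGauge Q (κ ∘ R.idx) x = b.fibreGauge P κ x :=
  arcProd_refine R (U := fun j => b.W (κ j)) (b := fun j => b.β (κ j))
    (g := fun j j' => b.h (κ j) (κ j')) (fun _ => b.β_form _) (fun _ => b.h_self _) hx

theorem Cohomologous2.unitOn_fibreGauge (Q : Subdivision) (κ : ZMod Q.n → b.K) :
    UnitOn (b.fibreDom Q κ) (fun x => (b.fibreGauge Q κ x : ℂ)) ∧
    FormEq (b.fibreDom Q κ) (dlog fun x => (b.fibreGauge Q κ x : ℂ))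
      ((2 * Real.pi) • (fibreForm c Q (b.r ∘ κ) - fibreForm c' Q (b.r' ∘ κ))) := by
  obtain ⟨h1, h2⟩ := unitOn_arcProd (Q := Q) (b := fun i => b.β (κ i))
    (fun i => b.W_open (κ i)) (fun i => b.β_form (κ i))
    (fun i => b.h_smooth (κ i) (κ (i + 1))) b.dOpen_fibreDom subset_rfl
    fun x hx i => b.mem_of_mem_fibreDom hx i
  refine ⟨h1, h2.trans (FormEq.smul _ ?_)⟩
  refine arcForm_sub (U := fun i => b.W (κ i)) (fun i => (b.f_eq (κ i)).symm)
    (fun i => (c.f_form _).mono fun y hy => (b.W_subset _ hy).1)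
    (fun i => (c'.f_form _).mono fun y hy => (b.W_subset _ hy).2)
    (fun i => ?_) subset_rfl fun x hx i => b.mem_of_mem_fibreDom hx i
  intro n p hp w hw
  have h3 := b.a_eq _ _ n p hp w hw
  simp only [Function.comp_apply, Pi.add_apply, Pi.sub_apply, Pi.neg_apply, Pi.smul_apply] at h3 ⊢
  linear_combination (norm := module) -h3

/-- The transition functions of the fibre integrals of `c` and `c'` differ by the coboundary of
the fibre integral of `(h, β)`. -/
theorem Cohomologous2.fibreTransition_mul (hκ : x ∈ b.fibreDom Q κ) (hμ : x ∈ b.fibreDom Q μ) :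
    fibreTransition c Q (b.r ∘ κ) (b.r ∘ μ) x * b.fibreGauge Q κ x =
      fibreTransition c' Q (b.r' ∘ κ) (b.r' ∘ μ) x * b.fibreGauge Q μ x := by
  set U : ZMod Q.n → Set (X × Circle) := fun i => b.W (κ i) ∩ b.W (μ i) with hU
  have hUo : ∀ i, DOpen (U i) := fun i => (b.W_open _).inter (b.W_open _)
  have hx : x ∈ arcDom Q U := fun i τ hτ => ⟨hκ i τ hτ, hμ i τ hτ⟩
  have f1 : ∀ i, IsForm (U i) (c.a (b.r (κ i)) (b.r (μ i))) := fun i =>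
    (c.a_form _ _).mono fun y hy => ⟨(b.W_subset _ hy.1).1, (b.W_subset _ hy.2).1⟩
  have f2 : ∀ i, IsForm (U i) (c'.a (b.r' (κ i)) (b.r' (μ i))) := fun i =>
    (c'.a_form _ _).mono fun y hy => ⟨(b.W_subset _ hy.1).2, (b.W_subset _ hy.2).2⟩
  have f3 : ∀ i, IsForm (U i) (b.β (κ i)) := fun i => (b.β_form _).mono inter_subset_left
  have f4 : ∀ i, IsForm (U i) (b.β (μ i)) := fun i => (b.β_form _).mono inter_subset_right
  rw [fibreTransition_eq, fibreTransition_eq, fibreGauge, fibreGauge]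
  simp only [Function.comp_apply]
  rw [arcProd_mul f1 f3 hx, arcProd_mul f2 f4 hx]
  refine arcProd_gauge (h := fun i => b.h (κ i) (μ i)) hUo (fun i => (f1 i).add (f3 i))
    (fun i => b.h_smooth _ _) (fun i n p hp w hw => ?_) hx fun i => ?_
  · have h3 := b.a_eq _ _ n p hp w hw
    simp only [Pi.add_apply, Pi.sub_apply, Pi.neg_apply, Pi.smul_apply] at h3 ⊢
    linear_combination (norm := module) -h3
  · obtain ⟨ha, ha'⟩ := b.mem_of_mem_fibreDom hκ i
    obtain ⟨hb, hb'⟩ := b.mem_of_mem_fibreDom hμ i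
    have e1 := congrArg Additive.ofMul (b.θ_eq _ _ _ _ ⟨⟨ha, hb⟩, hb'⟩)
    have e2 := congrArg Additive.ofMul (b.θ_eq _ _ _ _ ⟨⟨ha, ha'⟩, hb'⟩)
    apply Additive.ofMul.injective
    simp only [Cocycle2.corner, ofMul_mul, ofMul_inv] at e1 e2 ⊢
    linear_combination (norm := module) e1 - e2

/-- Any two subdivisions have a common refinement so fine that its arcs over `x` can be labelled. -/
theorem Cohomologous2.exists_mem_fibreDom (x : X) (P P' : Subdivision) :
    ∃ (Q : Subdivision) (_ : P.Refinement Q) (_ : P'.Refinement Q) (κ : ZMod Q.n → b.K),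
      x ∈ b.fibreDom Q κ := by
  obtain ⟨ε, hε, h⟩ := exists_lebesgue b.W_open b.W_cover x
  obtain ⟨Q, ⟨R⟩, ⟨R'⟩, hQ⟩ := Subdivision.exists_common_refinement P P' hε
  choose τ hτ hτt using fun i => exists_circle_exp (Q.t i)
  choose κ hκ using fun i => h (τ i)
  refine ⟨Q, R, R', κ, fun i τ' hτ' => ?_⟩
  rw [← hτt, ← circle_exp_add]
  refine hκ i _ ?_
  rw [add_sub_cancel_left, abs_of_nonneg hτ'.1]
  exact hτ'.2.trans_lt (hQ i)

theorem sub_eq_smul_two_pi {M : Type*} [AddCommGroup M] [Module ℝ M] (a a' f f' : M) :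
    a - a' = (1 / (2 * Real.pi)) • (-((2 * Real.pi) • (f - a)) + (2 * Real.pi) • (f - f') +
      (2 * Real.pi) • (f' - a')) := by
  rw [← smul_neg, ← smul_add, ← smul_add, smul_smul, one_div_mul_cancel two_pi_ne_zero, one_smul]
  abel

/-- Fibre integrals of cohomologous cocycles are cohomologous. -/
theorem IsFibreIntegral.cohomologous {c c' : Cocycle2 (X × Circle)} (b : Cohomologous2 c c')
    {e e' : Cocycle1 X} (he : IsFibreIntegral c e)
    (he' : IsFibreIntegral c' e') : Nonempty (Cohomologous1 e e') := by
  obtain ⟨P, s, hU, hA, hu⟩ := he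
  obtain ⟨P', s', hU', hA', hu'⟩ := he'
  let K : Type u := Σ (j : e.I) (j' : e'.I) (Q : Subdivision) (_ : (P j).Refinement Q)
    (_ : (P' j').Refinement Q), (ZMod Q.n → b.K)
  have hdom : ∀ j x, x ∈ e.U j → x ∈ fibreDom c (P j) (s j) := fun j x hx => hU j x hx
  have hdom' : ∀ j x, x ∈ e'.U j → x ∈ fibreDom c' (P' j) (s' j) := fun j x hx => hU' j x hx
  -- `h` is composed of the transition from the labels of `e` to those induced by `κ`, the fibre
  -- integral of `(h, β)`, and the transition to the labels of `e'`
  let h : K → X → Circle := fun ⟨j, j', Q, R, R', κ⟩ x =>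
    (fibreTransition c Q (s j ∘ R.idx) (b.r ∘ κ) x)⁻¹ * b.fibreGauge Q κ x *
      fibreTransition c' Q (s' j' ∘ R'.idx) (b.r' ∘ κ) x
  let W : K → Set X := fun ⟨j, j', Q, R, R', κ⟩ => e.U j ∩ e'.U j' ∩ b.fibreDom Q κ
  have hWo : ∀ q, DOpen (W q) := fun ⟨j, j', Q, R, R', κ⟩ =>
    ((e.U_open j).inter (e'.U_open j')).inter b.dOpen_fibreDom
  have hlog : ∀ q, UnitOn (W q) (fun x => (h q x : ℂ)) ∧
      FormEq (W q) (e.A q.1 - e'.A q.2.1) ((1 / (2 * Real.pi)) • dlog fun x => (h q x : ℂ)) := by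
    rintro ⟨j, j', Q, R, R', κ⟩
    set V : Set X := W ⟨j, j', Q, R, R', κ⟩ with hV
    have hVo : DOpen V := hWo ⟨j, j', Q, R, R', κ⟩
    have s1 : V ⊆ fibreDom c Q (s j ∘ R.idx) ∩ fibreDom c Q (b.r ∘ κ) := fun x hx =>
      ⟨fibreDom_refine R _ (hdom j x hx.1.1), b.fibreDom_left hx.2⟩
    have s2 : V ⊆ fibreDom c' Q (s' j' ∘ R'.idx) ∩ fibreDom c' Q (b.r' ∘ κ) := fun x hx =>
      ⟨fibreDom_refine R' _ (hdom' j' x hx.1.2), b.fibreDom_right hx.2⟩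
    obtain ⟨u1, l1⟩ := unitOn_fibreTransition (c := c) Q (s j ∘ R.idx) (b.r ∘ κ)
    obtain ⟨u2, l2⟩ := unitOn_fibreTransition (c := c') Q (s' j' ∘ R'.idx) (b.r' ∘ κ)
    obtain ⟨u3, l3⟩ := b.unitOn_fibreGauge Q κ
    have u1 := u1.mono s1
    have u2 := u2.mono s2
    have u3 := u3.mono (V' := V) fun x hx => hx.2
    have hh : (fun x => (h ⟨j, j', Q, R, R', κ⟩ x : ℂ)) = fun x =>
        starRingEnd ℂ (fibreTransition c Q (s j ∘ R.idx) (b.r ∘ κ) x : ℂ) *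
          (b.fibreGauge Q κ x : ℂ) *
            (fibreTransition c' Q (s' j' ∘ R'.idx) (b.r' ∘ κ) x : ℂ) := by
      funext x
      simp only [h, Circle.coe_mul, Circle.coe_inv_eq_conj]
    rw [hh]
    refine ⟨(u1.conj.mul u3).mul u2, fun n p hp w hw => ?_⟩
    have e1 := dlog_mul hVo (u1.conj.mul u3) u2 n p hp w hw
    have e2 := dlog_mul hVo u1.conj u3 n p hp w hw
    have e3 := dlog_conj hVo u1 n p hp w hw
    have e4 := l1 n p hp w (s1 hw)
    have e5 := l2 n p hp w (s2 hw)
    have e6 := l3 n p hp w hw.2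
    have e7 := (hA j n p hp w hw.1.1).trans
      (fibreForm_refine R (s j) n p hp w (hdom j _ hw.1.1)).symm
    have e8 := (hA' j' n p hp w hw.1.2).trans
      (fibreForm_refine R' (s' j') n p hp w (hdom' j' _ hw.1.2)).symm
    simp only [Pi.add_apply, Pi.sub_apply, Pi.neg_apply, Pi.smul_apply] at e1 e2 e3 e4 e5 e6 ⊢
    rw [e7, e8, e1, e2, e3, e4, e5, e6]
    exact sub_eq_smul_two_pi _ _ _ _
  refine ⟨{ K := K
            W := W
            W_open := hWo
            W_cover := fun x => ?_
            r := fun q => q.1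
            r' := fun q => q.2.1
            W_subset := fun ⟨j, j', Q, R, R', κ⟩ x hx => hx.1
            h := h
            h_smooth := fun q => (hlog q).1.smooth
            u_eq := ?_
            A_eq := fun q => (hlog q).2 }⟩
  · obtain ⟨j, hj⟩ := e.U_cover x
    obtain ⟨j', hj'⟩ := e'.U_cover x
    obtain ⟨Q, R, R', κ, hκ⟩ := b.exists_mem_fibreDom x (P j) (P' j')
    exact ⟨⟨j, j', Q, R, R', κ⟩, ⟨hj, hj'⟩, hκ⟩
  · rintro ⟨j₁, j₁', Q₁, R₁, R₁', κ⟩ ⟨j₂, j₂', Q₂, R₂, R₂', μ⟩ x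
      ⟨⟨⟨hx₁, hx₁'⟩, hκ⟩, ⟨⟨hx₂, hx₂'⟩, hμ⟩⟩
    obtain ⟨Q, ⟨S₁⟩, ⟨S₂⟩, -⟩ := Subdivision.exists_common_refinement Q₁ Q₂ one_pos
    obtain ⟨T₁⟩ := R₁.exists_trans S₁
    obtain ⟨T₁'⟩ := R₁'.exists_trans S₁
    obtain ⟨T₂⟩ := R₂.exists_trans S₂
    obtain ⟨T₂'⟩ := R₂'.exists_trans S₂
    have i₁ : T₁.idx = R₁.idx ∘ S₁.idx := funext (R₁.idx_trans S₁ T₁)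
    have i₁' : T₁'.idx = R₁'.idx ∘ S₁.idx := funext (R₁'.idx_trans S₁ T₁')
    have i₂ : T₂.idx = R₂.idx ∘ S₂.idx := funext (R₂.idx_trans S₂ T₂)
    have i₂' : T₂'.idx = R₂'.idx ∘ S₂.idx := funext (R₂'.idx_trans S₂ T₂')
    have d₁ := fibreDom_refine T₁ _ (hdom _ _ hx₁)
    have d₁' := fibreDom_refine T₁' _ (hdom' _ _ hx₁')
    have d₂ := fibreDom_refine T₂ _ (hdom _ _ hx₂)
    have d₂' := fibreDom_refine T₂' _ (hdom' _ _ hx₂')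
    have k₁ := b.fibreDom_refine S₁ _ hκ
    have k₂ := b.fibreDom_refine S₂ _ hμ
    -- all the factors are computed on the common refinement `Q`
    have a₁ : h ⟨j₁, j₁', Q₁, R₁, R₁', κ⟩ x =
        (fibreTransition c Q (s j₁ ∘ T₁.idx) (b.r ∘ κ ∘ S₁.idx) x)⁻¹ *
          b.fibreGauge Q (κ ∘ S₁.idx) x *
            fibreTransition c' Q (s' j₁' ∘ T₁'.idx) (b.r' ∘ κ ∘ S₁.idx) x := by
      rw [b.fibreGauge_refine S₁ hκ, i₁, i₁', ← Function.comp_assoc, ← Function.comp_assoc,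
        ← Function.comp_assoc, ← Function.comp_assoc, fibreTransition_refine S₁
          (fibreDom_refine R₁ _ (hdom _ _ hx₁)) (b.fibreDom_left hκ),
        fibreTransition_refine S₁ (fibreDom_refine R₁' _ (hdom' _ _ hx₁')) (b.fibreDom_right hκ)]
    have a₂ : h ⟨j₂, j₂', Q₂, R₂, R₂', μ⟩ x =
        (fibreTransition c Q (s j₂ ∘ T₂.idx) (b.r ∘ μ ∘ S₂.idx) x)⁻¹ *
          b.fibreGauge Q (μ ∘ S₂.idx) x *
            fibreTransition c' Q (s' j₂' ∘ T₂'.idx) (b.r' ∘ μ ∘ S₂.idx) x := by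
      rw [b.fibreGauge_refine S₂ hμ, i₂, i₂', ← Function.comp_assoc, ← Function.comp_assoc,
        ← Function.comp_assoc, ← Function.comp_assoc, fibreTransition_refine S₂
          (fibreDom_refine R₂ _ (hdom _ _ hx₂)) (b.fibreDom_left hμ),
        fibreTransition_refine S₂ (fibreDom_refine R₂' _ (hdom' _ _ hx₂')) (b.fibreDom_right hμ)]
    have hub : e.u j₁ j₂ x = fibreTransition c Q (s j₁ ∘ T₁.idx) (s j₂ ∘ T₂.idx) x :=
      hu _ _ x ⟨hx₁, hx₂⟩ Q _ _ _ _ _ _ (T₁.isRefinement _) (T₂.isRefinement _)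
    have hub' : e'.u j₁' j₂' x = fibreTransition c' Q (s' j₁' ∘ T₁'.idx) (s' j₂' ∘ T₂'.idx) x :=
      hu' _ _ x ⟨hx₁', hx₂'⟩ Q _ _ _ _ _ _ (T₁'.isRefinement _) (T₂'.isRefinement _)
    have m₁ := congrArg Additive.ofMul (fibreTransition_mul d₁ (b.fibreDom_left k₁)
      (b.fibreDom_left k₂))
    have m₂ := congrArg Additive.ofMul (fibreTransition_mul d₁ d₂ (b.fibreDom_left k₂))
    have m₁' := congrArg Additive.ofMul (fibreTransition_mul d₁' (b.fibreDom_right k₁)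
      (b.fibreDom_right k₂))
    have m₂' := congrArg Additive.ofMul (fibreTransition_mul d₁' d₂' (b.fibreDom_right k₂))
    have m₃ := congrArg Additive.ofMul (b.fibreTransition_mul k₁ k₂)
    rw [hub, hub', a₁, a₂]
    apply Additive.ofMul.injective
    simp only [ofMul_mul, ofMul_inv] at m₁ m₂ m₁' m₂' m₃ ⊢
    linear_combination (norm := module) m₂ - m₁ - m₂' + m₁' + m₃

end Gauge

/-! ### Existence of the fibre integral -/

section Exists

variable (c : Cocycle2 (X × Circle))

/-- The points `x` for which the `i`-th arc of `{x} × S¹` lies in `U_{s(i-1)} ∩ U_{s(i)}`. -/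
def fibreSet (Q : Subdivision) (s : ZMod Q.n → c.I) : Set X :=
  arcDom Q fun i => c.U (s (i - 1)) ∩ c.U (s i)

theorem fibreSet_subset (Q : Subdivision) (s : ZMod Q.n → c.I) :
    fibreSet c Q s ⊆ fibreDom c Q s := fun _ hx i τ hτ => (hx i τ hτ).2

theorem dOpen_fibreSet (Q : Subdivision) (s : ZMod Q.n → c.I) : DOpen (fibreSet c Q s) :=
  dOpen_arcDom fun _ => (c.U_open _).inter (c.U_open _)

/-- If the arcs are shorter than half a Lebesgue number `ε`, each may be labelled by the element of
the covering that contains the `ε`-neighbourhood of its initial point; that set contains the next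
arc as well. -/
theorem exists_mem_fibreSet (x : X) : ∃ Q s, x ∈ fibreSet c Q s := by
  obtain ⟨ε, hε, h⟩ := exists_lebesgue c.U_open c.U_cover x
  obtain ⟨Q, -, hQ⟩ := Subdivision.exists_through ∅ (half_pos hε)
  choose τ hτ hτt using fun i => exists_circle_exp (Q.t i)
  choose s hs using fun i => h (τ i)
  refine ⟨Q, s, fun i τ' hτ' => ⟨?_, ?_⟩⟩
  · have h1 := Q.t_succ (i - 1)
    rw [sub_add_cancel] at h1
    rw [h1, ← hτt, ← circle_exp_add, ← circle_exp_add]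
    refine hs (i - 1) _ ?_
    have h2 := Q.len_pos (i - 1)
    have h3 := hQ (i - 1)
    have h4 := hQ i
    rw [abs_lt]
    constructor <;> linarith [hτ'.1, hτ'.2]
  · rw [← hτt, ← circle_exp_add]
    refine hs i _ ?_
    rw [add_sub_cancel_left, abs_of_nonneg hτ'.1]
    linarith [hτ'.2, hQ i]

/-- The transition function from `(P, s)` to `(P', s')`, computed on some common refinement. -/
def fibreTransition₂ (q q' : Σ P : Subdivision, ZMod P.n → c.I) : X → Circle :=
  fibreTransition c (Subdivision.exists_common_refinement q.1 q'.1 one_pos).choose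
    (q.2 ∘ (Subdivision.exists_common_refinement q.1 q'.1 one_pos).choose_spec.1.some.idx)
    (q'.2 ∘ (Subdivision.exists_common_refinement q.1 q'.1 one_pos).choose_spec.2.1.some.idx)

variable {c}

theorem fibreTransition₂_eq {q q' : Σ P : Subdivision, ZMod P.n → c.I} {x : X}
    (hx : x ∈ fibreDom c q.1 q.2) (hx' : x ∈ fibreDom c q'.1 q'.2) {Q : Subdivision}
    (R : q.1.Refinement Q) (R' : q'.1.Refinement Q) :
    fibreTransition₂ c q q' x = fibreTransition c Q (q.2 ∘ R.idx) (q'.2 ∘ R'.idx) x := by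
  rw [fibreTransition₂]
  generalize_proofs h h₁ h₂
  obtain ⟨Q', ⟨S⟩, ⟨S'⟩, -⟩ := Subdivision.exists_common_refinement h.choose Q one_pos
  obtain ⟨T⟩ := R.exists_trans S'
  obtain ⟨T'⟩ := R'.exists_trans S'
  rw [← fibreTransition_refine S (fibreDom_refine _ _ hx) (fibreDom_refine _ _ hx'),
    ← fibreTransition_refine S' (fibreDom_refine _ _ hx) (fibreDom_refine _ _ hx')]
  have e₁ : h₁.some.idx ∘ S.idx = R.idx ∘ S'.idx := funext fun i => by
    rw [Function.comp_apply, Function.comp_apply, ← h₁.some.idx_trans S T, ← R.idx_trans S' T]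
  have e₂ : h₂.some.idx ∘ S.idx = R'.idx ∘ S'.idx := funext fun i => by
    rw [Function.comp_apply, Function.comp_apply, ← h₂.some.idx_trans S T', ← R'.idx_trans S' T']
  rw [Function.comp_assoc, Function.comp_assoc, Function.comp_assoc, Function.comp_assoc, e₁, e₂]

theorem fibreTransition₂_mul {q q' q'' : Σ P : Subdivision, ZMod P.n → c.I} {x : X}
    (hx : x ∈ fibreDom c q.1 q.2) (hx' : x ∈ fibreDom c q'.1 q'.2)
    (hx'' : x ∈ fibreDom c q''.1 q''.2) :
    fibreTransition₂ c q q' x * fibreTransition₂ c q' q'' x = fibreTransition₂ c q q'' x := by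
  obtain ⟨Q₁, ⟨R⟩, ⟨R'⟩, -⟩ := Subdivision.exists_common_refinement q.1 q'.1 one_pos
  obtain ⟨Q, ⟨S⟩, ⟨S''⟩, -⟩ := Subdivision.exists_common_refinement Q₁ q''.1 one_pos
  obtain ⟨T⟩ := R.exists_trans S
  obtain ⟨T'⟩ := R'.exists_trans S
  rw [fibreTransition₂_eq hx hx' T T', fibreTransition₂_eq hx' hx'' T' S'',
    fibreTransition₂_eq hx hx'' T S'']
  exact fibreTransition_mul (fibreDom_refine T _ hx) (fibreDom_refine T' _ hx')
    (fibreDom_refine S'' _ hx'')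

theorem fibreTransition₂_self {q : Σ P : Subdivision, ZMod P.n → c.I} {x : X}
    (hx : x ∈ fibreDom c q.1 q.2) : fibreTransition₂ c q q x = 1 :=
  mul_eq_left.1 (fibreTransition₂_mul hx hx hx)

theorem unitOn_fibreTransition₂ (q q' : Σ P : Subdivision, ZMod P.n → c.I) :
    UnitOn (fibreDom c q.1 q.2 ∩ fibreDom c q'.1 q'.2)
      (fun x => (fibreTransition₂ c q q' x : ℂ)) ∧
    FormEq (fibreDom c q.1 q.2 ∩ fibreDom c q'.1 q'.2)
      (dlog fun x => (fibreTransition₂ c q q' x : ℂ))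
      ((2 * Real.pi) • (fibreForm c q'.1 q'.2 - fibreForm c q.1 q.2)) := by
  rw [fibreTransition₂]
  generalize_proofs h h₁ h₂
  obtain ⟨h3, h4⟩ := unitOn_fibreTransition (c := c) h.choose (q.2 ∘ h₁.some.idx)
    (q'.2 ∘ h₂.some.idx)
  have hs := inter_subset_inter (fibreDom_refine h₁.some q.2) (fibreDom_refine h₂.some q'.2)
  refine ⟨h3.mono hs, (h4.mono hs).trans (FormEq.smul _ ?_)⟩
  exact ((fibreForm_refine h₂.some q'.2).mono inter_subset_right).sub
    ((fibreForm_refine h₁.some q.2).mono inter_subset_left)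

variable (c)

/-- The integral over the fibre of the cocycle `c`. -/
def fibreCocycle : Cocycle1 X where
  I := Σ P : Subdivision, ZMod P.n → c.I
  U q := fibreSet c q.1 q.2
  U_open q := dOpen_fibreSet c q.1 q.2
  U_cover x := by
    obtain ⟨Q, s, h⟩ := exists_mem_fibreSet c x
    exact ⟨⟨Q, s⟩, h⟩
  u := fibreTransition₂ c
  u_smooth q q' := (unitOn_fibreTransition₂ q q').1.smooth.mono
    (inter_subset_inter (fibreSet_subset c _ _) (fibreSet_subset c _ _))
  A q := fibreForm c q.1 q.2
  A_form q := isForm_fibreForm.mono (fibreSet_subset c _ _)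
  u_self q x hx := fibreTransition₂_self (fibreSet_subset c _ _ hx)
  u_swap q q' x hx := by
    have h := fibreSet_subset c _ _ hx.1
    have h' := fibreSet_subset c _ _ hx.2
    rw [eq_inv_iff_mul_eq_one, fibreTransition₂_mul h' h h', fibreTransition₂_self h']
  cocycle_u q q' q'' x h h' h'' := by
    rw [mul_right_comm, mul_inv_eq_one, mul_comm]
    exact fibreTransition₂_mul (fibreSet_subset c _ _ h) (fibreSet_subset c _ _ h')
      (fibreSet_subset c _ _ h'')
  cocycle_A q q' n p hp w hw := by
    have h := (unitOn_fibreTransition₂ q q').2 n p hp w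
      ⟨fibreSet_subset c _ _ hw.1, fibreSet_subset c _ _ hw.2⟩
    simp only [Pi.add_apply, Pi.sub_apply, Pi.neg_apply, Pi.smul_apply, Pi.zero_apply] at h ⊢
    rw [h, smul_smul, one_div_mul_cancel two_pi_ne_zero, one_smul]
    abel

theorem isFibreIntegral_fibreCocycle : IsFibreIntegral c (fibreCocycle c) := by
  refine ⟨fun q => q.1, fun q => q.2, fun q x hx => fibreSet_subset c _ _ hx,
    fun q => FormEq.refl _ _, fun q q' x hx Q s₁ s₂ r₁ k₁ r₂ k₂ h₁ h₂ => ?_⟩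
  obtain ⟨R₁, -, -, rfl⟩ := h₁.exists_refinement
  obtain ⟨R₂, -, -, rfl⟩ := h₂.exists_refinement
  exact fibreTransition₂_eq (fibreSet_subset c _ _ hx.1) (fibreSet_subset c _ _ hx.2) R₁ R₂

end Exists

variable (X) in
/-- Integration over the fibre. -/
def fibreIntegration : H2 (X × Circle) → H1 X :=
  Quot.lift (fun c => H1.mk (fibreCocycle c)) fun c c' ⟨b⟩ =>
    Quot.sound (IsFibreIntegral.cohomologous b (isFibreIntegral_fibreCocycle c) (isFibreIntegral_fibreCocycle c'))

theorem isFibreIntegration_fibreIntegration : IsFibreIntegration (fibreIntegration X) :=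
  ⟨fun c => ⟨_, isFibreIntegral_fibreCocycle c⟩, fun c _ he => Quot.sound
    (IsFibreIntegral.cohomologous (Cohomologous2.nonempty_refl c).some (isFibreIntegral_fibreCocycle c) he)⟩

end FibreCocycle

open LineBundle

/-! ### Curves, parallel transport and unit sections -/

section Curves

variable {X : Type u} [DiffeologicalSpace X] {V : Set X}

/-- 1-forms are determined by their values along curves. -/
theorem formEq_of_curves {ξ η : PreForm X 1} (hξ : IsForm V ξ) (hη : IsForm V η)
    (h : ∀ c : ℝ → X, IsCurve c → c 0 ∈ V → alongCurve ξ c 0 = alongCurve η c 0) :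
    FormEq V ξ η := by
  intro n p hp w hw
  ext v
  have hv : v = fun _ => v 0 := funext fun i => by rw [Subsingleton.elim i 0]
  set f : ℝ → Euc n := fun τ => w + τ • v 0 with hf
  have hfs : ContDiff ℝ ∞ f := by fun_prop
  have hf' : HasDerivAt f (v 0) 0 := by
    have := ((hasDerivAt_id (0 : ℝ)).smul_const (v 0)).const_add w
    rwa [one_smul] at this
  have hf0 : f 0 = w := by simp [hf]
  have h1 := h _ (isCurve_comp_plot hp hfs) (by rw [hf0]; exact hw)
  rw [hξ.alongCurve_plot hp hfs hf' (by rw [hf0]; exact hw),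
    hη.alongCurve_plot hp hfs hf' (by rw [hf0]; exact hw), hf0] at h1
  rw [hv]
  exact h1

theorem isPlot_surface {Γ : ℝ → X} (hΓ : IsCurve Γ) (z : Circle) :
    IsPlot fun w : Euc 2 => (Γ (w 0), z * Circle.exp (2 * Real.pi * w 1)) := by
  have h : IsPlot (cyl z fun w : Euc 1 => Γ (w 0)) := isPlot_cyl z hΓ
  exact h

/-- The fibre integral of a 2-form along a curve is an integral over a surface. -/
theorem IsForm.alongCurve_fibreIntegral {ξ : PreForm (X × Circle) 2} {U : Set (X × Circle)}
    (h : IsForm U ξ) {Γ : ℝ → X} (hΓ : IsCurve Γ) {z : Circle} {ℓ : ℝ} (hℓ : 0 ≤ ℓ) {x : ℝ}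
    (hx : Γ x ∈ arcSet z ℓ U) : alongCurve (GerbeTransgression.fibreIntegral z ℓ ξ) Γ x =
      ∫ τ in (0 : ℝ)..ℓ,
        alongSurface ξ (fun x' τ' => (Γ x', z * Circle.exp (2 * Real.pi * τ'))) x τ := by
  have hx' : (fun w : Euc 1 => Γ (w 0)) (EuclideanSpace.single 0 x) ∈ arcSet z ℓ U := by
    simpa using hx
  rw [alongCurve, fibreIntegral_apply]
  refine Eq.trans ((ContinuousAlternatingMap.apply ℝ (Euc 1) ℝ
    fun _ : Fin 1 => EuclideanSpace.single 0 1).intervalIntegral_comp_comm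
      (h.intervalIntegrable_contractLast hΓ hℓ hx')).symm ?_
  refine intervalIntegral.integral_congr fun τ _ => ?_
  simp only [ContinuousAlternatingMap.apply_apply]
  rw [contractLast_apply, alongSurface]
  have e1 : snocE (EuclideanSpace.single 0 x : Euc 1) τ = !₂[x, τ] := by
    ext i
    fin_cases i
    · exact (snocE_castSucc (n := 1) _ τ 0).trans (by simp)
    · exact snocE_last (n := 1) _ τ
  have e2 : (Matrix.vecCons (lastE 1) fun _ : Fin 1 =>
      appendZero 1 (EuclideanSpace.single 0 1)) = ![!₂[0, 1], !₂[1, 0]] := by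
    funext i
    fin_cases i
    · ext j
      fin_cases j <;> simp [lastE]
    · have e3 := snocE_eq (EuclideanSpace.single 0 1 : Euc 1) 0
      rw [zero_smul, add_zero] at e3
      refine e3.symm.trans ?_
      ext j
      fin_cases j
      · exact (snocE_castSucc (n := 1) _ 0 0).trans (by simp)
      · exact snocE_last (n := 1) _ 0
  rw [e1, e2]
  rfl

theorem FormEq.alongSurface {ξ η : PreForm X 2} (h : FormEq V ξ η) {σ : ℝ → ℝ → X}
    (hσ : IsPlot fun w : Euc 2 => σ (w 0) (w 1)) {x τ : ℝ} (hx : σ x τ ∈ V) :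
    GerbeTransgression.alongSurface ξ σ x τ = GerbeTransgression.alongSurface η σ x τ := by
  simp only [GerbeTransgression.alongSurface]
  rw [h 2 _ hσ _ (by simpa using hx)]

theorem sigma_congr {F : X → Type} (s : ∀ x, F x) {x y : X} (h : x = y) :
    (⟨x, s x⟩ : Σ x, F x) = ⟨y, s y⟩ := by
  subst h
  rfl

/-- Parallel transport of a unit section with connection form `ξ` multiplies it by `exp(-i ∫ ξ)`. -/
theorem transports_section {W : Set X} {L : LineBundle X W} {c : ℝ → X} {a b : ℝ}
    (hc : IsCurve c) {O : Set X} {s : ∀ x, L.Fib x} {ξ : PreForm X 1} (hO : DOpen O) (hOW : O ⊆ W)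
    (hs : L.IsUnitSection O s ξ) (hcO : ∀ τ ∈ Icc a b, c τ ∈ O) :
    L.Transports c a b ⟨c a, s (c a)⟩
      ⟨c b, Circle.exp (-∫ t in a..b, alongCurve ξ c t) • s (c b)⟩ := by
  refine ⟨_, isParallel_exp_smul hc hO hOW hs hcO 1, ?_, ?_⟩
  · simp
  · rw [mul_one, Circle.smul_def]

/-- Parallel transport in the coordinate given by a unit section. -/
theorem LineBundle.Transports.inner_eq {W : Set X} {L : LineBundle X W} {c : ℝ → X} {a b : ℝ}
    {v : L.Fib (c a)} {w : L.Fib (c b)} (h : L.Transports c a b ⟨_, v⟩ ⟨_, w⟩) (hab : a ≤ b)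
    (hc : IsCurve c) {O : Set X} {s : ∀ x, L.Fib x} {ξ : PreForm X 1} (hO : DOpen O) (hOW : O ⊆ W)
    (hs : L.IsUnitSection O s ξ) (hcO : ∀ τ ∈ Icc a b, c τ ∈ O) :
    (inner ℂ (s (c b)) w : ℂ) =
      Circle.exp (-∫ t in a..b, alongCurve ξ c t) * inner ℂ (s (c a)) v := by
  obtain ⟨σ, hσ, ha, hb⟩ := h
  have ha' : σ a = v := eq_of_heq (Sigma.mk.inj ha).2
  have hb' : σ b = w := eq_of_heq (Sigma.mk.inj hb).2
  rw [← ha', ← hb']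
  exact hσ.eq_exp hc hO hOW hs hcO b ⟨hab, le_rfl⟩

end Curves

/-! ### Cocycles of gerbes and their sections -/

/-- Unit sections `s_{κμ}` representing the cocycle `c` of the gerbe `G`. -/
structure Gerbe.Sections {X : Type u} [DiffeologicalSpace X] (G : Gerbe X) (c : Cocycle2 X) where
  r : c.I → G.I
  subset : ∀ κ, c.U κ ⊆ G.U (r κ)
  s : ∀ κ μ x, (G.L (r κ) (r μ)).Fib x
  unit : ∀ κ μ, (G.L (r κ) (r μ)).IsUnitSection (c.U κ ∩ c.U μ) (s κ μ) ((2 * Real.pi) • c.a κ μ)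
  θ_smul : ∀ κ μ ν, ∀ x ∈ c.U κ ∩ c.U μ ∩ c.U ν,
    c.θ κ μ ν x • (G.θ (r κ) (r μ) (r ν)).mul x (s κ μ x) (s μ ν x) = s κ ν x
  f_eq : ∀ κ, FormEq (c.U κ) (c.f κ) (-G.F (r κ))

namespace Gerbe.Sections

variable {X : Type u} [DiffeologicalSpace X] {G : Gerbe X} {c : Cocycle2 X}

theorem nonempty (h : G.HasCocycle c) : Nonempty (G.Sections c) := by
  obtain ⟨r, hr, s, h1, h2, h3⟩ := h
  exact ⟨⟨r, hr, s, h1, h2, h3⟩⟩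

variable (D : G.Sections c) {κ μ ν : c.I} {x : X}

theorem norm_s (hκ : x ∈ c.U κ) (hμ : x ∈ c.U μ) : ‖D.s κ μ x‖ = 1 := (D.unit κ μ).1.1 x ⟨hκ, hμ⟩

theorem s_ne_zero (hκ : x ∈ c.U κ) (hμ : x ∈ c.U μ) : D.s κ μ x ≠ 0 :=
  norm_ne_zero_iff.1 (by rw [D.norm_s hκ hμ]; exact one_ne_zero)

theorem mul_s (hκ : x ∈ c.U κ) (hμ : x ∈ c.U μ) (hν : x ∈ c.U ν) :
    (G.θ (D.r κ) (D.r μ) (D.r ν)).mul x (D.s κ μ x) (D.s μ ν x) =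
      (c.θ κ μ ν x)⁻¹ • D.s κ ν x := by
  rw [← D.θ_smul κ μ ν x ⟨⟨hκ, hμ⟩, hν⟩, inv_smul_smul]

theorem mul_self (hκ : x ∈ c.U κ) :
    (G.θ (D.r κ) (D.r κ) (D.r κ)).mul x (D.s κ κ x) (D.s κ κ x) = D.s κ κ x := by
  rw [D.mul_s hκ hκ hκ, c.θ_self κ κ x ⟨hκ, hκ⟩, inv_one, one_smul]

theorem isOne_s (hκ : x ∈ c.U κ) : G.IsOne (G.elt (D.s κ κ x)) :=
  ⟨_, _, _, D.s_ne_zero hκ hκ, D.mul_self hκ, rfl⟩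

theorem elt_congr {κ' μ' : c.I} {x' : X} (hκ : κ = κ') (hμ : μ = μ') (hx : x = x') :
    G.elt (D.s κ μ x) = G.elt (D.s κ' μ' x') := by
  subst hκ hμ hx
  rfl

end Gerbe.Sections

/-! ### The cocycle of a transgression -/

section Transgression

variable {E : Type v} [NormedAddCommGroup E] [NormedSpace ℝ E]
  {B : Type u} [TopologicalSpace B] [ChartedSpace E B] {G : Gerbe (Mfd E B)}
  {c : Cocycle2 (Mfd E B)} (D : G.Sections c)

/-- The cocycle on `LB × S¹` whose fibre integral is the cocycle of the transgression. -/
abbrev evCocycle (c : Cocycle2 (Mfd E B)) : Cocycle2 (Loop E B × Circle) :=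
  c.pullback ev ev_smooth

variable {P Q : Subdivision} {s s' : ZMod Q.n → c.I} {γ : Loop E B}

theorem mem_loopSet (hγ : γ ∈ fibreSet (evCocycle c) Q s) : γ ∈ loopSet G Q (D.r ∘ s) :=
  fun i τ hτ => ⟨D.subset _ (hγ i τ hτ).1, D.subset _ (hγ i τ hτ).2⟩

/-- The first arc of `Q` inside an arc of `P` needs the labels of two arcs of `P`, the other arcs of
`Q` only one. -/
theorem loopSet_refine {P Q : Subdivision} (R : P.Refinement Q) (s : ZMod P.n → G.I) :
    loopSet G P s ⊆ loopSet G Q (s ∘ R.idx) := by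
  intro γ hγ i τ hτ
  obtain ⟨o, ho, ho', h⟩ := R.exists_offset i
  rw [h τ]
  have h1 := hγ (R.idx i) (o + τ) ⟨add_nonneg ho hτ.1, by linarith [hτ.2]⟩
  refine ⟨?_, h1.2⟩
  rcases R.idx_succ (i - 1) with h2 | ⟨-, -, h2⟩
  · rw [sub_add_cancel] at h2
    rw [Function.comp_apply, ← h2]
    exact h1.2
  · rw [sub_add_cancel] at h2
    rw [Function.comp_apply, ← add_sub_cancel_right (R.idx (i - 1)) 1, ← h2]
    exact h1.1

theorem isCurve_loop (γ : Loop E B) (Q : Subdivision) (i : ZMod Q.n) :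
    IsCurve (X := Mfd E B) fun τ => ev (γ, Q.point i τ) :=
  ev_smooth _ _ (isCurve_arc γ (Q.t i))

theorem isCurve_evalAt {Γ : ℝ → Loop E B} (hΓ : IsCurve Γ) (z : Circle) :
    IsCurve (X := Mfd E B) fun x => ev (Γ x, z) :=
  ev_smooth _ _ ((dSmooth_prodMk z) _ _ hΓ)

theorem isPlot_evalSurface {Γ : ℝ → Loop E B} (hΓ : IsCurve Γ) (Q : Subdivision) (i : ZMod Q.n) :
    IsPlot (X := Mfd E B) fun w : Euc 2 => ev (Γ (w 0), Q.point i (w 1)) :=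
  ev_smooth _ _ (isPlot_surface hΓ (Q.t i))

/-- The holonomy of the connection form of the fibre integral along a path of loops, in terms of
the gerbe. -/
theorem exp_fibreForm_eq {Γ : ℝ → Loop E B} (hΓ : IsCurve Γ) {a b : ℝ} (hab : a ≤ b)
    (h : ∀ x ∈ Icc a b, Γ x ∈ fibreDom (evCocycle c) Q s) :
    Circle.exp (-∫ x in a..b, alongCurve (-((2 * Real.pi) • fibreForm (evCocycle c) Q s)) Γ x) =
      Circle.exp (2 * Real.pi * ∑ i, ∫ x in a..b, ∫ τ in (0 : ℝ)..Q.len i,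
        alongSurface (G.F (D.r (s i))) (fun x' τ' => ev (Γ x', Q.point i τ')) x τ) *
      ∏ i, Circle.exp (-∫ x in a..b, alongCurve ((2 * Real.pi) • c.a (s i) (s (i + 1)))
        (fun x => ev (Γ x, Q.t (i + 1))) x) := by
  set φ : ZMod Q.n → ℝ → ℝ := fun i =>
    alongCurve (fibreIntegral (Q.t i) (Q.len i) ((evCocycle c).f (s i))) Γ with hφ
  set ψ : ZMod Q.n → ℝ → ℝ := fun i => alongCurve (((evCocycle c).a (s i) (s (i + 1))).pullback
    fun x => (x, Q.t (i + 1))) Γ with hψ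
  have hφc : ∀ i, ContinuousOn (φ i) (Icc a b) := fun i =>
    ((((evCocycle c).f_form (s i)).fibreIntegral ((evCocycle c).U_open _)
      (Q.len_pos i).le).contDiffOn_alongCurve hΓ).continuousOn.mono fun x hx => h x hx i
  have hψc : ∀ i, ContinuousOn (ψ i) (Icc a b) := fun i =>
    ((((evCocycle c).a_form (s i) (s (i + 1))).pullback
      (dSmooth_prodMk (Q.t (i + 1)))).contDiffOn_alongCurve hΓ).continuousOn.mono
        fun x hx => mem_of_mem_fibreDom (h x hx) i
  have hφi : ∀ i, IntervalIntegrable (φ i) MeasureTheory.volume a b := fun i =>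
    (hφc i).intervalIntegrable_of_Icc hab
  have hψi : ∀ i, IntervalIntegrable (ψ i) MeasureTheory.volume a b := fun i =>
    (hψc i).intervalIntegrable_of_Icc hab
  have h1 : ∀ x, alongCurve (-((2 * Real.pi) • fibreForm (evCocycle c) Q s)) Γ x =
      2 * Real.pi * (∑ i, φ i x + ∑ i, ψ i x) := by
    intro x
    simp only [hφ, hψ, alongCurve, fibreForm, arcForm, Pi.neg_apply, Pi.smul_apply, Pi.sub_apply,
      preForm_sum_apply, ContinuousAlternatingMap.neg_apply, ContinuousAlternatingMap.smul_apply,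
      ContinuousAlternatingMap.sub_apply, ContinuousAlternatingMap.sum_apply, smul_eq_mul]
    ring
  -- the sign arises from `f = -F`
  have h2 : ∀ i, ∫ x in a..b, ∫ τ in (0 : ℝ)..Q.len i,
      alongSurface (G.F (D.r (s i))) (fun x' τ' => ev (Γ x', Q.point i τ')) x τ =
        -∫ x in a..b, φ i x := by
    intro i
    rw [← intervalIntegral.integral_neg]
    refine intervalIntegral.integral_congr fun x hx => ?_
    rw [uIcc_of_le hab] at hx
    simp only [hφ]
    rw [((evCocycle c).f_form (s i)).alongCurve_fibreIntegral hΓ (Q.len_pos i).le (h x hx i),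
      ← intervalIntegral.integral_neg]
    refine intervalIntegral.integral_congr fun τ hτ => ?_
    rw [uIcc_of_le (Q.len_pos i).le] at hτ
    have h3 := (D.f_eq (s i)).alongSurface (σ := fun x' τ' => ev (Γ x', Q.point i τ'))
      (isPlot_evalSurface hΓ Q i) (h x hx i τ hτ)
    have h4 : alongSurface ((evCocycle c).f (s i))
        (fun x' τ' => (Γ x', Q.t i * Circle.exp (2 * Real.pi * τ'))) x τ =
        alongSurface (c.f (s i)) (fun x' τ' => ev (Γ x', Q.point i τ')) x τ := rfl
    rw [h4, h3]
    simp [alongSurface]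
  have h5 : ∀ (t : Finset (ZMod Q.n)) (F : ZMod Q.n → ℝ), ∏ i ∈ t, Circle.exp (F i) =
      Circle.exp (∑ i ∈ t, F i) := fun t F => by
    induction t using Finset.induction_on with
    | empty => simp
    | insert a s ha ih => rw [Finset.sum_insert ha, Finset.prod_insert ha, Circle.exp_add, ih]
  have h6 : ∀ i, ∫ x in a..b, alongCurve ((2 * Real.pi) • c.a (s i) (s (i + 1)))
      (fun x => ev (Γ x, Q.t (i + 1))) x = 2 * Real.pi * ∫ x in a..b, ψ i x := fun i =>
    intervalIntegral.integral_const_mul _ _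
  rw [h5, ← Circle.exp_add]
  congr 1
  simp only [h1, h2, h6]
  rw [intervalIntegral.integral_const_mul, intervalIntegral.integral_add,
    intervalIntegral.integral_finsetSum fun i _ => hφi i,
    intervalIntegral.integral_finsetSum fun i _ => hψi i]
  · simp only [Finset.sum_neg_distrib, ← Finset.mul_sum]
    ring
  · exact (continuousOn_finsetSum _ fun i _ => hφc i).intervalIntegrable_of_Icc hab
  · exact (continuousOn_finsetSum _ fun i _ => hψc i).intervalIntegrable_of_Icc hab

variable {T : LineBundle (Loop E B) univ} (g : IsGlued G T)

/-- The section of a transgression given by unit sections of the gerbe. -/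
def IsGlued.unitSection (Q : Subdivision) (s : ZMod Q.n → c.I) (γ : Loop E B) : T.Fib γ :=
  g.m Q (D.r ∘ s) γ fun i => D.s (s i) (s (i + 1)) (ev (γ, Q.t (i + 1)))

/-- The additional factors of the refined section are of the form `s_{κκ}`, hence equal to `1`. -/
theorem IsGlued.unitSection_refine (R : P.Refinement Q) (s : ZMod P.n → c.I)
    (hγ : γ ∈ fibreSet (evCocycle c) P s) :
    g.unitSection D Q (s ∘ R.idx) γ = g.unitSection D P s γ := by
  refine g.refine_m P Q (D.r ∘ s) (D.r ∘ s ∘ R.idx) R.r R.k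
    (R.isRefinement (D.r ∘ s)) γ (mem_loopSet D hγ) _ _ (fun j => ?_) fun j l hl => ?_
  · exact D.elt_congr (congrArg s (R.idx_last j)) (congrArg s (R.idx_last_succ j))
      (by rw [R.t_last_succ])
  · have e : R.idx (R.r j + (l : ZMod Q.n) + 1) = j := by
      rw [add_assoc, ← Nat.cast_succ, R.idx_add j hl]
    have h1 : ev (γ, Q.t (R.r j + (l : ZMod Q.n) + 1)) ∈ c.U (s j) :=
      mem_of_mem_arcDom_refine R (U := fun j => (evCocycle c).U (s j))
        (fibreSet_subset _ _ _ hγ) j hl.le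
    have h2 := D.isOne_s h1
    rwa [← D.elt_congr (congrArg s (R.idx_add j hl.le)) (congrArg s e) rfl] at h2

/-- Parallel transport of the unit sections along the arcs of a loop. -/
theorem transports_arc (hγ : γ ∈ fibreDom (evCocycle c) Q s)
    (hγ' : γ ∈ fibreDom (evCocycle c) Q s') (i : ZMod Q.n) :
    (G.L (D.r (s i)) (D.r (s' i))).Transports (fun τ => ev (γ, Q.point i τ)) 0 (Q.len i)
      ⟨ev (γ, Q.t i), D.s (s i) (s' i) (ev (γ, Q.t i))⟩
      ⟨ev (γ, Q.t (i + 1)), Circle.exp (-(2 * Real.pi * arcInt (Q.t i) (Q.len i)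
        ((evCocycle c).a (s i) (s' i)) γ)) • D.s (s i) (s' i) (ev (γ, Q.t (i + 1)))⟩ := by
  have h2 := transports_section (isCurve_loop γ Q i)
    ((c.U_open (s i)).inter (c.U_open (s' i)))
    (inter_subset_inter (D.subset _) (D.subset _)) (D.unit (s i) (s' i))
    fun τ hτ => ⟨hγ i τ hτ, hγ' i τ hτ⟩
  have e1 : ∫ t in (0 : ℝ)..Q.len i, alongCurve ((2 * Real.pi) • c.a (s i) (s' i))
      (fun τ => ev (γ, Q.point i τ)) t =
      2 * Real.pi * arcInt (Q.t i) (Q.len i) ((evCocycle c).a (s i) (s' i)) γ :=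
    intervalIntegral.integral_const_mul _ _
  rw [e1] at h2
  have e2 : ev (γ, Q.point i 0) = ev (γ, Q.t i) := by rw [Q.point_zero]
  have e3 : ev (γ, Q.point i (Q.len i)) = ev (γ, Q.t (i + 1)) := by rw [Q.point_len]
  rw [sigma_congr (D.s (s i) (s' i)) e2, sigma_congr (fun y => Circle.exp (-(2 * Real.pi *
    arcInt (Q.t i) (Q.len i) ((evCocycle c).a (s i) (s' i)) γ)) • D.s (s i) (s' i) y) e3] at h2
  exact h2

/-- The sections for two labellings differ by the transition function of the fibre integral: the
parallel transports of the `s_{s(i)s'(i)}` along the arcs give the exponentials of the integrals of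
the `a_{s(i)s'(i)}`, and comparing the products `s_{s(i)s(i+1)} s_{s(i+1)s'(i+1)}` and
`s_{s(i)s'(i)} s_{s'(i)s'(i+1)}` gives the factors `θ`. -/
theorem IsGlued.unitSection_relabel (hγ : γ ∈ fibreDom (evCocycle c) Q s)
    (hγ' : γ ∈ fibreDom (evCocycle c) Q s') (hl : γ ∈ loopSet G Q (D.r ∘ s))
    (hl' : γ ∈ loopSet G Q (D.r ∘ s')) :
    g.unitSection D Q s γ = fibreTransition (evCocycle c) Q s s' γ • g.unitSection D Q s' γ := by
  set e : ZMod Q.n → ℝ := fun i =>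
    2 * Real.pi * arcInt (Q.t i) (Q.len i) ((evCocycle c).a (s i) (s' i)) γ with he
  set z : ZMod Q.n → Circle := fun i => Circle.exp (e i) *
    (evCocycle c).corner (s i) (s' i) (s (i + 1)) (s' (i + 1)) (γ, Q.t (i + 1)) with hz
  have hFT : fibreTransition (evCocycle c) Q s s' γ = ∏ i, z i := fibreTransition_eq _ _ _ _
  have h1 := g.relabel_m Q (D.r ∘ s) (D.r ∘ s') γ ⟨hl, hl'⟩
    (fun i => D.s (s i) (s (i + 1)) (ev (γ, Q.t (i + 1))))
    (fun i => (z i : ℂ) • D.s (s' i) (s' (i + 1)) (ev (γ, Q.t (i + 1))))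
    (fun i => D.s (s i) (s' i) (ev (γ, Q.t i)))
    (fun i => Circle.exp (-e i) • D.s (s i) (s' i) (ev (γ, Q.t (i + 1))))
    (fun i => D.norm_s (mem_start_of_mem_arcDom hγ i) (mem_start_of_mem_arcDom hγ' i))
    (fun i => ?_) (fun i => ?_)
  · rw [MultilinearMap.map_smul_univ] at h1
    rw [hFT, Circle.smul_def]
    refine Eq.trans h1.symm ?_
    congr 1
    exact (map_prod Circle.coeHom z Finset.univ).symm
  · exact transports_arc D hγ hγ' i
  · have ha := mem_of_mem_fibreDom hγ i
    have hb := mem_of_mem_fibreDom hγ' i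
    have h3 := D.mul_s ha.1 ha.2 hb.2
    have h4 := D.mul_s ha.1 hb.1 hb.2
    have h5 : (G.θ (D.r (s i)) (D.r (s' i)) (D.r (s' (i + 1)))).mul (ev (γ, Q.t (i + 1)))
        (Circle.exp (-e i) • D.s (s i) (s' i) (ev (γ, Q.t (i + 1))))
        (z i • D.s (s' i) (s' (i + 1)) (ev (γ, Q.t (i + 1)))) =
        Circle.exp (-e i) • z i • (c.θ (s i) (s' i) (s' (i + 1)) (ev (γ, Q.t (i + 1))))⁻¹ •
          D.s (s i) (s' (i + 1)) (ev (γ, Q.t (i + 1))) := by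
      rw [TensorIso.smul_mul, TensorIso.mul_smul, h4]
    refine h3.trans (Eq.trans ?_ h5.symm)
    rw [smul_smul, smul_smul]
    congr 1
    have h6 : z i = Circle.exp (e i) * (c.θ (s i) (s' i) (s' (i + 1)) (ev (γ, Q.t (i + 1))) *
      (c.θ (s i) (s (i + 1)) (s' (i + 1)) (ev (γ, Q.t (i + 1))))⁻¹) := rfl
    rw [h6, Circle.exp_neg]
    apply Additive.ofMul.injective
    simp only [ofMul_mul, ofMul_inv]
    abel

/-- The connection form of the section is determined by the parallel transport of the transgression
along curves, that is, by the holonomies of the `a_{s(i)s(i+1)}` and the integrals of the curving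
forms. -/
theorem IsGlued.isUnitSection_unitSection (Q : Subdivision) (s : ZMod Q.n → c.I) :
    T.IsUnitSection (fibreSet (evCocycle c) Q s) (g.unitSection D Q s)
      (-((2 * Real.pi) • fibreForm (evCocycle c) Q s)) := by
  set O := fibreSet (evCocycle c) Q s with hO
  have hOo : DOpen O := dOpen_fibreSet _ _ _
  have hsub : O ⊆ fibreDom (evCocycle c) Q s := fibreSet_subset _ _ _
  have h1 : T.IsSmoothUnit O (g.unitSection D Q s) :=
    (g.smooth_m Q (D.r ∘ s) (fun i => c.U (s i) ∩ c.U (s (i + 1)))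
      (fun i => D.s (s i) (s (i + 1))) fun i => ⟨(c.U_open _).inter (c.U_open _),
        inter_subset_inter (D.subset _) (D.subset _), (D.unit _ _).1⟩).mono fun γ hγ =>
      ⟨mem_loopSet D hγ, fun i => mem_of_mem_fibreDom (hsub hγ) i⟩
  obtain ⟨ξ, hξ⟩ := h1.exists_form hOo (subset_univ _)
  refine hξ.congr_form (formEq_of_curves ((isForm_fibreForm.mono hsub).smul _).neg
    (hξ.isForm hOo (subset_univ _)) fun Γ hΓ h0 => ?_)
  -- compare the two holonomies along short initial segments of `Γ`
  obtain ⟨ε, hε, hball⟩ := Metric.isOpen_iff.1 (hΓ.isOpen_preimage hOo) 0 h0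
  have hδ : (0 : ℝ) < ε / 2 := half_pos hε
  have hmem : ∀ x ∈ Icc 0 (ε / 2), Γ x ∈ O := fun x hx => hball (by
    rw [Metric.mem_ball, Real.dist_eq, sub_zero, abs_of_nonneg hx.1]
    linarith [hx.2])
  set η := -((2 * Real.pi) • fibreForm (evCocycle c) Q s) with hη
  have hηf : IsForm O η := ((isForm_fibreForm.mono hsub).smul _).neg
  have hceta : ContinuousOn (alongCurve η Γ) (Icc 0 (ε / 2)) :=
    (hηf.contDiffOn_alongCurve hΓ).continuousOn.mono hmem
  have hcxi : ContinuousOn (alongCurve ξ Γ) (Icc 0 (ε / 2)) :=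
    ((hξ.isForm hOo (subset_univ _)).contDiffOn_alongCurve hΓ).continuousOn.mono hmem
  have key : ∀ b ∈ Icc 0 (ε / 2), (Circle.exp (-∫ t in (0 : ℝ)..b, alongCurve η Γ t) : ℂ) =
      Circle.exp (-∫ t in (0 : ℝ)..b, alongCurve ξ Γ t) := by
    intro b hb
    have hmem' : ∀ x ∈ Icc 0 b, Γ x ∈ O := fun x hx => hmem x ⟨hx.1, hx.2.trans hb.2⟩
    have h2 := g.transport_m Q (D.r ∘ s) Γ 0 b hΓ hb.1 (fun x hx => mem_loopSet D (hmem' x hx))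
      (fun i => D.s (s i) (s (i + 1)) (ev (Γ 0, Q.t (i + 1))))
      (fun i => (Circle.exp (-∫ x in (0 : ℝ)..b, alongCurve ((2 * Real.pi) • c.a (s i) (s (i + 1)))
        (fun x => ev (Γ x, Q.t (i + 1))) x) : ℂ) •
          D.s (s i) (s (i + 1)) (ev (Γ b, Q.t (i + 1))))
      fun i => transports_section (isCurve_evalAt hΓ (Q.t (i + 1)))
        ((c.U_open _).inter (c.U_open _)) (inter_subset_inter (D.subset _) (D.subset _))
        (D.unit _ _) fun x hx => mem_of_mem_fibreDom (hsub (hmem' x hx)) i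
    have h3 := h2.inner_eq hb.1 hΓ hOo (subset_univ _) hξ hmem'
    have h4 : ∀ x, Γ x ∈ O →
        inner ℂ (g.unitSection D Q s (Γ x)) (g.unitSection D Q s (Γ x)) = (1 : ℂ) := fun x hx =>
      inner_self_of_norm (h1.1 _ hx)
    have h5 : g.m Q (D.r ∘ s) (Γ 0) (fun i => D.s (s i) (s (i + 1)) (ev (Γ 0, Q.t (i + 1)))) =
      g.unitSection D Q s (Γ 0) := rfl
    have h6 : g.m Q (D.r ∘ s) (Γ b) (fun i => D.s (s i) (s (i + 1)) (ev (Γ b, Q.t (i + 1)))) =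
      g.unitSection D Q s (Γ b) := rfl
    rw [MultilinearMap.map_smul_univ, h5, h6, h4 0 (hmem' 0 ⟨le_rfl, hb.1⟩), mul_one,
      Circle.smul_def, inner_smul_right, inner_smul_right, h4 b (hmem' b ⟨hb.1, le_rfl⟩),
      mul_one] at h3
    rw [← h3, exp_fibreForm_eq D hΓ hb.1 fun x hx => hsub (hmem' x hx), Circle.coe_mul]
    congr 1
    exact map_prod Circle.coeHom _ _
  -- differentiate both holonomies at the initial point
  have hd1 := hasDerivWithinAt_exp_integral hceta 0 ⟨le_rfl, hδ.le⟩
  have hd2 := (hasDerivWithinAt_exp_integral hcxi 0 ⟨le_rfl, hδ.le⟩).congr key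
    (key 0 ⟨le_rfl, hδ.le⟩)
  have h7 := (uniqueDiffOn_Icc hδ 0 ⟨le_rfl, hδ.le⟩).eq_deriv _ hd1 hd2
  simpa using h7

/-- A transgression of `G` has the fibre integral of the pullback of a cocycle of `G` as a
cocycle. -/
theorem IsGlued.hasCocycle (g : IsGlued G T) (D : G.Sections c) :
    T.HasCocycle (fibreCocycle (evCocycle c)) := by
  refine ⟨fun q => g.unitSection D q.1 q.2, fun q => g.isUnitSection_unitSection D q.1 q.2,
    fun q q' γ hγ => ?_⟩
  obtain ⟨Q, ⟨R⟩, ⟨R'⟩, -⟩ := Subdivision.exists_common_refinement q.1 q'.1 one_pos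
  have h1 := fibreSet_subset _ _ _ hγ.1
  have h2 := fibreSet_subset _ _ _ hγ.2
  have h3 : (fibreCocycle (evCocycle c)).u q q' γ =
      fibreTransition (evCocycle c) Q (q.2 ∘ R.idx) (q'.2 ∘ R'.idx) γ :=
    fibreTransition₂_eq h1 h2 R R'
  rw [h3]
  change g.unitSection D q.1 q.2 γ = _ • g.unitSection D q'.1 q'.2 γ
  rw [← g.unitSection_refine D R q.2 hγ.1, ← g.unitSection_refine D R' q'.2 hγ.2]
  exact g.unitSection_relabel D (fibreDom_refine R _ h1) (fibreDom_refine R' _ h2)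
    (loopSet_refine R _ (mem_loopSet D hγ.1)) (loopSet_refine R' _ (mem_loopSet D hγ.2))

end Transgression

open LineBundle

/-! ### Positions inside the arcs of a subdivision -/

namespace Subdivision.Refinement

variable {P Q Q' : Subdivision} (R : P.Refinement Q)

/-- The distance of the starting point of the arc `i` of `Q` from the starting point of the arc of
`P` containing it. -/
def offset (i : ZMod Q.n) : ℝ := Q.arcSum (R.r (R.idx i)) (R.equiv.symm i).2

/-- The arc `i` of `Q` is the last one in the arc of `P` containing it. -/
def IsLast (i : ZMod Q.n) : Prop := ∃ j, i + 1 = R.r j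

theorem offset_add (j : ZMod P.n) {l : ℕ} (hl : l ≤ R.k j) :
    R.offset (R.r j + (l : ZMod Q.n)) = Q.arcSum (R.r j) l := by
  have : R.equiv.symm (R.r j + (l : ZMod Q.n)) = ⟨j, l, Nat.lt_succ_of_le hl⟩ :=
    R.equiv.symm_apply_eq.2 rfl
  rw [offset, idx, this]

theorem offset_nonneg (i : ZMod Q.n) : 0 ≤ R.offset i := Q.arcSum_nonneg _ _

theorem offset_add_len_le (i : ZMod Q.n) : R.offset i + Q.len i ≤ P.len (R.idx i) := by
  obtain ⟨l, hl, hi⟩ := R.exists_eq_add i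
  rw [R.len_eq (R.idx i)]
  generalize R.idx i = j at hl hi
  subst hi
  rw [R.offset_add j hl, ← arcSum_succ]
  exact Q.arcSum_mono _ (Nat.succ_le_succ hl)

theorem point_eq (i : ZMod Q.n) (τ : ℝ) :
    Q.point i τ = P.point (R.idx i) (R.offset i + τ) := by
  obtain ⟨l, hl, hi⟩ := R.exists_eq_add i
  generalize R.idx i = j at hl hi
  subst hi
  rw [R.offset_add j hl, R.point_add_eq]

theorem offset_r (j : ZMod P.n) : R.offset (R.r j) = 0 := by
  have h := R.offset_add j (Nat.zero_le _)
  rwa [Nat.cast_zero, add_zero, arcSum_zero] at h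

theorem isLast_last (j : ZMod P.n) : R.IsLast (R.r j + (R.k j : ZMod Q.n)) :=
  ⟨j + 1, (R.r_succ j).symm⟩

variable {R} in
theorem IsLast.eq {i : ZMod Q.n} (h : R.IsLast i) :
    i = R.r (R.idx i) + (R.k (R.idx i) : ZMod Q.n) := by
  obtain ⟨j, hj⟩ := h
  have h1 : i = R.r (j - 1) + (R.k (j - 1) : ZMod Q.n) := by
    have h2 := R.r_succ (j - 1)
    rw [sub_add_cancel, ← hj] at h2
    exact add_right_cancel h2
  have h3 := R.idx_last (j - 1)
  rw [← h1] at h3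
  rw [h3]
  exact h1

theorem isLast_add {j : ZMod P.n} {l : ℕ} (hl : l ≤ R.k j) :
    R.IsLast (R.r j + (l : ZMod Q.n)) ↔ l = R.k j := by
  refine ⟨fun h => ?_, fun h => h ▸ R.isLast_last j⟩
  have h1 := h.eq
  rw [R.idx_add j hl] at h1
  have h2 : R.toFun ⟨j, l, Nat.lt_succ_of_le hl⟩ = R.toFun ⟨j, R.k j, Nat.lt_succ_self _⟩ := h1
  have h3 := R.toFun_injective h2
  simpa using h3

variable {R} in
theorem IsLast.idx_succ {i : ZMod Q.n} (h : R.IsLast i) : R.idx (i + 1) = R.idx i + 1 := by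
  have h1 := R.idx_last_succ (R.idx i)
  rwa [← h.eq] at h1

variable {R} in
theorem IsLast.succ_eq {i : ZMod Q.n} (h : R.IsLast i) : i + 1 = R.r (R.idx i + 1) := by
  rw [R.r_succ, ← h.eq]

theorem idx_succ_of_not_isLast {i : ZMod Q.n} (h : ¬R.IsLast i) : R.idx (i + 1) = R.idx i := by
  rcases R.idx_succ i with h1 | ⟨-, h1, -⟩
  · exact h1
  · exact absurd ⟨_, h1⟩ h

variable {R} in
theorem IsLast.offset_add_len {i : ZMod Q.n} (h : R.IsLast i) :
    R.offset i + Q.len i = P.len (R.idx i) := by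
  have h1 := h.eq
  rw [R.len_eq (R.idx i)]
  generalize R.idx i = j at h1
  subst h1
  rw [R.offset_add j le_rfl, ← arcSum_succ]

theorem offset_succ_of_not_isLast {i : ZMod Q.n} (h : ¬R.IsLast i) :
    R.offset (i + 1) = R.offset i + Q.len i := by
  obtain ⟨l, hl, hi⟩ := R.exists_eq_add i
  generalize R.idx i = j at hl hi
  subst hi
  have h1 : l < R.k j := lt_of_le_of_ne hl fun h2 => h ((R.isLast_add hl).2 h2)
  rw [R.offset_add j hl, ← arcSum_succ, add_assoc, ← Nat.cast_succ, R.offset_add j h1]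

variable {R} in
theorem IsLast.t_succ {i : ZMod Q.n} (h : R.IsLast i) : Q.t (i + 1) = P.t (R.idx i + 1) := by
  rw [h.succ_eq, R.t_eq]

theorem isLast_trans (S : Q.Refinement Q') (T : P.Refinement Q') (i : ZMod Q'.n) :
    T.IsLast i ↔ S.IsLast i ∧ R.IsLast (S.idx i) := by
  have hr : ∀ j, T.r j = S.r (R.r j) := fun j => Q'.t_injective (by rw [T.t_eq, S.t_eq, R.t_eq])
  have hinj : Function.Injective S.r := fun m m' h => by rw [← S.idx_r m, h, S.idx_r]
  constructor
  · rintro ⟨j, hj⟩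
    have h1 : S.IsLast i := ⟨R.r j, by rw [hj, hr]⟩
    exact ⟨h1, j, hinj (by rw [← h1.succ_eq, hj, hr])⟩
  · rintro ⟨h1, j, hj⟩
    exact ⟨j, by rw [h1.succ_eq, hj, hr]⟩

end Subdivision.Refinement

/-! ### Coordinates with respect to the unit sections of a gerbe -/

section One

variable {X : Type u} [DiffeologicalSpace X] {G : Gerbe X}

open Classical in
/-- The section `1` of `L_{αα}` over `U_α`, that is, the non-zero idempotent; outside `U_α` its
value is irrelevant. -/
def Gerbe.oneSec (G : Gerbe X) (α : G.I) (x : X) : (G.L α α).Fib x :=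
  if h : ∃ e : (G.L α α).Fib x, e ≠ 0 ∧ (G.θ α α α).mul x e e = e then h.choose else 0

theorem Gerbe.oneSec_eq {α : G.I} {x : X} (hx : x ∈ G.U α) {e : (G.L α α).Fib x} (he : e ≠ 0)
    (hee : (G.θ α α α).mul x e e = e) : G.oneSec α x = e := by
  have h : ∃ e : (G.L α α).Fib x, e ≠ 0 ∧ (G.θ α α α).mul x e e = e := ⟨e, he, hee⟩
  rw [Gerbe.oneSec, dif_pos h]
  exact Gerbe.idem_unique hx h.choose_spec.1 h.choose_spec.2 he hee

namespace Gerbe.Sections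

variable {c : Cocycle2 X} (D : G.Sections c) {κ μ ν : c.I} {x : X}

/-- The sections exhaust the covering of the gerbe. -/
def IsFull (D : G.Sections c) : Prop := ∀ α, ∀ x ∈ G.U α, ∃ κ, x ∈ c.U κ ∧ D.r κ = α

theorem oneSec_eq (hx : x ∈ c.U κ) : G.oneSec (D.r κ) x = D.s κ κ x :=
  Gerbe.oneSec_eq (D.subset κ hx) (D.s_ne_zero hx hx) (D.mul_self hx)

theorem isUnitSection_oneSec {D : G.Sections c} (hD : D.IsFull) (α : G.I) :
    (G.L α α).IsUnitSection (G.U α) (G.oneSec α) 0 := by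
  refine IsUnitSection.of_local fun x hx => ?_
  obtain ⟨κ, hκ, rfl⟩ := hD α x hx
  refine ⟨c.U κ, c.U_open κ, hκ, ?_⟩
  have h1 := (D.unit κ κ).mono (O' := G.U (D.r κ) ∩ c.U κ) fun y hy => ⟨hy.2, hy.2⟩
  refine (h1.congr ((G.U_open _).inter (c.U_open κ)) fun y hy => D.oneSec_eq hy.2).congr_form
    fun n p hp w hw => ?_
  have h2 := c.a_self κ n p hp w hw.2
  simp only [Pi.smul_apply, Pi.zero_apply] at h2 ⊢
  rw [h2, smul_zero]

theorem oneSec_ne_zero (hD : D.IsFull) {α : G.I} (hx : x ∈ G.U α) : G.oneSec α x ≠ 0 :=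
  norm_ne_zero_iff.1 (by rw [(isUnitSection_oneSec hD α).1.1 x hx]; exact one_ne_zero)

theorem oneSec_mul_self (hD : D.IsFull) {α : G.I} (hx : x ∈ G.U α) :
    (G.θ α α α).mul x (G.oneSec α x) (G.oneSec α x) = G.oneSec α x := by
  obtain ⟨κ, hκ, rfl⟩ := hD α x hx
  rw [D.oneSec_eq hκ, D.mul_self hκ]

open Classical in
/-- The coordinate of an element of `L_{αβ}` with respect to the section `s_{κμ}`, if this is a
section of `L_{αβ}`.  Comparing the indices only here avoids transporting elements between the
fibres of propositionally equal bundles. -/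
def coord (κ μ : c.I) (α β : G.I) (x : X) : (G.L α β).Fib x →ₗ[ℂ] ℂ :=
  if h : D.r κ = α ∧ D.r μ = β then
    h.1.rec (motive := fun α _ => (G.L α β).Fib x →ₗ[ℂ] ℂ)
      (h.2.rec (motive := fun β _ => (G.L (D.r κ) β).Fib x →ₗ[ℂ] ℂ)
        (innerSL ℂ (D.s κ μ x)).toLinearMap)
  else 0

theorem coord_apply (v : (G.L (D.r κ) (D.r μ)).Fib x) :
    D.coord κ μ _ _ x v = inner ℂ (D.s κ μ x) v := by
  rw [coord, dif_pos ⟨rfl, rfl⟩]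
  rfl

theorem coord_congr {α β α' β' : G.I} {x' : X} {v : (G.L α β).Fib x} {v' : (G.L α' β').Fib x'}
    (h : G.elt v = G.elt v') : D.coord κ μ _ _ _ v = D.coord κ μ _ _ _ v' :=
  congrArg (fun w : G.Elt => D.coord κ μ w.1.1 w.1.2 w.2.1 w.2.2) h

variable {α β γ : G.I}

theorem eq_coord_smul (hκ : x ∈ c.U κ) (hμ : x ∈ c.U μ) (v : (G.L (D.r κ) (D.r μ)).Fib x) :
    v = D.coord κ μ _ _ x v • D.s κ μ x := by
  rw [coord_apply]
  exact IsUnitSection.eq_smul (inter_subset_inter (D.subset κ) (D.subset μ)) (D.unit κ μ).1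
    ⟨hκ, hμ⟩ v

theorem norm_coord (hα : D.r κ = α) (hβ : D.r μ = β) (hκ : x ∈ c.U κ) (hμ : x ∈ c.U μ)
    (v : (G.L α β).Fib x) : ‖D.coord κ μ α β x v‖ = ‖v‖ := by
  subst hα hβ
  rw [coord_apply]
  exact norm_inner_of_finrank_eq_one ((G.L _ _).rank_one x ⟨D.subset κ hκ, D.subset μ hμ⟩)
    (D.norm_s hκ hμ) v

theorem coord_mul (hα : D.r κ = α) (hβ : D.r μ = β) (hγ : D.r ν = γ) (hκ : x ∈ c.U κ)
    (hμ : x ∈ c.U μ) (hν : x ∈ c.U ν) (v : (G.L α β).Fib x) (w : (G.L β γ).Fib x) :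
    (c.θ κ μ ν x : ℂ) * D.coord κ ν α γ x ((G.θ α β γ).mul x v w) =
      D.coord κ μ α β x v * D.coord μ ν β γ x w := by
  subst hα hβ hγ
  have key : ∀ a b : ℂ, D.coord κ ν _ _ x ((G.θ (D.r κ) (D.r μ) (D.r ν)).mul x (a • D.s κ μ x)
      (b • D.s μ ν x)) = a * (b * ((c.θ κ μ ν x)⁻¹ : Circle)) := by
    intro a b
    rw [LinearMap.map_smul₂, map_smul, map_smul, map_smul, D.mul_s hκ hμ hν, Circle.smul_def,
      map_smul, coord_apply, inner_self_of_norm (D.norm_s hκ hν)]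
    simp only [smul_eq_mul, _root_.mul_one]
  have h1 := key (D.coord κ μ _ _ x v) (D.coord μ ν _ _ x w)
  rw [← D.eq_coord_smul hκ hμ v, ← D.eq_coord_smul hμ hν w] at h1
  rw [h1, Circle.coe_inv]
  have h2 : (c.θ κ μ ν x : ℂ) ≠ 0 := Circle.coe_ne_zero _
  field_simp

theorem coord_oneSec (hα : D.r κ = α) (hκ : x ∈ c.U κ) :
    D.coord κ κ α α x (G.oneSec α x) = 1 := by
  subst hα
  rw [coord_apply, D.oneSec_eq hκ, inner_self_of_norm (D.norm_s hκ hκ)]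

theorem norm_oneSec (hα : D.r κ = α) (hκ : x ∈ c.U κ) : ‖G.oneSec α x‖ = 1 := by
  subst hα
  rw [D.oneSec_eq hκ, D.norm_s hκ hκ]

theorem coord_of_isOne {v : (G.L α β).Fib x} (hv : G.IsOne (G.elt v)) (hx : x ∈ G.U α) :
    D.coord κ μ α β x v = D.coord κ μ α α x (G.oneSec α x) := by
  obtain ⟨α', x', e, he, hee, h⟩ := hv
  have h1 : α = α' := congrArg (fun w : G.Elt => w.1.1) h
  have h2 : x = x' := congrArg (fun w : G.Elt => w.2.1) h
  subst h1 h2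
  rw [D.coord_congr h, Gerbe.oneSec_eq hx he hee]

/-- The coordinate of a parallel section. -/
theorem coord_parallel (hα : D.r κ = α) (hβ : D.r μ = β) {b : ℝ → X} (hb : IsCurve b) {a e : ℝ}
    {σ : ∀ τ, (G.L α β).Fib (b τ)} (hσ : (G.L α β).IsParallel b a e σ) {o ℓ : ℝ} (ho : a ≤ o)
    (hℓ : 0 ≤ ℓ) (hoe : o + ℓ ≤ e) (hbU : ∀ τ ∈ Icc 0 ℓ, b (o + τ) ∈ c.U κ ∩ c.U μ) :
    D.coord κ μ α β _ (σ (o + ℓ)) = Circle.exp (-(2 * Real.pi *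
      ∫ τ in (0 : ℝ)..ℓ, alongCurve (c.a κ μ) (fun τ => b (o + τ)) τ)) *
      D.coord κ μ α β _ (σ o) := by
  subst hα hβ
  have h0 : D.coord κ μ (D.r κ) (D.r μ) _ (σ o) = D.coord κ μ _ _ _ (σ (o + 0)) := by
    rw [add_zero]
  rw [h0, coord_apply, coord_apply]
  have hc : IsCurve fun τ => b (o + τ) := by
    have h := isCurve_comp_plot (p := fun w : Euc 1 => b (w 0)) hb
      (f := fun t => EuclideanSpace.single 0 (o + t))
      (contDiff_single_one.comp (contDiff_const.add contDiff_id))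
    simpa using h
  have h1 := (hσ.shift ho hoe hb).eq_exp hc ((c.U_open κ).inter (c.U_open μ))
    (inter_subset_inter (D.subset κ) (D.subset μ)) (D.unit κ μ) hbU ℓ ⟨hℓ, le_rfl⟩
  have e1 : ∫ t in (0 : ℝ)..ℓ, alongCurve ((2 * Real.pi) • c.a κ μ) (fun τ => b (o + τ)) t =
      2 * Real.pi * ∫ t in (0 : ℝ)..ℓ, alongCurve (c.a κ μ) (fun τ => b (o + τ)) t :=
    intervalIntegral.integral_const_mul _ _
  rw [e1] at h1
  exact h1

theorem hasDerivWithinAt_coord (hα : D.r κ = α) (hβ : D.r μ = β) {b : ℝ → X} (hb : IsCurve b)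
    {a e : ℝ} {σ : ∀ τ, (G.L α β).Fib (b τ)} (hσ : (G.L α β).IsParallel b a e σ) {τ : ℝ}
    (hτ : τ ∈ Icc a e) (hbτ : b τ ∈ c.U κ ∩ c.U μ) :
    HasDerivWithinAt (fun τ => D.coord κ μ α β _ (σ τ))
      (-Complex.I * ((2 * Real.pi * alongCurve (c.a κ μ) b τ : ℝ) : ℂ) *
        D.coord κ μ α β _ (σ τ)) (Icc a e) τ := by
  subst hα hβ
  simp only [coord_apply]
  exact hσ.hasDerivWithinAt hb ((c.U_open κ).inter (c.U_open μ))
    (inter_subset_inter (D.subset κ) (D.subset μ)) (D.unit κ μ) hτ hbτ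

theorem unitOn_coord (hα : D.r κ = α) (hβ : D.r μ = β) {O : Set X} {e : ∀ x, (G.L α β).Fib x}
    (he : (G.L α β).IsSmoothUnit O e) :
    UnitOn (O ∩ (c.U κ ∩ c.U μ)) fun x => D.coord κ μ α β x (e x) := by
  subst hα hβ
  simp only [coord_apply]
  exact IsSmoothUnit.ratio (fun x hx => inter_subset_inter (D.subset κ) (D.subset μ) hx.2)
    (he.mono inter_subset_left) ((D.unit κ μ).1.mono inter_subset_right)

end Gerbe.Sections

end One

open LineBundle

/-! ### Local pieces in coordinates -/

section Fill

variable {E : Type v} [NormedAddCommGroup E] [NormedSpace ℝ E]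
  {B : Type u} [TopologicalSpace B] [ChartedSpace E B] {G : Gerbe (Mfd E B)}
  {c : Cocycle2 (Mfd E B)} (D : G.Sections c) {P Q : Subdivision} {s s' : ZMod P.n → G.I}
  {γ : Loop E B}

theorem mem_division (hγ : γ ∈ fibreSet (evCocycle c) Q lab) (i : ZMod Q.n) :
    ev (γ, Q.t (i + 1)) ∈ c.U (lab i) ∩ c.U (lab (i + 1)) :=
  mem_of_mem_fibreDom (fibreSet_subset _ _ _ hγ) i

open Classical in
/-- Coordinates of an element `⨂ v` of the local piece for `(P, s)` on a refinement `Q` of `P`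
with labels in the index set of the cocycle: at the additional points of division the factor is
`1`. -/
def fillCoord (R : P.Refinement Q) (lab : ZMod Q.n → c.I) (γ : Loop E B)
    (v : ∀ j, (G.L (s j) (s (j + 1))).Fib (ev (γ, P.t (j + 1)))) (i : ZMod Q.n) : ℂ :=
  if R.IsLast i then D.coord (lab i) (lab (i + 1)) _ _ _ (v (R.idx i))
  else D.coord (lab i) (lab (i + 1)) _ _ _ (G.oneSec (s (R.idx i)) (ev (γ, Q.t (i + 1))))

/-- The contribution of the additional points of division. -/
def fillConst (s : ZMod P.n → G.I) (R : P.Refinement Q) (lab : ZMod Q.n → c.I) (γ : Loop E B) : ℂ :=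
  ∏ j, ∏ l ∈ Finset.range (R.k j), D.coord (lab (R.r j + (l : ZMod Q.n)))
    (lab (R.r j + (l : ZMod Q.n) + 1)) _ _ _
    (G.oneSec (s j) (ev (γ, Q.t (R.r j + (l : ZMod Q.n) + 1))))

/-- The product of the coordinates as a multilinear map. -/
def fillMap (s : ZMod P.n → G.I) (R : P.Refinement Q) (lab : ZMod Q.n → c.I) (γ : Loop E B) :
    MultilinearMap ℂ (fun j : ZMod P.n => (G.L (s j) (s (j + 1))).Fib (ev (γ, P.t (j + 1)))) ℂ :=
  fillConst D s R lab γ • (MultilinearMap.mkPiAlgebra ℂ (ZMod P.n) ℂ).compLinearMap fun j =>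
    D.coord (lab (R.r j + (R.k j : ZMod Q.n))) (lab (R.r (j + 1))) (s j) (s (j + 1))
      (ev (γ, P.t (j + 1)))

variable {lab lab' : ZMod Q.n → c.I} (R : P.Refinement Q)

theorem fillMap_apply (v : ∀ j, (G.L (s j) (s (j + 1))).Fib (ev (γ, P.t (j + 1)))) :
    fillMap D s R lab γ v = fillConst D s R lab γ * ∏ j,
      D.coord (lab (R.r j + (R.k j : ZMod Q.n))) (lab (R.r (j + 1))) _ _ _ (v j) := rfl

theorem fillMap_eq_prod (v : ∀ j, (G.L (s j) (s (j + 1))).Fib (ev (γ, P.t (j + 1)))) :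
    fillMap D s R lab γ v = ∏ i, fillCoord D R lab γ v i := by
  rw [fillMap_apply, fillConst, R.prod_eq, ← Finset.prod_mul_distrib]
  refine Finset.prod_congr rfl fun j _ => ?_
  rw [Finset.prod_range_succ]
  congr 1
  · refine Finset.prod_congr rfl fun l hl => ?_
    have hl' := Finset.mem_range.1 hl
    rw [fillCoord, if_neg fun h => hl'.ne ((R.isLast_add hl'.le).1 h), R.idx_add j hl'.le]
  · rw [fillCoord, if_pos (R.isLast_last j), R.idx_last, ← R.r_succ]

/-- As all the sections have unit length, the product of the coordinates has the norm of `⨂ v`. -/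
theorem norm_fillMap (h : ∀ i, D.r (lab i) = s (R.idx i))
    (hγ : γ ∈ fibreSet (evCocycle c) Q lab)
    (v : ∀ j, (G.L (s j) (s (j + 1))).Fib (ev (γ, P.t (j + 1)))) :
    ‖fillMap D s R lab γ v‖ = ∏ j, ‖v j‖ := by
  rw [fillMap_apply, _root_.norm_mul, norm_prod, fillConst, norm_prod, Finset.prod_eq_one, one_mul]
  · refine Finset.prod_congr rfl fun j _ => ?_
    have hm := mem_division hγ (R.r j + (R.k j : ZMod Q.n))
    rw [R.t_last_succ, ← R.r_succ] at hm
    exact D.norm_coord (by rw [h, R.idx_last]) (by rw [h, R.idx_r]) hm.1 hm.2 _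
  · intro j _
    rw [norm_prod]
    refine Finset.prod_eq_one fun l hl => ?_
    have hl' := Finset.mem_range.1 hl
    have hm := mem_division hγ (R.r j + (l : ZMod Q.n))
    have e1 : D.r (lab (R.r j + (l : ZMod Q.n))) = s j := by rw [h, R.idx_add j hl'.le]
    have e2 : D.r (lab (R.r j + (l : ZMod Q.n) + 1)) = s j := by
      rw [h, add_assoc, ← Nat.cast_succ, R.idx_add j hl']
    rw [D.norm_coord e1 e2 hm.1 hm.2, D.norm_oneSec e1 hm.1]

/-- The product of the coordinates does not change when the subdivision is refined further. -/
theorem fillMap_refine {Q' : Subdivision} (S : Q.Refinement Q') (T : P.Refinement Q')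
    (h : ∀ i, D.r (lab i) = s (R.idx i)) (hγ : γ ∈ fibreSet (evCocycle c) Q lab) :
    fillMap D s T (lab ∘ S.idx) γ = fillMap D s R lab γ := by
  ext v
  rw [fillMap_eq_prod, fillMap_eq_prod, S.prod_eq]
  refine Finset.prod_congr rfl fun m _ => ?_
  rw [Finset.prod_range_succ, Finset.prod_eq_one fun l hl => ?_, one_mul]
  · have h1 : T.IsLast (S.r m + (S.k m : ZMod Q'.n)) ↔ R.IsLast m := by
      rw [R.isLast_trans S T, S.idx_last]
      exact and_iff_right (S.isLast_last m)
    have h2 : T.idx (S.r m + (S.k m : ZMod Q'.n)) = R.idx m := by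
      rw [R.idx_trans S T, S.idx_last]
    rw [fillCoord, fillCoord, h2]
    simp only [Function.comp_apply, S.idx_last, S.idx_last_succ]
    by_cases hm : R.IsLast m
    · rw [if_pos (h1.2 hm), if_pos hm]
    · rw [if_neg (mt h1.1 hm), if_neg hm, S.t_last_succ]
  · have hl' := Finset.mem_range.1 hl
    have h1 : ¬T.IsLast (S.r m + (l : ZMod Q'.n)) := fun h1 =>
      hl'.ne ((S.isLast_add hl'.le).1 ((R.isLast_trans S T _).1 h1).1)
    have h2 : T.idx (S.r m + (l : ZMod Q'.n)) = R.idx m := by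
      rw [R.idx_trans S T, S.idx_add m hl'.le]
    have h3 : S.idx (S.r m + (l : ZMod Q'.n) + 1) = m := by
      rw [add_assoc, ← Nat.cast_succ, S.idx_add m hl']
    rw [fillCoord, if_neg h1, h2]
    simp only [Function.comp_apply, S.idx_add m hl'.le, h3]
    exact D.coord_oneSec (h m) (mem_of_mem_arcDom_refine S (U := fun j => (evCocycle c).U (lab j))
      (fibreSet_subset _ _ _ hγ) m hl'.le)

/-- Compatibility with the transition maps for refinements. -/
theorem fillMap_insert {P' : Subdivision} (R₀ : P.Refinement P') (R' : P'.Refinement Q)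
    (h : ∀ i, D.r (lab i) = s (R.idx i)) (hγ : γ ∈ fibreSet (evCocycle c) Q lab)
    (v : ∀ j, (G.L (s j) (s (j + 1))).Fib (ev (γ, P.t (j + 1))))
    (v' : ∀ j, (G.L ((s ∘ R₀.idx) j) ((s ∘ R₀.idx) (j + 1))).Fib (ev (γ, P'.t (j + 1))))
    (h1 : ∀ j, G.elt (v' (R₀.r j + (R₀.k j : ZMod P'.n))) = G.elt (v j))
    (h2 : ∀ j, ∀ l < R₀.k j, G.IsOne (G.elt (v' (R₀.r j + (l : ZMod P'.n))))) :
    fillMap D (s ∘ R₀.idx) R' lab γ v' = fillMap D s R lab γ v := by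
  rw [fillMap_eq_prod, fillMap_eq_prod]
  refine Finset.prod_congr rfl fun i _ => ?_
  have hidx := R₀.idx_trans R' R i
  by_cases hi : R'.IsLast i
  · by_cases hm : R₀.IsLast (R'.idx i)
    · have h3 := h1 (R₀.idx (R'.idx i))
      rw [← hm.eq] at h3
      rw [fillCoord, fillCoord, if_pos hi, if_pos ((R₀.isLast_trans R' R i).2 ⟨hi, hm⟩), hidx]
      exact D.coord_congr h3
    · have h3 : G.IsOne (G.elt (v' (R'.idx i))) := by
        obtain ⟨l, hl, hli⟩ := R₀.exists_eq_add (R'.idx i)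
        have hlk : l < R₀.k (R₀.idx (R'.idx i)) := by
          refine lt_of_le_of_ne hl fun hlk => hm ?_
          rw [hli, hlk]
          exact R₀.isLast_last _
        have h4 := h2 _ l hlk
        rwa [← hli] at h4
      have hx : ev (γ, P'.t (R'.idx i + 1)) = ev (γ, Q.t (i + 1)) := by rw [hi.t_succ]
      rw [fillCoord, fillCoord, if_pos hi,
        if_neg fun hT => hm ((R₀.isLast_trans R' R i).1 hT).2, D.coord_of_isOne h3]
      · simp only [Function.comp_apply]
        rw [hx, hidx]
      · rw [hx, Function.comp_apply, ← hidx, ← h]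
        exact D.subset _ (mem_division hγ i).1
  · rw [fillCoord, fillCoord, if_neg hi,
      if_neg fun hT => hi ((R₀.isLast_trans R' R i).1 hT).1, hidx]
    rfl

/-- Compatibility with the transition maps for a change of the labels. -/
theorem fillMap_relabel (h : ∀ i, D.r (lab i) = s (R.idx i))
    (h' : ∀ i, D.r (lab' i) = s' (R.idx i)) (hγ : γ ∈ fibreSet (evCocycle c) Q lab)
    (hγ' : γ ∈ fibreSet (evCocycle c) Q lab') (hl : γ ∈ loopSet G P s) (hl' : γ ∈ loopSet G P s')
    (hD : D.IsFull)
    (v : ∀ j, (G.L (s j) (s (j + 1))).Fib (ev (γ, P.t (j + 1))))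
    (v' : ∀ j, (G.L (s' j) (s' (j + 1))).Fib (ev (γ, P.t (j + 1))))
    (w : ∀ i, (G.L (s i) (s' i)).Fib (ev (γ, P.t i)))
    (w' : ∀ i, (G.L (s i) (s' i)).Fib (ev (γ, P.t (i + 1))))
    (hw : ∀ i, ‖w i‖ = 1)
    (hww' : ∀ i, (G.L (s i) (s' i)).Transports (fun τ => ev (γ, P.point i τ)) 0 (P.len i)
      ⟨_, w i⟩ ⟨_, w' i⟩)
    (hv : ∀ i, (G.θ (s i) (s (i + 1)) (s' (i + 1))).mul _ (v i) (w (i + 1)) =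
      (G.θ (s i) (s' i) (s' (i + 1))).mul _ (w' i) (v' i)) :
    fibreTransition (evCocycle c) Q lab lab' γ * fillMap D s R lab γ v =
      fillMap D s' R lab' γ v' := by
  choose σ hσ hσ0 hσ1 using hww'
  -- the coordinates of the parallel sections
  set W : c.I → c.I → ZMod P.n → ℝ → ℂ := fun κ μ j o => D.coord κ μ _ _ _ (σ j o) with hW
  have hW0 : ∀ κ μ j, W κ μ j 0 = D.coord κ μ _ _ _ (w j) := fun κ μ j =>
    congrArg (fun p : Σ x, (G.L (s j) (s' j)).Fib x => D.coord κ μ _ _ p.1 p.2) (hσ0 j)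
  have hW1 : ∀ κ μ j, W κ μ j (P.len j) = D.coord κ μ _ _ _ (w' j) := fun κ μ j =>
    congrArg (fun p : Σ x, (G.L (s j) (s' j)).Fib x => D.coord κ μ _ _ p.1 p.2) (hσ1 j)
  set A : ZMod Q.n → ℝ := fun i => ∫ τ in (0 : ℝ)..Q.len i,
    alongCurve ((evCocycle c).a (lab i) (lab' i)) (fun τ' => (γ, Q.point i τ')) τ with hA
  have hpt : ∀ i τ, ev (γ, P.point (R.idx i) (R.offset i + τ)) = ev (γ, Q.point i τ) :=
    fun i τ => by rw [R.point_eq]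
  -- along the arc `i` the coordinate changes by the holonomy of `a`
  have hstep : ∀ i, W (lab i) (lab' i) (R.idx i) (R.offset i + Q.len i) =
      Circle.exp (-(2 * Real.pi * A i)) * W (lab i) (lab' i) (R.idx i) (R.offset i) := by
    intro i
    have h1 := D.coord_parallel (h i) (h' i)
      (b := fun τ => ev (γ, P.point (R.idx i) τ)) (isCurve_loop γ P (R.idx i)) (hσ (R.idx i))
      (R.offset_nonneg i) (Q.len_pos i).le (R.offset_add_len_le i) fun τ hτ => by
        rw [hpt]
        exact ⟨fibreSet_subset _ _ _ hγ i τ hτ, fibreSet_subset _ _ _ hγ' i τ hτ⟩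
    simp only [hpt] at h1
    exact h1
  have hmemP : ∀ j, ∀ τ ∈ Icc 0 (P.len j), ev (γ, P.point j τ) ∈ G.U (s j) ∩ G.U (s' j) :=
    fun j τ hτ => ⟨(hl j τ hτ).2, (hl' j τ hτ).2⟩
  -- the coordinates do not vanish, since the parallel sections keep the norm one of `w`
  have hWne : ∀ i, W (lab i) (lab' i) (R.idx i) (R.offset i) ≠ 0 := by
    have hmem : ∀ i, ∀ τ ∈ Icc 0 (Q.len i), ev (γ, P.point (R.idx i) (R.offset i + τ)) ∈
        c.U (lab i) ∩ c.U (lab' i) := fun i τ hτ => by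
      rw [hpt]
      exact ⟨fibreSet_subset _ _ _ hγ i τ hτ, fibreSet_subset _ _ _ hγ' i τ hτ⟩
    have hmem0 : ∀ i, ev (γ, P.point (R.idx i) (R.offset i)) ∈ c.U (lab i) ∩ c.U (lab' i) :=
      fun i => by
        have h1 := hmem i 0 ⟨le_rfl, (Q.len_pos i).le⟩
        rwa [add_zero] at h1
    have hWnorm : ∀ i, ‖W (lab i) (lab' i) (R.idx i) (R.offset i)‖ =
        ‖σ (R.idx i) (R.offset i)‖ := fun i =>
      D.norm_coord (h i) (h' i) (hmem0 i).1 (hmem0 i).2 _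
    have hnext : ∀ i, ‖σ (R.idx i) (R.offset i + Q.len i)‖ = ‖σ (R.idx i) (R.offset i)‖ := by
      intro i
      have h1 := hmem i (Q.len i) ⟨(Q.len_pos i).le, le_rfl⟩
      have h2 := congrArg norm (hstep i)
      rw [_root_.norm_mul, Circle.norm_coe, one_mul, hWnorm] at h2
      rw [← h2]
      exact (D.norm_coord (h i) (h' i) h1.1 h1.2 _).symm
    have hone : ∀ j, ∀ l ≤ R.k j, ‖σ j (Q.arcSum (R.r j) l)‖ = 1 := by
      intro j l
      induction l with
      | zero =>
        intro _
        rw [Q.arcSum_zero, ← hw j]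
        exact congrArg (fun p : Σ x, (G.L (s j) (s' j)).Fib x => ‖p.2‖) (hσ0 j)
      | succ l ih =>
        intro hl
        have h1 := hnext (R.r j + (l : ZMod Q.n))
        rw [R.idx_add j (Nat.le_of_succ_le hl), R.offset_add j (Nat.le_of_succ_le hl),
          ← Q.arcSum_succ] at h1
        rw [h1, ih (Nat.le_of_succ_le hl)]
    intro i
    refine norm_ne_zero_iff.1 ?_
    obtain ⟨l, hlk, hi⟩ := R.exists_eq_add i
    have h1 : R.offset i = Q.arcSum (R.r (R.idx i)) l := by
      generalize R.idx i = j at hlk hi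
      subst hi
      exact R.offset_add j hlk
    rw [hWnorm, h1, hone _ l hlk]
    exact one_ne_zero
  -- an arc of `Q` contributes its factor of the transition function, up to the coordinates of the
  -- parallel sections at both ends
  have key : ∀ i, (Circle.exp (2 * Real.pi * A i) *
      c.θ (lab i) (lab' i) (lab' (i + 1)) (ev (γ, Q.t (i + 1))) *
      (c.θ (lab i) (lab (i + 1)) (lab' (i + 1)) (ev (γ, Q.t (i + 1))))⁻¹ : Circle) *
      fillCoord D R lab γ v i *
      W (lab (i + 1)) (lab' (i + 1)) (R.idx (i + 1)) (R.offset (i + 1)) =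
      W (lab i) (lab' i) (R.idx i) (R.offset i) * fillCoord D R lab' γ v' i := by
    intro i
    have hm := mem_division hγ i
    have hm' := mem_division hγ' i
    -- `K` is the coordinate of the product of `v` (or `1`) with the parallel section at the end of
    -- the arc, expressed in both ways allowed by `hv` (or by the unit laws)
    obtain ⟨K, hK1, hK2⟩ : ∃ K : ℂ,
        (c.θ (lab i) (lab (i + 1)) (lab' (i + 1)) (ev (γ, Q.t (i + 1))) : ℂ) * K =
          fillCoord D R lab γ v i *
          W (lab (i + 1)) (lab' (i + 1)) (R.idx (i + 1)) (R.offset (i + 1)) ∧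
        (c.θ (lab i) (lab' i) (lab' (i + 1)) (ev (γ, Q.t (i + 1))) : ℂ) * K =
          W (lab i) (lab' i) (R.idx i) (R.offset i + Q.len i) * fillCoord D R lab' γ v' i := by
      by_cases hi : R.IsLast i
      · have hx : ev (γ, Q.t (i + 1)) = ev (γ, P.t (R.idx i + 1)) := by rw [hi.t_succ]
        have e1 : D.r (lab (i + 1)) = s (R.idx i + 1) := by rw [h, hi.idx_succ]
        have e2 : D.r (lab' (i + 1)) = s' (R.idx i + 1) := by rw [h', hi.idx_succ]
        rw [hx] at hm hm' ⊢
        have e3 : R.offset (i + 1) = 0 := by rw [hi.succ_eq, R.offset_r]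
        rw [hi.idx_succ, e3, hW0, hi.offset_add_len, hW1, fillCoord, if_pos hi, fillCoord,
          if_pos hi]
        refine ⟨D.coord (lab i) (lab' (i + 1)) _ _ _
          ((G.θ _ _ _).mul _ (v (R.idx i)) (w (R.idx i + 1))),
          D.coord_mul (h i) e1 e2 hm.1 hm.2 hm'.2 _ _, ?_⟩
        rw [hv]
        exact D.coord_mul (h i) (h' i) e2 hm.1 hm'.1 hm'.2 _ _
      · have hx : ev (γ, P.point (R.idx i) (R.offset i + Q.len i)) = ev (γ, Q.t (i + 1)) := by
          rw [hpt, Q.point_len]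
        have e1 : D.r (lab (i + 1)) = s (R.idx i) := by rw [h, R.idx_succ_of_not_isLast hi]
        have e2 : D.r (lab' (i + 1)) = s' (R.idx i) := by rw [h', R.idx_succ_of_not_isLast hi]
        rw [fillCoord, if_neg hi, fillCoord, if_neg hi, R.idx_succ_of_not_isLast hi,
          R.offset_succ_of_not_isLast hi]
        rw [← hx] at hm hm' ⊢
        have hU : ev (γ, P.point (R.idx i) (R.offset i + Q.len i)) ∈
            G.U (s (R.idx i)) ∩ G.U (s' (R.idx i)) :=
          hmemP _ _ ⟨add_nonneg (R.offset_nonneg i) (Q.len_pos i).le, R.offset_add_len_le i⟩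
        refine ⟨D.coord (lab i) (lab' (i + 1)) _ _ _ (σ (R.idx i) (R.offset i + Q.len i)), ?_, ?_⟩
        · have h3 := D.coord_mul (h i) e1 e2 hm.1 hm.2 hm'.2
            (G.oneSec (s (R.idx i)) (ev (γ, P.point (R.idx i) (R.offset i + Q.len i))))
            (σ (R.idx i) (R.offset i + Q.len i))
          rw [Gerbe.one_mul hU.1 hU.2 (Gerbe.Sections.oneSec_ne_zero D hD hU.1)
            (Gerbe.Sections.oneSec_mul_self D hD hU.1)] at h3
          exact h3
        · have h3 := D.coord_mul (h i) (h' i) e2 hm.1 hm'.1 hm'.2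
            (σ (R.idx i) (R.offset i + Q.len i))
            (G.oneSec (s' (R.idx i)) (ev (γ, P.point (R.idx i) (R.offset i + Q.len i))))
          rw [Gerbe.mul_one hU.1 hU.2 (Gerbe.Sections.oneSec_ne_zero D hD hU.2)
            (Gerbe.Sections.oneSec_mul_self D hD hU.2)] at h3
          exact h3
    rw [hstep, Circle.exp_neg, Circle.coe_inv] at hK2
    have n1 : (Circle.exp (2 * Real.pi * A i) : ℂ) ≠ 0 := Circle.coe_ne_zero _
    have n2 : (c.θ (lab i) (lab (i + 1)) (lab' (i + 1)) (ev (γ, Q.t (i + 1))) : ℂ) ≠ 0 :=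
      Circle.coe_ne_zero _
    rw [mul_assoc, ← hK1, Circle.coe_mul, Circle.coe_mul, Circle.coe_inv]
    field_simp at hK2 ⊢
    linear_combination hK2
  -- around the circle the coordinates of the parallel sections cancel
  have hprod := Finset.prod_congr (rfl : (Finset.univ : Finset (ZMod Q.n)) = _) fun i _ => key i
  rw [Finset.prod_mul_distrib, Finset.prod_mul_distrib, Finset.prod_mul_distrib,
    Q.prod_shift (fun i => W (lab i) (lab' i) (R.idx i) (R.offset i)),
    mul_comm (∏ i, W (lab i) (lab' i) (R.idx i) (R.offset i))] at hprod
  have h5 := mul_right_cancel₀ (Finset.prod_ne_zero_iff.2 fun i _ => hWne i) hprod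
  rw [fillMap_eq_prod, fillMap_eq_prod, ← h5]
  congr 1
  exact map_prod Circle.coeHom _ _

end Fill

open LineBundle

/-! ### Existence of the transgression -/

/-- A refinement with the labels carried along is good for all points for which the given
subdivision is. -/
theorem fibreSet_refine {X : Type u} [DiffeologicalSpace X] (c : Cocycle2 (X × Circle))
    {P Q : Subdivision} (R : P.Refinement Q) (lab : ZMod P.n → c.I) :
    fibreSet c P lab ⊆ fibreSet c Q (lab ∘ R.idx) := by
  intro x hx i τ hτ
  have h0 : (x, Q.t i * Circle.exp (2 * Real.pi * τ)) = (x, Q.point i τ) := rfl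
  rw [h0, R.point_eq]
  have h1 : (x, P.point (R.idx i) (R.offset i + τ)) ∈
      c.U (lab (R.idx i - 1)) ∩ c.U (lab (R.idx i)) :=
    hx (R.idx i) (R.offset i + τ)
      ⟨add_nonneg (R.offset_nonneg i) hτ.1, by linarith [hτ.2, R.offset_add_len_le i]⟩
  refine ⟨?_, h1.2⟩
  rcases R.idx_succ (i - 1) with h2 | ⟨-, -, h2⟩
  · rw [sub_add_cancel] at h2
    rw [Function.comp_apply, ← h2]
    exact h1.2
  · rw [sub_add_cancel] at h2
    rw [Function.comp_apply, ← add_sub_cancel_right (R.idx (i - 1)) 1, ← h2]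
    exact h1.1

section Glue

variable {E : Type v} [NormedAddCommGroup E] [NormedSpace ℝ E]
  {B : Type u} [TopologicalSpace B] [ChartedSpace E B] {G : Gerbe (Mfd E B)}
  {c : Cocycle2 (Mfd E B)}

/-- Unit sections of `L` representing the fibre integral of `ev* c`. -/
structure FibreSections (c : Cocycle2 (Mfd E B)) (L : LineBundle (Loop E B) univ) where
  σ : ∀ (Q : Subdivision) (_ : ZMod Q.n → c.I) (γ : Loop E B), L.Fib γ
  unit : ∀ Q lab, L.IsUnitSection (fibreSet (evCocycle c) Q lab) (σ Q lab)
    (-((2 * Real.pi) • fibreForm (evCocycle c) Q lab))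
  trans : ∀ Q lab lab', ∀ γ ∈ fibreSet (evCocycle c) Q lab ∩ fibreSet (evCocycle c) Q lab',
    σ Q lab γ = fibreTransition (evCocycle c) Q lab lab' γ • σ Q lab' γ
  refine : ∀ (P Q : Subdivision) (R : P.Refinement Q) (lab : ZMod P.n → c.I),
    ∀ γ ∈ fibreSet (evCocycle c) P lab, σ Q (lab ∘ R.idx) γ = σ P lab γ

/-- The sections belonging to a refinement with the labels carried along agree with the given ones,
because the transition function between them is one. -/
theorem FibreSections.nonempty {L : LineBundle (Loop E B) univ}
    (h : L.HasCocycle (fibreCocycle (evCocycle c))) : Nonempty (FibreSections c L) := by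
  obtain ⟨σ, h1, h2⟩ := h
  have hid : ∀ Q : Subdivision, ∃ R : Q.Refinement Q, ∀ i, R.idx i = i := fun Q =>
    ⟨Subdivision.Refinement.ofSubset fun j => ⟨j, rfl⟩, fun i => Subdivision.Refinement.idx_self _ i⟩
  refine ⟨⟨fun Q lab => σ ⟨Q, lab⟩, fun Q lab => h1 ⟨Q, lab⟩, fun Q lab lab' γ hγ => ?_,
    fun P Q R lab γ hγ => ?_⟩⟩
  · obtain ⟨R, hR⟩ := hid Q
    rw [h2 ⟨Q, lab⟩ ⟨Q, lab'⟩ γ hγ]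
    have h3 := fibreTransition₂_eq (c := evCocycle c) (q := ⟨Q, lab⟩) (q' := ⟨Q, lab'⟩)
      (fibreSet_subset _ _ _ hγ.1) (fibreSet_subset _ _ _ hγ.2) R R
    have h4 : R.idx = id := funext hR
    rw [h4] at h3
    exact congrArg (· • σ ⟨Q, lab'⟩ γ) h3
  · obtain ⟨S, hS⟩ := hid Q
    have hγ' := fibreSet_refine (evCocycle c) R lab hγ
    have h5 := h2 ⟨Q, lab ∘ R.idx⟩ ⟨P, lab⟩ γ ⟨hγ', hγ⟩
    have h3 := fibreTransition₂_eq (c := evCocycle c) (q := ⟨Q, lab ∘ R.idx⟩) (q' := ⟨P, lab⟩)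
      (fibreSet_subset _ _ _ hγ') (fibreSet_subset _ _ _ hγ) S R
    have h4 : S.idx = id := funext hS
    rw [h4, Function.comp_id, fibreTransition_self (fibreSet_subset _ _ _ hγ')] at h3
    exact h5.trans ((congrArg (· • σ ⟨P, lab⟩ γ) h3).trans (one_smul _ _))

variable (D : G.Sections c) {P : Subdivision} {s s' : ZMod P.n → G.I} {γ : Loop E B}

/-- A lift of the labels `s` of the arcs of `P` to the index set of the cocycle, on a refinement
of `P`. -/
structure Lift (P : Subdivision) (s : ZMod P.n → G.I) where
  Q : Subdivision
  R : P.Refinement Q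
  lab : ZMod Q.n → c.I
  r_lab : ∀ i, D.r (lab i) = s (R.idx i)

variable {D}

/-- The loops for which the lift gives a local trivialisation. -/
def Lift.dom (q : Lift D P s) : Set (Loop E B) := fibreSet (evCocycle c) q.Q q.lab

theorem Lift.dOpen_dom (q : Lift D P s) : DOpen q.dom := dOpen_fibreSet _ _ _

/-- Near each loop of `V(P, s)` the labels can be lifted after a refinement, because the `U_κ` with
`r(κ) = α` cover `U_α`. -/
theorem exists_lift (hD : D.IsFull) (hγ : γ ∈ loopSet G P s) : ∃ q : Lift D P s, γ ∈ q.dom := by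
  -- the arcs `j` and `j + 1` together form a compact set in `U_{s(j)}`
  have hU : ∀ j, ∀ τ ∈ Icc 0 (P.len j + P.len (j + 1)), ev (γ, P.point j τ) ∈ G.U (s j) := by
    intro j τ hτ
    rcases le_total τ (P.len j) with h | h
    · exact (hγ j τ ⟨hτ.1, h⟩).2
    · have h1 := (hγ (j + 1) (τ - P.len j) ⟨by linarith, by linarith [hτ.2]⟩).1
      have h2 := P.point_add j 1 (τ - P.len j)
      rw [Nat.cast_one, P.arcSum_one, add_sub_cancel] at h2
      rwa [add_sub_cancel_right, h2] at h1
  have hleb : ∀ j, ∃ δ > 0, ∀ τ ∈ Icc 0 (P.len j + P.len (j + 1)), ∃ κ : c.I, D.r κ = s j ∧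
      ∀ τ' ∈ Icc 0 (P.len j + P.len (j + 1)), |τ' - τ| < δ → ev (γ, P.point j τ') ∈ c.U κ := by
    intro j
    obtain ⟨δ, hδ, h⟩ := lebesgue_number_lemma_of_metric
      (isCompact_Icc (a := (0 : ℝ)) (b := P.len j + P.len (j + 1)))
      (c := fun κ : {κ : c.I // D.r κ = s j} => (fun τ => ev (γ, P.point j τ)) ⁻¹' c.U κ)
      (fun κ => (isCurve_loop γ P j).isOpen_preimage (c.U_open κ)) fun τ hτ => by
        obtain ⟨κ, hκ, hr⟩ := hD _ _ (hU j τ hτ)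
        exact mem_iUnion.2 ⟨⟨κ, hr⟩, hκ⟩
    refine ⟨δ, hδ, fun τ hτ => ?_⟩
    obtain ⟨κ, hκ⟩ := h τ hτ
    exact ⟨κ, κ.2, fun τ' _ h' => hκ (by rwa [Metric.mem_ball, Real.dist_eq])⟩
  choose δ hδ hκ using hleb
  have hε : ∃ ε > 0, ∀ j, ε ≤ δ j / 2 ∧ ε ≤ P.len j := by
    have h1 : ∀ j, 0 < min (δ j / 2) (P.len j) := fun j => lt_min (half_pos (hδ j)) (P.len_pos j)
    obtain ⟨j₀, hj₀⟩ := Finite.exists_min fun j => min (δ j / 2) (P.len j)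
    exact ⟨_, h1 j₀, fun j => le_min_iff.1 (hj₀ j)⟩
  obtain ⟨ε, hε0, hε⟩ := hε
  obtain ⟨Q, ⟨R⟩, -, hQ⟩ := Subdivision.exists_common_refinement P P hε0
  have ho : ∀ i, R.offset i ∈ Icc 0 (P.len (R.idx i) + P.len (R.idx i + 1)) := fun i =>
    ⟨R.offset_nonneg i, by
      linarith [R.offset_add_len_le i, Q.len_pos i, P.len_pos (R.idx i + 1)]⟩
  choose lab hlab hlabU using fun i => hκ (R.idx i) (R.offset i) (ho i)
  -- the label chosen for the arc `i` is good for the arcs `i` and `i + 1`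
  have hmem : ∀ i, ∀ τ ∈ Icc 0 (Q.len i + Q.len (i + 1)), ev (γ, Q.point i τ) ∈ c.U (lab i) := by
    intro i τ hτ
    rw [R.point_eq]
    have h1 := hQ i
    have h2 := hQ (i + 1)
    have h3 := hε (R.idx i)
    have h4 := hε (R.idx i + 1)
    refine hlabU i _ ⟨add_nonneg (R.offset_nonneg i) hτ.1, ?_⟩ ?_
    · linarith [hτ.2, R.offset_add_len_le i]
    · rw [add_sub_cancel_left, abs_of_nonneg hτ.1]
      linarith [hτ.2]
  refine ⟨⟨Q, R, lab, hlab⟩, fun i τ hτ => ⟨?_, ?_⟩⟩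
  · have h1 := hmem (i - 1) (Q.len (i - 1) + τ)
      ⟨add_nonneg (Q.len_pos _).le hτ.1, by rw [sub_add_cancel]; linarith [hτ.2]⟩
    have h2 := Q.point_add (i - 1) 1 τ
    rw [Nat.cast_one, sub_add_cancel, Q.arcSum_one] at h2
    rw [← h2] at h1
    exact h1
  · exact hmem i τ ⟨hτ.1, by linarith [hτ.2, Q.len_pos (i + 1)]⟩

variable {L : LineBundle (Loop E B) univ} (F : FibreSections c L)

/-- The identification of the local piece for `(P, s)` with `L`, in terms of a lift. -/
def Lift.glue (q : Lift D P s) (γ : Loop E B) :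
    MultilinearMap ℂ (fun j : ZMod P.n => (G.L (s j) (s (j + 1))).Fib (ev (γ, P.t (j + 1))))
      (L.Fib γ) :=
  (LinearMap.toSpanSingleton ℂ (L.Fib γ) (F.σ q.Q q.lab γ)).compMultilinearMap
    (fillMap D s q.R q.lab γ)

theorem Lift.glue_apply (q : Lift D P s)
    (v : ∀ j, (G.L (s j) (s (j + 1))).Fib (ev (γ, P.t (j + 1)))) :
    q.glue F γ v = fillMap D s q.R q.lab γ v • F.σ q.Q q.lab γ := rfl

/-- Refining the subdivision of a lift. -/
def Lift.refine (q : Lift D P s) {Q : Subdivision} (S : q.Q.Refinement Q) (T : P.Refinement Q) :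
    Lift D P s where
  Q := Q
  R := T
  lab := q.lab ∘ S.idx
  r_lab i := by rw [Function.comp_apply, q.r_lab, q.R.idx_trans S T]

theorem Lift.mem_dom_refine {q : Lift D P s} {Q : Subdivision} (S : q.Q.Refinement Q)
    (T : P.Refinement Q) (hγ : γ ∈ q.dom) : γ ∈ (q.refine S T).dom :=
  fibreSet_refine (evCocycle c) S q.lab hγ

theorem Lift.glue_refine {q : Lift D P s} {Q : Subdivision} (S : q.Q.Refinement Q)
    (T : P.Refinement Q) (hγ : γ ∈ q.dom) : (q.refine S T).glue F γ = q.glue F γ := by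
  ext v
  rw [glue_apply, glue_apply]
  exact congrArg₂ (fun z w => z • w)
    (congrFun (congrArg DFunLike.coe (fillMap_refine D q.R S T q.r_lab hγ)) v)
    (F.refine _ _ S q.lab γ hγ)

/-- The identifications are compatible with changes of the labels, even for different lifts, as
these have a common refinement. -/
theorem Lift.glue_relabel (hD : D.IsFull) (q : Lift D P s) (q' : Lift D P s') (hγ : γ ∈ q.dom)
    (hγ' : γ ∈ q'.dom) (hl : γ ∈ loopSet G P s) (hl' : γ ∈ loopSet G P s')
    (v : ∀ j, (G.L (s j) (s (j + 1))).Fib (ev (γ, P.t (j + 1))))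
    (v' : ∀ j, (G.L (s' j) (s' (j + 1))).Fib (ev (γ, P.t (j + 1))))
    (w : ∀ i, (G.L (s i) (s' i)).Fib (ev (γ, P.t i)))
    (w' : ∀ i, (G.L (s i) (s' i)).Fib (ev (γ, P.t (i + 1))))
    (hw : ∀ i, ‖w i‖ = 1)
    (hww' : ∀ i, (G.L (s i) (s' i)).Transports (fun τ => ev (γ, P.point i τ)) 0 (P.len i)
      ⟨_, w i⟩ ⟨_, w' i⟩)
    (hv : ∀ i, (G.θ (s i) (s (i + 1)) (s' (i + 1))).mul _ (v i) (w (i + 1)) =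
      (G.θ (s i) (s' i) (s' (i + 1))).mul _ (w' i) (v' i)) :
    q'.glue F γ v' = q.glue F γ v := by
  obtain ⟨Q, ⟨S⟩, ⟨S'⟩, -⟩ := Subdivision.exists_common_refinement q.Q q'.Q one_pos
  obtain ⟨T⟩ := q.R.exists_trans S
  have h1 := Lift.mem_dom_refine S T hγ
  have h2 := Lift.mem_dom_refine S' T hγ'
  rw [← Lift.glue_refine F S T hγ, ← Lift.glue_refine F S' T hγ', glue_apply, glue_apply]
  have h3 := fillMap_relabel D T (q.refine S T).r_lab (q'.refine S' T).r_lab h1 h2 hl hl' hD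
    v v' w w' hw hww' hv
  have h4 := F.trans Q (q.refine S T).lab (q'.refine S' T).lab γ ⟨h1, h2⟩
  change fillMap D s' T (q'.refine S' T).lab γ v' • F.σ Q (q'.refine S' T).lab γ =
    fillMap D s T (q.refine S T).lab γ v • F.σ Q (q.refine S T).lab γ
  rw [h4, ← h3, Circle.smul_def, smul_smul, mul_comm]

/-- The section `1` of `L_{αα}` is parallel. -/
theorem oneSec_transports (hD : D.IsFull) {α : G.I} {b : ℝ → Mfd E B} (hb : IsCurve b) {a e : ℝ}
    (hU : ∀ τ ∈ Icc a e, b τ ∈ G.U α) :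
    (G.L α α).IsParallel b a e fun τ => G.oneSec α (b τ) := by
  have h := isParallel_exp_smul hb (G.U_open α) (W := G.U α ∩ G.U α)
    (fun x hx => ⟨hx, hx⟩)
    (Gerbe.Sections.isUnitSection_oneSec hD α) hU (1 : ℂ)
  have h0 : ∀ t, alongCurve (0 : PreForm (Mfd E B) 1) b t = 0 := fun t => rfl
  simpa [h0] using h

/-- The identification does not depend on the lift. -/
theorem Lift.glue_eq (hD : D.IsFull) (q q' : Lift D P s) (hγ : γ ∈ q.dom)
    (hγ' : γ ∈ q'.dom) (hl : γ ∈ loopSet G P s) : q'.glue F γ = q.glue F γ := by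
  ext v
  have hU : ∀ i, ev (γ, P.t i) ∈ G.U (s i) := fun i => by
    have h := (hl i 0 ⟨le_rfl, (P.len_pos i).le⟩).2
    rwa [P.point_zero] at h
  have hU' : ∀ i, ev (γ, P.t (i + 1)) ∈ G.U (s i) := fun i => by
    have h := (hl i _ ⟨(P.len_pos i).le, le_rfl⟩).2
    rwa [P.point_len] at h
  -- this is the case `s = s'` of a change of the labels, with the section `1` of `L_{αα}` as
  -- parallel section
  refine Lift.glue_relabel F hD q q' hγ hγ' hl hl v v (fun i => G.oneSec (s i) _)
    (fun i => G.oneSec (s i) _) (fun i => ?_) (fun i => ?_) fun i => ?_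
  · exact (Gerbe.Sections.isUnitSection_oneSec hD (s i)).1.1 _ (hU i)
  · exact ⟨_, oneSec_transports hD (isCurve_loop γ P i) fun τ hτ => (hl i τ hτ).2,
      sigma_congr _ (congrArg (fun z => ev (γ, z)) (P.point_zero i)), sigma_congr _ (congrArg (fun z => ev (γ, z)) (P.point_len i))⟩
  · rw [Gerbe.mul_one (hU' i) (hU (i + 1)) (D.oneSec_ne_zero hD (hU (i + 1)))
      (D.oneSec_mul_self hD (hU (i + 1))), Gerbe.one_mul (hU' i) (hU (i + 1))
      (D.oneSec_ne_zero hD (hU' i)) (D.oneSec_mul_self hD (hU' i))]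

open Classical in
variable (D) in
/-- The identification of the local pieces with `L`, by any lift whose domain contains `γ`. Such
lifts exist over `V(P, s)`; elsewhere the value is irrelevant. -/
def glueMap (P : Subdivision) (s : ZMod P.n → G.I) (γ : Loop E B) :
    MultilinearMap ℂ (fun j : ZMod P.n => (G.L (s j) (s (j + 1))).Fib (ev (γ, P.t (j + 1))))
      (L.Fib γ) :=
  if h : ∃ q : Lift D P s, γ ∈ q.dom then h.choose.glue F γ else 0

theorem glueMap_eq (hD : D.IsFull) (q : Lift D P s) (hγ : γ ∈ q.dom) (hl : γ ∈ loopSet G P s) :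
    glueMap D F P s γ = q.glue F γ := by
  have h : ∃ q : Lift D P s, γ ∈ q.dom := ⟨q, hγ⟩
  rw [glueMap, dif_pos h]
  exact Lift.glue_eq F hD _ _ hγ h.choose_spec hl

theorem norm_glueMap (hD : D.IsFull) (hl : γ ∈ loopSet G P s)
    (v : ∀ j, (G.L (s j) (s (j + 1))).Fib (ev (γ, P.t (j + 1)))) :
    ‖glueMap D F P s γ v‖ = ∏ j, ‖v j‖ := by
  obtain ⟨q, hq⟩ := exists_lift hD hl
  rw [glueMap_eq F hD q hq hl, Lift.glue_apply, norm_smul, norm_fillMap D q.R q.r_lab hq,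
    (F.unit q.Q q.lab).1.1 γ hq, mul_one]

/-- A lift of the refined labels is also a lift of the given ones. -/
theorem glueMap_refine (hD : D.IsFull) {Q : Subdivision} (R : P.Refinement Q)
    (hl : γ ∈ loopSet G P s)
    (v : ∀ j, (G.L (s j) (s (j + 1))).Fib (ev (γ, P.t (j + 1))))
    (v' : ∀ j, (G.L ((s ∘ R.idx) j) ((s ∘ R.idx) (j + 1))).Fib (ev (γ, Q.t (j + 1))))
    (h1 : ∀ j, G.elt (v' (R.r j + (R.k j : ZMod Q.n))) = G.elt (v j))
    (h2 : ∀ j, ∀ l < R.k j, G.IsOne (G.elt (v' (R.r j + (l : ZMod Q.n))))) :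
    glueMap D F Q (s ∘ R.idx) γ v' = glueMap D F P s γ v := by
  have hl' := loopSet_refine R s hl
  obtain ⟨q, hq⟩ := exists_lift hD hl'
  obtain ⟨T⟩ := R.exists_trans q.R
  let q' : Lift D P s := ⟨q.Q, T, q.lab, fun i => by
    rw [q.r_lab, Function.comp_apply, R.idx_trans q.R T]⟩
  rw [glueMap_eq F hD q hq hl', glueMap_eq F hD q' hq hl, Lift.glue_apply, Lift.glue_apply]
  exact congrArg (fun z : ℂ => z • F.σ q.Q q.lab γ)
    (fillMap_insert D T R q.R q'.r_lab hq v v' h1 h2)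

/-- On the domain of a lift the coordinates are smooth functions of modulus one. -/
theorem isSmoothUnit_glueMap (hD : D.IsFull) (O : ZMod P.n → Set (Mfd E B))
    (e : ∀ i x, (G.L (s i) (s (i + 1))).Fib x)
    (he : ∀ i, (G.L (s i) (s (i + 1))).IsSmoothUnit (O i) (e i)) :
    L.IsSmoothUnit (loopSet G P s ∩ {γ | ∀ i, ev (γ, P.t (i + 1)) ∈ O i})
      (fun γ => glueMap D F P s γ fun i => e i (ev (γ, P.t (i + 1)))) := by
  refine IsSmoothUnit.of_local fun γ₀ hγ₀ => ?_
  obtain ⟨q, hq⟩ := exists_lift hD hγ₀.1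
  refine ⟨q.dom, q.dOpen_dom, hq, ?_⟩
  set V := loopSet G P s ∩ {γ | ∀ i, ev (γ, P.t (i + 1)) ∈ O i} ∩ q.dom with hV
  have hdiv : ∀ i, ∀ γ ∈ V, ev (γ, q.Q.t (i + 1)) ∈ c.U (q.lab i) ∩ c.U (q.lab (i + 1)) :=
    fun i γ hγ => mem_division hγ.2 i
  have hev : ∀ z : Circle, DSmooth fun γ : Loop E B => ev (γ, z) := fun z n p hp =>
    ev_smooth _ _ ((dSmooth_prodMk z) _ _ hp)
  have hpull : ∀ {W : Set (Mfd E B)} {g : Mfd E B → ℂ} {z : Circle}, UnitOn W g →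
      (∀ γ ∈ V, ev (γ, z) ∈ W) → UnitOn V fun γ => g (ev (γ, z)) := fun {W g z} hg hz =>
    ⟨(hg.smooth.pullback (hev z)).mono hz, fun γ hγ => hg.norm _ (hz γ hγ)⟩
  have hprod : ∀ {ι : Type} (t : Finset ι) (g : ι → Loop E B → ℂ), (∀ i ∈ t, UnitOn V (g i)) →
      UnitOn V fun γ => ∏ i ∈ t, g i γ := fun t g hg =>
    ⟨SmoothOn.prod t fun i hi => (hg i hi).smooth, fun γ hγ => by
      rw [norm_prod]
      exact Finset.prod_eq_one fun i hi => (hg i hi).norm γ hγ⟩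
  have hfill : UnitOn V fun γ =>
      fillMap D s q.R q.lab γ fun i => e i (ev (γ, P.t (i + 1))) := by
    simp only [fillMap_apply, fillConst]
    refine UnitOn.mul (hprod _ _ fun j _ => hprod _ _ fun l hl => ?_) (hprod _ _ fun j _ => ?_)
    · have hl' := Finset.mem_range.1 hl
      have e1 : D.r (q.lab (q.R.r j + (l : ZMod q.Q.n))) = s j := by
        rw [q.r_lab, q.R.idx_add j hl'.le]
      have e2 : D.r (q.lab (q.R.r j + (l : ZMod q.Q.n) + 1)) = s j := by
        rw [q.r_lab, add_assoc, ← Nat.cast_succ, q.R.idx_add j hl']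
      refine hpull (D.unitOn_coord e1 e2 (Gerbe.Sections.isUnitSection_oneSec hD (s j)).1)
        fun γ hγ => ?_
      have hm := hdiv (q.R.r j + (l : ZMod q.Q.n)) γ hγ
      exact ⟨e1 ▸ D.subset _ hm.1, hm⟩
    · have e1 : D.r (q.lab (q.R.r j + (q.R.k j : ZMod q.Q.n))) = s j := by
        rw [q.r_lab, q.R.idx_last]
      have e2 : D.r (q.lab (q.R.r (j + 1))) = s (j + 1) := by rw [q.r_lab, q.R.idx_r]
      refine hpull (D.unitOn_coord e1 e2 (he j)) fun γ hγ => ?_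
      have hm := hdiv (q.R.r j + (q.R.k j : ZMod q.Q.n)) γ hγ
      rw [q.R.t_last_succ, ← q.R.r_succ] at hm
      exact ⟨hγ.1.2 j, hm⟩
  refine (IsSmoothUnit.smul hfill ((F.unit q.Q q.lab).1.mono fun γ hγ => hγ.2)).congr
    fun γ hγ => ?_
  rw [glueMap_eq F hD q hγ.2 hγ.1.1, Lift.glue_apply]

end Glue

open LineBundle

/-! ### Parallel transport in the transgression -/

/-- Logarithmic derivatives of the form `-i A` add up in products. -/
theorem hasDerivWithinAt_prod_log {ι : Type*} [DecidableEq ι] (t : Finset ι) {f : ι → ℝ → ℂ} {A : ι → ℝ}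
    {S : Set ℝ} {x : ℝ}
    (h : ∀ i ∈ t, HasDerivWithinAt (f i) (-Complex.I * (A i : ℂ) * f i x) S x) :
    HasDerivWithinAt (fun y => ∏ i ∈ t, f i y)
      (-Complex.I * ((∑ i ∈ t, A i : ℝ) : ℂ) * ∏ i ∈ t, f i x) S x := by
  induction t using Finset.induction_on with
  | empty => simpa using hasDerivWithinAt_const x S (1 : ℂ)
  | insert i t hi ih =>
    have h1 := (h i (Finset.mem_insert_self _ _)).mul
      (ih fun j hj => h j (Finset.mem_insert_of_mem hj))
    have e1 : (fun y => ∏ i ∈ insert i t, f i y) = f i * fun y => ∏ i ∈ t, f i y := by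
      funext y
      rw [Finset.prod_insert hi]
      rfl
    rw [e1]
    refine h1.congr_deriv ?_
    rw [Finset.prod_insert hi, Finset.sum_insert hi]
    push_cast
    ring

section Transport

variable {E : Type v} [NormedAddCommGroup E] [NormedSpace ℝ E]
  {B : Type u} [TopologicalSpace B] [ChartedSpace E B] {G : Gerbe (Mfd E B)}
  {c : Cocycle2 (Mfd E B)} {D : G.Sections c} {P : Subdivision} {s : ZMod P.n → G.I}
  {Γ : ℝ → Loop E B}

theorem alongCurve_arcForm_zero {Q : Subdivision}
    (f : ZMod Q.n → PreForm (Loop E B × Circle) 2) (x : ℝ) :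
    alongCurve (arcForm Q f fun _ => 0) Γ x =
      -∑ i, alongCurve (fibreIntegral (Q.t i) (Q.len i) (f i)) Γ x := by
  simp only [alongCurve, arcForm, Pi.neg_apply, Pi.sub_apply, preForm_sum_apply,
    ContinuousAlternatingMap.neg_apply, ContinuousAlternatingMap.sum_apply, PreForm.pullback, Pi.zero_apply, Finset.sum_const_zero,
    sub_zero]

/-- The integrals of the curving forms over the arcs, in terms of a lift of the labels. -/
theorem Lift.sum_fibreIntegral (q : Lift D P s) (hΓ : IsCurve Γ) {x : ℝ}
    (hl : Γ x ∈ loopSet G P s) (hq : Γ x ∈ q.dom) :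
    ∑ i, alongCurve (fibreIntegral (q.Q.t i) (q.Q.len i) ((evCocycle c).f (q.lab i))) Γ x =
      -∑ j, ∫ τ in (0 : ℝ)..P.len j,
        alongSurface (G.F (s j)) (fun x' τ' => ev (Γ x', P.point j τ')) x τ := by
  set f : ZMod P.n → PreForm (Loop E B × Circle) 2 := fun j => (G.F (s j)).pullback ev with hf
  have hfF : ∀ j, IsForm (ev ⁻¹' G.U (s j)) (f j) := fun j => (G.F_form (s j)).pullback ev_smooth
  have hdom : Γ x ∈ arcDom P fun j => (ev ⁻¹' G.U (s j) : Set (Loop E B × Circle)) :=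
    fun j τ hτ => (hl j τ hτ).2
  have hdomQ := arcDom_subset_refine q.R hdom
  have h1 : ∀ j, ∫ τ in (0 : ℝ)..P.len j,
      alongSurface (G.F (s j)) (fun x' τ' => ev (Γ x', P.point j τ')) x τ =
        alongCurve (fibreIntegral (P.t j) (P.len j) (f j)) Γ x := fun j =>
    ((hfF j).alongCurve_fibreIntegral hΓ (P.len_pos j).le (hdom j)).symm
  have h2 := (arcForm_refine q.R (a := fun _ _ => 0) hfF fun j => FormEq.refl _ _).alongCurve hΓ
    hdom
  rw [alongCurve_arcForm_zero, alongCurve_arcForm_zero] at h2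
  simp only [h1]
  rw [← h2, ← Finset.sum_neg_distrib]
  refine Finset.sum_congr rfl fun i _ => ?_
  have hqi := fibreSet_subset _ _ _ hq i
  rw [((evCocycle c).f_form (q.lab i)).alongCurve_fibreIntegral hΓ (q.Q.len_pos i).le hqi,
    (hfF (q.R.idx i)).alongCurve_fibreIntegral hΓ (q.Q.len_pos i).le (hdomQ i),
    ← intervalIntegral.integral_neg]
  refine intervalIntegral.integral_congr fun τ hτ => ?_
  rw [uIcc_of_le (q.Q.len_pos i).le] at hτ
  have h3 := (D.f_eq (q.lab i)).alongSurface (σ := fun x' τ' => ev (Γ x', q.Q.point i τ'))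
    (isPlot_evalSurface hΓ q.Q i) (hqi τ hτ)
  have h4 : alongSurface ((evCocycle c).f (q.lab i))
      (fun x' τ' => (Γ x', q.Q.t i * Circle.exp (2 * Real.pi * τ'))) x τ =
      alongSurface (c.f (q.lab i)) (fun x' τ' => ev (Γ x', q.Q.point i τ')) x τ := rfl
  have h5 : alongSurface (f (q.R.idx i))
      (fun x' τ' => (Γ x', q.Q.t i * Circle.exp (2 * Real.pi * τ'))) x τ =
      alongSurface (G.F (s (q.R.idx i))) (fun x' τ' => ev (Γ x', q.Q.point i τ')) x τ := rfl
  rw [h4, h5, h3, q.r_lab]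
  simp [alongSurface]

variable {L : LineBundle (Loop E B) univ} (F : FibreSections c L)

/-- The coordinates of a parallel family: at a point of division of `P` this is the equation for a
parallel section of `L_{s(j)s(j+1)}`, at an additional one that for the section `1`. -/
theorem hasDerivWithinAt_fillCoord (hD : D.IsFull) (q : Lift D P s) (hΓ : IsCurve Γ) {a b : ℝ}
    (hl : ∀ x ∈ Icc a b, Γ x ∈ loopSet G P s)
    {ρ : ∀ j x, (G.L (s j) (s (j + 1))).Fib (ev (Γ x, P.t (j + 1)))}
    (hρ : ∀ j, (G.L (s j) (s (j + 1))).IsParallel (fun x => ev (Γ x, P.t (j + 1))) a b (ρ j))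
    {x : ℝ} (hx : x ∈ Icc a b) (hq : Γ x ∈ q.dom) (i : ZMod q.Q.n) :
    HasDerivWithinAt (fun y => fillCoord D q.R q.lab (Γ y) (fun j => ρ j y) i)
      (-Complex.I * ((2 * Real.pi * alongCurve (((evCocycle c).a (q.lab i) (q.lab (i + 1))).pullback
        fun x => (x, q.Q.t (i + 1))) Γ x : ℝ) : ℂ) *
        fillCoord D q.R q.lab (Γ x) (fun j => ρ j x) i) (Icc a b) x := by
  have hm := mem_division hq i
  have ha : alongCurve (((evCocycle c).a (q.lab i) (q.lab (i + 1))).pullback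
      fun x => (x, q.Q.t (i + 1))) Γ x =
      alongCurve (c.a (q.lab i) (q.lab (i + 1))) (fun x => ev (Γ x, q.Q.t (i + 1))) x := rfl
  rw [ha]
  by_cases hi : q.R.IsLast i
  · simp only [fillCoord, if_pos hi]
    rw [hi.t_succ] at hm ⊢
    exact D.hasDerivWithinAt_coord (q.r_lab i) (by rw [q.r_lab, hi.idx_succ])
      (isCurve_evalAt hΓ _) (hρ (q.R.idx i)) hx hm
  · simp only [fillCoord, if_neg hi]
    refine D.hasDerivWithinAt_coord (q.r_lab i)
      (by rw [q.r_lab, q.R.idx_succ_of_not_isLast hi]) (isCurve_evalAt hΓ (q.Q.t (i + 1)))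
      (oneSec_transports hD (isCurve_evalAt hΓ (q.Q.t (i + 1))) fun y hy => ?_) hx hm
    have h1 := (loopSet_refine q.R s (hl y hy) i _ ⟨(q.Q.len_pos i).le, le_rfl⟩).2
    rwa [q.Q.point_len] at h1

/-- The identifications are compatible with parallel transport. In the coordinate given by a lift,
the holonomy of the connection form of `σ` splits into the one of the `a_{κμ}`, accounted for by the
coordinates, and the integral of the curving forms. -/
theorem transports_glueMap (hD : D.IsFull) (hΓ : IsCurve Γ) {a b : ℝ} (hab : a ≤ b)
    (hl : ∀ x ∈ Icc a b, Γ x ∈ loopSet G P s)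
    (v : ∀ j, (G.L (s j) (s (j + 1))).Fib (ev (Γ a, P.t (j + 1))))
    (v' : ∀ j, (G.L (s j) (s (j + 1))).Fib (ev (Γ b, P.t (j + 1))))
    (hv : ∀ i, (G.L (s i) (s (i + 1))).Transports (fun x => ev (Γ x, P.t (i + 1))) a b
      ⟨_, v i⟩ ⟨_, v' i⟩) :
    L.Transports Γ a b ⟨Γ a, glueMap D F P s (Γ a) v⟩
      ⟨Γ b, Circle.exp (2 * Real.pi * ∑ i, ∫ x in a..b, ∫ τ in (0 : ℝ)..P.len i,
          alongSurface (G.F (s i)) (fun x' τ' => ev (Γ x', P.point i τ')) x τ) •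
        glueMap D F P s (Γ b) v'⟩ := by
  choose ρ hρ hρa hρb using hv
  have hρa' : (fun j => ρ j a) = v := funext fun j => eq_of_heq (Sigma.mk.inj (hρa j)).2
  have hρb' : (fun j => ρ j b) = v' := funext fun j => eq_of_heq (Sigma.mk.inj (hρb j)).2
  set φ : ZMod P.n → ℝ → ℝ := fun j x => ∫ τ in (0 : ℝ)..P.len j,
    alongSurface (G.F (s j)) (fun x' τ' => ev (Γ x', P.point j τ')) x τ with hφ
  have hφc : ∀ j, ContinuousOn (φ j) (Icc a b) := by
    intro j
    have hF : IsForm (ev ⁻¹' G.U (s j)) ((G.F (s j)).pullback (ev (E := E) (B := B))) :=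
      (G.F_form (s j)).pullback ev_smooth
    refine (((hF.fibreIntegral ((G.U_open (s j)).preimage ev_smooth)
      (P.len_pos j).le).contDiffOn_alongCurve hΓ).continuousOn.mono
        fun x hx τ hτ => (hl x hx j τ hτ).2).congr fun x hx => ?_
    exact (hF.alongCurve_fibreIntegral hΓ (P.len_pos j).le fun τ hτ => (hl x hx j τ hτ).2).symm
  -- `exp(-i ∫ A)` is the factor arising from the curving forms
  set A : ℝ → ℝ := fun x => -(2 * Real.pi * ∑ j, φ j x) with hA
  have hAc : ContinuousOn A (Icc a b) :=
    (continuousOn_const.mul (continuousOn_finsetSum _ fun j _ => hφc j)).neg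
  have hAint : -∫ x in a..b, A x = 2 * Real.pi * ∑ j, ∫ x in a..b, φ j x := by
    simp only [hA]
    rw [intervalIntegral.integral_neg, neg_neg, intervalIntegral.integral_const_mul,
      intervalIntegral.integral_finsetSum fun j _ => (hφc j).intervalIntegrable_of_Icc hab]
  refine ⟨fun x => (Circle.exp (-∫ y in a..x, A y) : ℂ) • glueMap D F P s (Γ x) fun j => ρ j x,
    isParallel_of_section hΓ fun x₀ hx₀ => ?_, ?_, ?_⟩
  -- the equation of a parallel section is local, and is checked in the section `σ` of a lift
  · obtain ⟨q, hq⟩ := exists_lift hD (hl x₀ hx₀)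
    refine ⟨q.dom, F.σ q.Q q.lab, _, q.dOpen_dom, subset_univ _, F.unit q.Q q.lab, hq, ?_⟩
    have hval : ∀ x ∈ Icc a b, Γ x ∈ q.dom → (inner ℂ (F.σ q.Q q.lab (Γ x))
        ((Circle.exp (-∫ y in a..x, A y) : ℂ) • glueMap D F P s (Γ x) fun j => ρ j x) : ℂ) =
        Circle.exp (-∫ y in a..x, A y) *
          ∏ i, fillCoord D q.R q.lab (Γ x) (fun j => ρ j x) i := by
      intro x hx hqx
      rw [glueMap_eq F hD q hqx (hl x hx), Lift.glue_apply, inner_smul_right, inner_smul_right,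
        inner_self_of_norm ((F.unit q.Q q.lab).1.1 _ hqx), mul_one, fillMap_eq_prod]
    have hnear : ∀ᶠ x in 𝓝[Icc a b] x₀, x ∈ Icc a b ∧ Γ x ∈ q.dom :=
      (eventually_mem_nhdsWithin).and
        (nhdsWithin_le_nhds ((hΓ.isOpen_preimage q.dOpen_dom).mem_nhds hq))
    classical
    have hd := (hasDerivWithinAt_exp_integral hAc x₀ hx₀).mul
      (hasDerivWithinAt_prod_log Finset.univ fun i _ =>
        hasDerivWithinAt_fillCoord hD q hΓ hl hρ hx₀ hq i)
    have hd2 := hd.congr_of_eventuallyEq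
      (hnear.mono fun x hx => hval x hx.1 hx.2) (hval x₀ hx₀ hq)
    rw [hval x₀ hx₀ hq]
    refine hd2.congr_deriv ?_
    have h1 : alongCurve (-((2 * Real.pi) • fibreForm (evCocycle c) q.Q q.lab)) Γ x₀ =
        A x₀ + ∑ i, 2 * Real.pi * alongCurve
          (((evCocycle c).a (q.lab i) (q.lab (i + 1))).pullback fun x => (x, q.Q.t (i + 1)))
          Γ x₀ := by
      have h2 := q.sum_fibreIntegral hΓ (hl x₀ hx₀) hq
      have h3 : A x₀ = 2 * Real.pi * ∑ i,
          alongCurve (fibreIntegral (q.Q.t i) (q.Q.len i) ((evCocycle c).f (q.lab i))) Γ x₀ := by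
        rw [h2, mul_neg]
      rw [h3, ← Finset.mul_sum]
      simp only [alongCurve, fibreForm, arcForm, Pi.neg_apply, Pi.smul_apply, Pi.sub_apply,
        preForm_sum_apply, ContinuousAlternatingMap.neg_apply,
        ContinuousAlternatingMap.smul_apply, ContinuousAlternatingMap.sub_apply,
        ContinuousAlternatingMap.sum_apply, smul_eq_mul]
      ring
    rw [h1]
    push_cast
    ring
  · have h1 : (Circle.exp (-∫ y in a..a, A y) : ℂ) • glueMap D F P s (Γ a) (fun j => ρ j a) =
        glueMap D F P s (Γ a) v := by
      rw [hρa', intervalIntegral.integral_same, neg_zero, Circle.exp_zero, Circle.coe_one, one_smul]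
    exact congrArg (Sigma.mk (Γ a)) h1
  · have h1 : (Circle.exp (-∫ y in a..b, A y) : ℂ) • glueMap D F P s (Γ b) (fun j => ρ j b) =
        Circle.exp (2 * Real.pi * ∑ i, ∫ x in a..b, φ i x) • glueMap D F P s (Γ b) v' := by
      rw [hρb', hAint, Circle.smul_def]
    exact congrArg (Sigma.mk (Γ b)) h1

/-- A line bundle whose cocycle is the fibre integral of `ev* c` is a transgression. -/
def gluedOfSections (hD : D.IsFull) : IsGlued G L where
  m := glueMap D F
  norm_m P s γ hγ v := norm_glueMap F hD hγ v
  smooth_m P s O e he := isSmoothUnit_glueMap F hD O e fun i => (he i).2.2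
  refine_m P Q s s' r k h γ hγ v v' h1 h2 := by
    obtain ⟨R, rfl, rfl, rfl⟩ := h.exists_refinement
    exact glueMap_refine F hD R hγ v v' h1 h2
  relabel_m P s s' γ hγ v v' w w' hw hww' hv := by
    obtain ⟨q, hq⟩ := exists_lift hD hγ.1
    obtain ⟨q', hq'⟩ := exists_lift hD hγ.2
    rw [glueMap_eq F hD q hq hγ.1, glueMap_eq F hD q' hq' hγ.2]
    exact Lift.glue_relabel F hD q q' hq hq' hγ.1 hγ.2 v v' w w' hw hww' hv
  transport_m P s Γ a b hΓ hab hl v v' hv := transports_glueMap F hD hΓ hab hl v v' hv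

end Transport

section Full

variable {E : Type v} [NormedAddCommGroup E] [NormedSpace ℝ E] [FiniteDimensional ℝ E]
  {B : Type u} [TopologicalSpace B] [T2Space B] [ParacompactSpace B] [ChartedSpace E B]
  [IsManifold 𝓘(ℝ, E) ∞ B]

/-- Every gerbe has a cocycle whose sections exhaust the covering of the gerbe: intersect a
covering `W` on which the `L_{r(j)r(k)}` have sections with all `U_α`, and trivialise
`L_{α r(j)}` by its local frames; then `L_{αβ}` has sections, as
`L_{αβ} ⊗ L_{β r(k)} ≅ L_{α r(k)} ≅ L_{α r(j)} ⊗ L_{r(j) r(k)}`. -/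
theorem Gerbe.exists_full_sections (G : Gerbe (Mfd E B)) :
    ∃ (c : Cocycle2 (Mfd E B)) (D : G.Sections c), D.IsFull := by
  obtain ⟨c₀, h₀⟩ := G.exists_hasCocycle
  obtain ⟨D₀⟩ := Gerbe.Sections.nonempty h₀
  let K : Type u := Σ (α : G.I) (j : c₀.I), (G.L α (D₀.r j)).ι
  let W : K → Set (Mfd E B) := fun κ =>
    G.U κ.1 ∩ c₀.U κ.2.1 ∩ (G.L κ.1 (D₀.r κ.2.1)).dom κ.2.2
  have hW : ∀ κ, DOpen (W κ) := fun κ =>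
    ((G.U_open _).inter (c₀.U_open _)).inter ((G.L _ _).dom_open _)
  have hfull : ∀ α, ∀ x ∈ G.U α, ∃ κ : K, x ∈ W κ ∧ κ.1 = α := by
    intro α x hx
    obtain ⟨j, hj⟩ := c₀.U_cover x
    obtain ⟨b, hb⟩ := (G.L α (D₀.r j)).dom_cover x ⟨hx, D₀.subset j hj⟩
    exact ⟨⟨α, j, b⟩, ⟨⟨hx, hj⟩, hb⟩, rfl⟩
  have hcov : ∀ x, ∃ κ, x ∈ W κ := fun x => by
    obtain ⟨α, hα⟩ := G.U_cover x
    obtain ⟨κ, hκ, -⟩ := hfull α x hα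
    exact ⟨κ, hκ⟩
  obtain ⟨t⟩ := G.exists_triv W (fun κ => κ.1) hW (fun κ x hx => hx.1.1) fun κ μ => by
    obtain ⟨α, j, b⟩ := κ
    obtain ⟨β, k, b'⟩ := μ
    have hO : DOpen (W ⟨α, j, b⟩ ∩ W ⟨β, k, b'⟩) := (hW _).inter (hW _)
    have h1 := (G.θ α (D₀.r j) (D₀.r k)).parallel _ _ _ _ _ hO
      (fun x hx => ⟨⟨hx.1.1.1, D₀.subset j hx.1.1.2⟩, D₀.subset k hx.2.1.2⟩)
      (((G.L α (D₀.r j)).isUnitSection_frame b).mono fun x hx => hx.1.2)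
      ((D₀.unit j k).mono fun x hx => ⟨hx.1.1.2, hx.2.1.2⟩)
    obtain ⟨s, hs, -⟩ := (G.θ α β (D₀.r k)).exists_left hO
      (fun x hx => ⟨⟨hx.1.1.1, hx.2.1.1⟩, D₀.subset k hx.2.1.2⟩)
      (fun x hx => ⟨hx.1.1.1, hx.2.1.1⟩) (fun x hx => ⟨hx.1.1.1, D₀.subset k hx.2.1.2⟩)
      (((G.L β (D₀.r k)).isUnitSection_frame b').mono fun x hx => hx.2.2) h1
    exact ⟨s, _, hs⟩
  exact ⟨t.cocycle hW hcov, ⟨fun κ => κ.1, t.subset, t.s, t.unit' hW hcov,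
    fun κ μ ν x hx => t.θ_smul hW hx, fun κ => FormEq.refl _ _⟩, hfull⟩

/-- The geometric transgression exists. -/
theorem Gerbe.exists_isGlued (G : Gerbe (Mfd E B)) :
    ∃ L : LineBundle (Loop E B) univ, Nonempty (IsGlued G L) := by
  obtain ⟨c, D, hD⟩ := G.exists_full_sections
  obtain ⟨F⟩ := FibreSections.nonempty (hasCocycle_lineOf (fibreCocycle (evCocycle c)))
  exact ⟨_, ⟨gluedOfSections F hD⟩⟩

variable (E B) in
/-- The transgression map, defined through Deligne cohomology. -/
def transgression (G : GerbeClass (Mfd E B)) : LineClass (Loop E B) :=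
  (lineEquiv (Loop E B)).symm (fibreIntegration (Loop E B)
    (H2.pullback ev ev_smooth (gerbeEquiv E B G)))

theorem isTransgression_transgression : IsTransgression (transgression E B) := by
  refine ⟨Gerbe.exists_isGlued, fun G L ⟨g⟩ => ?_⟩
  obtain ⟨c, hc⟩ := G.exists_hasCocycle
  obtain ⟨D⟩ := Gerbe.Sections.nonempty hc
  change (lineEquiv (Loop E B)).symm (fibreIntegration (Loop E B)
    (H2.pullback ev ev_smooth (gerbeEquiv E B (Quot.mk _ G)))) = _
  rw [gerbeEquiv_mk hc]
  exact (Equiv.symm_apply_eq _).2 (lineEquiv_mk (g.hasCocycle D)).symm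

end Full

end GerbeTransgression

end

theorem lemma2p2 {E : Type v} [NormedAddCommGroup E] [NormedSpace ℝ E] [FiniteDimensional ℝ E]
    {B : Type u} [TopologicalSpace B] [T2Space B] [ParacompactSpace B] [ChartedSpace E B]
    [IsManifold 𝓘(ℝ, E) ∞ B] :
    ∃ (g : GerbeClass (Mfd E B) ≃ H2 (Mfd E B)) (l : LineClass (Loop E B) ≃ H1 (Loop E B))
      (J : H2 (Loop E B × Circle) → H1 (Loop E B))
      (T : GerbeClass (Mfd E B) → LineClass (Loop E B)),
      IsGerbeClassIso g ∧ IsLineIso l ∧ IsFibreIntegration J ∧ IsTransgression T ∧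
      ∀ G : GerbeClass (Mfd E B), l (T G) = J (H2.pullback ev ev_smooth (g G)) :=
  ⟨gerbeEquiv E B, lineEquiv (Loop E B), fibreIntegration (Loop E B), transgression E B,
    isGerbeClassIso_gerbeEquiv, isLineIso_lineEquiv, isFibreIntegration_fibreIntegration,
    isTransgression_transgression, fun _ => (lineEquiv (Loop E B)).apply_symm_apply _⟩
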